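/- **Setting.** Let $E_0<0$ and let $U_0\in C^2(\mathbb R^3)$ be the potential of a King model with cut-off energy $E_0$. That is, $U_0$ is spherically symmetric about the origin, $U_0(x)<E_0$ for some $x$, $\lim_{|x|\to\infty}U_0(x)=0$, and with $$E(x,v):=\tfrac12|v|^2+U_0(x),\qquad f_0(x,v):=\bigl(e^{E_0-E(x,v)}-1\bigr)_+$$ one has $\Delta U_0(x)=4\pi\int_{\mathbb R^3} f_0(x,v)\,dv$ for all $x$. *Solutions.* A solution of the Vlasov–Poisson system is a locally Lipschitz function $f=f(t,x,v)\ge 0$ on $[0,\infty)\times\mathbb R^3\times\mathbb R^3$ together with a potential $U=U(t,x)$ such that $\rho(t,x)=\int f(t,x,v)\,dv$ exists for all $t\ge0$ and $x$; $U(t,\cdot)\in C^2(\mathbb R^3)$, $\Delta U(t,\cdot)=4\pi\rho(t,\cdot)$ and $\lim_{|x|\to\infty}U(t,x)=0$ for all $t\ge 0$; $\nabla_xU$ and $D_x^2U$ are continuous on $[0,\infty)\times\mathbb R^3$; $\nabla_xU$ is bounded on $[0,T]\times\mathbb R^3$ for every $T>0$; and $$\partial_tf+v\cdot\nabla_xf-\nabla_xU\cdot\nabla_vf=0$$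 at every point $(t,x,v)$ with $t>0$ at which $f$ is differentiable (hence almost everywhere). Every classical, i.e. $C^1$, solution with these properties of $\rho$ and $U$ is a solution in this sense. *Perturbations.* Let $L(x,v):=|x\times v|^2=|x|^2|v|^2-(x\cdot v)^2$. Let $\mathcal S_{f_0}$ be the set of all $f\in L^1(\mathbb R^6)$ with $f\ge 0$ which are spherically symmetric, i.e. $f(Ax,Av)=f(x,v)$ for all $A\in \mathrm{SO}(3)$, and such that $$\iint\Phi(f,L)\,dv\,dx=\iint\Phi(f_0,L)\,dv\,dx$$ for all $\Phi=\Phi(f,L)\in C^2([0,\infty)^2)$ with $\Phi(0,L)=\partial_f\Phi(0,L)=0$ for $L\ge0$ and $\partial_f^2\Phi$ bounded (the integral on the left being required to exist). *Distance.* Let $\Phi_0(s):=(1+s)\ln(1+s)-s$ and, for a state $f$ with induced potential $U_f$ (that is, $\Delta U_f=4\pi\int f\,dv$, $\lim_{|x|\to\infty}U_f(x)=0$), let $$d(f,f_0):=\iint\bigl[\Phi_0(f)-\Phi_0(f_0)+(E-E_0)(f-f_0)\bigr]\,dv\,dx+\frac1{8\pi}\int|\nabla U_f-\nabla U_0|^2\,dx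 .$$ **Theorem.** There exist constants $\delta>0$ and $C>0$, depending only on the King model, such that for every solution $t\mapsto f(t)$ of the Vlasov–Poisson system whose initial datum $f(0)$ belongs to $\mathcal S_{f_0}$ and has compact support (in particular, for every classical solution with $f(0)\in\mathcal S_{f_0}\cap C^1_c(\mathbb R^6)$), and which satisfies $d(f(0),f_0)\le\delta$, the estimate $$d(f(t),f_0)\le C\,d(f(0),f_0)$$ holds for all $t>0$. -/

import Mathlib

open MeasureTheory Set Filter Topology

namespace KingModel

noncomputable section

/-- Euclidean three-space, used both for positions and for velocities. -/
abbrev R3 : Type := EuclideanSpace ℝ (Fin 3)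

/-- The spatial density `ρ_f(x) = ∫ f(x,v) dv` of a phase space density `f`. -/
def density (f : R3 → R3 → ℝ) (x : R3) : ℝ := ∫ v : R3, f x v

/-- `U` is the gravitational potential induced by the phase space density `f`: a `C²` solution of
`Δ U = 4 π ρ_f` with `U(x) → 0` as `|x| → ∞`. (Such a `U` is unique.) -/
structure IsPotential (f : R3 → R3 → ℝ) (U : R3 → ℝ) : Prop where
  contDiff : ContDiff ℝ 2 U
  poisson : ∀ x, Laplacian.laplacian U x = 4 * Real.pi * density f x
  decay : Tendsto U (cocompact R3) (𝓝 0)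

/-- A (global, forward in time) solution `(f, U)` of the Vlasov–Poisson system on
`[0,∞) × ℝ³ × ℝ³`. The distribution function is only required to be locally Lipschitz, and the
Vlasov equation to hold at every point `(t,x,v)`, `t > 0`, where it is differentiable, hence almost
everywhere. If `f` is continuously differentiable this is the usual notion of a classical solution,
so classical solutions are included; so is every King model, which is not differentiable at the
boundary of its support. The values for negative times play no role. -/
structure IsSolution (f : ℝ → R3 → R3 → ℝ) (U : ℝ → R3 → ℝ) : Prop where
  nonneg : ∀ t, 0 ≤ t → ∀ x v, 0 ≤ f t x v
  lipschitz :
    LocallyLipschitzOn (Ici 0 ×ˢ univ) (fun p : ℝ × R3 × R3 => f p.1 p.2.1 p.2.2)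
  /-- the spatial density exists -/
  integrable : ∀ t, 0 ≤ t → ∀ x, Integrable (f t x)
  /-- Poisson equation and boundary condition -/
  potential : ∀ t, 0 ≤ t → IsPotential (f t) (U t)
  /-- the first and second order `x`-derivatives of `U` are jointly continuous -/
  continuous_field : ContinuousOn (fun p : ℝ × R3 => gradient (U p.1) p.2) (Ici 0 ×ˢ univ)
  continuous_hessian :
    ContinuousOn (fun p : ℝ × R3 => iteratedFDeriv ℝ 2 (U p.1) p.2) (Ici 0 ×ˢ univ)
  /-- the force field is bounded on compact time intervals -/
  bounded_field : ∀ T : ℝ, ∃ B : ℝ, ∀ t ∈ Icc 0 T, ∀ x, ‖gradient (U t) x‖ ≤ B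
  vlasov : ∀ t, 0 < t → ∀ x v,
    DifferentiableAt ℝ (fun p : ℝ × R3 × R3 => f p.1 p.2.1 p.2.2) (t, x, v) →
    deriv (fun s => f s x v) t
      + inner ℝ v (gradient (fun y => f t y v) x)
      - inner ℝ (gradient (U t) x) (gradient (fun w => f t x w) v) = 0

/-- The particle energy `E(x,v) = |v|²/2 + U₀(x)`. -/
def energy (U₀ : R3 → ℝ) (x v : R3) : ℝ := ‖v‖ ^ 2 / 2 + U₀ x

/-- The King distribution function `f₀(x,v) = (exp(E₀ - E(x,v)) - 1)₊`. -/
def kingDensity (E₀ : ℝ) (U₀ : R3 → ℝ) (x v : R3) : ℝ :=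
  max (Real.exp (E₀ - energy U₀ x v) - 1) 0

/-- `U₀` is the potential of a King model with cut-off energy `E₀`: it is spherically symmetric
(about the origin), it is the potential induced by `kingDensity E₀ U₀`, and the model is not the
vacuum. -/
structure IsKingPotential (E₀ : ℝ) (U₀ : R3 → ℝ) : Prop where
  cutoff_neg : E₀ < 0
  radial : ∀ x y : R3, ‖x‖ = ‖y‖ → U₀ x = U₀ y
  potential : IsPotential (kingDensity E₀ U₀) U₀
  nonvacuum : ∃ x, U₀ x < E₀

/-- The modulus of angular momentum squared, `L = |x × v|² = |x|²|v|² - (x·v)²`. -/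
def angMomSq (x v : R3) : ℝ := ‖x‖ ^ 2 * ‖v‖ ^ 2 - (inner ℝ x v) ^ 2

/-- The admissible functions `Φ = Φ(f, L)`: `Φ ∈ C²([0,∞)²)`, `Φ(0,L) = ∂_f Φ(0,L) = 0` for
`L ≥ 0`, and `∂_f² Φ` is bounded. -/
structure IsAdmissible (Φ : ℝ → ℝ → ℝ) : Prop where
  contDiff : ContDiffOn ℝ 2 (fun p : ℝ × ℝ => Φ p.1 p.2) (Ici 0 ×ˢ Ici 0)
  zero : ∀ L, 0 ≤ L → Φ 0 L = 0
  deriv_zero : ∀ L, 0 ≤ L → derivWithin (fun s => Φ s L) (Ici 0) 0 = 0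
  bounded : ∃ B : ℝ, ∀ s, 0 ≤ s → ∀ L, 0 ≤ L →
    |iteratedDerivWithin 2 (fun s => Φ s L) (Ici 0) s| ≤ B

/-- The perturbation class `S_{f₀}`. Its elements are `L¹`-functions, so pointwise conditions are
understood almost everywhere. -/
structure MemS (f₀ f : R3 → R3 → ℝ) : Prop where
  integrable : Integrable (fun z : R3 × R3 => f z.1 z.2)
  nonneg : ∀ᵐ z : R3 × R3, 0 ≤ f z.1 z.2
  /-- invariance under all rotations `A ∈ SO(3)` -/
  symmetric : ∀ A : R3 ≃ₗᵢ[ℝ] R3, LinearMap.det (A.toLinearEquiv : R3 →ₗ[ℝ] R3) = 1 →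
    ∀ᵐ z : R3 × R3, f (A z.1) (A z.2) = f z.1 z.2
  casimir : ∀ Φ : ℝ → ℝ → ℝ, IsAdmissible Φ →
    Integrable (fun z : R3 × R3 => Φ (f z.1 z.2) (angMomSq z.1 z.2)) ∧
    ∫ z : R3 × R3, Φ (f z.1 z.2) (angMomSq z.1 z.2)
      = ∫ z : R3 × R3, Φ (f₀ z.1 z.2) (angMomSq z.1 z.2)

/-- The Casimir function `Φ₀(s) = (1+s) ln(1+s) - s` of the King model. -/
def casimirFun (s : ℝ) : ℝ := (1 + s) * Real.log (1 + s) - s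

/-- The distance `d(f, f₀)` of a state `f` with induced potential `U` to the King model
`f₀ = kingDensity E₀ U₀`. -/
def kingDist (E₀ : ℝ) (U₀ : R3 → ℝ) (f : R3 → R3 → ℝ) (U : R3 → ℝ) : ℝ :=
  (∫ z : R3 × R3,
    (casimirFun (f z.1 z.2) - casimirFun (kingDensity E₀ U₀ z.1 z.2)
      + (energy U₀ z.1 z.2 - E₀) * (f z.1 z.2 - kingDensity E₀ U₀ z.1 z.2)))
  + 1 / (8 * Real.pi) * ∫ x : R3, ‖gradient U x - gradient U₀ x‖ ^ 2

end

end KingModel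

open MeasureTheory Set Filter Topology

namespace KingModel

noncomputable section

/-! Write ψ = U_f − U₀, P = `freeEnergy`, K = `fieldEnergy`, so that d = P + K with P, K ≥ 0. The
difference P − K is, up to a constant, energy plus Casimir functional, hence conserved
(`freeEnergy_sub_fieldEnergy_eq`). If P − K ≥ K/32 whenever K is small (`exists_coercivity`), then
K, which is continuous in time, can never grow to the threshold, and d = (P − K) + 2K stays below a
multiple of its initial value.

Coercivity. Poisson's equation gives ∬ψ(f − f₀) = −2K. Since f is equimeasurable with f₀, also
∬(M(f) − M(f₀)) = 0 for every primitive M of a bounded continuous function. Thus P − 2K is the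
integral of `correctedDensity`, with M free to choose. On the support of f₀ the second derivative of
Φ₀ at f₀ is 1/(1 + f₀) = e^{E−E₀}, so a Legendre transform bounds that integral below by
−½∬e^{E₀−E}(ψ − n(E))² up to small errors, where n(E) = M'(f₀). What is needed is an n for which
this loss is a fraction of K strictly below one.

That is the Antonov-type estimate `integral_cutExp_mul_deviation_sq_le`. Let D be the transport
operator of U₀, η = x·v and θ = Dη the virial function. Then DE = 0 and Dθ = −κη, with κ = ΔU₀ +
u₀'/r > 0 away from the origin. On an energy level θ depends on the radius only and increases with
E, so n(E) can be taken to be the value of ψ at the radius where θ vanishes; then g = ψ − n(E) is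
divisible by θ. Integrating D(ηg²/θ) against a weight depending on E gives zero, and completing a
square leaves ∬e^{E₀−E}g² ≤ ∬e^{E₀−E}(Dψ)²/κ. For radial ψ the velocity integral on the right is
ρ₀|∇ψ|²/κ, and κ ≥ (16π/3)ρ₀ because ρ₀ decreases outwards. The result is 3/(16π)∫|∇ψ|² = 3K/2, an
ideal loss of 3K/4.

The rest of the budget pays for three defects. Near the origin the zero of θ is badly conditioned,
so radii are clamped at a small a > 0 and ψ is compared with its clamped profile, at cost O(a)K. The
multiplier n is only approximately Lipschitz with small slope, with a defect of order K. Outside the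
support of f₀ the integrand can be negative only in an energy shell of width τ of order √K, which
contributes order τ³. `le_freeEnergy_sub_fieldEnergy` collects these terms.

Solutions being merely locally Lipschitz, all evolution laws come from one transport identity,
proved by Rademacher's theorem and Fubini. Spherical symmetry is propagated by an L² Gronwall
estimate for f∘A − f, with the force difference controlled by an energy estimate for Poisson's
equation. Symmetry and equality of masses make ψ compactly supported, which legitimises the
integrations by parts. -/

/-! ### Transport of Lipschitz functions in phase space -/

theorem integrable_of_bound_of_isCompact {X : Type*} [TopologicalSpace X] [MeasurableSpace X]
    [OpensMeasurableSpace X] [T2Space X] {μ : Measure X} [IsFiniteMeasureOnCompacts μ] {φ : X → ℝ}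
    (hm : AEStronglyMeasurable φ μ) {K : Set X} (hK : IsCompact K) (h0 : ∀ x ∉ K, φ x = 0) {C : ℝ}
    (hb : ∀ x ∈ K, |φ x| ≤ C) : Integrable φ μ := by
  have h : IntegrableOn φ K μ := by
    refine Measure.integrableOn_of_bounded (M := C) hK.measure_lt_top.ne hm ?_
    filter_upwards [ae_restrict_mem hK.isClosed.measurableSet] with x hx using hb x hx
  exact (integrableOn_iff_integrable_of_support_subset
    (fun x hx => by by_contra hxK; exact hx (h0 x hxK))).1 h

/-- Integration by parts for Lipschitz functions, with the constant `1` as the other factor. -/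
theorem integral_lineDeriv_eq_zero {X : Type*} [NormedAddCommGroup X] [NormedSpace ℝ X]
    [FiniteDimensional ℝ X] [MeasurableSpace X] [BorelSpace X] {μ : Measure X}
    [μ.IsAddHaarMeasure] {C : NNReal} {h : X → ℝ} (hh : LipschitzWith C h)
    (hc : HasCompactSupport h) (v : X) : ∫ x, lineDeriv ℝ h x v ∂μ = 0 := by
  have := LipschitzWith.integral_lineDeriv_mul_eq (μ := μ) (LipschitzWith.const (1 : ℝ)) hh hc (-v)
  simp only [neg_neg, mul_one] at this
  rw [← this]
  simp [lineDeriv]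

theorem fderiv_eq_zero_of_notMem_of_isClosed {X : Type*} [NormedAddCommGroup X] [NormedSpace ℝ X]
    {h : X → ℝ} {K : Set X} (hK : IsClosed K) (h0 : ∀ x ∉ K, h x = 0) {x : X} (hx : x ∉ K) :
    fderiv ℝ h x = 0 := by
  have : h =ᶠ[𝓝 x] fun _ => 0 := by
    filter_upwards [hK.isOpen_compl.mem_nhds hx] with y hy using h0 y hy
  rw [this.fderiv_eq]; simp

instance isAddHaarMeasure_volume_phaseSpace : (volume : Measure (R3 × R3)).IsAddHaarMeasure := by
  rw [Measure.volume_eq_prod]; infer_instance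

instance isAddHaarMeasure_volume_timePhaseSpace :
    (volume : Measure (ℝ × R3 × R3)).IsAddHaarMeasure := by
  rw [Measure.volume_eq_prod]
  exact Measure.prod.instIsAddHaarMeasure (volume : Measure ℝ) (volume : Measure (R3 × R3))

theorem aestronglyMeasurable_fderiv_apply {X : Type*} [NormedAddCommGroup X] [NormedSpace ℝ X]
    [FiniteDimensional ℝ X] [MeasurableSpace X] [BorelSpace X] {μ : Measure X} (H : X → ℝ)
    {d : X → X} (hd : AEStronglyMeasurable d μ) :
    AEStronglyMeasurable (fun z => fderiv ℝ H z (d z)) μ := by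
  have h1 : AEStronglyMeasurable (fun z => fderiv ℝ H z) μ :=
    (measurable_fderiv ℝ H).aestronglyMeasurable
  exact isBoundedBilinearMap_apply.continuous.comp_aestronglyMeasurable (h1.prodMk hd)

/-- The transport operator `v · ∇ₓ - a(x) · ∇ᵥ` is divergence free. -/
theorem integral_fderiv_transport_eq_zero {C : NNReal} {H : R3 × R3 → ℝ} (hH : LipschitzWith C H)
    (hc : HasCompactSupport H) {a : R3 → R3} (ha : Continuous a) :
    ∫ z : R3 × R3, fderiv ℝ H z (z.2, -a z.1) = 0 := by
  have hint : ∀ d : R3 × R3 → R3 × R3, Continuous d →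
      Integrable (fun z => fderiv ℝ H z (d z)) := by
    intro d hd
    obtain ⟨B, hB⟩ := hc.isCompact.exists_bound_of_continuousOn hd.continuousOn
    refine integrable_of_bound_of_isCompact (C := C * B) ?_ hc.isCompact ?_ ?_
    · exact aestronglyMeasurable_fderiv_apply H hd.aestronglyMeasurable
    · intro z hz
      rw [fderiv_eq_zero_of_notMem_of_isClosed (isClosed_tsupport H)
        (fun x hx => image_eq_zero_of_notMem_tsupport hx) hz]; simp
    · intro z hz
      calc |fderiv ℝ H z (d z)| ≤ ‖fderiv ℝ H z‖ * ‖d z‖ := (fderiv ℝ H z).le_opNorm _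
        _ ≤ C * B := mul_le_mul (norm_fderiv_le_of_lipschitz ℝ hH) (hB z hz) (norm_nonneg _) C.2
  -- Each half of the field is constant in the variable along which it differentiates, so Fubini
  -- reduces both halves to integrals of line derivatives on slices.
  have hsplit : ∀ z : R3 × R3, fderiv ℝ H z (z.2, -a z.1)
      = fderiv ℝ H z (z.2, 0) + fderiv ℝ H z (0, -a z.1) := by
    intro z; rw [← map_add]; simp
  have hae : ∀ᵐ z : R3 × R3, DifferentiableAt ℝ H z := hH.ae_differentiableAt
  have i1 := hint (fun z => (z.2, 0)) (by fun_prop)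
  have i2 := hint (fun z => (0, -a z.1)) (by fun_prop)
  simp_rw [hsplit]
  rw [integral_add i1 i2]
  have e1 : ∫ z : R3 × R3, fderiv ℝ H z (z.2, 0) = 0 := by
    rw [Measure.volume_eq_prod, integral_prod_symm _ i1]
    rw [Measure.volume_eq_prod] at hae
    have := Measure.ae_ae_of_ae_prod ((Measure.measurePreserving_swap (μ := (volume : Measure R3))
      (ν := (volume : Measure R3))).quasiMeasurePreserving.ae hae)
    rw [integral_eq_zero_of_ae]
    filter_upwards [this] with v hv
    have hl : LipschitzWith C (fun x => H (x, v)) := by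
      simpa [Function.comp_def] using hH.comp (LipschitzWith.prodMk_right v)
    have hcl : HasCompactSupport (fun x => H (x, v)) := by
      refine HasCompactSupport.of_support_subset_isCompact (hc.isCompact.image continuous_fst) ?_
      intro x hx; exact ⟨(x, v), subset_tsupport _ hx, rfl⟩
    refine Eq.trans (integral_congr_ae ?_) (integral_lineDeriv_eq_zero hl hcl v)
    filter_upwards [hv] with x hx
    have := (hx.hasFDerivAt.hasLineDerivAt (v, 0)).lineDeriv
    simp only [Prod.swap_prod_mk] at this
    rw [← this]; simp [lineDeriv]
  have e2 : ∫ z : R3 × R3, fderiv ℝ H z (0, -a z.1) = 0 := by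
    rw [Measure.volume_eq_prod, integral_prod _ i2]
    rw [Measure.volume_eq_prod] at hae
    have := Measure.ae_ae_of_ae_prod hae
    rw [integral_eq_zero_of_ae]
    filter_upwards [this] with x hv
    have hl : LipschitzWith C (fun v => H (x, v)) := by
      simpa [Function.comp_def] using hH.comp (LipschitzWith.prodMk_left x)
    have hcl : HasCompactSupport (fun v => H (x, v)) := by
      refine HasCompactSupport.of_support_subset_isCompact (hc.isCompact.image continuous_snd) ?_
      intro v hx; exact ⟨(x, v), subset_tsupport _ hx, rfl⟩
    refine Eq.trans (integral_congr_ae ?_) (integral_lineDeriv_eq_zero hl hcl (-a x))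
    filter_upwards [hv] with v hx
    have := (hx.hasFDerivAt.hasLineDerivAt (0, -a x)).lineDeriv
    rw [← this]; simp [lineDeriv]
  rw [e1, e2, add_zero]

/-- Rate of change of the integral of a Lipschitz function along a phase space transport. -/
theorem integral_sub_integral_eq_integral_fderiv_transport {C : NNReal} {G : ℝ × R3 × R3 → ℝ}
    (hG : LipschitzWith C G) {K : Set (R3 × R3)} (hK : IsCompact K)
    (h0 : ∀ t, ∀ z ∉ K, G (t, z) = 0) {a : ℝ → R3 → R3} (ha : ∀ t, Continuous (a t)) (s t : ℝ) :
    (∫ z, G (t, z)) - ∫ z, G (s, z)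
      = ∫ τ in s..t, ∫ z : R3 × R3, fderiv ℝ G (τ, z) (1, (z.2, -a τ z.1)) := by
  have hslice : ∀ t, LipschitzWith C (fun z => G (t, z)) := fun t => by
    simpa [Function.comp_def] using hG.comp (LipschitzWith.prodMk_left t)
  have hslice' : ∀ z, LipschitzWith C (fun t => G (t, z)) := fun z => by
    simpa [Function.comp_def] using hG.comp (LipschitzWith.prodMk_right z)
  have hcs : ∀ t, HasCompactSupport (fun z => G (t, z)) := fun t =>
    HasCompactSupport.of_support_subset_isCompact hK
      (fun z hz => by by_contra hzK; exact hz (h0 t z hzK))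
  have hfd : ∀ p : ℝ × R3 × R3, p.2 ∉ K → fderiv ℝ G p = 0 := fun p hp =>
    fderiv_eq_zero_of_notMem_of_isClosed (K := univ ×ˢ K) (isClosed_univ.prod hK.isClosed)
      (fun x hx => h0 x.1 x.2 (fun h => hx ⟨mem_univ _, h⟩)) (fun h => hp h.2)
  have hae : ∀ᵐ p : ℝ × R3 × R3, DifferentiableAt ℝ G p := hG.ae_differentiableAt
  rw [Measure.volume_eq_prod] at hae
  have hae1 := Measure.ae_ae_of_ae_prod hae
  have hint : ∀ τ : ℝ, ∀ d : R3 × R3 → ℝ × R3 × R3, Continuous d →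
      Integrable (fun z => fderiv ℝ G (τ, z) (d z)) := by
    intro τ d hd
    obtain ⟨B, hB⟩ := hK.exists_bound_of_continuousOn hd.continuousOn
    refine integrable_of_bound_of_isCompact (C := C * B) ?_ hK ?_ ?_
    · have h1 : AEStronglyMeasurable (fun z : R3 × R3 => fderiv ℝ G (τ, z)) volume :=
        ((measurable_fderiv ℝ G).comp (measurable_prodMk_left)).aestronglyMeasurable
      exact isBoundedBilinearMap_apply.continuous.comp_aestronglyMeasurable
        (h1.prodMk hd.aestronglyMeasurable)
    · intro z hz
      rw [hfd (τ, z) hz]; simp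
    · intro z hz
      calc |fderiv ℝ G (τ, z) (d z)| ≤ ‖fderiv ℝ G (τ, z)‖ * ‖d z‖ :=
            (fderiv ℝ G (τ, z)).le_opNorm _
        _ ≤ C * B := mul_le_mul (norm_fderiv_le_of_lipschitz ℝ hG) (hB z hz) (norm_nonneg _) C.2
  -- At almost every time the slice is differentiable almost everywhere and the phase space part
  -- integrates to zero; only the time derivative remains.
  have inner_eq : ∀ᵐ τ : ℝ, ∫ z : R3 × R3, fderiv ℝ G (τ, z) (1, (z.2, -a τ z.1))
      = ∫ z : R3 × R3, fderiv ℝ G (τ, z) (1, 0) := by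
    filter_upwards [hae1] with τ hτ
    have hsplit : ∀ z : R3 × R3, fderiv ℝ G (τ, z) (1, (z.2, -a τ z.1))
        = fderiv ℝ G (τ, z) (1, 0) + fderiv ℝ G (τ, z) (0, (z.2, -a τ z.1)) := by
      intro z; rw [← map_add]; simp
    simp_rw [hsplit]
    have hat := ha τ
    rw [integral_add (hint τ (fun z => (1, 0)) (by fun_prop))
      (hint τ (fun z => (0, (z.2, -a τ z.1))) (by fun_prop))]
    have : ∫ z : R3 × R3, fderiv ℝ G (τ, z) (0, (z.2, -a τ z.1)) = 0 := by
      refine Eq.trans (integral_congr_ae ?_)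
        (integral_fderiv_transport_eq_zero (hslice τ) (hcs τ) (ha τ))
      filter_upwards [hτ] with z hz
      have h2 : HasFDerivAt (fun z => G (τ, z))
          ((fderiv ℝ G (τ, z)).comp (ContinuousLinearMap.inr ℝ ℝ (R3 × R3))) z :=
        hz.hasFDerivAt.comp z (hasFDerivAt_prodMk_right τ z)
      rw [h2.fderiv]; simp
    rw [this, add_zero]
  rw [intervalIntegral.integral_congr_ae' (g := fun τ => ∫ z : R3 × R3, fderiv ℝ G (τ, z) (1, 0))
    (by filter_upwards [inner_eq] with τ h _ using h)
    (by filter_upwards [inner_eq] with τ h _ using h)]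
  have hint2 : Integrable (Function.uncurry fun (τ : ℝ) (z : R3 × R3) => fderiv ℝ G (τ, z) (1, 0))
      ((volume.restrict (uIoc s t)).prod volume) := by
    have hm : Measurable (fun p : ℝ × R3 × R3 => fderiv ℝ G p (1, 0)) :=
      measurable_fderiv_apply_const ℝ G _
    have : IntegrableOn (fun p : ℝ × R3 × R3 => fderiv ℝ G p (1, 0)) (uIcc s t ×ˢ K)
        (volume.prod volume) := by
      refine Measure.integrableOn_of_bounded (M := C * ‖((1 : ℝ), (0 : R3 × R3))‖)
        (isCompact_uIcc.prod hK).measure_lt_top.ne hm.aestronglyMeasurable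
        (Eventually.of_forall fun p => ?_)
      exact ((fderiv ℝ G p).le_opNorm _).trans
        (mul_le_mul_of_nonneg_right (norm_fderiv_le_of_lipschitz ℝ hG) (norm_nonneg _))
    have h3 : IntegrableOn (fun p : ℝ × R3 × R3 => fderiv ℝ G p (1, 0)) (uIoc s t ×ˢ univ)
        (volume.prod volume) := by
      refine (this.of_forall_sdiff_eq_zero (s := uIcc s t ×ˢ K)
        (t := uIoc s t ×ˢ univ) (measurableSet_uIoc.prod MeasurableSet.univ) ?_)
      rintro p ⟨⟨hp1, -⟩, hp2⟩
      have : p.2 ∉ K := fun h => hp2 ⟨uIoc_subset_uIcc hp1, h⟩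
      rw [hfd p this]; simp
    rw [IntegrableOn, ← Measure.prod_restrict, Measure.restrict_univ] at h3
    exact h3
  rw [intervalIntegral_integral_swap hint2]
  rw [← integral_sub ((hslice t).continuous.integrable_of_hasCompactSupport (hcs t))
    ((hslice s).continuous.integrable_of_hasCompactSupport (hcs s))]
  have hae2 := Measure.ae_ae_of_ae_prod ((Measure.measurePreserving_swap
      (μ := (volume : Measure (R3 × R3)))
      (ν := (volume : Measure ℝ))).quasiMeasurePreserving.ae hae)
  refine integral_congr_ae ?_
  filter_upwards [hae2] with z hz
  -- Lipschitz dependence on time gives absolute continuity, hence the fundamental theorem of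
  -- calculus for almost every phase space point.
  have hac := ((hslice' z).lipschitzOnWith (s := uIcc s t)).absolutelyContinuousOnInterval
  rw [← hac.integral_deriv_eq_sub]
  refine intervalIntegral.integral_congr_ae ?_
  filter_upwards [hz] with τ hτ _
  have h2 : HasFDerivAt (fun τ => G (τ, z))
      ((fderiv ℝ G (τ, z)).comp (ContinuousLinearMap.inl ℝ ℝ (R3 × R3))) τ :=
    HasFDerivAt.comp τ (g := G) hτ.hasFDerivAt (hasFDerivAt_prodMk_left τ z)
  rw [h2.hasDerivAt.deriv]; simp

/-! ### Gradient, Laplacian, Green's identity, and functions of |x|² -/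

open Laplacian in
theorem laplacian_eq_sum_fderiv_fderiv {ι : Type*} [Fintype ι] (e : OrthonormalBasis ι ℝ R3)
    (f : R3 → ℝ) (x : R3) :
    laplacian f x = ∑ i, fderiv ℝ (fderiv ℝ f) x (e i) (e i) := by
  rw [InnerProductSpace.laplacian_eq_iteratedFDeriv_orthonormalBasis f e]
  simp [iteratedFDeriv_two_apply]

theorem inner_gradient_left (f : R3 → ℝ) (x v : R3) :
    inner ℝ (gradient f x) v = fderiv ℝ f x v := by
  simp [gradient]

theorem inner_gradient_right (f : R3 → ℝ) (x v : R3) :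
    inner ℝ v (gradient f x) = fderiv ℝ f x v := by
  rw [real_inner_comm, inner_gradient_left]

theorem inner_gradient_gradient {ι : Type*} [Fintype ι] (e : OrthonormalBasis ι ℝ R3)
    (f g : R3 → ℝ) (x : R3) :
    inner ℝ (gradient f x) (gradient g x) = ∑ i, fderiv ℝ f x (e i) * fderiv ℝ g x (e i) := by
  rw [← e.sum_inner_mul_inner]
  exact Finset.sum_congr rfl fun i _ => by rw [inner_gradient_left, inner_gradient_right]

theorem norm_gradient (f : R3 → ℝ) (x : R3) : ‖gradient f x‖ = ‖fderiv ℝ f x‖ := by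
  simp [gradient]

theorem continuous_gradient {f : R3 → ℝ} (hf : ContDiff ℝ 1 f) : Continuous (gradient f) :=
  (InnerProductSpace.toDual ℝ R3).symm.continuous.comp (hf.continuous_fderiv (by norm_num))

theorem contDiff_fderiv_of_two {f : R3 → ℝ} (hf : ContDiff ℝ 2 f) : ContDiff ℝ 1 (fderiv ℝ f) :=
  hf.fderiv_right (by norm_num)

theorem continuous_laplacian {f : R3 → ℝ} (hf : ContDiff ℝ 2 f) :
    Continuous (Laplacian.laplacian f) := by
  have h : Laplacian.laplacian f = fun x => ∑ i, fderiv ℝ (fderiv ℝ f) x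
      (EuclideanSpace.basisFun (Fin 3) ℝ i) (EuclideanSpace.basisFun (Fin 3) ℝ i) := by
    ext x; exact laplacian_eq_sum_fderiv_fderiv _ f x
  have h2 := (contDiff_fderiv_of_two hf).continuous_fderiv (by norm_num)
  rw [h]; fun_prop

/-- Green's identity. -/
theorem integral_inner_gradient_eq_neg_integral_mul_laplacian {ζ w : R3 → ℝ}
    (hζ : ContDiff ℝ 1 ζ) (hw : ContDiff ℝ 2 w)
    (hc : HasCompactSupport ζ ∨ HasCompactSupport w) :
    ∫ x, inner ℝ (gradient ζ x) (gradient w x) = -∫ x, ζ x * Laplacian.laplacian w x := by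
  let e := EuclideanSpace.basisFun (Fin 3) ℝ
  simp_rw [inner_gradient_gradient e, laplacian_eq_sum_fderiv_fderiv e, Finset.mul_sum]
  have hw1 := contDiff_fderiv_of_two hw
  have hw2 := hw1.continuous_fderiv (by norm_num)
  have hζ1 := hζ.continuous_fderiv (by norm_num)
  have hw0 := hw.continuous_fderiv (by norm_num)
  have i1 : ∀ i, Integrable (fun x => fderiv ℝ ζ x (e i) * fderiv ℝ w x (e i)) := fun i => by
    refine Continuous.integrable_of_hasCompactSupport (by fun_prop) ?_
    exact hc.elim (fun h => (h.fderiv_apply (𝕜 := ℝ) (e i)).mul_right)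
      (fun h => (h.fderiv_apply (𝕜 := ℝ) (e i)).mul_left)
  have i2 : ∀ i, Integrable (fun x => ζ x * fderiv ℝ (fderiv ℝ w) x (e i) (e i)) := fun i => by
    refine Continuous.integrable_of_hasCompactSupport ?_ (hc.elim (fun h => h.mul_right)
      (fun h => ((h.fderiv (𝕜 := ℝ)).fderiv (𝕜 := ℝ)).mono' ?_ |>.mul_left))
    · have := hζ.continuous
      fun_prop
    · refine (Function.support_subset_iff'.2 fun x hx => ?_).trans (subset_tsupport _)
      rw [Function.notMem_support.1 hx]; rfl
  have i3 : ∀ i, Integrable (fun x => ζ x * fderiv ℝ w x (e i)) := fun i => by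
    refine Continuous.integrable_of_hasCompactSupport ?_ (hc.elim (fun h => h.mul_right)
      (fun h => (h.fderiv_apply (𝕜 := ℝ) (e i)).mul_left))
    have := hζ.continuous
    fun_prop
  rw [integral_finsetSum _ (fun i _ => i1 i), integral_finsetSum _ (fun i _ => i2 i),
    ← Finset.sum_neg_distrib]
  refine Finset.sum_congr rfl fun i _ => ?_
  have hd : ∀ x, fderiv ℝ (fun y => fderiv ℝ w y (e i)) x (e i)
      = fderiv ℝ (fderiv ℝ w) x (e i) (e i) := by
    intro x
    have h1 : HasFDerivAt (fderiv ℝ w) (fderiv ℝ (fderiv ℝ w) x) x :=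
      (hw1.differentiable (by norm_num) x).hasFDerivAt
    have h2 := h1.clm_apply (hasFDerivAt_const (e i) x)
    rw [h2.fderiv]; simp
  have := integral_mul_fderiv_eq_neg_fderiv_mul_of_integrable (𝕜 := ℝ) (μ := volume) (f := ζ)
    (g := fun y => fderiv ℝ w y (e i)) (v := e i) (i1 i) (by simpa [hd] using i2 i) (i3 i)
    (fun x _ => hζ.differentiable (by norm_num) x)
    (fun x _ => (hw1.differentiable (by norm_num) x).clm_apply (differentiableAt_const _))
  simp_rw [hd] at this
  rw [this]; simp

/-- The inner product of `R3` as a bilinear map. -/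
def innerR3 : R3 →L[ℝ] R3 →L[ℝ] ℝ := innerSL ℝ

@[simp]
theorem innerR3_apply (x y : R3) : innerR3 x y = inner ℝ x y := rfl

/-- Radial functions are differentiated as functions of |x|², which unlike |x| is smooth at the
origin. -/
theorem hasFDerivAt_comp_normSq {q : ℝ → ℝ} {q' : ℝ} {x : R3} (hq : HasDerivAt q q' (‖x‖ ^ 2)) :
    HasFDerivAt (fun y => q (‖y‖ ^ 2)) ((2 * q') • innerR3 x) x := by
  have h := hq.comp_hasFDerivAt x (hasStrictFDerivAt_norm_sq x).hasFDerivAt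
  refine h.congr_fderiv (ContinuousLinearMap.ext fun v => ?_)
  change q' * ((2 : ℕ) • inner ℝ x v) = 2 * q' * inner ℝ x v
  rw [nsmul_eq_mul]
  push_cast
  ring

theorem hasFDerivAt_fderiv_of_normSq {W : R3 → ℝ} {q q₁ : ℝ → ℝ} {q₂ : ℝ} {x : R3}
    (hW : W =ᶠ[𝓝 x] fun y => q (‖y‖ ^ 2)) (hq : ∀ᶠ s in 𝓝 (‖x‖ ^ 2), HasDerivAt q (q₁ s) s)
    (hq₁ : HasDerivAt q₁ q₂ (‖x‖ ^ 2)) :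
    HasFDerivAt (fderiv ℝ W) ((2 * q₁ (‖x‖ ^ 2)) • innerR3
      + ((4 * q₂) • innerR3 x).smulRight (innerR3 x)) x := by
  have hc : ContinuousAt (fun y : R3 => ‖y‖ ^ 2) x := by fun_prop
  have h1 : fderiv ℝ W =ᶠ[𝓝 x] fun y => (2 * q₁ (‖y‖ ^ 2)) • innerR3 y := by
    filter_upwards [hW.eventually_nhds, hc.eventually hq] with y hy hqy
    rw [Filter.EventuallyEq.fderiv_eq hy]
    exact (hasFDerivAt_comp_normSq hqy).fderiv
  have h2 : HasFDerivAt (fun y : R3 => 2 * q₁ (‖y‖ ^ 2)) ((4 * q₂) • innerR3 x) x := by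
    have := (hasFDerivAt_comp_normSq hq₁).const_mul 2
    refine this.congr_fderiv (ContinuousLinearMap.ext fun v => ?_)
    change 2 * (2 * q₂ * inner ℝ x v) = 4 * q₂ * inner ℝ x v
    ring
  have h3 := h2.smul (innerR3.hasFDerivAt (x := x))
  exact h3.congr_of_eventuallyEq h1

theorem gradient_of_normSq {W : R3 → ℝ} {q : ℝ → ℝ} {q₁ : ℝ} {x : R3}
    (hW : W =ᶠ[𝓝 x] fun y => q (‖y‖ ^ 2)) (hq : HasDerivAt q q₁ (‖x‖ ^ 2)) :
    gradient W x = (2 * q₁) • x := by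
  refine ext_inner_right ℝ fun v => ?_
  rw [inner_gradient_left, hW.fderiv_eq, (hasFDerivAt_comp_normSq hq).fderiv]
  simp [inner_smul_left]

theorem laplacian_of_normSq {W : R3 → ℝ} {q q₁ : ℝ → ℝ} {q₂ : ℝ} {x : R3}
    (hW : W =ᶠ[𝓝 x] fun y => q (‖y‖ ^ 2)) (hq : ∀ᶠ s in 𝓝 (‖x‖ ^ 2), HasDerivAt q (q₁ s) s)
    (hq₁ : HasDerivAt q₁ q₂ (‖x‖ ^ 2)) :
    Laplacian.laplacian W x = 6 * q₁ (‖x‖ ^ 2) + 4 * q₂ * ‖x‖ ^ 2 := by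
  let e := EuclideanSpace.basisFun (Fin 3) ℝ
  rw [laplacian_eq_sum_fderiv_fderiv e, (hasFDerivAt_fderiv_of_normSq hW hq hq₁).fderiv]
  have h1 : ∀ i, inner ℝ (e i) (e i) = (1 : ℝ) := fun i => by simp
  have h2 : ∑ i, inner ℝ x (e i) * inner ℝ x (e i) = ‖x‖ ^ 2 := by
    have := e.sum_inner_mul_inner x x
    rw [← real_inner_self_eq_norm_sq, ← this]
    exact Finset.sum_congr rfl fun i _ => by rw [real_inner_comm x (e i)]
  simp only [add_apply, smul_apply, innerR3_apply,
    ContinuousLinearMap.smulRight_apply, smul_eq_mul, h1, Finset.sum_add_distrib]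
  rw [← h2, Finset.mul_sum]
  simp
  congr 1
  · ring
  · exact Finset.sum_congr rfl fun i _ => by ring

theorem fderiv_comp_linearIsometryEquiv {W : R3 → ℝ} (hW : Differentiable ℝ W) (A : R3 ≃ₗᵢ[ℝ] R3)
    (x v : R3) : fderiv ℝ (fun y => W (A y)) x v = fderiv ℝ W (A x) (A v) := by
  have := (hW (A x)).hasFDerivAt.comp x (A.toContinuousLinearEquiv.hasFDerivAt (x := x))
  have h2 : HasFDerivAt (fun y => W (A y)) _ x := this
  rw [h2.fderiv]; rfl

theorem gradient_comp_linearIsometryEquiv {W : R3 → ℝ} (hW : Differentiable ℝ W)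
    (A : R3 ≃ₗᵢ[ℝ] R3) (x : R3) :
    A (gradient (fun y => W (A y)) x) = gradient W (A x) := by
  refine ext_inner_right ℝ fun v => ?_
  obtain ⟨v, rfl⟩ := A.surjective v
  rw [A.inner_map_map, inner_gradient_left, inner_gradient_left,
    fderiv_comp_linearIsometryEquiv hW]

theorem laplacian_comp_linearIsometryEquiv {W : R3 → ℝ} (hW : ContDiff ℝ 2 W) (A : R3 ≃ₗᵢ[ℝ] R3)
    (x : R3) : Laplacian.laplacian (fun y => W (A y)) x = Laplacian.laplacian W (A x) := by
  let e := EuclideanSpace.basisFun (Fin 3) ℝ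
  rw [laplacian_eq_sum_fderiv_fderiv e, laplacian_eq_sum_fderiv_fderiv (e.map A)]
  refine Finset.sum_congr rfl fun i _ => ?_
  have hw1 := contDiff_fderiv_of_two hW
  have h0 : fderiv ℝ (fun y => W (A y)) = fun y =>
      (fderiv ℝ W (A y)).comp (A.toContinuousLinearEquiv : R3 →L[ℝ] R3) := by
    ext y v
    exact fderiv_comp_linearIsometryEquiv (hW.differentiable (by norm_num)) A y v
  have h1 : HasFDerivAt (fun y => fderiv ℝ W (A y))
      ((fderiv ℝ (fderiv ℝ W) (A x)).comp (A.toContinuousLinearEquiv : R3 →L[ℝ] R3)) x :=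
    HasFDerivAt.comp x (g := fderiv ℝ W) (hw1.differentiable (by norm_num) (A x)).hasFDerivAt
      (A.toContinuousLinearEquiv.hasFDerivAt (x := x))
  rw [h0, (h1.clm_comp (hasFDerivAt_const _ x)).fderiv]
  simp

/-! ### Maximum principle and decay of potentials -/

/-- A positive value would force a global maximum. There some pure second derivative is positive, so
along that line the point is also a local minimum; the restriction is then locally constant,
contradicting the second derivative. -/
theorem le_zero_of_laplacian_pos {z : R3 → ℝ} (hz : ContDiff ℝ 2 z)
    (hΔ : ∀ x, 0 < Laplacian.laplacian z x) (h0 : Tendsto z (cocompact R3) (𝓝 0)) (x : R3) :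
    z x ≤ 0 := by
  by_contra! hx
  obtain ⟨y, hy⟩ := hz.continuous.exists_forall_ge' x
    ((h0.eventually (gt_mem_nhds hx)).mono fun _ h => h.le)
  let e := EuclideanSpace.basisFun (Fin 3) ℝ
  have hpos := hΔ y
  rw [laplacian_eq_sum_fderiv_fderiv e] at hpos
  obtain ⟨i, -, hi⟩ := Finset.exists_lt_of_sum_lt (s := Finset.univ) (f := fun _ => (0 : ℝ))
    (g := fun i => fderiv ℝ (fderiv ℝ z) y (e i) (e i)) (by simpa using hpos)
  set φ : ℝ → ℝ := fun s => z (y + s • e i) with hφ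
  have hline : ∀ s : ℝ, HasDerivAt (fun s : ℝ => y + s • e i) (e i) s := fun s => by
    simpa using ((hasDerivAt_id s).smul_const (e i)).const_add y
  have hd1 : ∀ s, HasDerivAt φ (fderiv ℝ z (y + s • e i) (e i)) s := fun s =>
    (hz.differentiable (by norm_num) _).hasFDerivAt.comp_hasDerivAt s (hline s)
  have hd2 : ∀ s, HasDerivAt (fun s => fderiv ℝ z (y + s • e i) (e i))
      (fderiv ℝ (fderiv ℝ z) (y + s • e i) (e i) (e i)) s := fun s => by
    have h1 := (((contDiff_fderiv_of_two hz).differentiable (by norm_num)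
      (y + s • e i)).hasFDerivAt.comp_hasDerivAt s (hline s))
    have h2 := h1.clm_apply (hasDerivAt_const s (e i))
    simpa using h2
  have hderiv : deriv φ = fun s => fderiv ℝ z (y + s • e i) (e i) := funext fun s => (hd1 s).deriv
  have hmax : IsLocalMax φ 0 := by
    refine Eventually.of_forall fun s => ?_
    simpa [hφ] using hy (y + s • e i)
  have hmin : IsLocalMin φ 0 := by
    refine isLocalMin_of_deriv_deriv_pos ?_ hmax.deriv_eq_zero (hd1 0).continuousAt
    rw [hderiv, (hd2 0).deriv]
    simpa using hi
  have hconst : φ =ᶠ[𝓝 0] fun _ => φ 0 := by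
    filter_upwards [hmax, hmin] with s h1 h2 using le_antisymm h1 h2
  have : deriv (deriv φ) 0 = 0 := by
    rw [hconst.deriv.deriv_eq]; simp
  rw [hderiv, (hd2 0).deriv] at this
  simp only [zero_smul, add_zero] at this
  exact hi.ne' this

/-- A decaying strictly superharmonic function. -/
def barrier (x : R3) : ℝ := (1 + ‖x‖ ^ 2) ^ (-(3 / 8) : ℝ)

theorem barrier_pos (x : R3) : 0 < barrier x := Real.rpow_pos_of_pos (by positivity) _

theorem contDiff_barrier : ContDiff ℝ 2 barrier := by
  refine ContDiff.rpow_const_of_ne (contDiff_const.add (contDiff_norm_sq ℝ)) fun x => ?_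
  positivity

theorem tendsto_barrier : Tendsto barrier (cocompact R3) (𝓝 0) := by
  have h1 : Tendsto (fun x : R3 => 1 + ‖x‖ ^ 2) (cocompact R3) atTop :=
    tendsto_atTop_add_const_left _ _
      ((tendsto_pow_atTop (by norm_num)).comp tendsto_norm_cocompact_atTop)
  exact (tendsto_rpow_neg_atTop (by norm_num : (0 : ℝ) < 3 / 8)).comp h1

/-- An exponent between 1/4 and 1/2 is wanted. Up to 1/2 the function is strictly superharmonic in
dimension three; above 1/4 its square decays faster than 1/|x|, which makes the cut-off errors of
the energy estimate vanish. -/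
theorem laplacian_barrier_le (x : R3) :
    Laplacian.laplacian barrier x ≤ -(1 + ‖x‖ ^ 2) ^ (-(19 / 8) : ℝ) := by
  have hder : ∀ (p s : ℝ), -1 < s → HasDerivAt (fun s : ℝ => (1 + s) ^ p)
      (p * (1 + s) ^ (p - 1)) s := by
    intro p s hs
    have := ((hasDerivAt_id s).const_add 1).rpow_const (p := p) (Or.inl (by simp; linarith))
    simpa using this
  have hs : (-1 : ℝ) < ‖x‖ ^ 2 := by linarith [sq_nonneg ‖x‖]
  have h := laplacian_of_normSq (W := barrier) (q := fun s => (1 + s) ^ (-(3 / 8) : ℝ))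
    (q₁ := fun s => -(3 / 8) * (1 + s) ^ (-(11 / 8) : ℝ))
    (q₂ := -(3 / 8) * (-(11 / 8) * (1 + ‖x‖ ^ 2) ^ (-(19 / 8) : ℝ))) (x := x)
    (Eventually.of_forall fun y => rfl)
    (by
      filter_upwards [lt_mem_nhds hs] with s hs
      convert hder _ s hs using 2
      norm_num)
    (by
      have := (hder (-(11 / 8)) _ hs).const_mul (-(3 / 8) : ℝ)
      rwa [show (-(11 / 8) - 1 : ℝ) = -(19 / 8) by norm_num] at this)
  rw [h]
  have e1 : (1 + ‖x‖ ^ 2) ^ (-(11 / 8) : ℝ)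
      = (1 + ‖x‖ ^ 2) ^ (-(19 / 8) : ℝ) * (1 + ‖x‖ ^ 2) := by
    rw [← Real.rpow_add_one (by positivity)]; norm_num
  rw [e1]
  have : 0 < (1 + ‖x‖ ^ 2) ^ (-(19 / 8) : ℝ) := Real.rpow_pos_of_pos (by positivity) _
  nlinarith [sq_nonneg ‖x‖, mul_nonneg this.le (sq_nonneg ‖x‖)]

/-- Comparison: for large C both ±w − C·barrier are strictly subharmonic. Outside the ball this is
the barrier's doing alone, and inside it C dominates the bound on the Laplacian of w. -/
theorem exists_abs_le_barrier {w : R3 → ℝ} (hw : ContDiff ℝ 2 w)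
    (h0 : Tendsto w (cocompact R3) (𝓝 0)) {R : ℝ}
    (hR : ∀ x, R < ‖x‖ → Laplacian.laplacian w x = 0) :
    ∃ C, 0 < C ∧ ∀ x, |w x| ≤ C * barrier x := by
  obtain ⟨B, hB⟩ := (isCompact_closedBall (0 : R3) R).exists_bound_of_continuousOn
    (continuous_laplacian hw).continuousOn
  set m := (1 + R ^ 2) ^ (-(19 / 8) : ℝ) with hm
  have hmpos : 0 < m := Real.rpow_pos_of_pos (by positivity) _
  set C := (|B| + 1) / m with hC
  have hCpos : 0 < C := by positivity
  have key : ∀ g : R3 → ℝ, ContDiff ℝ 2 g → Tendsto g (cocompact R3) (𝓝 0) →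
      (∀ x, R < ‖x‖ → Laplacian.laplacian g x = 0) →
      (∀ x, ‖x‖ ≤ R → |Laplacian.laplacian g x| ≤ |B|) → ∀ x, g x ≤ C * barrier x := by
    intro g hg g0 gR gB x
    have hb2 : ContDiff ℝ 2 (C • barrier) := contDiff_const.smul contDiff_barrier
    have := le_zero_of_laplacian_pos (z := g - C • barrier) (hg.sub hb2) ?_ ?_ x
    · simpa using this
    · intro y
      rw [ContDiffAt.laplacian_sub hg.contDiffAt hb2.contDiffAt,
        InnerProductSpace.laplacian_smul C contDiff_barrier.contDiffAt, smul_eq_mul]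
      have hb := laplacian_barrier_le y
      have hbp : 0 < (1 + ‖y‖ ^ 2) ^ (-(19 / 8) : ℝ) := Real.rpow_pos_of_pos (by positivity) _
      rcases lt_or_ge R ‖y‖ with hy | hy
      · rw [gR y hy]
        nlinarith
      · have hmy : m ≤ (1 + ‖y‖ ^ 2) ^ (-(19 / 8) : ℝ) := by
          refine Real.rpow_le_rpow_of_nonpos (by positivity) ?_ (by norm_num)
          gcongr
        have h1 : C * m = |B| + 1 := by rw [hC]; field_simp
        have h2 := (abs_le.1 (gB y hy)).1
        nlinarith [mul_le_mul_of_nonneg_left (hmy.trans (le_neg_of_le_neg hb)) hCpos.le]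
    · have := g0.sub (tendsto_barrier.const_mul C)
      simpa [Pi.sub_def, Pi.smul_def] using this
  refine ⟨C, hCpos, fun x => abs_le'.2 ⟨?_, ?_⟩⟩
  · refine key w hw h0 hR (fun x hx => (hB x (by simpa using hx)).trans (le_abs_self B)) x
  · refine key (-w) hw.neg (by simpa [Pi.neg_def] using h0.neg) (fun x hx => ?_) (fun x hx => ?_) x
    · rw [InnerProductSpace.laplacian_neg]; simp [hR x hx]
    · rw [InnerProductSpace.laplacian_neg]
      simpa using (hB x (by simpa using hx)).trans (le_abs_self B)

/-! ### An energy estimate for Poisson's equation via a Hardy inequality -/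

theorem gradient_mul {f g : R3 → ℝ} {x : R3} (hf : DifferentiableAt ℝ f x)
    (hg : DifferentiableAt ℝ g x) :
    gradient (f * g) x = f x • gradient g x + g x • gradient f x := by
  refine ext_inner_right ℝ fun v => ?_
  rw [inner_gradient_left, (hf.hasFDerivAt.mul hg.hasFDerivAt).fderiv, inner_add_left,
    inner_smul_left, inner_smul_left, inner_gradient_left, inner_gradient_left]
  simp

/-- Local energy identity for a function and a cut-off. -/
theorem integral_cutoff_mul_norm_gradient_sq {χ w : R3 → ℝ} (hχ : ContDiff ℝ 2 χ)
    (hc : HasCompactSupport χ) (hw : ContDiff ℝ 2 w) :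
    ∫ x, χ x * ‖gradient w x‖ ^ 2
      = (1 / 2) * (∫ x, w x ^ 2 * Laplacian.laplacian χ x)
        - ∫ x, χ x * w x * Laplacian.laplacian w x := by
  have hχ1 : ContDiff ℝ 1 χ := hχ.of_le (by norm_num)
  have hw1 : ContDiff ℝ 1 w := hw.of_le (by norm_num)
  have dχ := hχ.differentiable (by norm_num)
  have dw := hw.differentiable (by norm_num)
  have h1 : ∫ x, inner ℝ (gradient (χ * w) x) (gradient w x)
      = -∫ x, (χ * w) x * Laplacian.laplacian w x :=
    integral_inner_gradient_eq_neg_integral_mul_laplacian (hχ1.mul hw1) hw (Or.inl hc.mul_right)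
  have h2 : ∫ x, inner ℝ (gradient (w * w) x) (gradient χ x)
      = -∫ x, (w * w) x * Laplacian.laplacian χ x :=
    integral_inner_gradient_eq_neg_integral_mul_laplacian (hw1.mul hw1) hχ (Or.inr hc)
  have cw := continuous_gradient hw1
  have cχ := continuous_gradient hχ1
  have hgc : HasCompactSupport (gradient χ) := by
    refine (hc.fderiv (𝕜 := ℝ)).mono' ((Function.support_subset_iff'.2 fun x hx => ?_).trans
      (subset_tsupport _))
    rw [← norm_eq_zero, norm_gradient, Function.notMem_support.1 hx, norm_zero]
  have e1 : ∀ x, inner ℝ (gradient (χ * w) x) (gradient w x)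
      = χ x * ‖gradient w x‖ ^ 2 + w x * inner ℝ (gradient χ x) (gradient w x) := fun x => by
    have : gradient (χ * w) x = _ := gradient_mul (dχ x) (dw x)
    rw [this, inner_add_left, inner_smul_left, inner_smul_left, real_inner_self_eq_norm_sq]
    simp
  have e2 : ∀ x, inner ℝ (gradient (w * w) x) (gradient χ x)
      = 2 * (w x * inner ℝ (gradient χ x) (gradient w x)) := fun x => by
    have : gradient (w * w) x = _ := gradient_mul (dw x) (dw x)
    rw [this, inner_add_left, inner_smul_left, real_inner_comm]
    simp; ring
  simp_rw [e1] at h1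
  simp_rw [e2] at h2
  rw [integral_const_mul] at h2
  rw [integral_add] at h1
  · have e3 : ∫ x, (χ * w) x * Laplacian.laplacian w x
        = ∫ x, χ x * w x * Laplacian.laplacian w x := rfl
    have e4 : ∫ x, (w * w) x * Laplacian.laplacian χ x
        = ∫ x, w x ^ 2 * Laplacian.laplacian χ x :=
      integral_congr_ae (Eventually.of_forall fun x => by simp [sq])
    linarith
  · exact Continuous.integrable_of_hasCompactSupport (hχ.continuous.mul (cw.norm.pow 2))
      hc.mul_right
  · refine Continuous.integrable_of_hasCompactSupport
      (hw.continuous.mul (cχ.inner cw)) (HasCompactSupport.mul_left ?_)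
    refine hgc.mono' ((Function.support_subset_iff'.2 fun x hx => ?_).trans (subset_tsupport _))
    simp [Function.notMem_support.1 hx]

/-- The potential `½ log (1 + |x|²)`, whose Laplacian is a Hardy weight. -/
def hardyPotential (x : R3) : ℝ := 1 / 2 * Real.log (1 + ‖x‖ ^ 2)

theorem contDiff_hardyPotential : ContDiff ℝ 2 hardyPotential := by
  refine contDiff_const.mul (ContDiff.log (contDiff_const.add (contDiff_norm_sq ℝ)) fun x => ?_)
  positivity

theorem gradient_hardyPotential (x : R3) :
    gradient hardyPotential x = (1 + ‖x‖ ^ 2)⁻¹ • x := by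
  have h : HasDerivAt (fun s : ℝ => 1 / 2 * Real.log (1 + s)) (1 / 2 * (1 + ‖x‖ ^ 2)⁻¹)
      (‖x‖ ^ 2) := by
    have := (((hasDerivAt_id (‖x‖ ^ 2)).const_add 1).log (by simp; positivity)).const_mul (1 / 2)
    simpa using this
  rw [gradient_of_normSq (W := hardyPotential) (Eventually.of_forall fun y => rfl) h]
  congr 1; ring

/-- The Laplacian equals (3 + |x|²)/(1 + |x|²)². Together with |∇|² ≤ 1/(1 + |x|²) this yields a
Hardy inequality with weight 1/(1 + |x|²) after testing with χw². -/
theorem le_laplacian_hardyPotential (x : R3) :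
    (1 + ‖x‖ ^ 2)⁻¹ ≤ Laplacian.laplacian hardyPotential x := by
  have hs : (-1 : ℝ) < ‖x‖ ^ 2 := by linarith [sq_nonneg ‖x‖]
  have h := laplacian_of_normSq (W := hardyPotential) (q := fun s => 1 / 2 * Real.log (1 + s))
    (q₁ := fun s => 1 / 2 * (1 + s)⁻¹) (q₂ := 1 / 2 * (-((1 + ‖x‖ ^ 2) ^ 2)⁻¹)) (x := x)
    (Eventually.of_forall fun y => rfl)
    (by
      filter_upwards [lt_mem_nhds hs] with s hs
      have := (((hasDerivAt_id s).const_add 1).log (by simp; linarith)).const_mul (1 / 2)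
      simpa using this)
    (by
      have := (((hasDerivAt_id (‖x‖ ^ 2)).const_add 1).inv (by simp; positivity)).const_mul (1 / 2)
      simpa [neg_div] using this)
  rw [h]
  have hp : 0 < 1 + ‖x‖ ^ 2 := by positivity
  field_simp
  nlinarith [sq_nonneg ‖x‖]

/-- The radial cut-off functions `χₙ`, equal to `1` for `|x| ≤ n` and to `0` for `|x|² ≥ 2 n²`. -/
def cutoff (n : ℝ) (x : R3) : ℝ := Real.smoothTransition (2 - ‖x‖ ^ 2 / n ^ 2)

theorem contDiff_cutoff (n : ℝ) : ContDiff ℝ 2 (cutoff n) :=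
  Real.smoothTransition.contDiff.comp
    (contDiff_const.sub ((contDiff_norm_sq ℝ).div_const _))

theorem cutoff_nonneg (n : ℝ) (x : R3) : 0 ≤ cutoff n x := Real.smoothTransition.nonneg _

theorem cutoff_eq_one {n : ℝ} (hn : 0 < n) {x : R3} (hx : ‖x‖ ≤ n) : cutoff n x = 1 := by
  refine Real.smoothTransition.one_of_one_le ?_
  have : ‖x‖ ^ 2 / n ^ 2 ≤ 1 := by
    rw [div_le_one (by positivity)]; gcongr
  linarith

theorem cutoff_eq_zero {n : ℝ} (hn : 0 < n) {x : R3} (hx : 2 * n ≤ ‖x‖) : cutoff n x = 0 := by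
  refine Real.smoothTransition.zero_of_nonpos ?_
  have : 2 ≤ ‖x‖ ^ 2 / n ^ 2 := by
    rw [le_div_iff₀ (by positivity)]
    nlinarith
  linarith

theorem hasCompactSupport_cutoff {n : ℝ} (hn : 0 < n) : HasCompactSupport (cutoff n) :=
  HasCompactSupport.of_support_subset_isCompact (isCompact_closedBall (0 : R3) (2 * n))
    (fun x hx => by
      by_contra h
      exact hx (cutoff_eq_zero hn (by simpa using (not_le.1 (by simpa using h)).le)))

/-- Scaling: the cut-off is a fixed profile of |x|²/n² whose derivatives live where this ratio lies
in [1, 2], so one constant serves all n. -/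
theorem exists_bound_cutoff : ∃ B, 0 < B ∧ ∀ n, 0 < n → ∀ x : R3,
    |Laplacian.laplacian (cutoff n) x| ≤ B / n ^ 2 ∧
    |inner ℝ (gradient (cutoff n) x) (gradient hardyPotential x)| ≤ B / n ^ 2 := by
  let k : ℝ → ℝ := fun s => Real.smoothTransition (2 - s)
  have hk : ContDiff ℝ 2 k := Real.smoothTransition.contDiff.comp (contDiff_const.sub contDiff_id)
  have hk1 : ContDiff ℝ 1 (deriv k) := by
    have := (contDiff_succ_iff_deriv (n := 1) (f := k)).1 (by simpa [one_add_one_eq_two] using hk)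
    exact this.2.2
  have hk2 : Continuous (deriv (deriv k)) := hk1.continuous_deriv (by norm_num)
  obtain ⟨B1, hB1⟩ := (isCompact_Icc (a := (1 : ℝ)) (b := 2)).exists_bound_of_continuousOn
    hk1.continuous.continuousOn
  obtain ⟨B2, hB2⟩ := (isCompact_Icc (a := (1 : ℝ)) (b := 2)).exists_bound_of_continuousOn
    hk2.continuousOn
  have hB1p : 0 ≤ B1 := (norm_nonneg _).trans (hB1 1 (by simp))
  have hB2p : 0 ≤ B2 := (norm_nonneg _).trans (hB2 1 (by simp))
  have hconst : ∀ s ∉ Icc (1 : ℝ) 2, ∃ c, k =ᶠ[𝓝 s] fun _ => c := by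
    intro s hs
    rcases lt_or_ge s 1 with h | h
    · refine ⟨1, ?_⟩
      filter_upwards [gt_mem_nhds h] with y hy
      exact Real.smoothTransition.one_of_one_le (by linarith)
    · have h2 : 2 < s := by
        by_contra hh; exact hs ⟨h, not_lt.1 hh⟩
      refine ⟨0, ?_⟩
      filter_upwards [lt_mem_nhds h2] with y hy
      exact Real.smoothTransition.zero_of_nonpos (by linarith)
  have hD1 : ∀ s, |deriv k s| ≤ B1 := by
    intro s
    by_cases hs : s ∈ Icc (1 : ℝ) 2
    · exact hB1 s hs
    · obtain ⟨c, hc⟩ := hconst s hs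
      rw [hc.deriv_eq]; simpa using hB1p
  have hD2 : ∀ s, |deriv (deriv k) s| * |s| ≤ B2 * 2 := by
    intro s
    by_cases hs : s ∈ Icc (1 : ℝ) 2
    · have h1 : |s| ≤ 2 := abs_le.2 ⟨by linarith [hs.1], hs.2⟩
      exact mul_le_mul (hB2 s hs) h1 (abs_nonneg _) hB2p
    · obtain ⟨c, hc⟩ := hconst s hs
      rw [hc.deriv.deriv_eq]; simpa using hB2p
  -- The Laplacian is (6k'(s) + 4s·k''(s))/n² with s ≤ 2 wherever k'' is nonzero; the extra 1 only
  -- ensures positivity.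
  refine ⟨6 * B1 + 8 * B2 + 1, by positivity, fun n hn x => ?_⟩
  have hder : ∀ s : ℝ, HasDerivAt (fun s => k (s / n ^ 2)) (deriv k (s / n ^ 2) / n ^ 2) s := by
    intro s
    have := (hk.differentiable (by norm_num) (s / n ^ 2)).hasDerivAt.comp s
      ((hasDerivAt_id s).div_const (n ^ 2))
    simpa [Function.comp_def, div_eq_mul_inv] using this
  have hder2 : ∀ s : ℝ, HasDerivAt (fun s => deriv k (s / n ^ 2) / n ^ 2)
      (deriv (deriv k) (s / n ^ 2) / n ^ 2 / n ^ 2) s := by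
    intro s
    have := ((hk1.differentiable (by norm_num) (s / n ^ 2)).hasDerivAt.comp s
      ((hasDerivAt_id s).div_const (n ^ 2))).div_const (n ^ 2)
    simpa [Function.comp_def, div_eq_mul_inv] using this
  have hL := laplacian_of_normSq (W := cutoff n) (x := x) (Eventually.of_forall fun y => rfl)
    (Eventually.of_forall hder) (hder2 _)
  have hG := gradient_of_normSq (W := cutoff n) (x := x) (Eventually.of_forall fun y => rfl)
    (hder _)
  set s := ‖x‖ ^ 2 / n ^ 2 with hs
  have hs0 : 0 ≤ s := by positivity
  have d1 := hD1 s
  have d2 := hD2 s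
  constructor
  · rw [hL]
    have : 6 * (deriv k s / n ^ 2) + 4 * (deriv (deriv k) s / n ^ 2 / n ^ 2) * ‖x‖ ^ 2
        = (6 * deriv k s + 4 * (deriv (deriv k) s * s)) / n ^ 2 := by
      rw [hs]; field_simp
    rw [this, abs_div, abs_of_pos (by positivity : (0 : ℝ) < n ^ 2)]
    gcongr
    calc |6 * deriv k s + 4 * (deriv (deriv k) s * s)|
        ≤ |6 * deriv k s| + |4 * (deriv (deriv k) s * s)| := abs_add_le _ _
      _ ≤ 6 * B1 + 8 * B2 + 1 := by
        rw [abs_mul, abs_mul, abs_mul, abs_of_pos (by norm_num : (0 : ℝ) < 6),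
          abs_of_pos (by norm_num : (0 : ℝ) < 4)]
        linarith
  · rw [hG, gradient_hardyPotential, inner_smul_left, inner_smul_right,
      real_inner_self_eq_norm_sq]
    have : (1 + ‖x‖ ^ 2)⁻¹ * ‖x‖ ^ 2 ≤ 1 := by
      rw [inv_mul_le_iff₀ (by positivity)]; linarith
    have h0 : 0 ≤ (1 + ‖x‖ ^ 2)⁻¹ * ‖x‖ ^ 2 := by positivity
    simp only [conj_trivial]
    rw [abs_mul, abs_of_nonneg h0, abs_mul, abs_div, abs_of_pos (by positivity : (0 : ℝ) < n ^ 2),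
      abs_of_pos (by norm_num : (0 : ℝ) < 2)]
    calc 2 * (|deriv k s| / n ^ 2) * ((1 + ‖x‖ ^ 2)⁻¹ * ‖x‖ ^ 2)
        ≤ 2 * (|deriv k s| / n ^ 2) * 1 := by gcongr
      _ = (2 * |deriv k s|) / n ^ 2 := by ring
      _ ≤ _ := by gcongr; linarith

/-- Energy estimate for the Poisson equation with compactly supported right-hand side. -/
theorem setIntegral_norm_gradient_sq_le {w : R3 → ℝ} (hw : ContDiff ℝ 2 w)
    (h0 : Tendsto w (cocompact R3) (𝓝 0)) {R : ℝ}
    (hR : ∀ x, R < ‖x‖ → Laplacian.laplacian w x = 0) :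
    ∫ x in Metric.closedBall (0 : R3) R, ‖gradient w x‖ ^ 2
      ≤ 4 * (1 + R ^ 2) * ∫ x, Laplacian.laplacian w x ^ 2 := by
  obtain ⟨C, hC, hwC⟩ := exists_abs_le_barrier hw h0 hR
  obtain ⟨B, hB, hcut⟩ := exists_bound_cutoff
  set ω := (volume (Metric.closedBall (0 : R3) 1)).toReal with hω
  have hω0 : 0 ≤ ω := ENNReal.toReal_nonneg
  have hw1 : ContDiff ℝ 1 w := hw.of_le (by norm_num)
  have dw := hw.differentiable (by norm_num)
  have cΔ := continuous_laplacian hw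
  have cw := hw.continuous
  have cg := continuous_gradient hw1
  have hΔc : HasCompactSupport (Laplacian.laplacian w) :=
    HasCompactSupport.of_support_subset_isCompact (isCompact_closedBall (0 : R3) R)
      (fun x hx => by
        by_contra h
        exact hx (hR x (by simpa using h)))
  have hDint : Integrable (fun x => Laplacian.laplacian w x ^ 2) := by
    refine (cΔ.pow 2).integrable_of_hasCompactSupport ?_
    simpa [sq] using hΔc.mul_left (f := Laplacian.laplacian w)
  set D := ∫ x, Laplacian.laplacian w x ^ 2 with hD
  have main : ∀ n : ℝ, 1 ≤ n → R ≤ n →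
      ∫ x in Metric.closedBall (0 : R3) R, ‖gradient w x‖ ^ 2
        ≤ 4 * (1 + R ^ 2) * D + 3 / 2 * (8 * C ^ 2 * B * ω * n ^ (-(1 / 2) : ℝ)) := by
    intro n hn hRn
    have hn0 : 0 < n := by linarith
    -- Size of the cut-off errors: w² ≤ C²n^{-3/2} where |x| ≥ n, derivatives of the cut-off of size
    -- B/n², and volume 8n³ω.
    set ε := 8 * C ^ 2 * B * ω * n ^ (-(1 / 2) : ℝ) with hε
    set χ := cutoff n with hχ
    have χ2 : ContDiff ℝ 2 χ := contDiff_cutoff n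
    have χ1 : ContDiff ℝ 1 χ := χ2.of_le (by norm_num)
    have χc : HasCompactSupport χ := hasCompactSupport_cutoff hn0
    have χ0 : ∀ x, 0 ≤ χ x := cutoff_nonneg n
    have cχ := χ2.continuous
    have cgχ := continuous_gradient χ1
    have g2 := contDiff_hardyPotential
    have cgg := continuous_gradient (g2.of_le (by norm_num : (1 : WithTop ℕ∞) ≤ 2))
    have hloc : ∀ x, ‖x‖ < n ∨ 2 * n < ‖x‖ → ∃ c, χ =ᶠ[𝓝 x] fun _ => c := by
      rintro x (hx | hx)
      · refine ⟨1, ?_⟩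
        filter_upwards [continuous_norm.continuousAt.eventually (gt_mem_nhds hx)] with y hy
        exact cutoff_eq_one hn0 (le_of_lt hy)
      · refine ⟨0, ?_⟩
        filter_upwards [continuous_norm.continuousAt.eventually (lt_mem_nhds hx)] with y hy
        exact cutoff_eq_zero hn0 (le_of_lt hy)
    have err : ∀ φ : R3 → ℝ, (∀ x, ‖x‖ < n ∨ 2 * n < ‖x‖ → φ x = 0) →
        (∀ x, |φ x| ≤ w x ^ 2 * (B / n ^ 2)) → |∫ x, φ x| ≤ ε := by
      intro φ hφ0 hφ
      have hsupp : ∫ x, φ x = ∫ x in Metric.closedBall (0 : R3) (2 * n), φ x := by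
        symm
        refine setIntegral_eq_integral_of_forall_compl_eq_zero fun x hx => hφ0 x (Or.inr ?_)
        simpa using hx
      rw [hsupp]
      have hb : ∀ x ∈ Metric.closedBall (0 : R3) (2 * n),
          ‖φ x‖ ≤ C ^ 2 * n ^ (-(3 / 2) : ℝ) * (B / n ^ 2) := by
        intro x _
        rcases lt_or_ge ‖x‖ n with h | h
        · rw [hφ0 x (Or.inl h), norm_zero]; positivity
        · refine (hφ x).trans ?_
          gcongr
          have h1 : w x ^ 2 ≤ (C * barrier x) ^ 2 := by
            rw [← sq_abs (w x)]
            gcongr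
            exact hwC x
          refine h1.trans ?_
          rw [mul_pow]
          gcongr
          rw [barrier, ← Real.rpow_natCast, ← Real.rpow_mul (by positivity)]
          calc (1 + ‖x‖ ^ 2) ^ (-(3 / 8) * ((2 : ℕ) : ℝ))
              ≤ (n ^ 2) ^ (-(3 / 8) * ((2 : ℕ) : ℝ)) := by
                refine Real.rpow_le_rpow_of_nonpos (by positivity) ?_ (by norm_num)
                nlinarith
            _ = n ^ (-(3 / 2) : ℝ) := by
                rw [← Real.rpow_natCast n 2, ← Real.rpow_mul hn0.le]; norm_num
      have := norm_setIntegral_le_of_norm_le_const (μ := volume)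
        (isCompact_closedBall (0 : R3) (2 * n)).measure_lt_top hb
      refine this.trans (le_of_eq ?_)
      have hv : (volume : Measure R3).real (Metric.closedBall (0 : R3) (2 * n))
          = (2 * n) ^ 3 * ω := by
        rw [Measure.real, Measure.addHaar_closedBall' _ _ (by positivity), ENNReal.toReal_mul,
          ENNReal.toReal_ofReal (by positivity)]
        simp [hω]
      rw [hv, hε]
      have e1 : n ^ (-(1 / 2) : ℝ) = n ^ (-(3 / 2) : ℝ) * n := by
        rw [← Real.rpow_add_one hn0.ne']; norm_num
      rw [e1]
      field_simp
      ring
    have hgc : HasCompactSupport (gradient χ) := by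
      refine (χc.fderiv (𝕜 := ℝ)).mono' ((Function.support_subset_iff'.2 fun x hx => ?_).trans
        (subset_tsupport _))
      rw [← norm_eq_zero, norm_gradient, Function.notMem_support.1 hx, norm_zero]
    have hgc2 : HasCompactSupport
        (fun x => inner ℝ (gradient χ x) (gradient hardyPotential x)) := by
      refine hgc.mono' ((Function.support_subset_iff'.2 fun x hx => ?_).trans (subset_tsupport _))
      simp [Function.notMem_support.1 hx]
    have err1 : |∫ x, w x ^ 2 * Laplacian.laplacian χ x| ≤ ε := by
      refine err _ (fun x hx => ?_) fun x => ?_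
      · obtain ⟨c, hc⟩ := hloc x hx
        rw [(InnerProductSpace.laplacian_congr_nhds hc).self_of_nhds]
        simp
      · rw [abs_mul, abs_of_nonneg (sq_nonneg _)]
        gcongr
        exact (hcut n hn0 x).1
    have err2 : |∫ x, w x ^ 2 * inner ℝ (gradient χ x) (gradient hardyPotential x)| ≤ ε := by
      refine err _ (fun x hx => ?_) fun x => ?_
      · obtain ⟨c, hc⟩ := hloc x hx
        rw [inner_gradient_left, hc.fderiv_eq]
        simp
      · rw [abs_mul, abs_of_nonneg (sq_nonneg _)]
        gcongr
        exact (hcut n hn0 x).2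
    -- X is the cut-off Dirichlet energy and Y the Hardy term. `step1` bounds X by Y/8 and the
    -- source, by Young's inequality with weight 1 + |x|²; `step2` is Hardy's inequality in the form
    -- Y ≤ 4X + 2ε. Inserting one into the other absorbs half of X.
    set X := ∫ x, χ x * ‖gradient w x‖ ^ 2 with hX
    set Y := ∫ x, χ x * (w x ^ 2 * (1 + ‖x‖ ^ 2)⁻¹) with hY
    have iX : Integrable (fun x => χ x * ‖gradient w x‖ ^ 2) :=
      Continuous.integrable_of_hasCompactSupport (by fun_prop) χc.mul_right
    have cinv : Continuous (fun x : R3 => (1 + ‖x‖ ^ 2)⁻¹) :=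
      Continuous.inv₀ (by fun_prop) fun x => by positivity
    have iY : Integrable (fun x => χ x * (w x ^ 2 * (1 + ‖x‖ ^ 2)⁻¹)) :=
      Continuous.integrable_of_hasCompactSupport (by fun_prop) χc.mul_right
    have iXw : Integrable (fun x => χ x * w x * Laplacian.laplacian w x) :=
      Continuous.integrable_of_hasCompactSupport (by fun_prop)
        (HasCompactSupport.mul_left hΔc)
    have step1 : X ≤ 1 / 2 * ε + (1 / 8 * Y + 2 * (1 + R ^ 2) * D) := by
      rw [hX, integral_cutoff_mul_norm_gradient_sq χ2 χc hw]
      have : -∫ x, χ x * w x * Laplacian.laplacian w x ≤ 1 / 8 * Y + 2 * (1 + R ^ 2) * D := by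
        rw [← integral_neg, hY, hD, ← integral_const_mul, ← integral_const_mul,
          ← integral_add (iY.const_mul _) (hDint.const_mul _)]
        refine integral_mono iXw.neg ((iY.const_mul _).add (hDint.const_mul _)) fun x => ?_
        have hχle : χ x ≤ 1 := Real.smoothTransition.le_one _
        rcases lt_or_ge R ‖x‖ with h | h
        · simp only [hR x h]
          have := mul_nonneg (χ0 x) (mul_nonneg (sq_nonneg (w x))
            (by positivity : 0 ≤ (1 + ‖x‖ ^ 2)⁻¹))
          simp only [mul_zero, neg_zero]
          positivity
        · set a := 1 + ‖x‖ ^ 2 with ha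
          have hap : 0 < a := by positivity
          have haR : a ≤ 1 + R ^ 2 := by rw [ha]; gcongr
          set l := Laplacian.laplacian w x
          have k1 : -(w x * l) ≤ 1 / 8 * (w x ^ 2 * a⁻¹) + 2 * a * l ^ 2 := by
            have : 1 / 8 * (w x ^ 2 * a⁻¹) + 2 * a * l ^ 2 + w x * l
                = a⁻¹ / 8 * (w x + 4 * a * l) ^ 2 := by field_simp; ring
            have h2 : 0 ≤ a⁻¹ / 8 * (w x + 4 * a * l) ^ 2 := by positivity
            linarith
          have k2 : χ x * (2 * a * l ^ 2) ≤ 2 * (1 + R ^ 2) * l ^ 2 := by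
            calc χ x * (2 * a * l ^ 2) ≤ 1 * (2 * a * l ^ 2) := by gcongr
              _ ≤ 2 * (1 + R ^ 2) * l ^ 2 := by rw [one_mul]; gcongr
          have k3 := mul_le_mul_of_nonneg_left k1 (χ0 x)
          linarith
      have := (abs_le.1 err1).2
      linarith
    have step2 : Y ≤ 1 / 2 * Y + 2 * X + ε := by
      have G : ∫ x, inner ℝ (gradient (χ * (w * w)) x) (gradient hardyPotential x)
          = -∫ x, (χ * (w * w)) x * Laplacian.laplacian hardyPotential x :=
        integral_inner_gradient_eq_neg_integral_mul_laplacian (χ1.mul (hw1.mul hw1)) g2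
          (Or.inl χc.mul_right)
      have cΔg := continuous_laplacian g2
      have i1 : Integrable (fun x => (χ * (w * w)) x * Laplacian.laplacian hardyPotential x) :=
        Continuous.integrable_of_hasCompactSupport ((cχ.mul (cw.mul cw)).mul cΔg)
          (HasCompactSupport.mul_right χc.mul_right)
      have h1 : Y ≤ ∫ x, (χ * (w * w)) x * Laplacian.laplacian hardyPotential x := by
        refine integral_mono iY i1 fun x => ?_
        have := le_laplacian_hardyPotential x
        have h2 : 0 ≤ χ x * (w x * w x) := mul_nonneg (χ0 x) (mul_self_nonneg _)
        simp only [Pi.mul_apply]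
        nlinarith [mul_le_mul_of_nonneg_left this h2]
      have egr : ∀ x, inner ℝ (gradient (χ * (w * w)) x) (gradient hardyPotential x)
          = χ x * (2 * w x * inner ℝ (gradient w x) (gradient hardyPotential x))
            + w x ^ 2 * inner ℝ (gradient χ x) (gradient hardyPotential x) := fun x => by
        rw [gradient_mul (χ2.differentiable (by norm_num) x) ((dw x).mul (dw x)),
          gradient_mul (dw x) (dw x)]
        simp only [inner_add_left, inner_smul_left, Pi.mul_apply, conj_trivial]
        ring
      simp_rw [egr] at G
      have i2 : Integrable (fun x => χ x * (2 * w x *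
          inner ℝ (gradient w x) (gradient hardyPotential x))) :=
        Continuous.integrable_of_hasCompactSupport (by fun_prop) χc.mul_right
      have i3 : Integrable (fun x => w x ^ 2 *
          inner ℝ (gradient χ x) (gradient hardyPotential x)) :=
        Continuous.integrable_of_hasCompactSupport (by fun_prop) hgc2.mul_left
      rw [integral_add i2 i3] at G
      have h3 : -∫ x, χ x * (2 * w x * inner ℝ (gradient w x) (gradient hardyPotential x))
          ≤ 1 / 2 * Y + 2 * X := by
        rw [← integral_neg, hY, hX, ← integral_const_mul, ← integral_const_mul,
          ← integral_add (iY.const_mul _) (iX.const_mul _)]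
        refine integral_mono i2.neg ((iY.const_mul _).add (iX.const_mul _)) fun x => ?_
        have hp : 0 < 1 + ‖x‖ ^ 2 := by positivity
        have hn2 : ‖gradient hardyPotential x‖ ^ 2 ≤ (1 + ‖x‖ ^ 2)⁻¹ := by
          rw [gradient_hardyPotential, norm_smul, norm_inv, Real.norm_of_nonneg hp.le]
          rw [mul_pow, inv_pow, inv_mul_le_iff₀ (by positivity)]
          field_simp
          linarith
        have h4 : -(2 * w x * inner ℝ (gradient w x) (gradient hardyPotential x))
            ≤ 1 / 2 * (w x ^ 2 * (1 + ‖x‖ ^ 2)⁻¹) + 2 * ‖gradient w x‖ ^ 2 := by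
          have h5 := abs_real_inner_le_norm (gradient w x) (gradient hardyPotential x)
          have h6 : -(2 * w x * inner ℝ (gradient w x) (gradient hardyPotential x))
              ≤ 2 * |w x| * (‖gradient w x‖ * ‖gradient hardyPotential x‖) := by
            refine (neg_le_abs _).trans ?_
            rw [abs_mul, abs_mul, abs_two]
            gcongr
          have h7 : w x ^ 2 * ‖gradient hardyPotential x‖ ^ 2 ≤ w x ^ 2 * (1 + ‖x‖ ^ 2)⁻¹ := by
            gcongr
          nlinarith [sq_nonneg (|w x| * ‖gradient hardyPotential x‖ - 2 * ‖gradient w x‖),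
            sq_abs (w x)]
        have := mul_le_mul_of_nonneg_left h4 (χ0 x)
        linarith
      have := (abs_le.1 err2).1
      linarith
    have step3 : ∫ x in Metric.closedBall (0 : R3) R, ‖gradient w x‖ ^ 2 ≤ X := by
      have : ∫ x in Metric.closedBall (0 : R3) R, ‖gradient w x‖ ^ 2
          = ∫ x in Metric.closedBall (0 : R3) R, χ x * ‖gradient w x‖ ^ 2 := by
        refine setIntegral_congr_fun measurableSet_closedBall fun x hx => ?_
        have : ‖x‖ ≤ R := by simpa using hx
        simp [hχ, cutoff_eq_one hn0 (this.trans hRn)]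
      rw [this]
      exact setIntegral_le_integral iX
        (Eventually.of_forall fun x => mul_nonneg (χ0 x) (sq_nonneg _))
    linarith
  have hlim : Tendsto (fun n : ℝ => 4 * (1 + R ^ 2) * D
      + 3 / 2 * (8 * C ^ 2 * B * ω * n ^ (-(1 / 2) : ℝ))) atTop
      (𝓝 (4 * (1 + R ^ 2) * D + 3 / 2 * (8 * C ^ 2 * B * ω * 0))) :=
    (((tendsto_rpow_neg_atTop (by norm_num : (0 : ℝ) < 1 / 2)).const_mul _).const_mul _).const_add _
  rw [mul_zero, mul_zero, add_zero] at hlim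
  refine ge_of_tendsto hlim ?_
  filter_upwards [eventually_ge_atTop 1, eventually_ge_atTop R] with n h1 h2 using main n h1 h2

/-! ### The transport formula for locally Lipschitz functions -/

theorem locallyLipschitz_mul {X : Type*} [PseudoEMetricSpace X] {f g : X → ℝ}
    (hf : LocallyLipschitz f) (hg : LocallyLipschitz g) : LocallyLipschitz (fun x => f x * g x) :=
  (contDiff_mul (𝕜 := ℝ) (𝔸 := ℝ) (n := 1)).locallyLipschitz (𝕂 := ℝ) |>.comp (hf.prodMk hg)

theorem LocallyLipschitz.ae_differentiableAt_real {X : Type*} [NormedAddCommGroup X]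
    [NormedSpace ℝ X] [FiniteDimensional ℝ X] [MeasurableSpace X] [BorelSpace X] {μ : Measure X}
    [μ.IsAddHaarMeasure] {f : X → ℝ} (hf : LocallyLipschitz f) :
    ∀ᵐ x ∂μ, DifferentiableAt ℝ f x := by
  refine measure_null_of_locally_null _ fun x _ => ?_
  obtain ⟨K, t, ht, hK⟩ := hf x
  obtain ⟨u, hut, hu, hxu⟩ := mem_nhds_iff.1 ht
  refine ⟨{x | ¬DifferentiableAt ℝ f x} ∩ u, inter_mem_nhdsWithin _ (hu.mem_nhds hxu), ?_⟩
  have := (hK.mono hut).ae_differentiableWithinAt_of_mem (μ := μ)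
  refine measure_mono_null (fun y hy => ?_) this
  intro h
  exact hy.1 ((h hy.2).differentiableAt (hu.mem_nhds hy.2))

theorem fderiv_mul_apply {X : Type*} [NormedAddCommGroup X] [NormedSpace ℝ X] {f g : X → ℝ} {x : X}
    (hf : DifferentiableAt ℝ f x) (hg : DifferentiableAt ℝ g x) (d : X) :
    fderiv ℝ (fun p => f p * g p) x d = f x * fderiv ℝ g x d + g x * fderiv ℝ f x d := by
  rw [fderiv_fun_mul hf hg]; simp

/-- A locally Lipschitz function which is compactly supported in phase space, uniformly in time,
becomes globally Lipschitz after clamping the time variable. -/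
theorem exists_lipschitzWith_clamp {G : ℝ × R3 × R3 → ℝ} (hG : LocallyLipschitz G) {T : ℝ}
    (hT : 0 ≤ T) {K : Set (R3 × R3)} (hK : IsCompact K)
    (h0 : ∀ t ∈ Icc 0 T, ∀ z ∉ K, G (t, z) = 0) :
    ∃ C, LipschitzWith C (fun p : ℝ × R3 × R3 => G ((projIcc 0 T hT p.1 : ℝ), p.2)) := by
  obtain ⟨R, hR⟩ := hK.isBounded.subset_closedBall 0
  -- The margin 1 separates the support from the complement of the ball: for such pairs the distance
  -- is at least 1, and the sup bound on G replaces a local Lipschitz constant.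
  set S := Icc 0 T ×ˢ Metric.closedBall (0 : R3 × R3) (R + 1) with hS
  have hSc : IsCompact S := isCompact_Icc.prod (isCompact_closedBall _ _)
  obtain ⟨C₁, hC₁⟩ := hG.locallyLipschitzOn.exists_lipschitzOnWith_of_compact hSc
  obtain ⟨M, hM⟩ := hSc.exists_bound_of_continuousOn hG.continuous.continuousOn
  have hGM : ∀ t ∈ Icc 0 T, ∀ z, |G (t, z)| ≤ |M| := by
    intro t ht z
    by_cases hz : z ∈ K
    · have : (t, z) ∈ S := ⟨ht, Metric.closedBall_subset_closedBall (by linarith) (hR hz)⟩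
      exact (hM _ this).trans (le_abs_self _)
    · rw [h0 t ht z hz]; simp
  refine ⟨C₁ + Real.toNNReal |M|, LipschitzWith.of_dist_le_mul fun p p' => ?_⟩
  set t : ℝ := (projIcc 0 T hT p.1 : ℝ) with ht
  set t' : ℝ := (projIcc 0 T hT p'.1 : ℝ) with ht'
  have htm : t ∈ Icc 0 T := (projIcc 0 T hT p.1).2
  have htm' : t' ∈ Icc 0 T := (projIcc 0 T hT p'.1).2
  have hd : dist (t, p.2) (t', p'.2) ≤ dist p p' := by
    have : dist t t' ≤ dist p.1 p'.1 := by
      have := (LipschitzWith.projIcc hT).dist_le_mul p.1 p'.1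
      simpa [Subtype.dist_eq] using this
    rw [Prod.dist_eq, Prod.dist_eq]
    exact max_le_max this le_rfl
  have hpos : (0 : ℝ) ≤ C₁ := C₁.2
  have hdp : 0 ≤ dist p p' := dist_nonneg
  have hMp := abs_nonneg M
  rw [NNReal.coe_add, Real.coe_toNNReal _ hMp]
  by_cases hz : p.2 ∈ Metric.closedBall (0 : R3 × R3) (R + 1)
  · by_cases hz' : p'.2 ∈ Metric.closedBall (0 : R3 × R3) (R + 1)
    · have h1 := hC₁.dist_le_mul (t, p.2) ⟨htm, hz⟩ (t', p'.2) ⟨htm', hz'⟩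
      nlinarith [mul_le_mul_of_nonneg_left hd hpos, mul_nonneg hMp hdp]
    · have hz'K : p'.2 ∉ K := fun h => hz'
        (Metric.closedBall_subset_closedBall (by linarith) (hR h))
      by_cases hzK : p.2 ∈ K
      · have hz1 : ‖p.2‖ ≤ R := by simpa using hR hzK
        have hz2 : R + 1 < ‖p'.2‖ := by simpa using hz'
        have hdist : 1 ≤ dist p p' := by
          have h3 : ‖p'.2‖ - ‖p.2‖ ≤ ‖p'.2 - p.2‖ := norm_sub_norm_le _ _
          have h4 : dist p.2 p'.2 ≤ dist p p' := le_max_right _ _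
          rw [dist_comm, dist_eq_norm] at h4
          linarith
        rw [h0 t' htm' _ hz'K, dist_zero_right]
        have := hGM t htm p.2
        rw [Real.norm_eq_abs]
        nlinarith
      · rw [h0 t' htm' _ hz'K, h0 t htm _ hzK]
        simp only [dist_self]
        positivity
  · have hzK : p.2 ∉ K := fun h => hz (Metric.closedBall_subset_closedBall (by linarith) (hR h))
    by_cases hzK' : p'.2 ∈ K
    · have hz1 : ‖p'.2‖ ≤ R := by simpa using hR hzK'
      have hz2 : R + 1 < ‖p.2‖ := by simpa using hz
      have hdist : 1 ≤ dist p p' := by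
        have h3 : ‖p.2‖ - ‖p'.2‖ ≤ ‖p.2 - p'.2‖ := norm_sub_norm_le _ _
        have h4 : dist p.2 p'.2 ≤ dist p p' := le_max_right _ _
        rw [dist_eq_norm] at h4
        linarith
      rw [h0 t htm _ hzK, dist_zero_left]
      have := hGM t' htm' p'.2
      rw [Real.norm_eq_abs]
      nlinarith
    · rw [h0 t htm _ hzK, h0 t' htm' _ hzK']
      simp only [dist_self]
      positivity

/-- The transport formula for locally Lipschitz functions with compact support in phase space. -/
theorem integral_sub_integral_eq_of_locallyLipschitz {G : ℝ × R3 × R3 → ℝ}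
    (hG : LocallyLipschitz G) {T : ℝ} {K : Set (R3 × R3)} (hK : IsCompact K)
    (h0 : ∀ t ∈ Icc 0 T, ∀ z ∉ K, G (t, z) = 0) {a : ℝ → R3 → R3} (ha : ∀ t, Continuous (a t))
    {s t : ℝ} (hs : 0 ≤ s) (hst : s ≤ t) (ht : t ≤ T) :
    (∫ z, G (t, z)) - ∫ z, G (s, z)
      = ∫ τ in s..t, ∫ z : R3 × R3, fderiv ℝ G (τ, z) (1, (z.2, -a τ z.1)) := by
  have hT : 0 ≤ T := by linarith
  obtain ⟨C, hC⟩ := exists_lipschitzWith_clamp hG hT hK h0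
  have key := integral_sub_integral_eq_integral_fderiv_transport hC hK
    (fun t z hz => h0 _ (projIcc 0 T hT t).2 z hz) ha s t
  have e1 : ∀ τ ∈ Icc 0 T, (projIcc 0 T hT τ : ℝ) = τ := fun τ hτ => by
    rw [projIcc_of_mem hT hτ]
  simp only [e1 t ⟨by linarith, ht⟩, e1 s ⟨hs, by linarith⟩] at key
  rw [key]
  refine intervalIntegral.integral_congr_ae ?_
  -- Clamping changes nothing near interior times, whereas at τ = T it may alter the derivative;
  -- dropping one instant is harmless.
  have hne : ∀ᵐ τ : ℝ, τ ≠ t := by simp [ae_iff]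
  filter_upwards [hne] with τ hτt hτ
  rw [uIoc_of_le hst] at hτ
  have hτ2 : τ ∈ Ioo 0 T := ⟨by linarith [hτ.1], lt_of_lt_of_le (lt_of_le_of_ne hτ.2 hτt) ht⟩
  refine integral_congr_ae (Eventually.of_forall fun z => ?_)
  have : (fun p : ℝ × R3 × R3 => G ((projIcc 0 T hT p.1 : ℝ), p.2)) =ᶠ[𝓝 (τ, z)] G := by
    have h1 : ∀ᶠ p : ℝ × R3 × R3 in 𝓝 (τ, z), p.1 ∈ Ioo 0 T :=
      continuous_fst.continuousAt.eventually (Ioo_mem_nhds hτ2.1 hτ2.2)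
    filter_upwards [h1] with p hp
    rw [e1 p.1 ⟨hp.1.le, hp.2.le⟩]
  simp only [this.fderiv_eq]

/-! ### Solutions: the equation along characteristics and bounded support -/

/-- A phase space density on `[0,∞)`, continued to negative times by its initial value. -/
def extend (f : ℝ → R3 → R3 → ℝ) (p : ℝ × R3 × R3) : ℝ := f (max p.1 0) p.2.1 p.2.2

theorem extend_of_nonneg (f : ℝ → R3 → R3 → ℝ) {t : ℝ} (ht : 0 ≤ t) (z : R3 × R3) :
    extend f (t, z) = f t z.1 z.2 := by
  simp [extend, max_eq_left ht]

namespace IsSolution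

variable {f : ℝ → R3 → R3 → ℝ} {U : ℝ → R3 → ℝ}

theorem locallyLipschitz_extend (h : IsSolution f U) : LocallyLipschitz (extend f) := by
  have h1 := locallyLipschitzOn_iff_restrict.1 h.lipschitz
  let m : ℝ × R3 × R3 → (Ici (0 : ℝ) ×ˢ (univ : Set (R3 × R3)) : Set (ℝ × R3 × R3)) :=
    fun p => ⟨(max p.1 0, p.2), ⟨mem_Ici.2 (le_max_right _ _), mem_univ _⟩⟩
  have hm : LipschitzWith 1 m := by
    refine LipschitzWith.subtype_mk (f := fun p : ℝ × R3 × R3 => (max p.1 0, p.2)) ?_ _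
    simpa using (LipschitzWith.prod_fst.max_const 0).prodMk LipschitzWith.prod_snd
  exact h1.comp hm.locallyLipschitz

theorem extend_nonneg (h : IsSolution f U) (p : ℝ × R3 × R3) : 0 ≤ extend f p :=
  h.nonneg _ (le_max_right _ _) _ _

/-- At positive times the extension agrees locally with f, and the three terms of the Vlasov
equation add up to one directional derivative along (1, v, −∇U). -/
theorem fderiv_extend_apply (h : IsSolution f U) {t : ℝ} (ht : 0 < t) {z : R3 × R3}
    (hd : DifferentiableAt ℝ (extend f) (t, z)) :
    fderiv ℝ (extend f) (t, z) (1, (z.2, -gradient (U t) z.1)) = 0 := by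
  obtain ⟨x, v⟩ := z
  have hev : (fun p : ℝ × R3 × R3 => f p.1 p.2.1 p.2.2) =ᶠ[𝓝 (t, (x, v))] extend f := by
    have h1 : ∀ᶠ p : ℝ × R3 × R3 in 𝓝 (t, (x, v)), 0 < p.1 :=
      continuous_fst.continuousAt.eventually (lt_mem_nhds ht)
    filter_upwards [h1] with p hp
    simp [extend, max_eq_left hp.le]
  have hd' := hd.congr_of_eventuallyEq hev
  have hv := h.vlasov t ht x v hd'
  rw [← hev.fderiv_eq]
  set D := fderiv ℝ (fun p : ℝ × R3 × R3 => f p.1 p.2.1 p.2.2) (t, x, v) with hD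
  have hF : HasFDerivAt (fun p : ℝ × R3 × R3 => f p.1 p.2.1 p.2.2) D (t, x, v) := hd'.hasFDerivAt
  have d1 : deriv (fun s => f s x v) t = D (1, 0) := by
    have h2 : HasFDerivAt (fun s => f s x v) (D.comp (ContinuousLinearMap.inl ℝ ℝ (R3 × R3))) t :=
      HasFDerivAt.comp t (g := fun p : ℝ × R3 × R3 => f p.1 p.2.1 p.2.2)
        (f := fun s => (s, (x, v))) hF (hasFDerivAt_prodMk_left t (x, v))
    rw [h2.hasDerivAt.deriv]; simp
  have d2 : inner ℝ v (gradient (fun y => f t y v) x) = D (0, (v, 0)) := by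
    have h3 : HasFDerivAt (fun y : R3 => (t, (y, v)))
        ((ContinuousLinearMap.inr ℝ ℝ (R3 × R3)).comp (ContinuousLinearMap.inl ℝ R3 R3)) x :=
      (hasFDerivAt_prodMk_right t (x, v)).comp x (hasFDerivAt_prodMk_left x v)
    have h2 : HasFDerivAt (fun y => f t y v) (D.comp _) x :=
      HasFDerivAt.comp x (g := fun p : ℝ × R3 × R3 => f p.1 p.2.1 p.2.2) hF h3
    rw [inner_gradient_right, h2.fderiv]; simp
  have d3 : inner ℝ (gradient (U t) x) (gradient (fun w => f t x w) v)
      = D (0, (0, gradient (U t) x)) := by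
    have h3 : HasFDerivAt (fun y : R3 => (t, (x, y)))
        ((ContinuousLinearMap.inr ℝ ℝ (R3 × R3)).comp (ContinuousLinearMap.inr ℝ R3 R3)) v :=
      (hasFDerivAt_prodMk_right t (x, v)).comp v (hasFDerivAt_prodMk_right x v)
    have h2 : HasFDerivAt (fun y => f t x y) (D.comp _) v :=
      HasFDerivAt.comp v (g := fun p : ℝ × R3 × R3 => f p.1 p.2.1 p.2.2) hF h3
    rw [inner_gradient_right, h2.fderiv]; simp
  have hsplit : ((1 : ℝ), (v, -gradient (U t) x))
      = (1, 0) + (0, (v, 0)) - (0, (0, gradient (U t) x)) := by simp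
  change D (1, (v, -gradient (U t) x)) = 0
  rw [hsplit, map_sub, map_add, ← d1, ← d2, ← d3]
  exact hv


theorem continuous_extend (h : IsSolution f U) : Continuous (extend f) :=
  h.locallyLipschitz_extend.continuous

theorem continuous_slice (h : IsSolution f U) {t : ℝ} (ht : 0 ≤ t) :
    Continuous (fun z : R3 × R3 => f t z.1 z.2) := by
  have : (fun z : R3 × R3 => f t z.1 z.2) = fun z => extend f (t, z) :=
    funext fun z => (extend_of_nonneg f ht z).symm
  rw [this]
  exact h.continuous_extend.comp (by fun_prop)

/-- The force field, continued to negative times by its initial value. -/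
theorem continuous_field_slice (h : IsSolution f U) (t : ℝ) :
    Continuous (fun x => gradient (U (max t 0)) x) :=
  continuous_gradient ((h.potential _ (le_max_right _ _)).contDiff.of_le (by norm_num))

theorem nonpos_of_hasDerivAt_of_le {φ : ℝ → ℝ} {c : ℝ} (h : HasDerivAt φ c 0)
    (hle : ∀ τ, 0 ≤ τ → φ τ ≤ φ 0) : c ≤ 0 := by
  have := h.tendsto_slope_zero_right
  refine le_of_tendsto this ?_
  filter_upwards [self_mem_nhdsWithin] with τ hτ
  have h1 : φ (0 + τ) - φ 0 ≤ 0 := by rw [zero_add]; linarith [hle τ (le_of_lt hτ)]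
  exact mul_nonpos_of_nonneg_of_nonpos (inv_nonneg.2 (le_of_lt hτ)) h1

/-- Vanishing of the density at the tip of a backward cone on whose base it vanishes. -/
theorem eq_zero_of_cone (h : IsSolution f U) {t₀ B : ℝ} (ht₀ : 0 < t₀) (hB0 : 0 ≤ B)
    (hB : ∀ t ∈ Icc 0 t₀, ∀ x, ‖gradient (U t) x‖ ≤ B) (x₀ v₀ : R3)
    (h0 : ∀ x v, ‖x - x₀‖ < (‖v₀‖ + (B * t₀ + 1)) * t₀ + 1 → ‖v - v₀‖ < B * t₀ + 1 →
      f 0 x v = 0) : f t₀ x₀ v₀ = 0 := by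
  set r₂ := B * t₀ + 1 with hr₂
  set c₁ := ‖v₀‖ + r₂ with hc₁
  set r₁ := c₁ * t₀ + 1 with hr₁
  have hr₂p : 0 < r₂ := by positivity
  have hc₁p : 0 ≤ c₁ := by positivity
  -- The test function ζ = p₁p₂ is nonincreasing along characteristics: p₂ shrinks at speed B, which
  -- dominates the force, and p₁ at speed c₁, which dominates |v| wherever p₂ > 0. The radii are
  -- such that both factors equal 1 at the tip (t₀, x₀, v₀).
  let p₁ : ℝ × R3 × R3 → ℝ := fun p => max (r₁ - c₁ * p.1 - ‖p.2.1 - x₀‖) 0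
  let p₂ : ℝ × R3 × R3 → ℝ := fun p => max (r₂ - B * p.1 - ‖p.2.2 - v₀‖) 0
  let ζ : ℝ × R3 × R3 → ℝ := fun p => p₁ p * p₂ p
  have hn : ∀ y : R3, LipschitzWith 1 (fun x : R3 => ‖x - y‖) := fun y => by
    simpa [dist_eq_norm] using LipschitzWith.dist_left y
  have lin : ∀ r c : ℝ, LocallyLipschitz (fun p : ℝ × R3 × R3 => r - c * p.1) := fun r c =>
    (ContDiff.locallyLipschitz (𝕂 := ℝ) (by fun_prop))
  have sub : LocallyLipschitz (fun q : ℝ × ℝ => q.1 - q.2) :=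
    (ContDiff.locallyLipschitz (𝕂 := ℝ) (by fun_prop))
  have l₁ : LocallyLipschitz p₁ := by
    refine LocallyLipschitz.max_const (sub.comp ((lin r₁ c₁).prodMk ?_)) 0
    exact (hn x₀).locallyLipschitz.comp
      (LipschitzWith.prod_fst.locallyLipschitz.comp LipschitzWith.prod_snd.locallyLipschitz)
  have l₂ : LocallyLipschitz p₂ := by
    refine LocallyLipschitz.max_const (sub.comp ((lin r₂ B).prodMk ?_)) 0
    exact (hn v₀).locallyLipschitz.comp
      (LipschitzWith.prod_snd.locallyLipschitz.comp LipschitzWith.prod_snd.locallyLipschitz)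
  have lζ : LocallyLipschitz ζ := locallyLipschitz_mul l₁ l₂
  have hF := h.locallyLipschitz_extend
  have lG : LocallyLipschitz (fun p => extend f p * ζ p) := locallyLipschitz_mul hF lζ
  have hK : IsCompact (Metric.closedBall x₀ r₁ ×ˢ Metric.closedBall v₀ r₂) :=
    (isCompact_closedBall _ _).prod (isCompact_closedBall _ _)
  have hsupp : ∀ t ∈ Icc 0 t₀, ∀ z ∉ Metric.closedBall x₀ r₁ ×ˢ Metric.closedBall v₀ r₂,
      ζ (t, z) = 0 := by
    intro t ht z hz
    rw [mem_prod, not_and_or] at hz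
    rcases hz with hz | hz
    · have : r₁ < ‖z.1 - x₀‖ := by simpa [dist_eq_norm] using hz
      have h1 : p₁ (t, z) = 0 := max_eq_right (by nlinarith [mul_nonneg hc₁p ht.1])
      simp [ζ, h1]
    · have : r₂ < ‖z.2 - v₀‖ := by simpa [dist_eq_norm] using hz
      have h1 : p₂ (t, z) = 0 := max_eq_right (by nlinarith [mul_nonneg hB0 ht.1])
      simp [ζ, h1]
  have key := integral_sub_integral_eq_of_locallyLipschitz lG hK
    (fun t ht z hz => by simp [hsupp t ht z hz])
    (a := fun t x => gradient (U (max t 0)) x) h.continuous_field_slice le_rfl ht₀.le le_rfl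
  have hle : ∫ τ in (0 : ℝ)..t₀, ∫ z : R3 × R3,
      fderiv ℝ (fun p => extend f p * ζ p) (τ, z) (1, (z.2, -gradient (U (max τ 0)) z.1)) ≤ 0 := by
    have hae : ∀ᵐ p : ℝ × R3 × R3, DifferentiableAt ℝ (extend f) p ∧ DifferentiableAt ℝ ζ p :=
      (LocallyLipschitz.ae_differentiableAt_real hF).and
        (LocallyLipschitz.ae_differentiableAt_real lζ)
    rw [Measure.volume_eq_prod] at hae
    have hae1 := Measure.ae_ae_of_ae_prod hae
    rw [intervalIntegral.integral_of_le ht₀.le]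
    refine setIntegral_nonpos_ae measurableSet_Ioc ?_
    filter_upwards [hae1] with τ hτ hτm
    refine integral_nonpos_of_ae ?_
    filter_upwards [hτ] with z hz
    rw [fderiv_mul_apply hz.1 hz.2, Pi.zero_apply]
    have hmax : max τ 0 = τ := max_eq_left hτm.1.le
    rw [hmax, h.fderiv_extend_apply hτm.1 hz.1, mul_zero, add_zero]
    refine mul_nonpos_of_nonneg_of_nonpos (h.extend_nonneg _) ?_
    set d : ℝ × R3 × R3 := (1, (z.2, -gradient (U τ) z.1)) with hd
    have hline : HasDerivAt (fun s : ℝ => ζ ((τ, z) + s • d)) (fderiv ℝ ζ (τ, z) d) 0 :=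
      (hz.2.hasFDerivAt.hasLineDerivAt d)
    refine nonpos_of_hasDerivAt_of_le hline fun s hs => ?_
    have ha : ‖gradient (U τ) z.1‖ ≤ B := hB τ ⟨hτm.1.le, hτm.2⟩ z.1
    have hp₂ : p₂ ((τ, z) + s • d) ≤ p₂ (τ, z) := by
      refine max_le_max ?_ le_rfl
      have e1 : ((τ, z) + s • d).1 = τ + s := by simp [hd]
      have e2 : ((τ, z) + s • d).2.2 = z.2 - s • gradient (U τ) z.1 := by
        simp [hd, sub_eq_add_neg]
      rw [e1, e2]
      have : ‖z.2 - v₀‖ ≤ ‖z.2 - s • gradient (U τ) z.1 - v₀‖ + s * ‖gradient (U τ) z.1‖ := by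
        have h3 : ‖s • gradient (U τ) z.1‖ = s * ‖gradient (U τ) z.1‖ := by
          rw [norm_smul, Real.norm_of_nonneg hs]
        rw [← h3]
        refine le_trans (le_of_eq ?_) (norm_add_le _ _)
        congr 1; abel
      simp only
      nlinarith [mul_le_mul_of_nonneg_left ha hs]
    have hp20 : 0 ≤ p₂ ((τ, z) + s • d) := le_max_right _ _
    have hp10 : 0 ≤ p₁ ((τ, z) + s • d) := le_max_right _ _
    have hp2z : 0 ≤ p₂ (τ, z) := le_max_right _ _
    simp only [zero_smul, add_zero]
    rcases hp2z.eq_or_lt with h2 | h2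
    · have h3 : p₂ ((τ, z) + s • d) = 0 := le_antisymm (by linarith) hp20
      simp [ζ, h3, ← h2]
    · have hvz : ‖z.2 - v₀‖ < r₂ := by
        by_contra! hcon
        have : p₂ (τ, z) = 0 := max_eq_right (by
          have := mul_nonneg hB0 hτm.1.le
          simp only
          linarith)
        linarith
      have hv : ‖z.2‖ ≤ c₁ := by
        have := norm_le_norm_add_norm_sub v₀ z.2
        rw [norm_sub_rev] at this
        linarith
      have hp₁ : p₁ ((τ, z) + s • d) ≤ p₁ (τ, z) := by
        refine max_le_max ?_ le_rfl
        have e1 : ((τ, z) + s • d).1 = τ + s := by simp [hd]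
        have e2 : ((τ, z) + s • d).2.1 = z.1 + s • z.2 := by simp [hd]
        rw [e1, e2]
        have : ‖z.1 - x₀‖ ≤ ‖z.1 + s • z.2 - x₀‖ + s * ‖z.2‖ := by
          have h3 : ‖s • z.2‖ = s * ‖z.2‖ := by rw [norm_smul, Real.norm_of_nonneg hs]
          rw [← h3]
          refine le_trans (le_of_eq ?_) (norm_sub_le _ _)
          congr 1; abel
        simp only
        nlinarith [mul_le_mul_of_nonneg_left hv hs]
      exact mul_le_mul hp₁ hp₂ hp20 (le_max_right _ _)
  rw [← key] at hle
  have hzero : ∫ z : R3 × R3, extend f (0, z) * ζ (0, z) = 0 := by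
    rw [integral_eq_zero_of_ae]
    refine Eventually.of_forall fun z => ?_
    change extend f (0, z) * ζ (0, z) = 0
    rw [extend_of_nonneg f le_rfl]
    by_cases h1 : ‖z.1 - x₀‖ < r₁
    · by_cases h2 : ‖z.2 - v₀‖ < r₂
      · simp [h0 z.1 z.2 h1 h2]
      · have : p₂ (0, z) = 0 := max_eq_right (by simp only; linarith)
        simp [ζ, this]
    · have : p₁ (0, z) = 0 := max_eq_right (by simp only; linarith)
      simp [ζ, this]
  rw [hzero, sub_zero] at hle
  by_contra hne
  have hcs : HasCompactSupport (fun z : R3 × R3 => extend f (t₀, z) * ζ (t₀, z)) :=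
    HasCompactSupport.of_support_subset_isCompact hK (fun z hz => by
      by_contra hzK
      exact hz (by simp [hsupp t₀ ⟨ht₀.le, le_rfl⟩ z hzK]))
  have hcont : Continuous (fun z : R3 × R3 => extend f (t₀, z) * ζ (t₀, z)) :=
    lG.continuous.comp (by fun_prop)
  have hpos := hcont.integral_pos_of_hasCompactSupport_nonneg_nonzero (μ := volume) (x := (x₀, v₀))
    hcs (fun z => mul_nonneg (h.extend_nonneg _) (mul_nonneg (le_max_right _ _) (le_max_right _ _)))
    (by
      rw [extend_of_nonneg f ht₀.le]
      refine mul_ne_zero hne ?_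
      simp [ζ, p₁, p₂, r₁, r₂])
  linarith

/-- The support of a solution with compactly supported initial datum stays bounded. -/
theorem exists_support_bound (h : IsSolution f U)
    (hc : HasCompactSupport (fun z : R3 × R3 => f 0 z.1 z.2)) (T : ℝ) :
    ∃ R, 0 < R ∧ ∀ t ∈ Icc 0 T, ∀ x v, R ≤ ‖x‖ ∨ R ≤ ‖v‖ → f t x v = 0 := by
  obtain ⟨B', hB'⟩ := h.bounded_field T
  obtain ⟨R₀, hR₀⟩ := hc.isCompact.isBounded.subset_closedBall 0
  have hf0 : ∀ x v, |R₀| < ‖x‖ ∨ |R₀| < ‖v‖ → f 0 x v = 0 := by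
    intro x v hxv
    have : (x, v) ∉ tsupport (fun z : R3 × R3 => f 0 z.1 z.2) := by
      intro hmem
      have h1 := hR₀ hmem
      rw [mem_closedBall_zero_iff, Prod.norm_def, max_le_iff] at h1
      have := le_abs_self R₀
      rcases hxv with h2 | h2
      · exact absurd h1.1 (by simp only; linarith)
      · exact absurd h1.2 (by simp only; linarith)
    exact image_eq_zero_of_notMem_tsupport (f := fun z : R3 × R3 => f 0 z.1 z.2) this
  set B := |B'| with hBdef
  set S := |T| with hS
  set V := |R₀| + B * S + 1 with hV
  set X := |R₀| + (V + (B * S + 1)) * S + 1 with hX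
  have hB0 : 0 ≤ B := abs_nonneg _
  have hS0 : 0 ≤ S := abs_nonneg _
  have hR00 := abs_nonneg R₀
  have hVp : 0 < V := by positivity
  have hXp : 0 < X := by positivity
  refine ⟨max X V + 1, by positivity, fun t ht x v hxv => ?_⟩
  have hXm := le_max_left X V
  have hVm := le_max_right X V
  have htS : t ≤ S := ht.2.trans (le_abs_self T)
  have hBt : B * t ≤ B * S := mul_le_mul_of_nonneg_left htS hB0
  have hmem : ∀ w : R3, V < ‖w‖ → f t x w = 0 := by
    intro w hw
    rcases ht.1.eq_or_lt with h0 | h0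
    · rw [← h0]
      exact hf0 x w (Or.inr (lt_of_le_of_lt (by nlinarith [mul_nonneg hB0 hS0]) hw))
    · refine h.eq_zero_of_cone h0 hB0 (fun s hs y => ((hB' s ⟨hs.1, hs.2.trans ht.2⟩ y).trans
        (le_abs_self _))) x w (fun y u _ hu => hf0 y u (Or.inr ?_))
      have := norm_sub_norm_le w u
      rw [norm_sub_rev] at this
      linarith
  rcases lt_or_ge V ‖v‖ with hv | hv
  · exact hmem v hv
  · have hx : X < ‖x‖ := by
      rcases hxv with h1 | h1 <;> linarith
    rcases ht.1.eq_or_lt with h0 | h0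
    · rw [← h0]
      refine hf0 x v (Or.inl (lt_of_le_of_lt ?_ hx))
      have : 0 ≤ (V + (B * S + 1)) * S := by positivity
      linarith
    · refine h.eq_zero_of_cone h0 hB0 (fun s hs y => ((hB' s ⟨hs.1, hs.2.trans ht.2⟩ y).trans
        (le_abs_self _))) x v (fun y u hy _ => hf0 y u (Or.inl ?_))
      have h3 := norm_sub_norm_le x y
      rw [norm_sub_rev] at h3
      have : (‖v‖ + (B * t + 1)) * t ≤ (V + (B * S + 1)) * S := by
        gcongr
      linarith

end IsSolution

/-! ### Uniqueness for Poisson's equation and tools for the L² Gronwall estimate -/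

/-- Subtracting ε·barrier from ±w makes it strictly subharmonic; then ε tends to zero. -/
theorem eq_zero_of_laplacian_eq_zero {w : R3 → ℝ} (hw : ContDiff ℝ 2 w)
    (h0 : Tendsto w (cocompact R3) (𝓝 0)) (hΔ : ∀ x, Laplacian.laplacian w x = 0) (x : R3) :
    w x = 0 := by
  have key : ∀ g : R3 → ℝ, ContDiff ℝ 2 g → Tendsto g (cocompact R3) (𝓝 0) →
      (∀ x, Laplacian.laplacian g x = 0) → g x ≤ 0 := by
    intro g hg g0 gΔ
    have h : ∀ ε : ℝ, 0 < ε → g x ≤ ε * barrier x := by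
      intro ε hε
      have hb2 : ContDiff ℝ 2 (ε • barrier) := contDiff_const.smul contDiff_barrier
      have := le_zero_of_laplacian_pos (z := g - ε • barrier) (hg.sub hb2) ?_ ?_ x
      · simpa using this
      · intro y
        rw [ContDiffAt.laplacian_sub hg.contDiffAt hb2.contDiffAt,
          InnerProductSpace.laplacian_smul ε contDiff_barrier.contDiffAt, smul_eq_mul, gΔ y]
        have hb := laplacian_barrier_le y
        have hbp : 0 < (1 + ‖y‖ ^ 2) ^ (-(19 / 8) : ℝ) := Real.rpow_pos_of_pos (by positivity) _
        nlinarith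
      · have := g0.sub (tendsto_barrier.const_mul ε)
        simpa [Pi.sub_def, Pi.smul_def] using this
    refine le_of_forall_pos_le_add fun ε hε => ?_
    have := h (ε / barrier x) (div_pos hε (barrier_pos x))
    rwa [div_mul_cancel₀ _ (barrier_pos x).ne', ← zero_add ε] at this
  refine le_antisymm (key w hw h0 hΔ) ?_
  have := key (-w) hw.neg (by simpa [Pi.neg_def] using h0.neg)
    (fun y => by rw [InnerProductSpace.laplacian_neg]; simp [hΔ y])
  simpa using this

/-- Cauchy–Schwarz, read off from ∫(g − c)² ≥ 0 with c the mean of g over B. -/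
theorem sq_setIntegral_le {X : Type*} [MeasurableSpace X] {μ : Measure X} {B : Set X}
    (hB : μ B ≠ ⊤) {g : X → ℝ} (hg : IntegrableOn g B μ)
    (hg2 : IntegrableOn (fun x => g x ^ 2) B μ) :
    (∫ x in B, g x ∂μ) ^ 2 ≤ μ.real B * ∫ x in B, g x ^ 2 ∂μ := by
  set m := ∫ x in B, g x ∂μ with hm
  have hc : ∀ c : ℝ, IntegrableOn (fun _ => c) B μ := fun c => integrableOn_const hB
  have h : ∀ c : ℝ, 0 ≤ (∫ x in B, g x ^ 2 ∂μ) - 2 * c * m + c ^ 2 * μ.real B := by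
    intro c
    have h1 : 0 ≤ ∫ x in B, (g x - c) ^ 2 ∂μ := integral_nonneg fun x => sq_nonneg _
    have h2 : ∀ x, (g x - c) ^ 2 = g x ^ 2 - 2 * c * g x + c ^ 2 := fun x => by ring
    simp_rw [h2] at h1
    have h3 : IntegrableOn (fun x => g x ^ 2 - 2 * c * g x) B μ := hg2.sub (hg.const_mul _)
    rw [integral_add h3 (hc _), integral_sub hg2 (hg.const_mul _),
      integral_const_mul, setIntegral_const, smul_eq_mul] at h1
    linarith
  have hv0 : 0 ≤ μ.real B := measureReal_nonneg
  rcases hv0.eq_or_lt with h0 | h0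
  · have : m = 0 := by
      have hz : μ B = 0 := (measureReal_eq_zero_iff hB).1 h0.symm
      rw [hm, setIntegral_measure_zero _ hz]
    rw [this, ← h0]; simp
  · have := h (m / μ.real B)
    have e : (∫ x in B, g x ^ 2 ∂μ) - 2 * (m / μ.real B) * m + (m / μ.real B) ^ 2 * μ.real B
        = (∫ x in B, g x ^ 2 ∂μ) - m ^ 2 / μ.real B := by field_simp; ring
    rw [e, sub_nonneg, div_le_iff₀ h0] at this
    linarith

/-- Bounded velocity support turns an L² bound in phase space into an L² bound for the spatial
density; this feeds the Poisson estimate. -/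
theorem integral_sq_integral_le {g : R3 × R3 → ℝ} (hg : Continuous g) {B : Set R3}
    (hB : IsCompact B) (h0 : ∀ z ∉ B ×ˢ B, g z = 0) :
    ∫ x, (∫ v, g (x, v)) ^ 2 ≤ (volume : Measure R3).real B * ∫ z, g z * g z := by
  have hi : Integrable (fun z : R3 × R3 => g z * g z) ((volume : Measure R3).prod volume) := by
    refine (hg.mul hg).integrable_of_hasCompactSupport
      (HasCompactSupport.of_support_subset_isCompact (hB.prod hB) fun z hz => ?_)
    by_contra hzK
    exact hz (by simp [h0 z hzK])
  have hpt : ∀ x, (∫ v, g (x, v)) ^ 2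
      ≤ (volume : Measure R3).real B * ∫ v, g (x, v) * g (x, v) := by
    intro x
    have c1 : Continuous (fun v => g (x, v)) := hg.comp (by fun_prop)
    have e1 : ∫ v, g (x, v) = ∫ v in B, g (x, v) :=
      (setIntegral_eq_integral_of_forall_compl_eq_zero
        (fun v hv => h0 _ (fun hm => hv hm.2))).symm
    have e2 : ∫ v, g (x, v) * g (x, v) = ∫ v in B, g (x, v) ^ 2 := by
      simp_rw [← sq]
      exact (setIntegral_eq_integral_of_forall_compl_eq_zero
        (fun v hv => by rw [h0 _ (fun hm => hv hm.2)]; simp)).symm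
    rw [e1, e2]
    exact sq_setIntegral_le hB.measure_lt_top.ne (c1.continuousOn.integrableOn_compact hB)
      ((c1.pow 2).continuousOn.integrableOn_compact hB)
  have e : ∫ z, g z * g z = ∫ x, ∫ v, g (x, v) * g (x, v) := integral_prod _ hi
  rw [e, ← integral_const_mul]
  exact integral_mono_of_nonneg (Eventually.of_forall fun x => sq_nonneg _)
    (hi.integral_prod_left.const_mul _) (Eventually.of_forall hpt)

theorem eq_zero_of_le_integral {D : ℝ → ℝ} (hD : Continuous D) {T c : ℝ} (hc : 0 ≤ c)
    (h0 : ∀ t ∈ Icc 0 T, 0 ≤ D t) (h : ∀ t ∈ Icc 0 T, D t ≤ c * ∫ τ in (0 : ℝ)..t, D τ) :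
    ∀ t ∈ Icc 0 T, D t = 0 := by
  have hder : ∀ t, HasDerivAt (fun t => ∫ τ in (0 : ℝ)..t, D τ) (D t) t := fun t =>
    (hD.integral_hasStrictDerivAt 0 t).hasDerivAt
  have hI : ∀ t ∈ Icc 0 T, ‖∫ τ in (0 : ℝ)..t, D τ‖ ≤ gronwallBound 0 c 0 (t - 0) := by
    refine norm_le_gronwallBound_of_norm_deriv_right_le
      (fun t _ => (hder t).continuousAt.continuousWithinAt)
      (fun t _ => (hder t).hasDerivWithinAt) (by simp) fun t ht => ?_
    have ht' : t ∈ Icc 0 T := ⟨ht.1, ht.2.le⟩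
    have h1 := h t ht'
    rw [Real.norm_of_nonneg (h0 t ht'), add_zero]
    exact h1.trans (mul_le_mul_of_nonneg_left (le_abs_self _) hc)
  intro t ht
  have h1 := hI t ht
  rw [gronwallBound_ε0_δ0, norm_le_zero_iff] at h1
  have h2 := h t ht
  rw [h1, mul_zero] at h2
  exact le_antisymm h2 (h0 t ht)

/-! ### Conserved Casimirs, weak Vlasov equation, propagation of symmetry -/

namespace IsSolution

variable {f : ℝ → R3 → R3 → ℝ} {U : ℝ → R3 → ℝ}

theorem ae_ae_differentiableAt_extend (h : IsSolution f U) :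
    ∀ᵐ τ : ℝ, ∀ᵐ z : R3 × R3, DifferentiableAt ℝ (extend f) (τ, z) := by
  have hae : ∀ᵐ p : ℝ × R3 × R3, DifferentiableAt ℝ (extend f) p :=
    LocallyLipschitz.ae_differentiableAt_real h.locallyLipschitz_extend
  rw [Measure.volume_eq_prod] at hae
  exact Measure.ae_ae_of_ae_prod hae

theorem extend_eq_zero {T R : ℝ}
    (hR : ∀ t ∈ Icc 0 T, ∀ x v, R ≤ ‖x‖ ∨ R ≤ ‖v‖ → f t x v = 0) :
    ∀ t ∈ Icc 0 T, ∀ z ∉ Metric.closedBall (0 : R3) R ×ˢ Metric.closedBall (0 : R3) R,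
      extend f (t, z) = 0 := by
  intro t ht z hz
  rw [extend_of_nonneg f ht.1]
  refine hR t ht _ _ ?_
  rw [mem_prod, not_and_or] at hz
  exact hz.imp (fun h => by simpa using (not_le.1 (by simpa using h)).le)
    (fun h => by simpa using (not_le.1 (by simpa using h)).le)

theorem hasCompactSupport_slice (h : IsSolution f U)
    (hc : HasCompactSupport (fun z : R3 × R3 => f 0 z.1 z.2)) {t : ℝ} (ht : 0 ≤ t) :
    HasCompactSupport (fun z : R3 × R3 => f t z.1 z.2) := by
  obtain ⟨R, -, hR⟩ := h.exists_support_bound hc t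
  refine HasCompactSupport.of_support_subset_isCompact
    ((isCompact_closedBall (0 : R3) R).prod (isCompact_closedBall (0 : R3) R)) fun z hz => ?_
  by_contra hzK
  have := extend_eq_zero hR t ⟨ht, le_rfl⟩ z hzK
  rw [extend_of_nonneg f ht] at this
  exact hz this

/-- Conservation of Casimir functionals. -/
theorem integral_comp_eq (h : IsSolution f U)
    (hc : HasCompactSupport (fun z : R3 × R3 => f 0 z.1 z.2)) {M : ℝ → ℝ} (hM : ContDiff ℝ 1 M)
    (hM0 : M 0 = 0) {t : ℝ} (ht : 0 ≤ t) :
    ∫ z : R3 × R3, M (f t z.1 z.2) = ∫ z : R3 × R3, M (f 0 z.1 z.2) := by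
  obtain ⟨R, -, hR⟩ := h.exists_support_bound hc t
  have hK := (isCompact_closedBall (0 : R3) R).prod (isCompact_closedBall (0 : R3) R)
  have lG : LocallyLipschitz (M ∘ extend f) :=
    (hM.locallyLipschitz (𝕂 := ℝ)).comp h.locallyLipschitz_extend
  have key := integral_sub_integral_eq_of_locallyLipschitz lG hK
    (fun s hs z hz => by rw [Function.comp_apply, extend_eq_zero hR s hs z hz, hM0])
    (a := fun t x => gradient (U (max t 0)) x) h.continuous_field_slice le_rfl ht le_rfl
  rw [intervalIntegral.integral_congr_ae (g := fun _ => (0 : ℝ))] at key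
  · simp only [Function.comp_apply, extend_of_nonneg f ht, extend_of_nonneg f le_rfl,
      intervalIntegral.integral_zero] at key
    linarith
  · filter_upwards [h.ae_ae_differentiableAt_extend] with τ hτ hτm
    rw [uIoc_of_le ht] at hτm
    refine integral_eq_zero_of_ae ?_
    filter_upwards [hτ] with z hz
    have h1 : HasFDerivAt (M ∘ extend f) _ (τ, z) :=
      (hM.differentiable (by norm_num) _).hasDerivAt.comp_hasFDerivAt (τ, z) hz.hasFDerivAt
    rw [h1.fderiv, smul_apply, max_eq_left hτm.1.le, h.fderiv_extend_apply hτm.1 hz]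
    simp

/-- The weak form of the Vlasov equation. -/
theorem integral_mul_sub_integral_mul (h : IsSolution f U)
    (hc : HasCompactSupport (fun z : R3 × R3 => f 0 z.1 z.2)) {ζ : R3 × R3 → ℝ}
    (hζ : ContDiff ℝ 1 ζ) {s t : ℝ} (hs : 0 ≤ s) (hst : s ≤ t) :
    (∫ z : R3 × R3, ζ z * f t z.1 z.2) - ∫ z : R3 × R3, ζ z * f s z.1 z.2
      = ∫ τ in s..t, ∫ z : R3 × R3,
          f τ z.1 z.2 * fderiv ℝ ζ z (z.2, -gradient (U τ) z.1) := by
  obtain ⟨R, -, hR⟩ := h.exists_support_bound hc t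
  have hK := (isCompact_closedBall (0 : R3) R).prod (isCompact_closedBall (0 : R3) R)
  have hζ' : ContDiff ℝ 1 (fun p : ℝ × R3 × R3 => ζ p.2) := hζ.comp contDiff_snd
  have lG : LocallyLipschitz (fun p : ℝ × R3 × R3 => ζ p.2 * extend f p) :=
    locallyLipschitz_mul (hζ'.locallyLipschitz (𝕂 := ℝ)) h.locallyLipschitz_extend
  have key := integral_sub_integral_eq_of_locallyLipschitz lG hK
    (fun s hs z hz => by rw [extend_eq_zero hR s hs z hz, mul_zero])
    (a := fun t x => gradient (U (max t 0)) x) h.continuous_field_slice hs hst le_rfl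
  simp only [extend_of_nonneg f (hs.trans hst), extend_of_nonneg f hs] at key
  rw [key]
  refine intervalIntegral.integral_congr_ae ?_
  filter_upwards [h.ae_ae_differentiableAt_extend] with τ hτ hτm
  rw [uIoc_of_le hst] at hτm
  have hτ0 : 0 < τ := lt_of_le_of_lt hs hτm.1
  refine integral_congr_ae ?_
  filter_upwards [hτ] with z hz
  rw [fderiv_mul_apply (hζ'.differentiable (by norm_num) _) hz, max_eq_left hτ0.le,
    h.fderiv_extend_apply hτ0 hz, mul_zero, zero_add, extend_of_nonneg f hτ0.le]
  have h1 : HasFDerivAt (fun p : ℝ × R3 × R3 => ζ p.2)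
      ((fderiv ℝ ζ z).comp (ContinuousLinearMap.snd ℝ ℝ (R3 × R3))) (τ, z) :=
    HasFDerivAt.comp (τ, z) (g := ζ) (f := fun p : ℝ × R3 × R3 => p.2)
      (hζ.differentiable (by norm_num) z).hasFDerivAt hasFDerivAt_snd
  rw [h1.fderiv]; simp


set_option maxHeartbeats 1000000 in
/-- Symmetry of the initial datum under a linear isometry is preserved by the evolution. -/
theorem isometry_invariant (h : IsSolution f U)
    (hc : HasCompactSupport (fun z : R3 × R3 => f 0 z.1 z.2)) (A : R3 ≃ₗᵢ[ℝ] R3)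
    (hA : ∀ x v, f 0 (A x) (A v) = f 0 x v) {T : ℝ} (hT : 0 ≤ T) (x : R3) :
    U T (A x) = U T x := by
  obtain ⟨R, hR0, hR⟩ := h.exists_support_bound hc T
  set B := Metric.closedBall (0 : R3) R with hBdef
  have hB : IsCompact B := isCompact_closedBall (0 : R3) R
  have hK := hB.prod hB
  set ω := (volume : Measure R3).real B with hω
  have hω0 : 0 ≤ ω := measureReal_nonneg
  let Φ : (ℝ × R3 × R3) ≃L[ℝ] (ℝ × R3 × R3) :=
    (ContinuousLinearEquiv.refl ℝ ℝ).prodCongr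
      (A.toContinuousLinearEquiv.prodCongr A.toContinuousLinearEquiv)
  have hΦ : ∀ t z, Φ (t, z) = (t, (A z.1, A z.2)) := fun t z => rfl
  set F := extend f with hF
  have lF : LocallyLipschitz F := h.locallyLipschitz_extend
  have lFA : LocallyLipschitz (F ∘ Φ) := lF.comp Φ.lipschitz.locallyLipschitz
  have lsub : LocallyLipschitz (fun p => (F ∘ Φ) p - F p) :=
    (ContDiff.locallyLipschitz (𝕂 := ℝ)
      (by fun_prop : ContDiff ℝ 1 (fun q : ℝ × ℝ => q.1 - q.2))).comp (lFA.prodMk lF)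
  set δ : ℝ × R3 × R3 → ℝ := fun p => (F ∘ Φ) p - F p with hδ
  have cδ : Continuous δ := lsub.continuous
  have lG : LocallyLipschitz (fun p => δ p * δ p) := locallyLipschitz_mul lsub lsub
  have hz0 : ∀ t ∈ Icc 0 T, ∀ z ∉ B ×ˢ B, F (t, z) = 0 := extend_eq_zero hR
  have hδ0 : ∀ t ∈ Icc 0 T, ∀ z ∉ B ×ˢ B, δ (t, z) = 0 := by
    intro t ht z hz
    have h1 : (A z.1, A z.2) ∉ B ×ˢ B := by
      simpa [hBdef, mem_prod] using hz
    simp only [hδ, Function.comp_apply, hΦ, hz0 t ht z hz, hz0 t ht _ h1, sub_zero]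
  obtain ⟨C, hC⟩ := exists_lipschitzWith_clamp lF hT hK hz0
  have hfd : ∀ τ ∈ Ioo 0 T, ∀ z, ‖fderiv ℝ F (τ, z)‖ ≤ C := by
    intro τ hτ z
    have : (fun p : ℝ × R3 × R3 => F ((projIcc 0 T hT p.1 : ℝ), p.2)) =ᶠ[𝓝 (τ, z)] F := by
      have h1 : ∀ᶠ p : ℝ × R3 × R3 in 𝓝 (τ, z), p.1 ∈ Ioo 0 T :=
        continuous_fst.continuousAt.eventually (Ioo_mem_nhds hτ.1 hτ.2)
      filter_upwards [h1] with p hp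
      rw [projIcc_of_mem hT ⟨hp.1.le, hp.2.le⟩]
    rw [← this.fderiv_eq]
    exact norm_fderiv_le_of_lipschitz ℝ hC
  have hU2 : ∀ t, 0 ≤ t → ContDiff ℝ 2 (U t) := fun t ht => (h.potential t ht).contDiff
  set w : ℝ → R3 → ℝ := fun t => (fun y => U t (A y)) - U t with hw
  have hUA2 : ∀ t, 0 ≤ t → ContDiff ℝ 2 (fun y => U t (A y)) := fun t ht =>
    (hU2 t ht).comp A.toContinuousLinearEquiv.contDiff
  have hw2 : ∀ t, 0 ≤ t → ContDiff ℝ 2 (w t) := fun t ht => (hUA2 t ht).sub (hU2 t ht)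
  have hwdec : ∀ t, 0 ≤ t → Tendsto (w t) (cocompact R3) (𝓝 0) := by
    intro t ht
    have h1 := (h.potential t ht).decay
    have h2 : Tendsto (fun y => U t (A y)) (cocompact R3) (𝓝 0) :=
      h1.comp A.toHomeomorph.isClosedEmbedding.tendsto_cocompact
    have h3 := h2.sub h1
    rw [sub_zero] at h3
    exact h3
  have hint : ∀ t, 0 ≤ t → ∀ x, Integrable (fun v => f t x v) := h.integrable
  have hwΔ : ∀ t, 0 ≤ t → ∀ x, Laplacian.laplacian (w t) x
      = 4 * Real.pi * ∫ v, δ (t, (x, v)) := by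
    intro t ht x
    rw [hw]
    simp only
    rw [ContDiffAt.laplacian_sub (hUA2 t ht).contDiffAt (hU2 t ht).contDiffAt,
      laplacian_comp_linearIsometryEquiv (hU2 t ht), (h.potential t ht).poisson,
      (h.potential t ht).poisson, ← mul_sub]
    congr 1
    have e1 : density (f t) (A x) = ∫ v, f t (A x) (A v) :=
      (A.measurePreserving.integral_comp A.toHomeomorph.measurableEmbedding _).symm
    rw [e1, density, ← integral_sub]
    · simp [hδ, hF, hΦ, extend_of_nonneg f ht]
    · exact (A.measurePreserving.integrable_comp_emb A.toHomeomorph.measurableEmbedding).2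
        (hint t ht (A x))
    · exact hint t ht x
  set D : ℝ → ℝ := fun t => ∫ z in B ×ˢ B, δ (t, z) * δ (t, z) with hD
  have cD : Continuous D :=
    continuous_parametric_integral_of_continuous
      (f := fun (t : ℝ) (z : R3 × R3) => δ (t, z) * δ (t, z)) (by
        have : Continuous (fun p : ℝ × R3 × R3 => δ p * δ p) := cδ.mul cδ
        exact this) hK
  have hDeq : ∀ t ∈ Icc 0 T, ∫ z, δ (t, z) * δ (t, z) = D t := by
    intro t ht
    rw [hD]
    exact (setIntegral_eq_integral_of_forall_compl_eq_zero
      (fun z hz => by simp [hδ0 t ht z hz])).symm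
  have hρ : ∀ t ∈ Icc 0 T, ∫ x, Laplacian.laplacian (w t) x ^ 2
      ≤ (4 * Real.pi) ^ 2 * (ω * D t) := by
    intro t ht
    have cδt : Continuous (fun z : R3 × R3 => δ (t, z)) := cδ.comp (by fun_prop)
    have := integral_sq_integral_le cδt hB (hδ0 t ht)
    rw [hDeq t ht] at this
    simp_rw [hwΔ t ht.1, mul_pow]
    rw [integral_const_mul]
    exact mul_le_mul_of_nonneg_left this (by positivity)
  -- From 2C|δ||∇w| ≤ Cδ² + C|∇w|². The second term is traced through the volume ω of the velocity
  -- ball, the energy estimate 4(1 + R²), the factor 4π of Poisson's equation and the L² bound of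
  -- the density by δ.
  set c : ℝ := C + C * (ω * (4 * (1 + R ^ 2) * ((4 * Real.pi) ^ 2 * ω))) with hcdef
  have hc0 : 0 ≤ c := by positivity
  have hdecay : ∀ t ∈ Icc 0 T, D t ≤ c * ∫ τ in (0 : ℝ)..t, D τ := by
    intro t ht
    have key := integral_sub_integral_eq_of_locallyLipschitz lG hK
      (fun s hs z hz => by rw [hδ0 s hs z hz, mul_zero])
      (a := fun t x => gradient (U (max t 0)) x) h.continuous_field_slice le_rfl ht.1 ht.2
    have hinit : ∫ z : R3 × R3, δ (0, z) * δ (0, z) = 0 := by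
      have : ∀ z : R3 × R3, δ (0, z) = 0 := fun z => by
        simp [hδ, hF, hΦ, extend_of_nonneg f le_rfl, hA]
      simp [this]
    rw [hDeq t ht, hinit, sub_zero] at key
    rw [key, ← intervalIntegral.integral_const_mul]
    refine (le_abs_self _).trans ?_
    rw [← Real.norm_eq_abs]
    refine intervalIntegral.norm_integral_le_of_norm_le ht.1 ?_
      ((cD.const_mul c).intervalIntegrable _ _)
    have hae : ∀ᵐ p : ℝ × R3 × R3, DifferentiableAt ℝ F p ∧ DifferentiableAt ℝ (F ∘ Φ) p :=
      (LocallyLipschitz.ae_differentiableAt_real lF).and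
        (LocallyLipschitz.ae_differentiableAt_real lFA)
    rw [Measure.volume_eq_prod] at hae
    have hne : ∀ᵐ τ : ℝ, τ ≠ t := by simp [ae_iff]
    filter_upwards [Measure.ae_ae_of_ae_prod hae, hne] with τ hτ hτt hτm
    have hτ0 : 0 < τ := hτm.1
    have hτT : τ ∈ Icc 0 T := ⟨hτ0.le, hτm.2.trans ht.2⟩
    have hτo : τ ∈ Ioo 0 T := ⟨hτ0, lt_of_lt_of_le (lt_of_le_of_ne hτm.2 hτt) ht.2⟩
    have dU := (hU2 τ hτ0.le).differentiable (by norm_num)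
    have cgw := continuous_gradient ((hw2 τ hτ0.le).of_le (by norm_num : (1 : WithTop ℕ∞) ≤ 2))
    have cδτ : Continuous (fun z : R3 × R3 => δ (τ, z)) := cδ.comp (by fun_prop)
    have i1 : IntegrableOn (fun z : R3 × R3 => δ (τ, z) * δ (τ, z)) (B ×ˢ B) :=
      (cδτ.mul cδτ).continuousOn.integrableOn_compact hK
    have i2 : IntegrableOn (fun z : R3 × R3 => ‖gradient (w τ) z.1‖ ^ 2) (B ×ˢ B) := by
      refine Continuous.continuousOn ?_ |>.integrableOn_compact hK
      exact (cgw.comp continuous_fst).norm.pow 2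
    have hbound : ∀ᵐ z : R3 × R3, ‖fderiv ℝ (fun p => δ p * δ p) (τ, z)
        (1, (z.2, -gradient (U (max τ 0)) z.1))‖
        ≤ (B ×ˢ B).indicator (fun z => C * (δ (τ, z) * δ (τ, z))
          + C * ‖gradient (w τ) z.1‖ ^ 2) z := by
      filter_upwards [hτ] with z hz
      have dδ : DifferentiableAt ℝ δ (τ, z) := hz.2.sub hz.1
      rw [fderiv_mul_apply dδ dδ, max_eq_left hτ0.le]
      by_cases hzK : z ∈ B ×ˢ B
      · rw [indicator_of_mem hzK]
        -- F∘Φ is transported by the rotated force, so its derivative along the unrotated flow is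
        -- the velocity derivative of F in the direction of the force difference.
        have hδd : fderiv ℝ δ (τ, z) (1, (z.2, -gradient (U τ) z.1))
            = fderiv ℝ F (Φ (τ, z)) (0, (0, A (gradient (w τ) z.1))) := by
          have h1 : fderiv ℝ δ (τ, z) = fderiv ℝ (F ∘ Φ) (τ, z) - fderiv ℝ F (τ, z) :=
            fderiv_sub hz.2 hz.1
          rw [h1, sub_apply, h.fderiv_extend_apply hτ0 hz.1, sub_zero, Φ.comp_right_fderiv]
          have hdA : DifferentiableAt ℝ F (Φ (τ, z)) := Φ.comp_right_differentiableAt_iff.1 hz.2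
          have h2 := h.fderiv_extend_apply hτ0 (z := (A z.1, A z.2)) hdA
          rw [← hF, ← hΦ] at h2
          have e1 : A (gradient (w τ) z.1)
              = gradient (U τ) (A z.1) - A (gradient (U τ) z.1) := by
            have h3 : gradient (w τ) z.1
                = gradient (fun y => U τ (A y)) z.1 - gradient (U τ) z.1 := by
              refine ext_inner_right ℝ fun u => ?_
              rw [inner_sub_left, inner_gradient_left, inner_gradient_left, inner_gradient_left]
              have : fderiv ℝ (w τ) z.1 = _ := fderiv_sub
                ((hUA2 τ hτ0.le).differentiable (by norm_num) z.1) (dU z.1)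
              rw [this, sub_apply]
            rw [h3, map_sub, gradient_comp_linearIsometryEquiv dU]
          have e2 : Φ (1, (z.2, -gradient (U τ) z.1))
              = (1, (A z.2, -gradient (U τ) (A z.1))) + (0, (0, A (gradient (w τ) z.1))) := by
            rw [hΦ, e1]
            refine Prod.ext (by simp) (Prod.ext (by simp) ?_)
            simp only [Prod.snd_add, map_neg]
            abel
          rw [ContinuousLinearMap.comp_apply]
          change fderiv ℝ F (Φ (τ, z)) (Φ (1, (z.2, -gradient (U τ) z.1))) = _
          rw [e2, map_add]
          have h4 : fderiv ℝ F (Φ (τ, z)) (1, (A z.2, -gradient (U τ) (A z.1))) = 0 := h2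
          rw [h4, zero_add]
        rw [hδd]
        have hn : ‖fderiv ℝ F (Φ (τ, z)) (0, (0, A (gradient (w τ) z.1)))‖
            ≤ C * ‖gradient (w τ) z.1‖ := by
          refine ((fderiv ℝ F (Φ (τ, z))).le_opNorm _).trans ?_
          have : ‖((0 : ℝ), ((0 : R3), A (gradient (w τ) z.1)))‖ = ‖gradient (w τ) z.1‖ := by
            simp [Prod.norm_def]
          rw [this]
          gcongr
          exact hfd τ hτo _
        rw [← two_mul, norm_mul, norm_mul, Real.norm_two, Real.norm_eq_abs (δ (τ, z))]
        calc 2 * (|δ (τ, z)| * ‖fderiv ℝ F (Φ (τ, z)) (0, (0, A (gradient (w τ) z.1)))‖)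
            ≤ 2 * (|δ (τ, z)| * (C * ‖gradient (w τ) z.1‖)) := by gcongr
          _ ≤ C * (δ (τ, z) * δ (τ, z)) + C * ‖gradient (w τ) z.1‖ ^ 2 := by
            have hCp : (0 : ℝ) ≤ C := C.2
            have := mul_nonneg hCp (sq_nonneg (|δ (τ, z)| - ‖gradient (w τ) z.1‖))
            nlinarith [abs_mul_abs_self (δ (τ, z))]
      · rw [indicator_of_notMem hzK, hδ0 τ hτT z hzK]; simp
    have i3 : IntegrableOn (fun z : R3 × R3 => C * (δ (τ, z) * δ (τ, z))
        + C * ‖gradient (w τ) z.1‖ ^ 2) (B ×ˢ B) := (i1.const_mul _).add (i2.const_mul _)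
    refine (norm_integral_le_of_norm_le (i3.integrable_indicator hK.isClosed.measurableSet)
      hbound).trans ?_
    rw [integral_indicator hK.isClosed.measurableSet]
    have e3 : ∫ z in B ×ˢ B, (C * (δ (τ, z) * δ (τ, z)) + C * ‖gradient (w τ) z.1‖ ^ 2)
        = C * D τ + C * ∫ z in B ×ˢ B, ‖gradient (w τ) z.1‖ ^ 2 := by
      rw [integral_add (i1.const_mul _) (i2.const_mul _), integral_const_mul, integral_const_mul]
    have e4 : ∫ z in B ×ˢ B, ‖gradient (w τ) z.1‖ ^ 2
        = ω * ∫ x in B, ‖gradient (w τ) x‖ ^ 2 := by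
      have := setIntegral_prod_mul (μ := (volume : Measure R3)) (ν := (volume : Measure R3))
        (fun x => ‖gradient (w τ) x‖ ^ 2) (fun _ => (1 : ℝ)) B B
      simp only [mul_one, setIntegral_const, smul_eq_mul] at this
      rw [mul_comm]
      exact this
    have hen := setIntegral_norm_gradient_sq_le (hw2 τ hτ0.le) (hwdec τ hτ0.le) (R := R)
      (fun x hx => by
        rw [hwΔ τ hτ0.le]
        have : ∀ v, δ (τ, (x, v)) = 0 := fun v => hδ0 τ hτT _ (fun hm => by
          have : ‖x‖ ≤ R := by simpa [hBdef] using hm.1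
          linarith)
        simp [this])
    have hD0 : 0 ≤ D τ := integral_nonneg fun z => mul_self_nonneg _
    refine e3.le.trans ?_
    rw [e4, hcdef, add_mul]
    have hCp : (0 : ℝ) ≤ C := C.2
    refine add_le_add le_rfl ?_
    calc C * (ω * ∫ x in B, ‖gradient (w τ) x‖ ^ 2)
        ≤ C * (ω * (4 * (1 + R ^ 2) * ((4 * Real.pi) ^ 2 * (ω * D τ)))) := by
          gcongr
          exact hen.trans (by gcongr; exact hρ τ hτT)
      _ = C * (ω * (4 * (1 + R ^ 2) * ((4 * Real.pi) ^ 2 * ω))) * D τ := by ring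
  have hDz := eq_zero_of_le_integral cD hc0
    (fun t _ => integral_nonneg fun z => mul_self_nonneg _) hdecay T ⟨hT, le_rfl⟩
  have hmT : T ∈ Icc 0 T := ⟨hT, le_rfl⟩
  have hδT : ∀ z, δ (T, z) = 0 := by
    intro z
    by_contra hne
    have cδT : Continuous (fun z : R3 × R3 => δ (T, z)) := cδ.comp (by fun_prop)
    have hcs : HasCompactSupport (fun z : R3 × R3 => δ (T, z) * δ (T, z)) :=
      HasCompactSupport.of_support_subset_isCompact hK (fun z hz => by
        by_contra hzK
        exact hz (by simp [hδ0 T hmT z hzK]))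
    have hpos := (cδT.mul cδT).integral_pos_of_hasCompactSupport_nonneg_nonzero (μ := volume)
      (x := z) hcs (fun z => mul_self_nonneg _) (mul_self_ne_zero.2 hne)
    have := hDeq T hmT
    rw [hDz] at this
    exact hpos.ne' this
  have := eq_zero_of_laplacian_eq_zero (hw2 T hT) (hwdec T hT)
    (fun y => by rw [hwΔ T hT]; simp [hδT]) x
  simpa [hw, sub_eq_zero] using this

end IsSolution

/-! ### Radial functions and their profiles -/

/-- `W` is spherically symmetric about the origin. -/
def IsRadial (W : R3 → ℝ) : Prop := ∀ x y : R3, ‖x‖ = ‖y‖ → W x = W y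

/-- A fixed unit vector. -/
def unitVec : R3 := EuclideanSpace.single 0 1

theorem norm_unitVec : ‖unitVec‖ = 1 := by simp [unitVec]

/-- The restriction of `W` to a fixed line through the origin. -/
def profile (W : R3 → ℝ) (r : ℝ) : ℝ := W (r • unitVec)

theorem norm_smul_unitVec {r : ℝ} (hr : 0 ≤ r) : ‖r • unitVec‖ = r := by
  rw [norm_smul, norm_unitVec, mul_one, Real.norm_of_nonneg hr]

theorem contDiff_profile {W : R3 → ℝ} {n : WithTop ℕ∞} (hW : ContDiff ℝ n W) :
    ContDiff ℝ n (profile W) :=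
  hW.comp (by fun_prop)

theorem integral_fun_norm (F : ℝ → ℝ) :
    ∫ x : R3, F ‖x‖ = 4 * Real.pi * ∫ r in Ioi (0 : ℝ), r ^ 2 * F r := by
  have hv : (volume : Measure R3).real (Metric.ball 0 1) = 4 * Real.pi / 3 := by
    rw [measureReal_def, EuclideanSpace.volume_ball_fin_three]
    rw [ENNReal.toReal_mul, ENNReal.toReal_pow, ENNReal.toReal_ofReal (by norm_num),
      ENNReal.toReal_ofReal (by positivity)]
    ring
  have := integral_fun_norm_addHaar (volume : Measure R3) F
  rw [this, hv]
  simp only [finrank_euclideanSpace, Fintype.card_fin, smul_eq_mul, nsmul_eq_mul]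
  push_cast
  ring_nf

namespace IsRadial

variable {W : R3 → ℝ}

theorem eq_profile (h : IsRadial W) (x : R3) : W x = profile W ‖x‖ :=
  h _ _ (norm_smul_unitVec (norm_nonneg x)).symm

theorem sub {V : R3 → ℝ} (h : IsRadial W) (h' : IsRadial V) : IsRadial (W - V) := fun x y hxy => by
  rw [Pi.sub_apply, Pi.sub_apply, h x y hxy, h' x y hxy]

theorem eventuallyEq (h : IsRadial W) (x : R3) :
    W =ᶠ[𝓝 x] fun y => (fun s => profile W (√s)) (‖y‖ ^ 2) :=
  Eventually.of_forall fun y => by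
    change W y = profile W (√(‖y‖ ^ 2))
    rw [Real.sqrt_sq (norm_nonneg y)]; exact h.eq_profile y

theorem hasDerivAt_profile_sqrt (hW : ContDiff ℝ 2 W) {s : ℝ} (hs : 0 < s) :
    HasDerivAt (fun s => profile W (√s)) (deriv (profile W) (√s) / (2 * √s)) s := by
  have h1 := (((contDiff_profile hW).differentiable (by norm_num)) (√s)).hasDerivAt
  have := h1.comp s (Real.hasDerivAt_sqrt hs.ne')
  refine this.congr_deriv ?_
  ring

theorem contDiff_deriv_profile (hW : ContDiff ℝ 2 W) : ContDiff ℝ 1 (deriv (profile W)) :=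
  (contDiff_succ_iff_deriv.1 ((contDiff_profile hW).of_le (by norm_num) :
    ContDiff ℝ (1 + 1) (profile W))).2.2

theorem hasDerivAt_deriv_profile (hW : ContDiff ℝ 2 W) (r : ℝ) :
    HasDerivAt (deriv (profile W)) (deriv (deriv (profile W)) r) r :=
  ((contDiff_deriv_profile hW).differentiable (by norm_num) r).hasDerivAt

theorem hasDerivAt_profile (hW : ContDiff ℝ 2 W) (r : ℝ) :
    HasDerivAt (profile W) (deriv (profile W) r) r :=
  ((contDiff_profile hW).differentiable (by norm_num) r).hasDerivAt

theorem hasDerivAt_deriv_profile_sqrt (hW : ContDiff ℝ 2 W) {r : ℝ} (hr : 0 < r) :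
    HasDerivAt (fun s => deriv (profile W) (√s) / (2 * √s))
      (deriv (deriv (profile W)) r / (4 * r ^ 2) - deriv (profile W) r / (4 * r ^ 3)) (r ^ 2) := by
  have hs : √(r ^ 2) = r := Real.sqrt_sq hr.le
  have hr2 : r ^ 2 ≠ 0 := by positivity
  have h0 := Real.hasDerivAt_sqrt hr2
  rw [hs] at h0
  have h1 : HasDerivAt (fun s => deriv (profile W) (√s))
      (deriv (deriv (profile W)) r * (1 / (2 * r))) (r ^ 2) :=
    HasDerivAt.comp (h₂ := deriv (profile W)) (r ^ 2)
      (by rw [hs]; exact hasDerivAt_deriv_profile hW r) h0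
  have h2 := h1.div (h0.const_mul 2) (by rw [hs]; positivity)
  refine h2.congr_deriv ?_
  rw [hs]
  field_simp
  ring

theorem gradient_eq (h : IsRadial W) (hW : ContDiff ℝ 2 W) {x : R3} (hx : x ≠ 0) :
    gradient W x = (deriv (profile W) ‖x‖ / ‖x‖) • x := by
  have hx' : 0 < ‖x‖ := norm_pos_iff.2 hx
  rw [gradient_of_normSq (h.eventuallyEq x) (hasDerivAt_profile_sqrt hW (by positivity)),
    Real.sqrt_sq hx'.le]
  congr 1
  field_simp

theorem norm_gradient_eq (h : IsRadial W) (hW : ContDiff ℝ 2 W) {x : R3} (hx : x ≠ 0) :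
    ‖gradient W x‖ = |deriv (profile W) ‖x‖| := by
  have hx' : 0 < ‖x‖ := norm_pos_iff.2 hx
  rw [h.gradient_eq hW hx, norm_smul, norm_div, norm_norm, div_mul_cancel₀ _ hx'.ne',
    Real.norm_eq_abs]

theorem inner_gradient_self (h : IsRadial W) (hW : ContDiff ℝ 2 W) (x : R3) :
    inner ℝ x (gradient W x) = ‖x‖ * deriv (profile W) ‖x‖ := by
  by_cases hx : x = 0
  · simp [hx]
  · have hx' : 0 < ‖x‖ := norm_pos_iff.2 hx
    rw [h.gradient_eq hW hx, inner_smul_right, real_inner_self_eq_norm_sq]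
    field_simp

theorem fderiv_fderiv_apply_self (h : IsRadial W) (hW : ContDiff ℝ 2 W) {x : R3} (hx : x ≠ 0)
    (v : R3) :
    fderiv ℝ (fderiv ℝ W) x v x = deriv (deriv (profile W)) ‖x‖ * inner ℝ x v := by
  have hx' : 0 < ‖x‖ := norm_pos_iff.2 hx
  have hp : ∀ᶠ s in 𝓝 (‖x‖ ^ 2), HasDerivAt (fun s => profile W (√s))
      (deriv (profile W) (√s) / (2 * √s)) s := by
    filter_upwards [lt_mem_nhds (by positivity : 0 < ‖x‖ ^ 2)] with s hs
    exact hasDerivAt_profile_sqrt hW hs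
  rw [(hasFDerivAt_fderiv_of_normSq (h.eventuallyEq x) hp
    (hasDerivAt_deriv_profile_sqrt hW hx')).fderiv]
  simp only [add_apply, smul_apply, smul_eq_mul,
    ContinuousLinearMap.smulRight_apply, innerR3_apply, real_inner_self_eq_norm_sq,
    Real.sqrt_sq hx'.le, real_inner_comm v x]
  field_simp
  ring

theorem laplacian_eq (h : IsRadial W) (hW : ContDiff ℝ 2 W) {x : R3} (hx : x ≠ 0) :
    Laplacian.laplacian W x
      = deriv (deriv (profile W)) ‖x‖ + 2 * (deriv (profile W) ‖x‖ / ‖x‖) := by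
  have hx' : 0 < ‖x‖ := norm_pos_iff.2 hx
  have hp : ∀ᶠ s in 𝓝 (‖x‖ ^ 2), HasDerivAt (fun s => profile W (√s))
      (deriv (profile W) (√s) / (2 * √s)) s := by
    filter_upwards [lt_mem_nhds (by positivity : 0 < ‖x‖ ^ 2)] with s hs
    exact hasDerivAt_profile_sqrt hW hs
  rw [laplacian_of_normSq (h.eventuallyEq x) hp (hasDerivAt_deriv_profile_sqrt hW hx'),
    Real.sqrt_sq hx'.le]
  field_simp
  ring

theorem laplacian (h : IsRadial W) (hW : ContDiff ℝ 2 W) :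
    IsRadial (Laplacian.laplacian W) := by
  intro x y hxy
  by_cases hx : x = 0
  · have hy : y = 0 := by rw [hx, norm_zero] at hxy; exact norm_eq_zero.1 hxy.symm
    rw [hx, hy]
  · have hy : y ≠ 0 := by rw [← norm_pos_iff, ← hxy]; exact norm_pos_iff.2 hx
    rw [h.laplacian_eq hW hx, h.laplacian_eq hW hy, hxy]

/-- The profile along a full line through the origin is an even function. -/
theorem deriv_profile_zero (h : IsRadial W) (hW : ContDiff ℝ 2 W) : deriv (profile W) 0 = 0 := by
  have h1 := hasDerivAt_profile hW 0
  have h2 : HasDerivAt (fun r => profile W (-r)) (-deriv (profile W) 0) 0 := by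
    have := HasDerivAt.comp (0 : ℝ) (h₂ := profile W) (h := fun r => -r)
      (by rw [neg_zero]; exact h1) (hasDerivAt_neg 0)
    rw [mul_neg, mul_one] at this
    exact this
  have h3 : (fun r => profile W (-r)) = profile W := by
    ext r; exact h _ _ (by simp)
  rw [h3] at h2
  have := h1.unique h2
  linarith

/-- The flux `r² w'(r)` of a radial function has derivative `r² Δw`. -/
theorem hasDerivAt_flux (h : IsRadial W) (hW : ContDiff ℝ 2 W) {r : ℝ} (hr : 0 ≤ r) :
    HasDerivAt (fun r => r ^ 2 * deriv (profile W) r)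
      (r ^ 2 * profile (Laplacian.laplacian W) r) r := by
  have h1 := (hasDerivAt_pow 2 r).mul (hasDerivAt_deriv_profile hW r)
  refine h1.congr_deriv ?_
  rcases hr.eq_or_lt with rfl | hr
  · simp
  · have hne : r • unitVec ≠ 0 := by rw [← norm_pos_iff, norm_smul_unitVec hr.le]; exact hr
    rw [profile, h.laplacian_eq hW hne, norm_smul_unitVec hr.le]
    field_simp
    push_cast
    ring

theorem integral_flux (h : IsRadial W) (hW : ContDiff ℝ 2 W) {r : ℝ} (hr : 0 ≤ r) :
    ∫ s in (0 : ℝ)..r, s ^ 2 * profile (Laplacian.laplacian W) s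
      = r ^ 2 * deriv (profile W) r := by
  have hc : Continuous (profile (Laplacian.laplacian W)) :=
    (continuous_laplacian hW).comp (by fun_prop)
  rw [intervalIntegral.integral_eq_sub_of_hasDerivAt
    (f := fun r => r ^ 2 * deriv (profile W) r)]
  · simp
  · intro s hs
    rw [uIcc_of_le hr] at hs
    exact h.hasDerivAt_flux hW hs.1
  · exact (by fun_prop : Continuous fun s : ℝ => s ^ 2 * profile (Laplacian.laplacian W) s)
      |>.intervalIntegrable _ _

/-- A radial potential of a compactly supported density of total mass zero vanishes outside the
support. -/
theorem eq_zero_of_integral_laplacian_eq_zero (h : IsRadial W) (hW : ContDiff ℝ 2 W)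
    (h0 : Tendsto W (cocompact R3) (𝓝 0)) {R : ℝ} (hR : 0 < R)
    (hΔ : ∀ x, R ≤ ‖x‖ → Laplacian.laplacian W x = 0) (hm : ∫ x, Laplacian.laplacian W x = 0)
    {x : R3} (hx : R ≤ ‖x‖) : W x = 0 := by
  have hrad := h.laplacian hW
  have hF0 : ∀ r, R ≤ r → profile (Laplacian.laplacian W) r = 0 := fun r hr =>
    hΔ _ (by rwa [norm_smul_unitVec (hR.le.trans hr)])
  -- Newton's theorem: up to the factor 4π the flux r²w'(r) is the integral of Δw over the ball of
  -- radius r, which for r ≥ R is the total integral, zero.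
  have hder : ∀ r, R ≤ r → deriv (profile W) r = 0 := by
    intro r hr
    have h1 : ∫ x, Laplacian.laplacian W x
        = ∫ x : R3, profile (Laplacian.laplacian W) ‖x‖ :=
      integral_congr_ae (Eventually.of_forall fun x => hrad.eq_profile x)
    rw [h1, integral_fun_norm] at hm
    have hm' : ∫ r in Ioi (0 : ℝ), r ^ 2 * profile (Laplacian.laplacian W) r = 0 := by
      rcases mul_eq_zero.1 hm with h | h
      · exact absurd h (by positivity)
      · exact h
    have h2 : ∫ r in Ioi (0 : ℝ), r ^ 2 * profile (Laplacian.laplacian W) r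
        = ∫ s in (0 : ℝ)..r, s ^ 2 * profile (Laplacian.laplacian W) s := by
      rw [intervalIntegral.integral_of_le (hR.le.trans hr)]
      refine (setIntegral_eq_of_subset_of_forall_sdiff_eq_zero measurableSet_Ioi
        Ioc_subset_Ioi_self fun s hs => ?_)
      have : r < s := by
        by_contra hle
        exact hs.2 ⟨hs.1, not_lt.1 hle⟩
      rw [hF0 s (hr.trans this.le), mul_zero]
    rw [h2, h.integral_flux hW (hR.le.trans hr)] at hm'
    rcases mul_eq_zero.1 hm' with h | h
    · exact absurd h (by have := hR.trans_le hr; positivity)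
    · exact h
  have hconst : ∀ r, R ≤ r → profile W r = profile W R := by
    intro r hr
    have hd := (contDiff_profile hW).differentiable (by norm_num)
    exact constant_of_has_deriv_right_zero (f := profile W) hd.continuous.continuousOn
      (fun s hs => by
        have := (hd s).hasDerivAt
        rw [hder s hs.1] at this
        exact this.hasDerivWithinAt) r ⟨hr, le_rfl⟩
  have hlim : Tendsto (fun r : ℝ => profile W r) atTop (𝓝 0) := by
    refine h0.comp ?_
    rw [← Metric.cobounded_eq_cocompact, ← tendsto_norm_atTop_iff_cobounded]
    refine tendsto_abs_atTop_atTop.congr fun r => ?_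
    rw [norm_smul, norm_unitVec, mul_one, Real.norm_eq_abs]
  have : profile W R = 0 := by
    refine tendsto_nhds_unique (tendsto_const_nhds.congr' ?_) hlim
    filter_upwards [eventually_ge_atTop R] with r hr using (hconst r hr).symm
  rw [h.eq_profile, hconst _ hx, this]

end IsRadial

/-! ### Radial symmetry of the potential of a solution -/

/-- The reflection in the bisecting plane carries x to y but has determinant −1. A second
reflection, with normal orthogonal to y, fixes y and restores the orientation. -/
theorem exists_rotation_of_norm_eq {x y : R3} (hxy : ‖x‖ = ‖y‖) :
    ∃ A : R3 ≃ₗᵢ[ℝ] R3, LinearMap.det (A.toLinearEquiv : R3 →ₗ[ℝ] R3) = 1 ∧ A x = y := by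
  by_cases h : x = y
  · exact ⟨LinearIsometryEquiv.refl ℝ R3, by
      change LinearMap.det (LinearMap.id : R3 →ₗ[ℝ] R3) = 1
      simp, h⟩
  have hdet : ∀ w : R3, w ≠ 0 →
      LinearMap.det ((ℝ ∙ w)ᗮ.reflection.toLinearEquiv : R3 →ₗ[ℝ] R3) = -1 := by
    intro w hw
    have := (ℝ ∙ w)ᗮ.det_reflection
    rw [Submodule.orthogonal_orthogonal, finrank_span_singleton hw, pow_one] at this
    exact this
  obtain ⟨w, hw, hwy⟩ : ∃ w : R3, w ≠ 0 ∧ inner ℝ w y = 0 := by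
    have h1 : (ℝ ∙ y)ᗮ ≠ ⊥ := by
      intro hb
      have h2 := Submodule.finrank_add_finrank_orthogonal (ℝ ∙ y)
      rw [hb, finrank_bot, finrank_euclideanSpace] at h2
      have h3 := finrank_span_le_card (R := ℝ) ({y} : Set R3)
      simp at h3 h2
      omega
    obtain ⟨w, hw, hw0⟩ := Submodule.exists_mem_ne_zero_of_ne_bot h1
    exact ⟨w, hw0, by rw [real_inner_comm]; exact Submodule.mem_orthogonal_singleton_iff_inner_right.1 hw⟩
  refine ⟨((ℝ ∙ (x - y))ᗮ.reflection).trans (ℝ ∙ w)ᗮ.reflection, ?_, ?_⟩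
  · have h1 : ((((ℝ ∙ (x - y))ᗮ.reflection).trans (ℝ ∙ w)ᗮ.reflection).toLinearEquiv : R3 →ₗ[ℝ] R3)
        = ((ℝ ∙ w)ᗮ.reflection.toLinearEquiv : R3 →ₗ[ℝ] R3).comp
          ((ℝ ∙ (x - y))ᗮ.reflection.toLinearEquiv : R3 →ₗ[ℝ] R3) := rfl
    rw [h1, LinearMap.det_comp, hdet w hw, hdet _ (sub_ne_zero.2 h)]
    norm_num
  · rw [LinearIsometryEquiv.trans_apply, Submodule.reflection_sub hxy]
    exact Submodule.reflection_mem_subspace_eq_self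
      (Submodule.mem_orthogonal_singleton_iff_inner_right.2 hwy)

/-- Continuity upgrades the almost everywhere symmetry of the initial datum to a pointwise one,
which the evolution then preserves. -/
theorem IsSolution.isRadial {f : ℝ → R3 → R3 → ℝ} {U : ℝ → R3 → ℝ} (h : IsSolution f U)
    (hc : HasCompactSupport (fun z : R3 × R3 => f 0 z.1 z.2)) {f₀ : R3 → R3 → ℝ}
    (hS : MemS f₀ (f 0)) {t : ℝ} (ht : 0 ≤ t) : IsRadial (U t) := by
  intro x y hxy
  obtain ⟨A, hA, rfl⟩ := exists_rotation_of_norm_eq hxy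
  have hcont := h.continuous_slice le_rfl
  have h1 : (fun z : R3 × R3 => f 0 (A z.1) (A z.2)) = fun z => f 0 z.1 z.2 := by
    refine (Continuous.ae_eq_iff_eq volume ?_ hcont).1 (hS.symmetric A hA)
    exact hcont.comp (f := fun z : R3 × R3 => (A z.1, A z.2)) (by fun_prop)
  exact (h.isometry_invariant hc A (fun x v => congrFun h1 (x, v)) ht x).symm

theorem exists_lipschitzWith_of_locallyLipschitz {X : Type*} [NormedAddCommGroup X] [ProperSpace X]
    {H : X → ℝ} (hH : LocallyLipschitz H) (hc : HasCompactSupport H) : ∃ C, LipschitzWith C H := by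
  obtain ⟨R, hR⟩ := hc.isCompact.isBounded.subset_closedBall 0
  have hSc : IsCompact (Metric.closedBall (0 : X) (R + 1)) := isCompact_closedBall _ _
  obtain ⟨C₁, hC₁⟩ := hH.locallyLipschitzOn.exists_lipschitzOnWith_of_compact hSc
  obtain ⟨M, hM⟩ := hc.exists_bound_of_continuous hH.continuous
  have h0 : ∀ x, R < ‖x‖ → H x = 0 := fun x hx => by
    by_contra hne
    have := hR (subset_tsupport _ hne)
    simp only [Metric.mem_closedBall, dist_zero_right] at this
    linarith
  have hMn : 0 ≤ M := (norm_nonneg _).trans (hM 0)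
  have key : ∀ x y, ‖x‖ ≤ ‖y‖ → |H x - H y| ≤ max (C₁ : ℝ) M * dist x y := by
    intro x y hxy
    by_cases hy : ‖y‖ ≤ R + 1
    · have := hC₁.dist_le_mul x (by simpa using hxy.trans hy) y (by simpa using hy)
      rw [Real.dist_eq] at this
      exact this.trans (mul_le_mul_of_nonneg_right (le_max_left _ _) dist_nonneg)
    · rw [h0 y (by linarith), sub_zero]
      by_cases hx : ‖x‖ ≤ R
      · have h1 : 1 ≤ dist x y := by
          have := norm_sub_norm_le y x
          rw [dist_comm, dist_eq_norm]
          linarith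
        calc |H x| ≤ M := hM x
          _ ≤ M * dist x y := le_mul_of_one_le_right hMn h1
          _ ≤ _ := mul_le_mul_of_nonneg_right (le_max_right _ _) dist_nonneg
      · rw [h0 x (by linarith), abs_zero]
        exact mul_nonneg (hMn.trans (le_max_right _ _)) dist_nonneg
  refine ⟨Real.toNNReal (max C₁ M), LipschitzWith.of_dist_le_mul fun x y => ?_⟩
  rw [Real.coe_toNNReal _ (hMn.trans (le_max_right _ _)), Real.dist_eq]
  rcases le_total ‖x‖ ‖y‖ with h | h
  · exact key x y h
  · rw [abs_sub_comm, dist_comm]; exact key y x h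

/-! ### The virial function along the flow of the King potential -/

/-- The virial function `|v|² - x·∇U₀`, the derivative of `x·v` along the flow. -/
def virial (U₀ : R3 → ℝ) (z : R3 × R3) : ℝ := ‖z.2‖ ^ 2 - fderiv ℝ U₀ z.1 z.1

/-- `Δ U₀ + u₀'(r) / r`. -/
def kappa (U₀ : R3 → ℝ) (x : R3) : ℝ :=
  Laplacian.laplacian U₀ x + deriv (profile U₀) ‖x‖ / ‖x‖

/-- `2 u₀(r) + r u₀'(r)`: twice the energy at which the virial function vanishes. -/
def virialEnergy (U₀ : R3 → ℝ) (r : ℝ) : ℝ := 2 * profile U₀ r + r * deriv (profile U₀) r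

theorem contDiff_energy {U₀ : R3 → ℝ} (h : ContDiff ℝ 2 U₀) :
    ContDiff ℝ 2 (fun z : R3 × R3 => energy U₀ z.1 z.2) := by
  unfold energy
  have h1 : ContDiff ℝ 2 (fun z : R3 × R3 => ‖z.2‖ ^ 2) := contDiff_snd.norm_sq ℝ
  exact (h1.div_const 2).add (h.comp contDiff_fst)

theorem contDiff_virial {U₀ : R3 → ℝ} (h : ContDiff ℝ 2 U₀) : ContDiff ℝ 1 (virial U₀) := by
  unfold virial
  have h1 : ContDiff ℝ 1 (fun z : R3 × R3 => ‖z.2‖ ^ 2) := contDiff_snd.norm_sq ℝ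
  exact h1.sub (((contDiff_fderiv_of_two h).comp contDiff_fst).clm_apply contDiff_fst)

theorem hasFDerivAt_normSq_snd (z : R3 × R3) : HasFDerivAt (fun z : R3 × R3 => ‖z.2‖ ^ 2)
    ((2 • innerR3 z.2).comp (ContinuousLinearMap.snd ℝ R3 R3)) z :=
  HasFDerivAt.comp z (g := fun v : R3 => ‖v‖ ^ 2) (hasStrictFDerivAt_norm_sq z.2).hasFDerivAt
    hasFDerivAt_snd

theorem fderiv_energy_apply {U₀ : R3 → ℝ} (h : Differentiable ℝ U₀) (z d : R3 × R3) :
    fderiv ℝ (fun z : R3 × R3 => energy U₀ z.1 z.2) z d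
      = inner ℝ z.2 d.2 + fderiv ℝ U₀ z.1 d.1 := by
  have h1 := hasFDerivAt_normSq_snd z
  have h2 : HasFDerivAt (fun z : R3 × R3 => U₀ z.1)
      ((fderiv ℝ U₀ z.1).comp (ContinuousLinearMap.fst ℝ R3 R3)) z :=
    HasFDerivAt.comp z (g := U₀) (h z.1).hasFDerivAt hasFDerivAt_fst
  have h3 : HasFDerivAt (fun z : R3 × R3 => energy U₀ z.1 z.2) _ z := (h1.mul_const 2⁻¹).add h2
  rw [h3.fderiv]
  simp

theorem fderiv_energy_transport {U₀ : R3 → ℝ} (h : Differentiable ℝ U₀) (z : R3 × R3) :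
    fderiv ℝ (fun z : R3 × R3 => energy U₀ z.1 z.2) z (z.2, -gradient U₀ z.1) = 0 := by
  rw [fderiv_energy_apply h]
  simp

theorem hasFDerivAt_inner_fst_snd (z : R3 × R3) :
    HasFDerivAt (fun z : R3 × R3 => inner ℝ z.1 z.2)
      ((innerR3 z.1).comp (ContinuousLinearMap.snd ℝ R3 R3)
        + (innerR3 z.2).comp (ContinuousLinearMap.fst ℝ R3 R3)) z := by
  have h1 : HasFDerivAt (fun z : R3 × R3 => inner ℝ z.1 z.2) _ z :=
    (hasFDerivAt_fst (𝕜 := ℝ) (p := z)).inner ℝ hasFDerivAt_snd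
  refine h1.congr_fderiv (ContinuousLinearMap.ext fun d => ?_)
  simp [real_inner_comm]

theorem fderiv_inner_transport (U₀ : R3 → ℝ) (z : R3 × R3) :
    fderiv ℝ (fun z : R3 × R3 => inner ℝ z.1 z.2) z (z.2, -gradient U₀ z.1) = virial U₀ z := by
  rw [(hasFDerivAt_inner_fst_snd z).fderiv]
  simp [virial]
  ring

/-- The derivative is −(u₀'' + 3u₀'/r)(x·v), from −3∇U₀·v and −D²U₀(v, x). With
`fderiv_inner_transport` the pair (x·v, θ) thus solves a linear oscillator along the flow, with
frequency coefficient κ. -/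
theorem fderiv_virial_transport {U₀ : R3 → ℝ} (hr : IsRadial U₀) (h : ContDiff ℝ 2 U₀)
    {z : R3 × R3} (hz : z.1 ≠ 0) :
    fderiv ℝ (virial U₀) z (z.2, -gradient U₀ z.1) = -(kappa U₀ z.1 * inner ℝ z.1 z.2) := by
  have h1 := hasFDerivAt_normSq_snd z
  have h2 : HasFDerivAt (fun z : R3 × R3 => fderiv ℝ U₀ z.1)
      ((fderiv ℝ (fderiv ℝ U₀) z.1).comp (ContinuousLinearMap.fst ℝ R3 R3)) z :=
    HasFDerivAt.comp z (g := fderiv ℝ U₀)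
      ((contDiff_fderiv_of_two h).differentiable (by norm_num) z.1).hasFDerivAt hasFDerivAt_fst
  have h3 : HasFDerivAt (virial U₀) _ z := h1.sub (h2.clm_apply hasFDerivAt_fst)
  rw [h3.fderiv]
  have e1 : fderiv ℝ U₀ z.1 z.2 = deriv (profile U₀) ‖z.1‖ / ‖z.1‖ * inner ℝ z.1 z.2 := by
    rw [← inner_gradient_left, hr.gradient_eq h hz, inner_smul_left]; rfl
  have e2 := hr.fderiv_fderiv_apply_self h hz z.2
  have e3 : inner ℝ z.2 (gradient U₀ z.1) = fderiv ℝ U₀ z.1 z.2 := inner_gradient_right _ _ _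
  rw [kappa, hr.laplacian_eq h hz]
  simp [e1, e2, e3]
  ring

/-- On a fixed energy level the virial function depends on the radius alone, so its zeros there are
the radii at which `virialEnergy` equals twice the energy. -/
theorem virial_eq {U₀ : R3 → ℝ} (hr : IsRadial U₀) (h : ContDiff ℝ 2 U₀) (z : R3 × R3) :
    virial U₀ z = 2 * energy U₀ z.1 z.2 - virialEnergy U₀ ‖z.1‖ := by
  rw [virial, energy, virialEnergy, ← inner_gradient_right, hr.inner_gradient_self h,
    hr.eq_profile z.1]
  ring

theorem hasDerivAt_virialEnergy {U₀ : R3 → ℝ} (hr : IsRadial U₀) (h : ContDiff ℝ 2 U₀) {r : ℝ}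
    (hr0 : 0 < r) : HasDerivAt (virialEnergy U₀) (r * kappa U₀ (r • unitVec)) r := by
  have h1 := ((IsRadial.hasDerivAt_profile h r).const_mul 2).add
    ((hasDerivAt_id r).mul (IsRadial.hasDerivAt_deriv_profile h r))
  refine h1.congr_deriv ?_
  have hne : r • unitVec ≠ 0 := by rw [← norm_pos_iff, norm_smul_unitVec hr0.le]; exact hr0
  rw [kappa, hr.laplacian_eq h hne, norm_smul_unitVec hr0.le]
  simp only [id]
  field_simp
  ring

/-! ### The King density in the velocity variable -/

theorem continuous_energy {U₀ : R3 → ℝ} (h : Continuous U₀) :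
    Continuous (fun z : R3 × R3 => energy U₀ z.1 z.2) := by
  unfold energy; fun_prop

theorem continuous_kingDensity {E₀ : ℝ} {U₀ : R3 → ℝ} (h : Continuous U₀) :
    Continuous (fun z : R3 × R3 => kingDensity E₀ U₀ z.1 z.2) := by
  unfold kingDensity energy; fun_prop

theorem kingDensity_nonneg (E₀ : ℝ) (U₀ : R3 → ℝ) (x v : R3) : 0 ≤ kingDensity E₀ U₀ x v :=
  le_max_right _ _

theorem kingDensity_of_le {E₀ : ℝ} {U₀ : R3 → ℝ} {x v : R3} (h : energy U₀ x v ≤ E₀) :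
    kingDensity E₀ U₀ x v = Real.exp (E₀ - energy U₀ x v) - 1 :=
  max_eq_left (by have := Real.one_le_exp (sub_nonneg.2 h); linarith)

theorem kingDensity_of_ge {E₀ : ℝ} {U₀ : R3 → ℝ} {x v : R3} (h : E₀ ≤ energy U₀ x v) :
    kingDensity E₀ U₀ x v = 0 :=
  max_eq_right (by have := Real.exp_le_one_iff.2 (sub_nonpos.2 h); linarith)

theorem hasCompactSupport_kingDensity_slice (E₀ : ℝ) (U₀ : R3 → ℝ) (x : R3) :
    HasCompactSupport (kingDensity E₀ U₀ x) := by
  refine HasCompactSupport.of_support_subset_isCompact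
    (isCompact_closedBall (0 : R3) (1 + |E₀ - U₀ x|)) fun v hv => ?_
  have h1 : energy U₀ x v < E₀ := by
    by_contra hge
    exact hv (kingDensity_of_ge (not_lt.1 hge))
  rw [energy] at h1
  rw [mem_closedBall_zero_iff]
  nlinarith [le_abs_self (E₀ - U₀ x), norm_nonneg v, sq_nonneg (‖v‖ - 1)]

theorem continuous_kingDensity_slice (E₀ : ℝ) (U₀ : R3 → ℝ) (x : R3) :
    Continuous (kingDensity E₀ U₀ x) := by
  unfold kingDensity energy; fun_prop

theorem integrable_kingDensity_slice (E₀ : ℝ) (U₀ : R3 → ℝ) (x : R3) :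
    Integrable (kingDensity E₀ U₀ x) :=
  (continuous_kingDensity_slice E₀ U₀ x).integrable_of_hasCompactSupport (hasCompactSupport_kingDensity_slice E₀ U₀ x)

theorem density_kingDensity_anti {E₀ : ℝ} {U₀ : R3 → ℝ} {x y : R3}
    (hxy : U₀ x ≤ U₀ y) : density (kingDensity E₀ U₀) y ≤ density (kingDensity E₀ U₀) x := by
  refine integral_mono (integrable_kingDensity_slice E₀ U₀ y) (integrable_kingDensity_slice E₀ U₀ x)
    fun v => ?_
  refine max_le_max (sub_le_sub_right (Real.exp_le_exp.2 ?_) _) le_rfl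
  unfold energy
  linarith

theorem density_kingDensity_pos {E₀ : ℝ} {U₀ : R3 → ℝ} {x : R3}
    (hx : U₀ x < E₀) : 0 < density (kingDensity E₀ U₀) x := by
  refine (continuous_kingDensity_slice E₀ U₀ x).integral_pos_of_hasCompactSupport_nonneg_nonzero (μ := volume)
    (hasCompactSupport_kingDensity_slice E₀ U₀ x) (fun v => kingDensity_nonneg E₀ U₀ x v)
    (x := 0) ?_
  have h1 : energy U₀ x 0 < E₀ := by simpa [energy] using hx
  rw [kingDensity_of_le h1.le]
  have := Real.one_lt_exp_iff.2 (sub_pos.2 h1)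
  linarith

/-- Integration by parts in the velocity variable. -/
theorem integral_exp_mul_inner_sq (E₀ : ℝ) (U₀ : R3 → ℝ) (x : R3) :
    ∫ v : R3, {v | energy U₀ x v ≤ E₀}.indicator
      (fun v => Real.exp (E₀ - energy U₀ x v) * (inner ℝ x v) ^ 2) v
      = ‖x‖ ^ 2 * density (kingDensity E₀ U₀) x := by
  have cE : ContDiff ℝ 1 (fun v : R3 => energy U₀ x v) := by
    unfold energy
    have : ContDiff ℝ 1 (fun v : R3 => ‖v‖ ^ 2) := contDiff_id.norm_sq ℝ
    exact (this.div_const 2).add contDiff_const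
  have cexp : ContDiff ℝ 1 (fun v : R3 => Real.exp (E₀ - energy U₀ x v) - 1) :=
    (contDiff_const.sub cE).exp.sub contDiff_const
  have lf : LocallyLipschitz (kingDensity E₀ U₀ x) :=
    (cexp.locallyLipschitz (𝕂 := ℝ)).max (LocallyLipschitz.const 0)
  have lin : LocallyLipschitz (fun v : R3 => inner ℝ x v) :=
    ContDiff.locallyLipschitz (𝕂 := ℝ) (contDiff_const.inner ℝ contDiff_id)
  have lH : LocallyLipschitz (fun v : R3 => inner ℝ x v * kingDensity E₀ U₀ x v) :=
    locallyLipschitz_mul lin lf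
  have hcs : HasCompactSupport (fun v : R3 => inner ℝ x v * kingDensity E₀ U₀ x v) :=
    (hasCompactSupport_kingDensity_slice E₀ U₀ x).mul_left
  obtain ⟨C, hC⟩ := exists_lipschitzWith_of_locallyLipschitz lH hcs
  -- The v-derivative of (x·v)f₀ in direction x is |x|²f₀ − e^{E₀−E}(x·v)² inside the support and 0
  -- outside; its integral vanishes. The boundary of the support in v lies on a sphere, hence is
  -- null.
  have key := integral_lineDeriv_eq_zero (μ := (volume : Measure R3)) hC hcs x
  have hnull : ∀ᵐ v : R3, energy U₀ x v ≠ E₀ := by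
    have : volume (Metric.sphere (0 : R3) (√(2 * (E₀ - U₀ x)))) = 0 :=
      Measure.addHaar_sphere _ _ _
    refine measure_mono_null (fun v hv => ?_) this
    have hv' : energy U₀ x v = E₀ := by simpa using hv
    rw [energy] at hv'
    rw [mem_sphere_zero_iff_norm, show 2 * (E₀ - U₀ x) = ‖v‖ ^ 2 by linarith,
      Real.sqrt_sq (norm_nonneg v)]
  have hae : ∀ᵐ v : R3, lineDeriv ℝ (fun v : R3 => inner ℝ x v * kingDensity E₀ U₀ x v) v x
      = ‖x‖ ^ 2 * kingDensity E₀ U₀ x v - {v | energy U₀ x v ≤ E₀}.indicator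
        (fun v => Real.exp (E₀ - energy U₀ x v) * (inner ℝ x v) ^ 2) v := by
    filter_upwards [hnull] with v hv
    have hin : HasFDerivAt (fun v : R3 => inner ℝ x v) (innerR3 x) v := (innerR3 x).hasFDerivAt
    have hE : HasFDerivAt (fun v : R3 => energy U₀ x v) (innerR3 v) v := by
      have h1 := ((hasStrictFDerivAt_norm_sq v).hasFDerivAt.mul_const 2⁻¹).add_const (U₀ x)
      refine h1.congr_fderiv (ContinuousLinearMap.ext fun d => ?_)
      simp
    rcases lt_or_gt_of_ne hv with hlt | hgt
    · have hev : (fun v : R3 => inner ℝ x v * kingDensity E₀ U₀ x v) =ᶠ[𝓝 v]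
          fun v => inner ℝ x v * (Real.exp (E₀ - energy U₀ x v) - 1) := by
        filter_upwards [cE.continuous.continuousAt.eventually (gt_mem_nhds hlt)] with w hw
        rw [kingDensity_of_le (le_of_lt hw)]
      have h2 := hin.mul (((hE.const_sub E₀).exp).sub_const 1)
      rw [(h2.congr_of_eventuallyEq hev).hasLineDerivAt x |>.lineDeriv,
        indicator_of_mem (show v ∈ {v | energy U₀ x v ≤ E₀} from hlt.le), kingDensity_of_le hlt.le]
      simp [real_inner_comm]
      ring
    · have hev : (fun v : R3 => inner ℝ x v * kingDensity E₀ U₀ x v) =ᶠ[𝓝 v] fun v => 0 := by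
        filter_upwards [cE.continuous.continuousAt.eventually (lt_mem_nhds hgt)] with w hw
        rw [kingDensity_of_ge (le_of_lt hw), mul_zero]
      rw [((hasFDerivAt_const (0 : ℝ) v).congr_of_eventuallyEq hev).hasLineDerivAt x |>.lineDeriv,
        indicator_of_notMem (show v ∉ {v | energy U₀ x v ≤ E₀} from not_le.2 hgt),
        kingDensity_of_ge hgt.le]
      simp
  have i1 : Integrable (fun v => ‖x‖ ^ 2 * kingDensity E₀ U₀ x v) :=
    (integrable_kingDensity_slice E₀ U₀ x).const_mul _
  have i2 : Integrable ({v | energy U₀ x v ≤ E₀}.indicator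
        (fun v => Real.exp (E₀ - energy U₀ x v) * (inner ℝ x v) ^ 2)) := by
    have hK : IsCompact {v : R3 | energy U₀ x v ≤ E₀} := by
      refine Metric.isCompact_of_isClosed_isBounded (isClosed_le cE.continuous continuous_const)
        ((Metric.isBounded_closedBall (x := (0 : R3)) (r := 1 + |E₀ - U₀ x|)).subset
          fun v hv => ?_)
      have hv' : energy U₀ x v ≤ E₀ := hv
      rw [energy] at hv'
      rw [mem_closedBall_zero_iff]
      nlinarith [le_abs_self (E₀ - U₀ x), norm_nonneg v, sq_nonneg (‖v‖ - 1)]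
    refine IntegrableOn.integrable_indicator ?_ hK.isClosed.measurableSet
    refine ContinuousOn.integrableOn_compact hK (Continuous.continuousOn ?_)
    have := cE.continuous
    fun_prop
  rw [integral_congr_ae hae, integral_sub i1 i2, integral_const_mul] at key
  rw [density]
  linarith

/-! ### Monotonicity and positivity for the King potential -/

namespace IsKingPotential

variable {E₀ : ℝ} {U₀ : R3 → ℝ}

theorem isRadial (h : IsKingPotential E₀ U₀) : IsRadial U₀ := h.radial

theorem contDiff (h : IsKingPotential E₀ U₀) : ContDiff ℝ 2 U₀ := h.potential.contDiff

theorem continuous (h : IsKingPotential E₀ U₀) : Continuous U₀ := h.contDiff.continuous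

theorem density_nonneg (E₀ : ℝ) (U₀ : R3 → ℝ) (x : R3) : 0 ≤ density (kingDensity E₀ U₀) x :=
  integral_nonneg fun v => kingDensity_nonneg E₀ U₀ x v

theorem laplacian_nonneg (h : IsKingPotential E₀ U₀) (x : R3) : 0 ≤ Laplacian.laplacian U₀ x := by
  rw [h.potential.poisson]
  have := density_nonneg E₀ U₀ x
  positivity

theorem continuous_profile_laplacian (h : IsKingPotential E₀ U₀) :
    Continuous (profile (Laplacian.laplacian U₀)) :=
  (continuous_laplacian h.contDiff).comp (by fun_prop)

theorem deriv_profile_nonneg (h : IsKingPotential E₀ U₀) {r : ℝ} (hr : 0 ≤ r) :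
    0 ≤ deriv (profile U₀) r := by
  rcases hr.eq_or_lt with rfl | hr
  · exact (h.isRadial.deriv_profile_zero h.contDiff).ge
  · have h1 := h.isRadial.integral_flux h.contDiff hr.le
    have h2 : 0 ≤ ∫ s in (0 : ℝ)..r, s ^ 2 * profile (Laplacian.laplacian U₀) s :=
      intervalIntegral.integral_nonneg hr.le fun s _ =>
        mul_nonneg (sq_nonneg s) (h.laplacian_nonneg _)
    rw [h1] at h2
    exact nonneg_of_mul_nonneg_right h2 (by positivity)

theorem profile_mono (h : IsKingPotential E₀ U₀) : MonotoneOn (profile U₀) (Ici 0) := by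
  refine monotoneOn_of_deriv_nonneg (convex_Ici 0)
    (contDiff_profile h.contDiff).continuous.continuousOn
    ((contDiff_profile h.contDiff).differentiable (by norm_num)).differentiableOn fun r hr => ?_
  rw [interior_Ici] at hr
  exact h.deriv_profile_nonneg (le_of_lt hr)

theorem mono (h : IsKingPotential E₀ U₀) {x y : R3} (hxy : ‖x‖ ≤ ‖y‖) : U₀ x ≤ U₀ y := by
  rw [h.isRadial.eq_profile x, h.isRadial.eq_profile y]
  exact h.profile_mono (norm_nonneg x) (norm_nonneg y) hxy

theorem apply_zero_le (h : IsKingPotential E₀ U₀) (x : R3) : U₀ 0 ≤ U₀ x := h.mono (by simp)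

theorem apply_zero_lt (h : IsKingPotential E₀ U₀) : U₀ 0 < E₀ := by
  obtain ⟨x, hx⟩ := h.nonvacuum
  exact (h.apply_zero_le x).trans_lt hx

theorem laplacian_anti (h : IsKingPotential E₀ U₀) {x y : R3} (hxy : ‖x‖ ≤ ‖y‖) :
    Laplacian.laplacian U₀ y ≤ Laplacian.laplacian U₀ x := by
  rw [h.potential.poisson, h.potential.poisson]
  exact mul_le_mul_of_nonneg_left (density_kingDensity_anti (h.mono hxy)) (by positivity)

theorem laplacian_zero_pos (h : IsKingPotential E₀ U₀) : 0 < Laplacian.laplacian U₀ 0 := by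
  rw [h.potential.poisson]
  have := density_kingDensity_pos h.apply_zero_lt
  positivity

/-- r²u₀' is the integral of s²ΔU₀ over [0, r], and ΔU₀ is radially nonincreasing; compare it with
its values at r and at the origin. -/
theorem flux_bounds (h : IsKingPotential E₀ U₀) {r : ℝ} (hr : 0 < r) :
    profile (Laplacian.laplacian U₀) r / 3 ≤ deriv (profile U₀) r / r ∧
      deriv (profile U₀) r / r ≤ Laplacian.laplacian U₀ 0 / 3 := by
  have h1 := h.isRadial.integral_flux h.contDiff hr.le
  have hc := h.continuous_profile_laplacian
  have hi : ∀ c : ℝ, ∫ s in (0 : ℝ)..r, s ^ 2 * c = c * r ^ 3 / 3 := by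
    intro c
    rw [intervalIntegral.integral_mul_const, integral_pow]
    norm_num
    ring
  have hii : ∀ g : ℝ → ℝ, Continuous g →
      IntervalIntegrable (fun s => s ^ 2 * g s) volume 0 r := fun g hg =>
    (by fun_prop : Continuous fun s : ℝ => s ^ 2 * g s).intervalIntegrable _ _
  have hn : ∀ s : ℝ, 0 ≤ s → ‖s • unitVec‖ = s := fun s hs => norm_smul_unitVec hs
  constructor
  · have h2 := intervalIntegral.integral_mono_on hr.le
      (hii (fun _ => profile (Laplacian.laplacian U₀) r) continuous_const) (hii _ hc)
      fun s hs => mul_le_mul_of_nonneg_left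
        (h.laplacian_anti (by rw [hn s hs.1, hn r hr.le]; exact hs.2)) (sq_nonneg s)
    rw [hi, h1] at h2
    rw [div_le_div_iff₀ (by norm_num) hr]
    have : 0 < r ^ 2 := by positivity
    refine le_of_mul_le_mul_left ?_ this
    linarith
  · have h2 := intervalIntegral.integral_mono_on hr.le (hii _ hc)
      (hii (fun _ => Laplacian.laplacian U₀ 0) continuous_const)
      fun s hs => mul_le_mul_of_nonneg_left
        (h.laplacian_anti (x := 0) (y := s • unitVec) (by simp)) (sq_nonneg s)
    rw [hi, h1] at h2
    rw [div_le_div_iff₀ hr (by norm_num)]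
    have : 0 < r ^ 2 := by positivity
    refine le_of_mul_le_mul_left ?_ this
    linarith

/-- The flux r²u₀' never decreases, and it is positive for small r because ΔU₀(0) > 0. -/
theorem deriv_profile_pos (h : IsKingPotential E₀ U₀) {r : ℝ} (hr : 0 < r) :
    0 < deriv (profile U₀) r := by
  have hc := h.continuous_profile_laplacian
  have h0 : 0 < profile (Laplacian.laplacian U₀) 0 := by
    rw [profile, zero_smul]; exact h.laplacian_zero_pos
  have hev : ∀ᶠ s in 𝓝[>] (0 : ℝ), 0 < profile (Laplacian.laplacian U₀) s ∧ s < r :=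
    ((hc.continuousAt.eventually (lt_mem_nhds h0)).and (gt_mem_nhds hr)).filter_mono
      nhdsWithin_le_nhds
  obtain ⟨s, ⟨hs1, hs2⟩, hs0⟩ := (hev.and self_mem_nhdsWithin).exists
  have hs0 : 0 < s := hs0
  have h1 : 0 < deriv (profile U₀) s := by
    have := (h.flux_bounds hs0).1
    have h2 : 0 < deriv (profile U₀) s / s := by linarith
    exact (div_pos_iff_of_pos_right hs0).1 h2
  have hmono : MonotoneOn (fun r => r ^ 2 * deriv (profile U₀) r) (Ici 0) := by
    refine monotoneOn_of_hasDerivWithinAt_nonneg (convex_Ici 0)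
      (fun r hr => (h.isRadial.hasDerivAt_flux h.contDiff hr).continuousAt.continuousWithinAt)
      (f' := fun r => r ^ 2 * profile (Laplacian.laplacian U₀) r) (fun r hr => ?_) fun r hr => ?_
    · rw [interior_Ici] at hr
      exact (h.isRadial.hasDerivAt_flux h.contDiff (le_of_lt hr)).hasDerivWithinAt
    · exact mul_nonneg (sq_nonneg r) (h.laplacian_nonneg _)
  have h2 := hmono (mem_Ici.2 hs0.le) (mem_Ici.2 hr.le) hs2.le
  have h3 : 0 < r ^ 2 * deriv (profile U₀) r := lt_of_lt_of_le (by positivity) h2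
  exact pos_of_mul_pos_right h3 (sq_nonneg r)

theorem profile_norm_laplacian (h : IsKingPotential E₀ U₀) (x : R3) :
    profile (Laplacian.laplacian U₀) ‖x‖ = Laplacian.laplacian U₀ x :=
  ((h.isRadial.laplacian h.contDiff).eq_profile x).symm

/-- By the flux bound u₀'/r ≥ ΔU₀/3, hence κ ≥ (4/3)ΔU₀. This gain over κ ≥ ΔU₀ is where the
monotonicity of ρ₀ enters the stability constant. -/
theorem four_pi_density_le_kappa (h : IsKingPotential E₀ U₀) {x : R3} (hx : x ≠ 0) :
    4 * Real.pi * density (kingDensity E₀ U₀) x ≤ 3 / 4 * kappa U₀ x := by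
  have := (h.flux_bounds (norm_pos_iff.2 hx)).1
  rw [h.profile_norm_laplacian] at this
  rw [kappa, ← h.potential.poisson]
  linarith

theorem kappa_pos (h : IsKingPotential E₀ U₀) {x : R3} (hx : x ≠ 0) : 0 < kappa U₀ x :=
  add_pos_of_nonneg_of_pos (h.laplacian_nonneg x)
    (div_pos (h.deriv_profile_pos (norm_pos_iff.2 hx)) (norm_pos_iff.2 hx))

theorem kappa_le (h : IsKingPotential E₀ U₀) {x : R3} (hx : x ≠ 0) :
    kappa U₀ x ≤ 4 / 3 * Laplacian.laplacian U₀ 0 := by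
  have h1 := (h.flux_bounds (norm_pos_iff.2 hx)).2
  have h2 := h.laplacian_anti (x := 0) (y := x) (by simp)
  rw [kappa]
  linarith

/-- Compactness of the annulus. The origin must be excluded: there the quotient u₀'/r is 0 by
convention and `kappa` is not continuous. -/
theorem exists_le_kappa (h : IsKingPotential E₀ U₀) {a : ℝ} (ha : 0 < a) (R : ℝ) :
    ∃ c, 0 < c ∧ ∀ x : R3, a ≤ ‖x‖ → ‖x‖ ≤ R → c ≤ kappa U₀ x := by
  have hK : IsCompact {x : R3 | a ≤ ‖x‖ ∧ ‖x‖ ≤ R} := by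
    refine Metric.isCompact_of_isClosed_isBounded ?_ ?_
    · exact (isClosed_le continuous_const continuous_norm).inter
        (isClosed_le continuous_norm continuous_const)
    · exact (Metric.isBounded_closedBall (x := (0 : R3)) (r := R)).subset fun x hx => by
        simpa using hx.2
  have hne : ∀ x ∈ {x : R3 | a ≤ ‖x‖ ∧ ‖x‖ ≤ R}, x ≠ 0 := fun x hx =>
    norm_pos_iff.1 (ha.trans_le hx.1)
  have hcont : ContinuousOn (kappa U₀) {x : R3 | a ≤ ‖x‖ ∧ ‖x‖ ≤ R} := by
    have h1 := (continuous_laplacian h.contDiff)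
    have h2 := (IsRadial.contDiff_deriv_profile h.contDiff).continuous
    exact h1.continuousOn.add ((h2.comp continuous_norm).continuousOn.div
      continuous_norm.continuousOn fun x hx => norm_ne_zero_iff.2 (hne x hx))
  rcases ({x : R3 | a ≤ ‖x‖ ∧ ‖x‖ ≤ R}).eq_empty_or_nonempty with he | he
  · refine ⟨1, one_pos, fun x h1 h2 => ?_⟩
    have : x ∈ {x : R3 | a ≤ ‖x‖ ∧ ‖x‖ ≤ R} := ⟨h1, h2⟩
    rw [he] at this
    exact this.elim
  · obtain ⟨x, hx, hmin⟩ := hK.exists_isMinOn he hcont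
    exact ⟨kappa U₀ x, h.kappa_pos (hne x hx), fun y h1 h2 => hmin ⟨h1, h2⟩⟩

/-- The level E₀/2 lies strictly above E₀ and still below 0, the limit of U₀. This leaves room for
approximate energy cut-offs and for the shell just outside the support. -/
theorem exists_radius (h : IsKingPotential E₀ U₀) :
    ∃ R, 0 < R ∧ ∀ x, U₀ x ≤ E₀ / 2 → ‖x‖ ≤ R := by
  have h1 : ∀ᶠ x in cocompact R3, E₀ / 2 < U₀ x :=
    h.potential.decay.eventually (lt_mem_nhds (by linarith [h.cutoff_neg]))
  rw [← Metric.cobounded_eq_cocompact, Metric.hasBasis_cobounded_compl_closedBall (0 : R3)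
    |>.eventually_iff] at h1
  obtain ⟨R, -, hR⟩ := h1
  refine ⟨max R 1, by positivity, fun x hx => ?_⟩
  by_contra hlt
  have : x ∈ (Metric.closedBall (0 : R3) R)ᶜ := by
    simp only [mem_compl_iff, mem_closedBall_zero_iff, not_le]
    exact (le_max_left _ _).trans_lt (not_le.1 hlt)
  exact absurd (hR this) (not_lt.2 hx)

theorem isCompact_energy_le (h : IsKingPotential E₀ U₀) :
    IsCompact {z : R3 × R3 | energy U₀ z.1 z.2 ≤ E₀ / 2} := by
  obtain ⟨R, -, hR⟩ := h.exists_radius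
  refine Metric.isCompact_of_isClosed_isBounded
    (isClosed_le (continuous_energy h.continuous) continuous_const)
    ((Metric.isBounded_closedBall (x := (0 : R3 × R3)) (r := max R (1 + |E₀ / 2 - U₀ 0|))).subset
      fun z hz => ?_)
  have hz' : energy U₀ z.1 z.2 ≤ E₀ / 2 := hz
  rw [energy] at hz'
  rw [mem_closedBall_zero_iff, Prod.norm_def]
  refine max_le_max (hR _ ?_) ?_
  · nlinarith [sq_nonneg ‖z.2‖]
  · nlinarith [le_abs_self (E₀ / 2 - U₀ 0), norm_nonneg z.2, sq_nonneg (‖z.2‖ - 1),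
      h.apply_zero_le z.1]

theorem hasCompactSupport_kingDensity (h : IsKingPotential E₀ U₀) :
    HasCompactSupport (fun z : R3 × R3 => kingDensity E₀ U₀ z.1 z.2) := by
  refine HasCompactSupport.of_support_subset_isCompact h.isCompact_energy_le fun z hz => ?_
  by_contra hgt
  refine hz (kingDensity_of_ge ?_)
  have : E₀ / 2 < energy U₀ z.1 z.2 := not_le.1 hgt
  linarith [h.cutoff_neg]

theorem integrable_kingDensity (h : IsKingPotential E₀ U₀) :
    Integrable (fun z : R3 × R3 => kingDensity E₀ U₀ z.1 z.2) :=
  (continuous_kingDensity h.continuous).integrable_of_hasCompactSupport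
    h.hasCompactSupport_kingDensity

theorem kingDensity_le (h : IsKingPotential E₀ U₀) (x v : R3) :
    kingDensity E₀ U₀ x v ≤ Real.exp (E₀ - U₀ 0) - 1 := by
  have h1 := Real.one_le_exp (sub_nonneg.2 h.apply_zero_lt.le)
  refine max_le (sub_le_sub_right (Real.exp_le_exp.2 ?_) _) (by linarith)
  have := h.apply_zero_le x
  unfold energy
  nlinarith [sq_nonneg ‖v‖]

theorem virialEnergy_mono (h : IsKingPotential E₀ U₀) :
    MonotoneOn (virialEnergy U₀) (Ici 0) := by
  have hcont : Continuous (virialEnergy U₀) := by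
    have h1 := (contDiff_profile h.contDiff).continuous
    have h2 := (IsRadial.contDiff_deriv_profile h.contDiff).continuous
    unfold virialEnergy
    fun_prop
  refine monotoneOn_of_hasDerivWithinAt_nonneg (convex_Ici 0) hcont.continuousOn
    (f' := fun r => r * kappa U₀ (r • unitVec)) (fun r hr => ?_) fun r hr => ?_
  · rw [interior_Ici] at hr
    exact (hasDerivAt_virialEnergy h.isRadial h.contDiff hr).hasDerivWithinAt
  · rw [interior_Ici] at hr
    have hr' : 0 < r := hr
    have hne : r • unitVec ≠ 0 := by rw [← norm_pos_iff, norm_smul_unitVec hr'.le]; exact hr'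
    exact mul_nonneg hr'.le (h.kappa_pos hne).le

/-- The derivative is rκ, bounded below for r in [a, R]; it degenerates at r = 0, which is why radii
are clamped at a. -/
theorem exists_mul_le_virialEnergy_sub (h : IsKingPotential E₀ U₀) {a : ℝ} (ha : 0 < a) (R : ℝ) :
    ∃ c, 0 < c ∧ ∀ r s, a ≤ r → r ≤ s → s ≤ R →
      c * (s - r) ≤ virialEnergy U₀ s - virialEnergy U₀ r := by
  obtain ⟨c, hc, hκ⟩ := h.exists_le_kappa ha R
  refine ⟨a * c, by positivity, fun r s har hrs hsR => ?_⟩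
  have hd : ∀ τ ∈ Icc r s, HasDerivAt (virialEnergy U₀) (τ * kappa U₀ (τ • unitVec)) τ :=
    fun τ hτ => hasDerivAt_virialEnergy h.isRadial h.contDiff (ha.trans_le (har.trans hτ.1))
  refine (convex_Icc r s).mul_sub_le_image_sub_of_le_deriv
    (fun τ hτ => (hd τ hτ).continuousAt.continuousWithinAt)
    (fun τ hτ => (hd τ (interior_subset hτ)).differentiableAt.differentiableWithinAt)
    (fun τ hτ => ?_) r ⟨le_rfl, hrs⟩ s ⟨hrs, le_rfl⟩ hrs
  have hτ' := interior_subset hτ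
  have hτa : a ≤ τ := har.trans hτ'.1
  have hn : ‖τ • unitVec‖ = τ := norm_smul_unitVec (ha.le.trans hτa)
  rw [(hd τ hτ').deriv]
  exact mul_le_mul hτa (hκ _ (by rw [hn]; exact hτa) (by rw [hn]; exact hτ'.2.trans hsR)) hc.le
    (ha.le.trans hτa)

end IsKingPotential

/-! ### Pointwise control of radial functions by their Dirichlet energy -/

namespace IsRadial

variable {W : R3 → ℝ}

theorem ae_ne_zero : ∀ᵐ x : R3, x ≠ 0 := by simp [ae_iff]

theorem integral_norm_gradient_sq (h : IsRadial W) (hW : ContDiff ℝ 2 W) :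
    ∫ x, ‖gradient W x‖ ^ 2
      = 4 * Real.pi * ∫ r in Ioi (0 : ℝ), r ^ 2 * deriv (profile W) r ^ 2 := by
  rw [← integral_fun_norm (fun r => deriv (profile W) r ^ 2)]
  refine integral_congr_ae ?_
  filter_upwards [ae_ne_zero] with x hx
  rw [h.norm_gradient_eq hW hx, sq_abs]

theorem intervalIntegral_deriv_profile_sq_le (h : IsRadial W) (hW : ContDiff ℝ 2 W)
    (hc : HasCompactSupport W) {r s : ℝ} (hr : 0 ≤ r) (hrs : r ≤ s) :
    ∫ τ in r..s, τ ^ 2 * deriv (profile W) τ ^ 2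
      ≤ (∫ x, ‖gradient W x‖ ^ 2) / (4 * Real.pi) := by
  rw [h.integral_norm_gradient_sq hW, mul_div_cancel_left₀ _ (by positivity),
    intervalIntegral.integral_of_le hrs]
  refine setIntegral_mono_set ?_ ?_ ?_
  · have hcp : HasCompactSupport (fun r : ℝ => r ^ 2 * deriv (profile W) r ^ 2) := by
      have h1 : HasCompactSupport (profile W) := by
        refine hc.comp_isClosedEmbedding ?_
        have : Isometry (fun r : ℝ => r • unitVec) := by
          refine Isometry.of_dist_eq fun a b => ?_
          rw [dist_eq_norm, ← sub_smul, norm_smul, norm_unitVec, mul_one, dist_eq_norm]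
        exact this.isClosedEmbedding
      have h2 := h1.deriv
      have h3 : HasCompactSupport (fun r => deriv (profile W) r ^ 2) :=
        h2.comp_left (g := fun y => y ^ 2) (by norm_num)
      exact h3.mul_left
    have := (contDiff_deriv_profile hW).continuous
    exact (Continuous.integrable_of_hasCompactSupport (by fun_prop) hcp).integrableOn
  · exact Eventually.of_forall fun τ => by positivity
  · exact Eventually.of_forall fun τ hτ => hr.trans_lt hτ.1

/-- A template for two different splittings of |w'| by Young's inequality: the quadratic part is
paid by the Dirichlet energy, the rest is integrated explicitly. -/
theorem abs_profile_sub_le (h : IsRadial W) (hW : ContDiff ℝ 2 W) (hc : HasCompactSupport W)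
    {r s : ℝ} (hr : 0 ≤ r) (hrs : r ≤ s) {c : ℝ} (hc0 : 0 ≤ c) {g : ℝ → ℝ}
    (hg : ContinuousOn g (Icc r s))
    (hb : ∀ τ ∈ Icc r s, |deriv (profile W) τ| ≤ c * (τ ^ 2 * deriv (profile W) τ ^ 2) + g τ) :
    |profile W s - profile W r|
      ≤ c * ((∫ x, ‖gradient W x‖ ^ 2) / (4 * Real.pi)) + ∫ τ in r..s, g τ := by
  have hcont := (contDiff_deriv_profile hW).continuous
  have i1 : IntervalIntegrable (fun τ => c * (τ ^ 2 * deriv (profile W) τ ^ 2)) volume r s :=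
    (by fun_prop : Continuous _).intervalIntegrable _ _
  have i2 : IntervalIntegrable g volume r s := by
    refine ContinuousOn.intervalIntegrable ?_
    rwa [uIcc_of_le hrs]
  rw [← intervalIntegral.integral_eq_sub_of_hasDerivAt (fun τ _ => hasDerivAt_profile hW τ)
    (hcont.intervalIntegrable _ _)]
  calc |∫ τ in r..s, deriv (profile W) τ|
      ≤ ∫ τ in r..s, |deriv (profile W) τ| := intervalIntegral.abs_integral_le_integral_abs hrs
    _ ≤ ∫ τ in r..s, (c * (τ ^ 2 * deriv (profile W) τ ^ 2) + g τ) :=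
        intervalIntegral.integral_mono_on hrs (hcont.abs.intervalIntegrable _ _) (i1.add i2) hb
    _ ≤ _ := by
        rw [intervalIntegral.integral_add i1 i2, intervalIntegral.integral_const_mul]
        gcongr
        exact h.intervalIntegral_deriv_profile_sq_le hW hc hr hrs

theorem exists_profile_eq_zero (hc : HasCompactSupport W) (r : ℝ) :
    ∃ s, r ≤ s ∧ profile W s = 0 := by
  obtain ⟨R, hR⟩ := hc.isCompact.isBounded.subset_closedBall 0
  refine ⟨max r (|R| + 1), le_max_left _ _, ?_⟩
  by_contra hne
  have := hR (subset_tsupport _ hne)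
  have h0 : 0 ≤ max r (|R| + 1) := le_max_of_le_right (by positivity)
  rw [mem_closedBall_zero_iff, norm_smul_unitVec h0] at this
  linarith [le_max_right r (|R| + 1), le_abs_self R]

/-- A radial function is controlled pointwise by its Dirichlet energy. -/
theorem norm_mul_sq_le (h : IsRadial W) (hW : ContDiff ℝ 2 W) (hc : HasCompactSupport W) (x : R3) :
    ‖x‖ * W x ^ 2 ≤ (∫ x, ‖gradient W x‖ ^ 2) / (4 * Real.pi) := by
  have hA : 0 ≤ (∫ x, ‖gradient W x‖ ^ 2) / (4 * Real.pi) :=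
    div_nonneg (integral_nonneg fun x => sq_nonneg _) (by positivity)
  set A := (∫ x, ‖gradient W x‖ ^ 2) / (4 * Real.pi) with hAdef
  by_cases hx : x = 0
  · simpa [hx] using hA
  have hr : 0 < ‖x‖ := norm_pos_iff.2 hx
  rw [h.eq_profile x]
  set r := ‖x‖
  obtain ⟨s, hrs, hs⟩ := exists_profile_eq_zero hc r
  have key : ∀ μ : ℝ, 0 < μ → |profile W r| ≤ μ / 2 * A + 1 / (2 * μ) * (1 / r) := by
    intro μ hμ
    have hpos : ∀ τ ∈ Icc r s, 0 < τ := fun τ hτ => hr.trans_le hτ.1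
    have h1 := h.abs_profile_sub_le hW hc hr.le hrs (c := μ / 2) (by positivity)
      (g := fun τ => 1 / (2 * μ) * (τ ^ 2)⁻¹) ?_ ?_
    · rw [hs, zero_sub, abs_neg, ← hAdef] at h1
      refine h1.trans ?_
      rw [intervalIntegral.integral_const_mul]
      gcongr
      have h2 : ∫ τ in r..s, (τ ^ 2)⁻¹ = -s⁻¹ - -r⁻¹ := by
        refine intervalIntegral.integral_eq_sub_of_hasDerivAt (f := fun τ : ℝ => -τ⁻¹)
          (fun τ hτ => ?_) (ContinuousOn.intervalIntegrable ?_)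
        · rw [uIcc_of_le hrs] at hτ
          have h3 := (hasDerivAt_inv (hpos τ hτ).ne').neg
          rw [neg_neg] at h3
          exact h3
        · rw [uIcc_of_le hrs]
          exact (continuousOn_id.pow 2).inv₀ fun τ hτ => pow_ne_zero 2 (hpos τ hτ).ne'
      rw [h2, one_div]
      have : 0 ≤ s⁻¹ := inv_nonneg.2 (hr.le.trans hrs)
      linarith
    · exact continuousOn_const.mul
        ((continuousOn_id.pow 2).inv₀ fun τ hτ => pow_ne_zero 2 (hpos τ hτ).ne')
    · intro τ hτ
      have hτ0 := hpos τ hτ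
      have e : μ / 2 * (τ ^ 2 * deriv (profile W) τ ^ 2) + 1 / (2 * μ) * (τ ^ 2)⁻¹
          - |deriv (profile W) τ| = (μ * τ ^ 2 * |deriv (profile W) τ| - 1) ^ 2 / (2 * μ * τ ^ 2) := by
        rw [← sq_abs (deriv (profile W) τ)]
        field_simp
        ring
      have : 0 ≤ (μ * τ ^ 2 * |deriv (profile W) τ| - 1) ^ 2 / (2 * μ * τ ^ 2) := by positivity
      linarith
  by_cases h0 : profile W r = 0
  · rw [h0]; simpa using hA
  have hp : 0 < |profile W r| := abs_pos.2 h0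
  -- This μ makes the explicit term half of |w(r)|, so that it can be absorbed.
  have h2 := key (1 / (|profile W r| * r)) (by positivity)
  have e : 1 / (2 * (1 / (|profile W r| * r))) * (1 / r) = |profile W r| / 2 := by
    field_simp
  rw [e] at h2
  have h3 : |profile W r| / 2 ≤ A / (2 * |profile W r| * r) := by
    have : 1 / (|profile W r| * r) / 2 * A = A / (2 * |profile W r| * r) := by
      field_simp
    linarith
  rw [le_div_iff₀ (by positivity)] at h3
  rw [← sq_abs]
  nlinarith

/-- Uses |w'| ≤ ε + w'²/(4ε) and τ ≥ a. The outcome is a Lipschitz bound of arbitrarily small slope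
with a defect that is quadratic in w; an honest Lipschitz constant of w is not controlled by its
Dirichlet energy. -/
theorem abs_profile_sub_le_of_le (h : IsRadial W) (hW : ContDiff ℝ 2 W) (hc : HasCompactSupport W)
    {a : ℝ} (ha : 0 < a) {r s : ℝ} (hr : a ≤ r) (hs : a ≤ s) {ε : ℝ} (hε : 0 < ε) :
    |profile W s - profile W r|
      ≤ ε * |s - r| + (∫ x, ‖gradient W x‖ ^ 2) / (4 * Real.pi) / (4 * ε * a ^ 2) := by
  wlog hrs : r ≤ s generalizing r s
  · rw [abs_sub_comm, abs_sub_comm s]; exact this hs hr (le_of_not_ge hrs)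
  have h1 := h.abs_profile_sub_le hW hc (ha.le.trans hr) hrs (c := 1 / (4 * ε * a ^ 2))
    (by positivity) (g := fun _ => ε) continuousOn_const ?_
  · refine h1.trans (le_of_eq ?_)
    rw [intervalIntegral.integral_const, smul_eq_mul, abs_of_nonneg (sub_nonneg.2 hrs)]
    ring
  · intro τ hτ
    have hτa : a ≤ τ := hr.trans hτ.1
    set q := deriv (profile W) τ
    have h2 : |q| ≤ q ^ 2 / (4 * ε) + ε := by
      have : q ^ 2 / (4 * ε) + ε - |q| = (|q| - 2 * ε) ^ 2 / (4 * ε) := by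
        rw [← sq_abs q]; field_simp; ring
      have h0 : 0 ≤ (|q| - 2 * ε) ^ 2 / (4 * ε) := by positivity
      linarith
    refine h2.trans (add_le_add ?_ le_rfl)
    have h3 : 1 / (4 * ε * a ^ 2) * (τ ^ 2 * q ^ 2) = q ^ 2 / (4 * ε) * (τ ^ 2 / a ^ 2) := by
      field_simp
    rw [h3]
    refine le_mul_of_one_le_right (by positivity) ((one_le_div (by positivity)).2 ?_)
    gcongr

end IsRadial

/-! ### Casimir identities for primitives of continuous bounded functions -/

theorem contDiff_primitive {n : ℝ → ℝ} (hn : Continuous n) :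
    ContDiff ℝ 1 (fun s => ∫ τ in (0 : ℝ)..s, n τ) := by
  have hd : ∀ s, HasDerivAt (fun s => ∫ τ in (0 : ℝ)..s, n τ) (n s) s := fun s =>
    (hn.integral_hasStrictDerivAt 0 s).hasDerivAt
  rw [contDiff_one_iff_deriv]
  refine ⟨fun s => (hd s).differentiableAt, ?_⟩
  rw [funext fun s => (hd s).deriv]
  exact hn

theorem isAdmissible_primitive {m m' : ℝ → ℝ} (hm : ∀ s, HasDerivAt m (m' s) s)
    (hm' : Continuous m') (h0 : m 0 = 0) {B : ℝ} (hB : ∀ s, |m' s| ≤ B) :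
    IsAdmissible (fun s _ => ∫ τ in (0 : ℝ)..s, m τ) := by
  have hmc : ContDiff ℝ 1 m := by
    rw [contDiff_one_iff_deriv]
    refine ⟨fun s => (hm s).differentiableAt, ?_⟩
    rw [funext fun s => (hm s).deriv]
    exact hm'
  have hd : ∀ s, HasDerivAt (fun s => ∫ τ in (0 : ℝ)..s, m τ) (m s) s := fun s =>
    (hmc.continuous.integral_hasStrictDerivAt 0 s).hasDerivAt
  have hder : deriv (fun s => ∫ τ in (0 : ℝ)..s, m τ) = m := funext fun s => (hd s).deriv
  have hM : ContDiff ℝ 2 (fun s => ∫ τ in (0 : ℝ)..s, m τ) := by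
    have : ContDiff ℝ (1 + 1) (fun s => ∫ τ in (0 : ℝ)..s, m τ) := by
      rw [contDiff_succ_iff_deriv]
      refine ⟨fun s => (hd s).differentiableAt, by simp, ?_⟩
      rw [hder]; exact hmc
    exact this.of_le (by norm_num)
  refine ⟨(hM.comp contDiff_fst).contDiffOn, fun L _ => by simp, fun L _ => ?_, B, fun s hs L _ => ?_⟩
  · rw [(hd 0).hasDerivWithinAt.derivWithin (uniqueDiffOn_Ici 0 0 (by simp)), h0]
  · rw [iteratedDerivWithin_eq_iteratedDeriv (uniqueDiffOn_Ici 0) hM.contDiffAt hs,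
      iteratedDeriv_succ, iteratedDeriv_one, hder, (hm s).deriv]
    exact hB s

/-- The Casimir identities of the class `S` for `Φ(f, L) = ∫₀^f n`, `n` continuous and bounded. -/
theorem MemS.integral_primitive_eq {f₀ f : R3 → R3 → ℝ} (hS : MemS f₀ f)
    (hi₀ : Integrable (fun z : R3 × R3 => f₀ z.1 z.2)) {n : ℝ → ℝ} (hn : Continuous n) {N : ℝ}
    (hN : ∀ s, |n s| ≤ N) :
    ∫ z : R3 × R3, (∫ τ in (0 : ℝ)..f z.1 z.2, n τ)
      = ∫ z : R3 × R3, (∫ τ in (0 : ℝ)..f₀ z.1 z.2, n τ) := by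
  have hN0 : 0 ≤ N := (abs_nonneg _).trans (hN 0)
  set F : ℝ → ℝ := fun s => ∫ τ in (0 : ℝ)..s, n τ with hF
  have hFd : ∀ s, HasDerivAt F (n s) s := fun s => (hn.integral_hasStrictDerivAt 0 s).hasDerivAt
  set κ : ℕ → ℝ := fun k => (k : ℝ) + 1 with hκ
  have hκ1 : ∀ k, 1 ≤ κ k := fun k => by simp [hκ]
  have hκ0 : ∀ k, 0 < κ k := fun k => one_pos.trans_le (hκ1 k)
  -- Difference quotients of the primitive smooth n to class C¹, and the factor c forces the value 0
  -- at s = 0, as admissibility demands. The products stay bounded by N and tend to n for s ≠ 0,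
  -- which suffices for convergence of their primitives.
  set a : ℕ → ℝ → ℝ := fun k s => κ k * (F (s + (κ k)⁻¹) - F s) with ha
  set c : ℕ → ℝ → ℝ := fun k s => κ k * s ^ 2 / (1 + κ k * s ^ 2) with hc
  have haN : ∀ k s, |a k s| ≤ N := by
    intro k s
    have h1 : F (s + (κ k)⁻¹) - F s = ∫ τ in s..(s + (κ k)⁻¹), n τ :=
      intervalIntegral.integral_interval_sub_left (hn.intervalIntegrable _ _)
        (hn.intervalIntegrable _ _)
    have h2 := intervalIntegral.norm_integral_le_of_norm_le_const (a := s) (b := s + (κ k)⁻¹)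
      (f := n) (C := N) fun τ _ => hN τ
    rw [ha]
    simp only
    rw [h1, abs_mul, abs_of_pos (hκ0 k)]
    have h3 : |s + (κ k)⁻¹ - s| = (κ k)⁻¹ := by
      rw [add_sub_cancel_left, abs_of_pos (inv_pos.2 (hκ0 k))]
    rw [h3, Real.norm_eq_abs] at h2
    calc κ k * |∫ τ in s..(s + (κ k)⁻¹), n τ| ≤ κ k * (N * (κ k)⁻¹) :=
          mul_le_mul_of_nonneg_left h2 (hκ0 k).le
      _ = N := by have := (hκ0 k).ne'; field_simp
  have hden : ∀ k s, 0 < 1 + κ k * s ^ 2 := fun k s => by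
    have := hκ0 k; positivity
  have hcn : ∀ k s, 0 ≤ c k s := fun k s => by
    have := hκ0 k; simp only [hc]; positivity
  have hc1 : ∀ k s, c k s ≤ 1 := fun k s => by
    simp only [hc]; rw [div_le_one (hden k s)]; linarith
  have had : ∀ k s, HasDerivAt (a k) (κ k * (n (s + (κ k)⁻¹) - n s)) s := fun k s =>
    ((HasDerivAt.comp_add_const s (κ k)⁻¹ (hFd _)).sub (hFd s)).const_mul _
  have hcd : ∀ k s, HasDerivAt (c k) (2 * κ k * s / (1 + κ k * s ^ 2) ^ 2) s := by
    intro k s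
    have h1 : HasDerivAt (fun s => κ k * s ^ 2) (κ k * (2 * s)) s := by
      simpa using (hasDerivAt_pow 2 s).const_mul (κ k)
    refine (h1.div (h1.const_add 1) (hden k s).ne').congr_deriv ?_
    have := (hden k s).ne'
    field_simp
    ring
  set m : ℕ → ℝ → ℝ := fun k s => a k s * c k s with hm
  have hmN : ∀ k s, |m k s| ≤ N := fun k s => by
    simp only [hm]
    rw [abs_mul, abs_of_nonneg (hcn k s)]
    calc |a k s| * c k s ≤ N * 1 := mul_le_mul (haN k s) (hc1 k s) (hcn k s) hN0
      _ = N := mul_one N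
  have hmd : ∀ k s, HasDerivAt (m k) (κ k * (n (s + (κ k)⁻¹) - n s) * c k s
      + a k s * (2 * κ k * s / (1 + κ k * s ^ 2) ^ 2)) s := fun k s => (had k s).mul (hcd k s)
  have hac : ∀ k, Continuous (a k) := fun k =>
    continuous_iff_continuousAt.2 fun s => (had k s).continuousAt
  have hcc : ∀ k, Continuous (c k) := fun k =>
    continuous_iff_continuousAt.2 fun s => (hcd k s).continuousAt
  have hmcont : ∀ k, Continuous (m k) := fun k => (hac k).mul (hcc k)
  have hadm : ∀ k, IsAdmissible (fun s _ => ∫ τ in (0 : ℝ)..s, m k τ) := by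
    intro k
    refine isAdmissible_primitive (hmd k) ?_ (by simp [hm, hc])
      (B := κ k * (N + N) * 1 + N * κ k) fun s => ?_
    · have h1 := hac k
      have h2 := hcc k
      have h3 : Continuous (fun s => 2 * κ k * s / (1 + κ k * s ^ 2) ^ 2) :=
        Continuous.div (by fun_prop) (by fun_prop) fun s => pow_ne_zero 2 (hden k s).ne'
      fun_prop
    · refine (abs_add_le _ _).trans (add_le_add ?_ ?_)
      · rw [abs_mul, abs_mul, abs_of_pos (hκ0 k), abs_of_nonneg (hcn k s)]
        have h1 : |n (s + (κ k)⁻¹) - n s| ≤ N + N :=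
          (abs_sub _ _).trans (add_le_add (hN _) (hN _))
        have := hκ0 k
        have := hcn k s
        have := hc1 k s
        gcongr
      · rw [abs_mul]
        have h1 : |2 * κ k * s / (1 + κ k * s ^ 2) ^ 2| ≤ κ k := by
          rw [abs_div, abs_of_pos (by have := hden k s; positivity : 0 < (1 + κ k * s ^ 2) ^ 2),
            div_le_iff₀ (by have := hden k s; positivity), abs_mul,
            abs_of_pos (by have := hκ0 k; positivity : 0 < 2 * κ k)]
          have h2 : 2 * |s| ≤ 1 + κ k * s ^ 2 := by
            nlinarith [sq_abs s, sq_nonneg (|s| - 1), hκ1 k, sq_nonneg s]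
          have h3 : 1 ≤ 1 + κ k * s ^ 2 := by have := hκ0 k; nlinarith [sq_nonneg s]
          have h4 : 1 + κ k * s ^ 2 ≤ (1 + κ k * s ^ 2) ^ 2 := by nlinarith
          have h5 := mul_le_mul_of_nonneg_left (h2.trans h4) (hκ0 k).le
          linarith
        exact mul_le_mul (haN k s) h1 (abs_nonneg _) hN0
  have hlim : ∀ s, s ≠ 0 → Tendsto (fun k => m k s) atTop (𝓝 (n s)) := by
    intro s hs
    have h1 : Tendsto (fun k : ℕ => (κ k)⁻¹) atTop (𝓝[≠] 0) := by
      refine tendsto_nhdsWithin_iff.2 ⟨?_, Eventually.of_forall fun k => inv_ne_zero (hκ0 k).ne'⟩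
      have := tendsto_one_div_add_atTop_nhds_zero_nat (𝕜 := ℝ)
      simpa [hκ] using this
    have h2 : Tendsto (fun k => a k s) atTop (𝓝 (n s)) := by
      have := (hFd s).tendsto_slope_zero.comp h1
      refine this.congr fun k => ?_
      simp [ha]
    have h3 : Tendsto (fun k => c k s) atTop (𝓝 1) := by
      have h4 : Tendsto (fun k : ℕ => 1 - (1 + κ k * s ^ 2)⁻¹) atTop (𝓝 (1 - 0)) := by
        refine tendsto_const_nhds.sub (tendsto_inv_atTop_zero.comp ?_)
        refine tendsto_atTop_add_const_left _ _ (Tendsto.atTop_mul_const (by positivity) ?_)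
        exact tendsto_atTop_add_const_right _ _ tendsto_natCast_atTop_atTop
      rw [sub_zero] at h4
      refine h4.congr fun k => ?_
      have := (hden k s).ne'
      simp only [hc]
      field_simp
      ring
    simpa using h2.mul h3
  have hlim2 : ∀ s, Tendsto (fun k => ∫ τ in (0 : ℝ)..s, m k τ) atTop (𝓝 (F s)) := by
    intro s
    refine intervalIntegral.tendsto_integral_filter_of_dominated_convergence (fun _ => N)
      (Eventually.of_forall fun k => (hmcont k).aestronglyMeasurable)
      (Eventually.of_forall fun k => Eventually.of_forall fun τ _ => hmN k τ)
      (by simp) ?_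
    have : ∀ᵐ τ : ℝ, τ ≠ 0 := by simp [ae_iff]
    filter_upwards [this] with τ hτ _ using hlim τ hτ
  have hcont : ∀ k, Continuous (fun s => ∫ τ in (0 : ℝ)..s, m k τ) := fun k =>
    intervalIntegral.continuous_primitive (fun _ _ => (hmcont k).intervalIntegrable _ _) 0
  have conv : ∀ g : R3 × R3 → ℝ, Integrable g → Tendsto
      (fun k => ∫ z, (∫ τ in (0 : ℝ)..g z, m k τ)) atTop (𝓝 (∫ z, F (g z))) := by
    intro g hg
    refine tendsto_integral_of_dominated_convergence (fun z => N * |g z|)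
      (fun k => (hcont k).comp_aestronglyMeasurable hg.aestronglyMeasurable)
      (hg.abs.const_mul N) (fun k => Eventually.of_forall fun z => ?_)
      (Eventually.of_forall fun z => hlim2 (g z))
    have := intervalIntegral.norm_integral_le_of_norm_le_const (a := 0) (b := g z)
      (f := m k) (C := N) fun τ _ => hmN k τ
    simpa using this
  have h1 := conv _ hS.integrable
  have h2 := conv _ hi₀
  refine tendsto_nhds_unique h1 (h2.congr fun k => ?_)
  exact (hS.casimir _ (hadm k)).2.symm

/-! ### States equimeasurable with the King model; free and field energy -/

/-- A compactly supported state with spherically symmetric potential which is equimeasurable with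
the King model. -/
structure IsState (E₀ : ℝ) (U₀ : R3 → ℝ) (g : R3 → R3 → ℝ) (V : R3 → ℝ) : Prop where
  continuous : Continuous (fun z : R3 × R3 => g z.1 z.2)
  nonneg : ∀ x v, 0 ≤ g x v
  hasCompactSupport : HasCompactSupport (fun z : R3 × R3 => g z.1 z.2)
  potential : IsPotential g V
  isRadial : IsRadial V
  casimir : ∀ n : ℝ → ℝ, Continuous n → ∀ N : ℝ, (∀ s, |n s| ≤ N) →
    ∫ z : R3 × R3, (∫ τ in (0 : ℝ)..g z.1 z.2, n τ)
      = ∫ z : R3 × R3, (∫ τ in (0 : ℝ)..kingDensity E₀ U₀ z.1 z.2, n τ)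

/-- The part of the distance to the King model which does not involve the fields. -/
def freeEnergy (E₀ : ℝ) (U₀ : R3 → ℝ) (g : R3 → R3 → ℝ) : ℝ :=
  ∫ z : R3 × R3, (casimirFun (g z.1 z.2) - casimirFun (kingDensity E₀ U₀ z.1 z.2)
    + (energy U₀ z.1 z.2 - E₀) * (g z.1 z.2 - kingDensity E₀ U₀ z.1 z.2))

/-- The field energy part of the distance to the King model. -/
def fieldEnergy (U₀ V : R3 → ℝ) : ℝ :=
  1 / (8 * Real.pi) * ∫ x : R3, ‖gradient V x - gradient U₀ x‖ ^ 2

theorem fieldEnergy_nonneg (U₀ V : R3 → ℝ) : 0 ≤ fieldEnergy U₀ V :=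
  mul_nonneg (by positivity) (integral_nonneg fun x => sq_nonneg _)

theorem gradient_sub_apply {V W : R3 → ℝ} (hV : ContDiff ℝ 2 V) (hW : ContDiff ℝ 2 W) (x : R3) :
    gradient (V - W) x = gradient V x - gradient W x := by
  refine ext_inner_right ℝ fun u => ?_
  rw [inner_sub_left, inner_gradient_left, inner_gradient_left, inner_gradient_left,
    fderiv_sub (hV.differentiable (by norm_num) x) (hW.differentiable (by norm_num) x), sub_apply]

theorem gradient_add_apply {V W : R3 → ℝ} (hV : ContDiff ℝ 2 V) (hW : ContDiff ℝ 2 W) (x : R3) :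
    gradient (V + W) x = gradient V x + gradient W x := by
  refine ext_inner_right ℝ fun u => ?_
  rw [inner_add_left, inner_gradient_left, inner_gradient_left, inner_gradient_left,
    fderiv_add (hV.differentiable (by norm_num) x) (hW.differentiable (by norm_num) x), add_apply]

theorem integral_mul_eq_integral_mul_density {g : R3 → R3 → ℝ}
    (hg : Continuous (fun z : R3 × R3 => g z.1 z.2))
    (hc : HasCompactSupport (fun z : R3 × R3 => g z.1 z.2)) {ζ : R3 → ℝ} (hζ : Continuous ζ) :
    Integrable (fun z : R3 × R3 => ζ z.1 * g z.1 z.2) ∧ Integrable (fun x => ζ x * density g x) ∧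
    ∫ z : R3 × R3, ζ z.1 * g z.1 z.2 = ∫ x, ζ x * density g x := by
  have hi : Integrable (fun z : R3 × R3 => ζ z.1 * g z.1 z.2) :=
    (by fun_prop : Continuous _).integrable_of_hasCompactSupport hc.mul_left
  refine ⟨hi, ?_, ?_⟩
  · have := Integrable.integral_prod_left (μ := (volume : Measure R3)) (ν := (volume : Measure R3)) hi
    simp only [integral_const_mul] at this
    exact this
  · have := integral_prod (μ := (volume : Measure R3)) (ν := (volume : Measure R3)) _ hi
    simp only [integral_const_mul] at this
    exact this

theorem continuous_casimirFun : Continuous casimirFun := by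
  unfold casimirFun
  exact (Real.continuous_mul_log.comp (by fun_prop : Continuous fun s : ℝ => 1 + s)).sub
    continuous_id

theorem hasDerivAt_casimirFun {s : ℝ} (hs : -1 < s) :
    HasDerivAt casimirFun (Real.log (1 + s)) s := by
  have h1 : HasDerivAt (fun s : ℝ => 1 + s) 1 s := (hasDerivAt_id s).const_add 1
  have h2 := ((h1.mul (h1.log (by linarith))).sub (hasDerivAt_id s))
  refine h2.congr_deriv ?_
  have : 1 + s ≠ 0 := by linarith
  field_simp
  ring

theorem continuous_log_one_add_max : Continuous (fun τ : ℝ => Real.log (1 + max τ 0)) :=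
  Continuous.log (by fun_prop) fun τ => by
    have := le_max_right τ 0
    linarith

theorem casimirFun_eq_primitive {s : ℝ} (hs : 0 ≤ s) :
    casimirFun s = ∫ τ in (0 : ℝ)..s, Real.log (1 + max τ 0) := by
  rw [intervalIntegral.integral_eq_sub_of_hasDerivAt (f := casimirFun) (fun τ hτ => ?_)
    (continuous_log_one_add_max.intervalIntegrable _ _)]
  · simp [casimirFun]
  · rw [uIcc_of_le hs] at hτ
    rw [max_eq_left hτ.1]
    exact hasDerivAt_casimirFun (by linarith [hτ.1])

namespace IsState

variable {E₀ : ℝ} {U₀ : R3 → ℝ} {g : R3 → R3 → ℝ} {V : R3 → ℝ}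

theorem integrable (h : IsState E₀ U₀ g V) : Integrable (fun z : R3 × R3 => g z.1 z.2) :=
  h.continuous.integrable_of_hasCompactSupport h.hasCompactSupport

theorem integral_eq (h : IsState E₀ U₀ g V) :
    ∫ z : R3 × R3, g z.1 z.2 = ∫ z : R3 × R3, kingDensity E₀ U₀ z.1 z.2 := by
  have := h.casimir (fun _ => 1) continuous_const 1 (by simp)
  simpa using this

/-- Apply the Casimir identity with n supported above S. Both integrals vanish, so g exceeds S
nowhere by continuity. The resulting uniform bound makes the convexity of the Casimir function
uniform. -/
theorem le (h : IsState E₀ U₀ g V) {S : ℝ} (hS0 : 0 ≤ S)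
    (hS : ∀ x v, kingDensity E₀ U₀ x v ≤ S) (x v : R3) : g x v ≤ S := by
  set n : ℝ → ℝ := fun s => min 1 (max (s - S) 0) with hn
  have hnc : Continuous n := by fun_prop
  have hn0 : ∀ s, 0 ≤ n s := fun s => le_min zero_le_one (le_max_right _ _)
  have hn1 : ∀ s, |n s| ≤ 1 := fun s => by rw [abs_of_nonneg (hn0 s)]; exact min_le_left _ _
  have hnS : ∀ s, s ≤ S → n s = 0 := fun s hs => by
    simp only [hn]; rw [max_eq_right (by linarith)]; norm_num
  have h1 := h.casimir n hnc 1 hn1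
  have h2 : ∀ s, 0 ≤ s → s ≤ S → ∫ τ in (0 : ℝ)..s, n τ = 0 := by
    intro s hs0 hs
    rw [intervalIntegral.integral_congr (g := fun _ => (0 : ℝ))]
    · simp
    · intro τ hτ
      rw [uIcc_of_le hs0] at hτ
      exact hnS τ (hτ.2.trans hs)
  have h3 : ∫ z : R3 × R3, (∫ τ in (0 : ℝ)..kingDensity E₀ U₀ z.1 z.2, n τ) = 0 := by
    rw [integral_eq_zero_of_ae]
    exact Eventually.of_forall fun z => h2 _ (kingDensity_nonneg _ _ _ _) (hS _ _)
  rw [h3] at h1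
  by_contra hlt
  have hlt := not_le.1 hlt
  have hMc : Continuous (fun s => ∫ τ in (0 : ℝ)..s, n τ) := (contDiff_primitive hnc).continuous
  have hpos := Continuous.integral_pos_of_hasCompactSupport_nonneg_nonzero (μ := volume)
    (f := fun z : R3 × R3 => ∫ τ in (0 : ℝ)..g z.1 z.2, n τ) (x := (x, v))
    (hMc.comp h.continuous)
    (h.hasCompactSupport.comp_left (g := fun s => ∫ τ in (0 : ℝ)..s, n τ) (by simp))
    (fun z => intervalIntegral.integral_nonneg (h.nonneg _ _) fun τ _ => hn0 τ) ?_
  · exact hpos.ne' h1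
  · have h4 : 0 < ∫ τ in S..g x v, n τ := by
      refine intervalIntegral.intervalIntegral_pos_of_pos_on (hnc.intervalIntegrable _ _)
        (fun τ hτ => ?_) hlt
      exact lt_min one_pos (lt_max_of_lt_left (by linarith [hτ.1]))
    have h5 := intervalIntegral.integral_add_adjacent_intervals
      (hnc.intervalIntegrable (μ := volume) 0 S) (hnc.intervalIntegrable S (g x v))
    rw [h2 S hS0 le_rfl, zero_add] at h5
    change ∫ τ in (0 : ℝ)..g x v, n τ ≠ 0
    rw [← h5]
    exact h4.ne'

theorem contDiff_sub (h : IsState E₀ U₀ g V) (hU₀ : IsKingPotential E₀ U₀) :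
    ContDiff ℝ 2 (V - U₀) := h.potential.contDiff.sub hU₀.contDiff

theorem isRadial_sub (h : IsState E₀ U₀ g V) (hU₀ : IsKingPotential E₀ U₀) :
    IsRadial (V - U₀) := h.isRadial.sub hU₀.isRadial

theorem laplacian_sub (h : IsState E₀ U₀ g V) (hU₀ : IsKingPotential E₀ U₀) (x : R3) :
    Laplacian.laplacian (V - U₀) x
      = 4 * Real.pi * (density g x - density (kingDensity E₀ U₀) x) := by
  rw [ContDiffAt.laplacian_sub h.potential.contDiff.contDiffAt hU₀.contDiff.contDiffAt,
    h.potential.poisson, hU₀.potential.poisson, mul_sub]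

theorem density_eq_zero {g : R3 → R3 → ℝ}
    (hc : HasCompactSupport (fun z : R3 × R3 => g z.1 z.2)) :
    ∃ R, 0 < R ∧ ∀ x, R ≤ ‖x‖ → density g x = 0 := by
  obtain ⟨R, hR⟩ := hc.isCompact.isBounded.subset_closedBall 0
  refine ⟨|R| + 1, by positivity, fun x hx => ?_⟩
  rw [density, integral_eq_zero_of_ae]
  refine Eventually.of_forall fun v => ?_
  by_contra hne
  have := hR (subset_tsupport _ (show (x, v) ∈ Function.support _ from hne))
  rw [mem_closedBall_zero_iff, Prod.norm_def] at this
  linarith [le_max_left ‖x‖ ‖v‖, le_abs_self R]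

/-- Both states have compact support and the same mass, so the radial difference potential vanishes
outside a ball by Newton's theorem. -/
theorem hasCompactSupport_sub (h : IsState E₀ U₀ g V) (hU₀ : IsKingPotential E₀ U₀) :
    HasCompactSupport (V - U₀) := by
  obtain ⟨R₁, hR₁, h1⟩ := density_eq_zero h.hasCompactSupport
  obtain ⟨R₂, hR₂, h2⟩ := density_eq_zero hU₀.hasCompactSupport_kingDensity
  refine HasCompactSupport.of_support_subset_isCompact
    (isCompact_closedBall (0 : R3) (max R₁ R₂)) fun x hx => ?_
  by_contra hlt
  have hlt : max R₁ R₂ ≤ ‖x‖ := by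
    rw [mem_closedBall_zero_iff, not_le] at hlt
    exact hlt.le
  refine hx ((h.isRadial_sub hU₀).eq_zero_of_integral_laplacian_eq_zero (h.contDiff_sub hU₀) ?_
    (R := max R₁ R₂) (lt_max_of_lt_left hR₁) (fun y hy => ?_) ?_ hlt)
  · have := h.potential.decay.sub hU₀.potential.decay
    rw [sub_zero] at this
    exact this
  · rw [h.laplacian_sub hU₀, h1 y ((le_max_left _ _).trans hy),
      h2 y ((le_max_right _ _).trans hy)]
    ring
  · obtain ⟨-, i1, e1⟩ := integral_mul_eq_integral_mul_density h.continuous h.hasCompactSupport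
      (ζ := fun _ => 1) continuous_const
    obtain ⟨-, i2, e2⟩ := integral_mul_eq_integral_mul_density
      (continuous_kingDensity hU₀.continuous) hU₀.hasCompactSupport_kingDensity
      (ζ := fun _ => 1) continuous_const
    simp only [one_mul] at i1 e1 i2 e2
    simp_rw [h.laplacian_sub hU₀]
    rw [integral_const_mul, integral_sub i1 i2, ← e1, ← e2, h.integral_eq, sub_self, mul_zero]

theorem fieldEnergy_eq (h : IsState E₀ U₀ g V) (hU₀ : IsKingPotential E₀ U₀) :
    fieldEnergy U₀ V = 1 / (8 * Real.pi) * ∫ x, ‖gradient (V - U₀) x‖ ^ 2 := by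
  rw [fieldEnergy]
  simp_rw [gradient_sub_apply h.potential.contDiff hU₀.contDiff]

theorem integral_mul_sub_eq (h : IsState E₀ U₀ g V) {g' : R3 → R3 → ℝ} {V' : R3 → ℝ}
    (hg' : Continuous (fun z : R3 × R3 => g' z.1 z.2))
    (hc' : HasCompactSupport (fun z : R3 × R3 => g' z.1 z.2)) (hV' : IsPotential g' V')
    {ζ : R3 → ℝ} (hζ : ContDiff ℝ 1 ζ) (hζc : HasCompactSupport ζ) :
    ∫ z : R3 × R3, ζ z.1 * (g z.1 z.2 - g' z.1 z.2)
      = -(1 / (4 * Real.pi)) * ∫ x, inner ℝ (gradient ζ x) (gradient (V - V') x) := by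
  obtain ⟨j1, i1, e1⟩ := integral_mul_eq_integral_mul_density h.continuous h.hasCompactSupport
    hζ.continuous
  obtain ⟨j2, i2, e2⟩ := integral_mul_eq_integral_mul_density hg' hc' hζ.continuous
  rw [integral_inner_gradient_eq_neg_integral_mul_laplacian (w := V - V') hζ
    (h.potential.contDiff.sub hV'.contDiff) (Or.inl hζc)]
  have e3 : ∀ x, Laplacian.laplacian (V - V') x
      = 4 * Real.pi * (density g x - density g' x) := fun x => by
    rw [ContDiffAt.laplacian_sub h.potential.contDiff.contDiffAt hV'.contDiff.contDiffAt,
      h.potential.poisson, hV'.poisson, mul_sub]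
  simp_rw [e3, mul_sub, mul_left_comm _ (4 * Real.pi)]
  rw [integral_sub j1 j2, e1, e2, integral_sub (i1.const_mul _) (i2.const_mul _),
    integral_const_mul, integral_const_mul]
  have : Real.pi ≠ 0 := Real.pi_ne_zero
  field_simp

theorem integral_potential_mul_sub (h : IsState E₀ U₀ g V) (hU₀ : IsKingPotential E₀ U₀) :
    ∫ z : R3 × R3, (V - U₀) z.1 * (g z.1 z.2 - kingDensity E₀ U₀ z.1 z.2)
      = -2 * fieldEnergy U₀ V := by
  rw [h.integral_mul_sub_eq (continuous_kingDensity hU₀.continuous)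
    hU₀.hasCompactSupport_kingDensity hU₀.potential
    ((h.contDiff_sub hU₀).of_le (by norm_num)) (h.hasCompactSupport_sub hU₀),
    h.fieldEnergy_eq hU₀]
  simp_rw [real_inner_self_eq_norm_sq]
  have : Real.pi ≠ 0 := Real.pi_ne_zero
  field_simp
  ring

theorem integrable_norm_gradient_sq (h : IsState E₀ U₀ g V) (hU₀ : IsKingPotential E₀ U₀) :
    Integrable (fun x => ‖gradient (V - U₀) x‖ ^ 2) := by
  have h1 := continuous_gradient ((h.contDiff_sub hU₀).of_le (by norm_num : (1 : WithTop ℕ∞) ≤ 2))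
  have h2 : HasCompactSupport (fun x => ‖fderiv ℝ (V - U₀) x‖) :=
    ((h.hasCompactSupport_sub hU₀).fderiv ℝ).norm
  simp_rw [← norm_gradient] at h2
  have h3 : HasCompactSupport (fun x => ‖gradient (V - U₀) x‖ ^ 2) :=
    h2.comp_left (g := fun y : ℝ => y ^ 2) (by norm_num)
  exact (h1.norm.pow 2).integrable_of_hasCompactSupport h3

/-- Polarisation |a|² − |b|² = (a + b)·(a − b), followed by Poisson's equation. The increment
becomes a pairing with g − g', so no time derivative of the potential is ever needed. -/
theorem fieldEnergy_sub {g' : R3 → R3 → ℝ} {V' : R3 → ℝ} (h : IsState E₀ U₀ g V)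
    (h' : IsState E₀ U₀ g' V') (hU₀ : IsKingPotential E₀ U₀) :
    fieldEnergy U₀ V - fieldEnergy U₀ V' = -(1 / 2) * ∫ z : R3 × R3,
      ((V - U₀) + (V' - U₀)) z.1 * (g z.1 z.2 - g' z.1 z.2) := by
  rw [h.integral_mul_sub_eq (ζ := (V - U₀) + (V' - U₀)) h'.continuous h'.hasCompactSupport
    h'.potential (((h.contDiff_sub hU₀).add (h'.contDiff_sub hU₀)).of_le (by norm_num))
    ((h.hasCompactSupport_sub hU₀).add (h'.hasCompactSupport_sub hU₀)),
    h.fieldEnergy_eq hU₀, h'.fieldEnergy_eq hU₀, ← mul_sub,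
    ← integral_sub (h.integrable_norm_gradient_sq hU₀) (h'.integrable_norm_gradient_sq hU₀)]
  have e : ∀ x, inner ℝ (gradient ((V - U₀) + (V' - U₀)) x) (gradient (V - V') x)
      = ‖gradient (V - U₀) x‖ ^ 2 - ‖gradient (V' - U₀) x‖ ^ 2 := by
    intro x
    have e1 : V - V' = (V - U₀) - (V' - U₀) := by abel
    rw [e1, gradient_add_apply (h.contDiff_sub hU₀) (h'.contDiff_sub hU₀),
      gradient_sub_apply (h.contDiff_sub hU₀) (h'.contDiff_sub hU₀),
      inner_add_left, inner_sub_right, inner_sub_right, real_inner_self_eq_norm_sq,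
      real_inner_self_eq_norm_sq, real_inner_comm]
    ring
  simp_rw [e]
  have : Real.pi ≠ 0 := Real.pi_ne_zero
  field_simp
  ring

theorem integrable_casimirFun (h : IsState E₀ U₀ g V) :
    Integrable (fun z : R3 × R3 => casimirFun (g z.1 z.2)) :=
  (continuous_casimirFun.comp h.continuous).integrable_of_hasCompactSupport
    (h.hasCompactSupport.comp_left (g := casimirFun) (by simp [casimirFun]))

theorem integrable_continuous_mul (h : IsState E₀ U₀ g V) {ζ : R3 × R3 → ℝ} (hζ : Continuous ζ) :
    Integrable (fun z : R3 × R3 => ζ z * g z.1 z.2) :=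
  (hζ.mul h.continuous).integrable_of_hasCompactSupport h.hasCompactSupport.mul_left

end IsState

theorem IsKingPotential.isState {E₀ : ℝ} {U₀ : R3 → ℝ} (h : IsKingPotential E₀ U₀) :
    IsState E₀ U₀ (kingDensity E₀ U₀) U₀ :=
  ⟨continuous_kingDensity h.continuous, kingDensity_nonneg E₀ U₀, h.hasCompactSupport_kingDensity,
    h.potential, h.isRadial, fun _ _ _ _ => rfl⟩

theorem IsState.freeEnergy_eq {E₀ : ℝ} {U₀ : R3 → ℝ} {g : R3 → R3 → ℝ} {V : R3 → ℝ}
    (h : IsState E₀ U₀ g V) (hU₀ : IsKingPotential E₀ U₀) :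
    freeEnergy E₀ U₀ g = (∫ z : R3 × R3, casimirFun (g z.1 z.2))
      + (∫ z : R3 × R3, (energy U₀ z.1 z.2 - E₀) * g z.1 z.2)
      - ((∫ z : R3 × R3, casimirFun (kingDensity E₀ U₀ z.1 z.2))
        + ∫ z : R3 × R3, (energy U₀ z.1 z.2 - E₀) * kingDensity E₀ U₀ z.1 z.2) := by
  have hE : Continuous (fun z : R3 × R3 => energy U₀ z.1 z.2 - E₀) :=
    (continuous_energy hU₀.continuous).sub continuous_const
  have a1 := h.integrable_casimirFun
  have a2 := h.integrable_continuous_mul hE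
  have b1 := hU₀.isState.integrable_casimirFun
  have b2 := hU₀.isState.integrable_continuous_mul hE
  rw [freeEnergy]
  have e : ∀ z : R3 × R3, casimirFun (g z.1 z.2) - casimirFun (kingDensity E₀ U₀ z.1 z.2)
      + (energy U₀ z.1 z.2 - E₀) * (g z.1 z.2 - kingDensity E₀ U₀ z.1 z.2)
      = (casimirFun (g z.1 z.2) + (energy U₀ z.1 z.2 - E₀) * g z.1 z.2)
        - (casimirFun (kingDensity E₀ U₀ z.1 z.2)
          + (energy U₀ z.1 z.2 - E₀) * kingDensity E₀ U₀ z.1 z.2) := fun z => by ring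
  simp_rw [e]
  rw [← integral_add a1 a2, ← integral_add b1 b2]
  exact integral_sub (a1.add a2) (b1.add b2)

/-! ### Continuity of the field energy and conservation of P − K -/

namespace IsSolution

variable {f : ℝ → R3 → R3 → ℝ} {U : ℝ → R3 → ℝ} {E₀ : ℝ} {U₀ : R3 → ℝ}

theorem isState (h : IsSolution f U) (hc : HasCompactSupport (fun z : R3 × R3 => f 0 z.1 z.2))
    (hU₀ : IsKingPotential E₀ U₀) (hS : MemS (kingDensity E₀ U₀) (f 0)) {t : ℝ} (ht : 0 ≤ t) :
    IsState E₀ U₀ (f t) (U t) where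
  continuous := h.continuous_slice ht
  nonneg := h.nonneg t ht
  hasCompactSupport := h.hasCompactSupport_slice hc ht
  potential := h.potential t ht
  isRadial := h.isRadial hc hS ht
  casimir n hn N hN := by
    rw [← hS.integral_primitive_eq hU₀.integrable_kingDensity hn hN]
    exact h.integral_comp_eq hc (contDiff_primitive hn) (by simp) ht

/-- The multiplier log(1 + s) is unbounded, so conservation is taken from the flow itself and not
from the class of Casimirs defining a state. -/
theorem integral_casimirFun_eq (h : IsSolution f U)
    (hc : HasCompactSupport (fun z : R3 × R3 => f 0 z.1 z.2)) {t : ℝ} (ht : 0 ≤ t) :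
    ∫ z : R3 × R3, casimirFun (f t z.1 z.2) = ∫ z : R3 × R3, casimirFun (f 0 z.1 z.2) := by
  have h1 := h.integral_comp_eq hc (contDiff_primitive continuous_log_one_add_max) (by simp) ht
  have e : ∀ t, 0 ≤ t → ∀ z : R3 × R3, casimirFun (f t z.1 z.2)
      = ∫ τ in (0 : ℝ)..f t z.1 z.2, Real.log (1 + max τ 0) := fun t ht z =>
    casimirFun_eq_primitive (h.nonneg t ht _ _)
  simp_rw [e t ht, e 0 le_rfl]
  exact h1

/-- A quantitative form of the weak Vlasov equation. -/
theorem abs_integral_mul_sub_le (h : IsSolution f U)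
    (hc : HasCompactSupport (fun z : R3 × R3 => f 0 z.1 z.2)) {ζ : R3 × R3 → ℝ}
    (hζ : ContDiff ℝ 1 ζ) {s t : ℝ} (hs : 0 ≤ s) (hst : s ≤ t) {R : ℝ}
    (hR : ∀ τ ∈ Icc s t, ∀ x v, R ≤ ‖x‖ ∨ R ≤ ‖v‖ → f τ x v = 0) {B : ℝ}
    (hB : ∀ τ ∈ Icc s t, ∀ z : R3 × R3, ‖z.1‖ ≤ R → ‖z.2‖ ≤ R →
      |fderiv ℝ ζ z (z.2, -gradient (U τ) z.1)| ≤ B) {m : ℝ}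
    (hm : ∀ τ ∈ Icc s t, Integrable (fun z : R3 × R3 => f τ z.1 z.2) ∧
      ∫ z : R3 × R3, f τ z.1 z.2 = m) :
    |(∫ z : R3 × R3, ζ z * f t z.1 z.2) - ∫ z : R3 × R3, ζ z * f s z.1 z.2|
      ≤ B * m * (t - s) := by
  rw [h.integral_mul_sub_integral_mul hc hζ hs hst]
  have h1 := intervalIntegral.norm_integral_le_of_norm_le_const (a := s) (b := t) (C := B * m)
    (f := fun τ => ∫ z : R3 × R3, f τ z.1 z.2 * fderiv ℝ ζ z (z.2, -gradient (U τ) z.1))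
    fun τ hτ => ?_
  · rwa [Real.norm_eq_abs, abs_of_nonneg (sub_nonneg.2 hst)] at h1
  · rw [uIoc_of_le hst] at hτ
    have hτ' : τ ∈ Icc s t := ⟨hτ.1.le, hτ.2⟩
    obtain ⟨hi, he⟩ := hm τ hτ'
    rw [← he, ← integral_const_mul]
    refine norm_integral_le_of_norm_le (hi.const_mul B) (Eventually.of_forall fun z => ?_)
    have hf0 := h.nonneg τ (hs.trans hτ'.1) z.1 z.2
    rw [norm_mul, Real.norm_of_nonneg hf0, Real.norm_eq_abs, mul_comm]
    by_cases hz : ‖z.1‖ ≤ R ∧ ‖z.2‖ ≤ R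
    · exact mul_le_mul_of_nonneg_right (hB τ hτ' z hz.1 hz.2) hf0
    · have : f τ z.1 z.2 = 0 := hR τ hτ' _ _ (by
        rw [not_and_or, not_le, not_le] at hz
        exact hz.imp le_of_lt le_of_lt)
      simp [this]

/-- On [0, T] the field energy is even Lipschitz: pair the Vlasov equation with U(t) + U(s) − 2U₀,
whose gradient is bounded on the support. -/
theorem continuousOn_fieldEnergy (h : IsSolution f U)
    (hc : HasCompactSupport (fun z : R3 × R3 => f 0 z.1 z.2))
    (hU₀ : IsKingPotential E₀ U₀) (hS : MemS (kingDensity E₀ U₀) (f 0)) (T : ℝ) :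
    ContinuousOn (fun t => fieldEnergy U₀ (U t)) (Icc 0 T) := by
  obtain ⟨R, hR0, hR⟩ := h.exists_support_bound hc T
  obtain ⟨B, hB⟩ := h.bounded_field T
  have hcg := continuous_gradient (hU₀.contDiff.of_le (by norm_num : (1 : WithTop ℕ∞) ≤ 2))
  obtain ⟨B₀, hB₀⟩ := (isCompact_closedBall (0 : R3) R).exists_bound_of_continuousOn
    hcg.continuousOn
  set m := ∫ z : R3 × R3, kingDensity E₀ U₀ z.1 z.2
  have hm0 : 0 ≤ m := integral_nonneg fun z => kingDensity_nonneg _ _ _ _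
  have hst : ∀ t, 0 ≤ t → IsState E₀ U₀ (f t) (U t) := fun t ht => h.isState hc hU₀ hS ht
  set c := 1 / 2 * ((2 * (|B| + |B₀|)) * R * m) with hcdef
  have hc0 : 0 ≤ c := by positivity
  have key : ∀ s ∈ Icc 0 T, ∀ t ∈ Icc 0 T, s ≤ t →
      |fieldEnergy U₀ (U t) - fieldEnergy U₀ (U s)| ≤ c * (t - s) := by
    intro s hs t ht hle
    rw [(hst t ht.1).fieldEnergy_sub (hst s hs.1) hU₀]
    have hζ := ((hst t ht.1).contDiff_sub hU₀).add ((hst s hs.1).contDiff_sub hU₀)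
    have hζ1 : ContDiff ℝ 1 (fun z : R3 × R3 => ((U t - U₀) + (U s - U₀)) z.1) :=
      (hζ.comp contDiff_fst).of_le (by norm_num)
    have h1 := h.abs_integral_mul_sub_le hc hζ1 hs.1 hle
      (fun τ hτ => hR τ ⟨hs.1.trans hτ.1, hτ.2.trans ht.2⟩)
      (B := (2 * (|B| + |B₀|)) * R) ?_ (m := m)
      (fun τ hτ => ⟨(hst τ (hs.1.trans hτ.1)).integrable, (hst τ (hs.1.trans hτ.1)).integral_eq⟩)
    · simp_rw [mul_sub]
      rw [integral_sub ((hst t ht.1).integrable_continuous_mul hζ1.continuous)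
        ((hst s hs.1).integrable_continuous_mul hζ1.continuous), abs_mul, abs_neg,
        abs_of_pos (by norm_num : (0 : ℝ) < 1 / 2), hcdef]
      linarith
    · intro τ hτ z hz1 hz2
      have e : fderiv ℝ (fun z : R3 × R3 => ((U t - U₀) + (U s - U₀)) z.1) z
          (z.2, -gradient (U τ) z.1) = fderiv ℝ ((U t - U₀) + (U s - U₀)) z.1 z.2 := by
        have : HasFDerivAt (fun z : R3 × R3 => ((U t - U₀) + (U s - U₀)) z.1)
            ((fderiv ℝ ((U t - U₀) + (U s - U₀)) z.1).comp (ContinuousLinearMap.fst ℝ R3 R3)) z :=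
          HasFDerivAt.comp z (g := (U t - U₀) + (U s - U₀))
            (hζ.differentiable (by norm_num) z.1).hasFDerivAt hasFDerivAt_fst
        rw [this.fderiv]; simp
      rw [e, ← Real.norm_eq_abs]
      refine (ContinuousLinearMap.le_opNorm _ _).trans ?_
      rw [← norm_gradient]
      have hn : ‖gradient ((U t - U₀) + (U s - U₀)) z.1‖ ≤ 2 * (|B| + |B₀|) := by
        rw [gradient_add_apply ((hst t ht.1).contDiff_sub hU₀) ((hst s hs.1).contDiff_sub hU₀),
          gradient_sub_apply (h.potential t ht.1).contDiff hU₀.contDiff,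
          gradient_sub_apply (h.potential s hs.1).contDiff hU₀.contDiff]
        have n1 := (hB t ht z.1).trans (le_abs_self B)
        have n2 := (hB s hs z.1).trans (le_abs_self B)
        have n3 := (hB₀ z.1 (by simpa using hz1)).trans (le_abs_self B₀)
        have n4 := norm_add_le (gradient (U t) z.1 - gradient U₀ z.1)
          (gradient (U s) z.1 - gradient U₀ z.1)
        have n5 := norm_sub_le (gradient (U t) z.1) (gradient U₀ z.1)
        have n6 := norm_sub_le (gradient (U s) z.1) (gradient U₀ z.1)
        linarith
      exact mul_le_mul hn hz2 (norm_nonneg _) (by positivity)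
  have hlip : LipschitzOnWith (Real.toNNReal c) (fun t => fieldEnergy U₀ (U t)) (Icc 0 T) := by
    refine LipschitzOnWith.of_dist_le_mul fun s hs t ht => ?_
    rw [Real.coe_toNNReal _ hc0, Real.dist_eq, Real.dist_eq]
    rcases le_total s t with hle | hle
    · rw [abs_sub_comm, abs_sub_comm s t, abs_of_nonneg (sub_nonneg.2 hle)]
      exact key s hs t ht hle
    · rw [abs_of_nonneg (sub_nonneg.2 hle)]
      exact key t ht s hs hle
  exact hlip.continuousOn

/-- Conservation of the difference of free energy and field energy. -/
theorem freeEnergy_sub_fieldEnergy_eq (h : IsSolution f U)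
    (hc : HasCompactSupport (fun z : R3 × R3 => f 0 z.1 z.2))
    (hU₀ : IsKingPotential E₀ U₀) (hS : MemS (kingDensity E₀ U₀) (f 0)) {T : ℝ} (hT : 0 ≤ T) :
    freeEnergy E₀ U₀ (f T) - fieldEnergy U₀ (U T)
      = freeEnergy E₀ U₀ (f 0) - fieldEnergy U₀ (U 0) := by
  obtain ⟨R, hR0, hR⟩ := h.exists_support_bound hc T
  set m := ∫ z : R3 × R3, kingDensity E₀ U₀ z.1 z.2
  have hm0 : 0 ≤ m := integral_nonneg fun z => kingDensity_nonneg _ _ _ _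
  have hst : ∀ t, 0 ≤ t → IsState E₀ U₀ (f t) (U t) := fun t ht => h.isState hc hU₀ hS ht
  have hE : ContDiff ℝ 2 (fun z : R3 × R3 => energy U₀ z.1 z.2 - E₀) :=
    (contDiff_energy hU₀.contDiff).sub contDiff_const
  set H : ℝ → ℝ := fun t => freeEnergy E₀ U₀ (f t) - fieldEnergy U₀ (U t) with hH
  have hunif : UniformContinuousOn (fun p : ℝ × R3 => gradient (U p.1) p.2)
      (Icc 0 T ×ˢ Metric.closedBall (0 : R3) R) :=
    (isCompact_Icc.prod (isCompact_closedBall _ _)).uniformContinuousOn_of_continuous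
      (h.continuous_field.mono fun p hp => ⟨hp.1.1, mem_univ _⟩)
  have key : ∀ ε : ℝ, 0 < ε → ∃ δ : ℝ, 0 < δ ∧ ∀ s ∈ Icc 0 T, ∀ t ∈ Icc 0 T, s ≤ t → t - s < δ →
      |H t - H s| ≤ ε * R * m * (t - s) := by
    intro ε hε
    obtain ⟨δ, hδ, hu⟩ := Metric.uniformContinuousOn_iff.1 hunif ε hε
    refine ⟨δ, hδ, fun s hs t ht hle hlt => ?_⟩
    have hψ := ((hst t ht.1).contDiff_sub hU₀).add ((hst s hs.1).contDiff_sub hU₀)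
    have hψ1 : ContDiff ℝ 2 (fun z : R3 × R3 => ((U t - U₀) + (U s - U₀)) z.1) :=
      hψ.comp contDiff_fst
    -- That is ½|v|² + ½(U(t) + U(s)) − E₀. Its derivative along the flow at an intermediate time τ
    -- is v paired with the mean of ∇U(t) − ∇U(τ) and ∇U(s) − ∇U(τ), small by uniform continuity of
    -- the field.
    set ζ : R3 × R3 → ℝ := fun z => (energy U₀ z.1 z.2 - E₀)
      + 1 / 2 * ((U t - U₀) + (U s - U₀)) z.1 with hζ
    have hζ1 : ContDiff ℝ 1 ζ := (hE.add (contDiff_const.mul hψ1)).of_le (by norm_num)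
    have e1 : H t - H s = (∫ z : R3 × R3, ζ z * f t z.1 z.2) - ∫ z : R3 × R3, ζ z * f s z.1 z.2 := by
      have d1 := (hst t ht.1).fieldEnergy_sub (hst s hs.1) hU₀
      have a1 := (hst t ht.1).integrable_continuous_mul hE.continuous
      have a2 := (hst s hs.1).integrable_continuous_mul hE.continuous
      have b1 := (hst t ht.1).integrable_continuous_mul hψ1.continuous
      have b2 := (hst s hs.1).integrable_continuous_mul hψ1.continuous
      simp_rw [mul_sub] at d1
      rw [integral_sub b1 b2] at d1
      have c1 : ∀ τ, (∫ z : R3 × R3, ζ z * f τ z.1 z.2)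
          = ∫ z : R3 × R3, ((energy U₀ z.1 z.2 - E₀) * f τ z.1 z.2
            + 1 / 2 * (((U t - U₀) + (U s - U₀)) z.1 * f τ z.1 z.2)) := fun τ =>
        integral_congr_ae (Eventually.of_forall fun z => by simp only [hζ]; ring)
      rw [c1, c1, integral_add a1 (b1.const_mul _), integral_add a2 (b2.const_mul _),
        integral_const_mul, integral_const_mul]
      simp only [hH]
      rw [(hst t ht.1).freeEnergy_eq hU₀, (hst s hs.1).freeEnergy_eq hU₀,
        h.integral_casimirFun_eq hc ht.1, h.integral_casimirFun_eq hc hs.1]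
      linarith
    rw [e1]
    refine h.abs_integral_mul_sub_le hc hζ1 hs.1 hle
      (fun τ hτ => hR τ ⟨hs.1.trans hτ.1, hτ.2.trans ht.2⟩) (fun τ hτ z hz1 hz2 => ?_) (m := m)
      (fun τ hτ => ⟨(hst τ (hs.1.trans hτ.1)).integrable, (hst τ (hs.1.trans hτ.1)).integral_eq⟩)
    have dψ : HasFDerivAt (fun z : R3 × R3 => ((U t - U₀) + (U s - U₀)) z.1)
        ((fderiv ℝ ((U t - U₀) + (U s - U₀)) z.1).comp (ContinuousLinearMap.fst ℝ R3 R3)) z :=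
      HasFDerivAt.comp z (g := (U t - U₀) + (U s - U₀))
        (hψ.differentiable (by norm_num) z.1).hasFDerivAt hasFDerivAt_fst
    have dE : HasFDerivAt (fun z : R3 × R3 => energy U₀ z.1 z.2 - E₀)
        (fderiv ℝ (fun z : R3 × R3 => energy U₀ z.1 z.2) z) z :=
      (((contDiff_energy hU₀.contDiff).differentiable (by norm_num) z).hasFDerivAt).sub_const E₀
    have dζ : HasFDerivAt ζ _ z := dE.add (dψ.const_mul (1 / 2))
    have hτT : τ ∈ Icc 0 T := ⟨hs.1.trans hτ.1, hτ.2.trans ht.2⟩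
    have e2 : fderiv ℝ ζ z (z.2, -gradient (U τ) z.1)
        = inner ℝ (((1 : ℝ) / 2) • (gradient (U t) z.1 - gradient (U τ) z.1)
          + ((1 : ℝ) / 2) • (gradient (U s) z.1 - gradient (U τ) z.1)) z.2 := by
      rw [dζ.fderiv, add_apply, fderiv_energy_apply (hU₀.contDiff.differentiable (by norm_num)),
        smul_apply, ContinuousLinearMap.comp_apply, ContinuousLinearMap.coe_fst',
        ← inner_gradient_left ((U t - U₀) + (U s - U₀)),
        gradient_add_apply ((hst t ht.1).contDiff_sub hU₀) ((hst s hs.1).contDiff_sub hU₀),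
        gradient_sub_apply (h.potential t ht.1).contDiff hU₀.contDiff,
        gradient_sub_apply (h.potential s hs.1).contDiff hU₀.contDiff, ← inner_gradient_left U₀]
      simp only [inner_add_left, inner_sub_left, inner_smul_left, inner_neg_right, smul_eq_mul,
        real_inner_comm z.2 (gradient (U τ) z.1), conj_trivial]
      ring
    rw [e2, ← Real.norm_eq_abs]
    refine (norm_inner_le_norm _ _).trans (mul_le_mul ?_ hz2 (norm_nonneg _) hε.le)
    have hx : z.1 ∈ Metric.closedBall (0 : R3) R := by simpa using hz1
    have n1 := hu (t, z.1) ⟨ht, hx⟩ (τ, z.1) ⟨hτT, hx⟩ (by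
      rw [Prod.dist_eq, dist_self, Real.dist_eq, abs_of_nonneg (sub_nonneg.2 hτ.2)]
      exact max_lt (by linarith [hτ.1]) hδ)
    have n2 := hu (s, z.1) ⟨hs, hx⟩ (τ, z.1) ⟨hτT, hx⟩ (by
      rw [Prod.dist_eq, dist_self, Real.dist_eq, abs_sub_comm, abs_of_nonneg (sub_nonneg.2 hτ.1)]
      exact max_lt (by linarith [hτ.2]) hδ)
    rw [dist_eq_norm] at n1 n2
    refine (norm_add_le _ _).trans ?_
    rw [norm_smul, norm_smul, Real.norm_of_nonneg (by norm_num : (0 : ℝ) ≤ 1 / 2)]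
    linarith
  -- Increments are o(t − s) uniformly, so subdividing [0, T] shows that H is constant.
  have hsmall : ∀ ε : ℝ, 0 < ε → |H T - H 0| ≤ ε * R * m * T := by
    intro ε hε
    obtain ⟨δ, hδ, hk⟩ := key ε hε
    obtain ⟨N, hN⟩ := exists_nat_gt (T / δ)
    have hN0 : 0 < (N : ℝ) := (div_nonneg hT hδ.le).trans_lt hN
    have hstep : T / N < δ := by
      rw [div_lt_iff₀ hN0]; rw [div_lt_iff₀ hδ] at hN; linarith
    have hind : ∀ k : ℕ, k ≤ N → |H (k * (T / N)) - H 0| ≤ ε * R * m * (k * (T / N)) := by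
      intro k
      induction k with
      | zero => intro _; simp
      | succ k ih =>
        intro hk1
        have ih' := ih (by omega)
        have hq : 0 ≤ T / N := by positivity
        have hle1 : ((k + 1 : ℕ) : ℝ) * (T / N) ≤ T := by
          have h3 : ((k + 1 : ℕ) : ℝ) ≤ N := by exact_mod_cast hk1
          calc ((k + 1 : ℕ) : ℝ) * (T / N) ≤ N * (T / N) := by gcongr
            _ = T := by field_simp
        have he : ((k + 1 : ℕ) : ℝ) * (T / N) = k * (T / N) + T / N := by push_cast; ring
        have hs0 : 0 ≤ (k : ℝ) * (T / N) := by positivity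
        have h4 := hk (k * (T / N)) ⟨hs0, by linarith⟩ (((k + 1 : ℕ) : ℝ) * (T / N))
          ⟨by linarith, hle1⟩ (by linarith) (by linarith)
        have h5 := abs_sub_le (H (((k + 1 : ℕ) : ℝ) * (T / N))) (H (k * (T / N))) (H 0)
        have h6 : ε * R * m * (((k + 1 : ℕ) : ℝ) * (T / N) - k * (T / N))
            + ε * R * m * (k * (T / N)) = ε * R * m * (((k + 1 : ℕ) : ℝ) * (T / N)) := by ring
        linarith
    have h7 := hind N le_rfl
    rwa [show (N : ℝ) * (T / N) = T by field_simp] at h7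
  have hzero : |H T - H 0| ≤ 0 := by
    refine le_of_forall_pos_le_add fun η hη => ?_
    have h8 := hsmall (η / (R * m * T + 1)) (by positivity)
    refine h8.trans ?_
    rw [zero_add]
    have h9 : η / (R * m * T + 1) * R * m * T = η * ((R * m * T) / (R * m * T + 1)) := by ring
    rw [h9]
    refine mul_le_of_le_one_right hη.le ((div_le_one (by positivity)).2 (by linarith))
  have := abs_nonpos_iff.1 hzero
  simp only [hH] at this
  linarith

end IsSolution

/-! ### The radius at which the virial function vanishes -/

/-- Projection of the real line onto `[a, R]`. -/
def clampTo (a R r : ℝ) : ℝ := max a (min R r)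

theorem clampTo_mono (a R : ℝ) : Monotone (clampTo a R) := fun _ _ h =>
  max_le_max le_rfl (min_le_min le_rfl h)

theorem continuous_clampTo (a R : ℝ) : Continuous (clampTo a R) := by unfold clampTo; fun_prop

theorem le_clampTo (a R r : ℝ) : a ≤ clampTo a R r := le_max_left _ _

theorem clampTo_le {a R : ℝ} (h : a ≤ R) (r : ℝ) : clampTo a R r ≤ R := max_le h (min_le_left _ _)

theorem clampTo_of_mem {a R r : ℝ} (h1 : a ≤ r) (h2 : r ≤ R) : clampTo a R r = r := by
  rw [clampTo, min_eq_right h2, max_eq_right h1]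

theorem clampTo_of_le {a R r : ℝ} (h : r ≤ a) : clampTo a R r = a :=
  max_eq_left ((min_le_right _ _).trans h)

theorem clampTo_sub_le {a R r s : ℝ} (h : r ≤ s) : clampTo a R s - clampTo a R r ≤ s - r := by
  unfold clampTo
  rcases max_cases a (min R s) with ⟨h1, h1'⟩ | ⟨h1, h1'⟩ <;>
  rcases max_cases a (min R r) with ⟨h2, h2'⟩ | ⟨h2, h2'⟩ <;>
  rcases min_cases R s with ⟨h3, h3'⟩ | ⟨h3, h3'⟩ <;>
  rcases min_cases R r with ⟨h4, h4'⟩ | ⟨h4, h4'⟩ <;>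
  linarith

theorem abs_clampTo_sub_le (a R r s : ℝ) : |clampTo a R s - clampTo a R r| ≤ |s - r| := by
  rcases le_total r s with h | h
  · rw [abs_of_nonneg (sub_nonneg.2 (clampTo_mono a R h)), abs_of_nonneg (sub_nonneg.2 h)]
    exact clampTo_sub_le h
  · rw [abs_of_nonpos (sub_nonpos.2 (clampTo_mono a R h)), abs_of_nonpos (sub_nonpos.2 h), neg_sub,
      neg_sub]
    exact clampTo_sub_le h

/-- The radius, clamped to `[a, R]`, at which the virial function vanishes on an energy level. -/
theorem IsKingPotential.exists_virialRadius {E₀ : ℝ} {U₀ : R3 → ℝ} (h : IsKingPotential E₀ U₀)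
    {a R : ℝ} (ha : 0 < a) (haR : a ≤ R) :
    ∃ (ρ : ℝ → ℝ) (c : ℝ), 0 ≤ c ∧ (∀ E, a ≤ ρ E) ∧ (∀ E E', |ρ E - ρ E'| ≤ c * |E - E'|) ∧
      ∀ z : R3 × R3, ‖z.1‖ ≤ R →
        |max ‖z.1‖ a - ρ (energy U₀ z.1 z.2)| ≤ c * |virial U₀ z| := by
  obtain ⟨c₁, hc₁, hΘ⟩ := h.exists_mul_le_virialEnergy_sub ha R
  have hcont : Continuous (virialEnergy U₀) := by
    have h1 := (contDiff_profile h.contDiff).continuous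
    have h2 := (IsRadial.contDiff_deriv_profile h.contDiff).continuous
    unfold virialEnergy
    fun_prop
  -- Continue `virialEnergy` from [a, R] with slope 1 on both sides. The result is an expanding
  -- bijection of the line whose inverse is Lipschitz with constant 1/c.
  set Θ : ℝ → ℝ := fun r => virialEnergy U₀ (clampTo a R r) + (r - clampTo a R r) with hΘdef
  have hΘc : Continuous Θ :=
    (hcont.comp (continuous_clampTo a R)).add (continuous_id.sub (continuous_clampTo a R))
  set c := min c₁ 1 with hc
  have hc0 : 0 < c := lt_min hc₁ one_pos
  have hexp : ∀ r s, r ≤ s → c * (s - r) ≤ Θ s - Θ r := by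
    intro r s hrs
    have h1 := hΘ (clampTo a R r) (clampTo a R s) (le_clampTo _ _ _) (clampTo_mono a R hrs)
      (clampTo_le haR s)
    have h2 : 0 ≤ clampTo a R s - clampTo a R r := sub_nonneg.2 (clampTo_mono a R hrs)
    have h3 : clampTo a R s - clampTo a R r ≤ s - r := clampTo_sub_le hrs
    have h4 := mul_le_mul_of_nonneg_right (min_le_left c₁ 1) h2
    have h5 := mul_le_mul_of_nonneg_right (min_le_right c₁ 1) (sub_nonneg.2 h3)
    simp only [hΘdef]
    rw [← hc] at h4 h5
    linarith
  have habs : ∀ r s, c * |s - r| ≤ |Θ s - Θ r| := by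
    intro r s
    rcases le_total r s with hrs | hrs
    · rw [abs_of_nonneg (sub_nonneg.2 hrs)]
      exact (hexp r s hrs).trans (le_abs_self _)
    · rw [abs_sub_comm, abs_of_nonneg (sub_nonneg.2 hrs), abs_sub_comm (Θ s)]
      exact (hexp s r hrs).trans (le_abs_self _)
  have hsurj : Function.Surjective Θ := by
    refine hΘc.surjective ?_ ?_
    · have h1 : Tendsto (fun s : ℝ => Θ 0 + c * s) atTop atTop :=
        tendsto_atTop_add_const_left _ _ (tendsto_id.const_mul_atTop hc0)
      refine tendsto_atTop_mono' _ ?_ h1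
      filter_upwards [eventually_ge_atTop 0] with s hs
      have := hexp 0 s hs
      linarith
    · have h1 : Tendsto (fun s : ℝ => Θ 0 + c * s) atBot atBot :=
        tendsto_atBot_add_const_left _ _ (tendsto_id.const_mul_atBot hc0)
      refine tendsto_atBot_mono' _ ?_ h1
      filter_upwards [eventually_le_atBot 0] with s hs
      have := hexp s 0 hs
      linarith
  set q := Function.surjInv hsurj with hq
  have hq1 : ∀ y, Θ (q y) = y := Function.surjInv_eq hsurj
  have hΘa : Θ a = virialEnergy U₀ a := by
    simp only [hΘdef]; rw [clampTo_of_mem le_rfl haR]; ring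
  -- The virial function is 2E − `virialEnergy`, hence the argument 2E and the factor 2.
  refine ⟨fun E => clampTo a R (q (2 * E)), 2 / c, by positivity, fun E => le_clampTo _ _ _,
    fun E E' => ?_, fun z hz => ?_⟩
  · have h1 := habs (q (2 * E')) (q (2 * E))
    rw [hq1, hq1, ← mul_sub, abs_mul, abs_two] at h1
    refine (abs_clampTo_sub_le _ _ _ _).trans ?_
    rw [div_mul_eq_mul_div, le_div_iff₀ hc0]
    linarith
  · rw [virial_eq h.isRadial h.contDiff z]
    set E := energy U₀ z.1 z.2
    set r := ‖z.1‖
    suffices hs : c * |max r a - clampTo a R (q (2 * E))| ≤ |2 * E - virialEnergy U₀ r| by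
      have h0 : 0 ≤ |2 * E - virialEnergy U₀ r| := abs_nonneg _
      rw [div_mul_eq_mul_div, le_div_iff₀ hc0]
      linarith
    rcases le_total a r with har | har
    · have e1 : clampTo a R r = r := clampTo_of_mem har hz
      have e2 : Θ r = virialEnergy U₀ r := by simp only [hΘdef]; rw [e1]; ring
      rw [max_eq_left har, ← e2]
      have h1 := habs r (q (2 * E))
      have h2 := abs_clampTo_sub_le a R r (q (2 * E))
      rw [e1] at h2
      rw [abs_sub_comm r]
      rw [hq1] at h1
      exact (mul_le_mul_of_nonneg_left h2 hc0.le).trans h1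
    · rw [max_eq_right har]
      rcases le_total (q (2 * E)) a with hqa | hqa
      · rw [clampTo_of_le hqa, sub_self, abs_zero, mul_zero]
        exact abs_nonneg _
      · have h1 := hexp a (q (2 * E)) hqa
        rw [hq1, hΘa] at h1
        have h2 := abs_clampTo_sub_le a R a (q (2 * E))
        rw [clampTo_of_le le_rfl, abs_of_nonneg (sub_nonneg.2 hqa)] at h2
        -- For |x| < a with the zero beyond a, monotonicity gives 2E ≥ `virialEnergy` at a ≥ its
        -- value at |x|: replacing |x| by a only shrinks the virial function.
        have h3 := h.virialEnergy_mono (mem_Ici.2 (norm_nonneg z.1)) (mem_Ici.2 ha.le) har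
        rw [abs_sub_comm]
        refine (mul_le_mul_of_nonneg_left h2 hc0.le).trans (h1.trans ((le_abs_self _).trans' ?_))
        linarith

/-! ### The Antonov-type estimate -/

/-- The derivative of a locally Lipschitz function of `e` vanishes where that of `e` does. -/
theorem fderiv_comp_apply_eq_zero {X : Type*} [NormedAddCommGroup X] [NormedSpace ℝ X]
    {n : ℝ → ℝ} (hn : LocallyLipschitz n) {e : X → ℝ} {z d : X} (he : DifferentiableAt ℝ e z)
    (hd : fderiv ℝ e z d = 0) (hne : DifferentiableAt ℝ (fun z => n (e z)) z) :
    fderiv ℝ (fun z => n (e z)) z d = 0 := by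
  have h1 : HasDerivAt (fun t : ℝ => e (z + t • d)) 0 0 := by
    have := he.hasFDerivAt.hasLineDerivAt d
    rw [hd] at this
    exact this
  have h2 : HasDerivAt (fun t : ℝ => n (e (z + t • d))) (fderiv ℝ (fun z => n (e z)) z d) 0 :=
    hne.hasFDerivAt.hasLineDerivAt d
  have h3 : HasDerivAt (fun t : ℝ => n (e (z + t • d))) 0 0 := by
    rw [hasDerivAt_iff_isLittleO] at h1 ⊢
    simp only [zero_smul, add_zero, sub_zero, smul_zero] at h1 ⊢
    obtain ⟨K, t, ht, hK⟩ := hn (e z)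
    have hc : ContinuousAt (fun s : ℝ => e (z + s • d)) 0 := by
      have : ContinuousAt e (z + (0 : ℝ) • d) := by simpa using he.continuousAt
      exact ContinuousAt.comp (g := e) (f := fun s : ℝ => z + s • d) this (by fun_prop)
    refine Asymptotics.IsBigO.trans_isLittleO (Asymptotics.IsBigO.of_bound K ?_) h1
    have hc' := hc.tendsto
    simp only [zero_smul, add_zero] at hc'
    filter_upwards [hc'.eventually ht] with s hs
    have := hK.dist_le_mul _ hs _ (mem_of_mem_nhds ht)
    rwa [dist_eq_norm, dist_eq_norm] at this
  exact h2.unique h3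

theorem integrable_fderiv_apply {C : NNReal} {H : R3 × R3 → ℝ} (hH : LipschitzWith C H)
    (hc : HasCompactSupport H) {d : R3 × R3 → R3 × R3} (hd : Continuous d) :
    Integrable (fun z => fderiv ℝ H z (d z)) := by
  obtain ⟨B, hB⟩ := hc.isCompact.exists_bound_of_continuousOn hd.continuousOn
  refine integrable_of_bound_of_isCompact (C := C * B)
    (aestronglyMeasurable_fderiv_apply H hd.aestronglyMeasurable) hc.isCompact
    (fun z hz => ?_) fun z hz => ?_
  · rw [fderiv_eq_zero_of_notMem_of_isClosed (isClosed_tsupport H)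
      (fun y hy => image_eq_zero_of_notMem_tsupport hy) hz]
    simp
  · rw [← Real.norm_eq_abs]
    refine ((fderiv ℝ H z).le_opNorm _).trans ?_
    exact mul_le_mul (norm_fderiv_le_of_lipschitz ℝ hH) (hB z hz) (norm_nonneg _) C.2

theorem IsRadial.hasFDerivAt_clamped {W : R3 → ℝ} (h : IsRadial W) (hW : ContDiff ℝ 2 W) {a : ℝ}
    {x : R3} (hx : ‖x‖ ≠ a) :
    HasFDerivAt (fun y => profile W (max ‖y‖ a)) (if a < ‖x‖ then fderiv ℝ W x else 0) x := by
  rcases lt_or_gt_of_ne hx with hlt | hgt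
  · rw [if_neg (not_lt.2 hlt.le)]
    refine (hasFDerivAt_const (profile W a) x).congr_of_eventuallyEq ?_
    filter_upwards [continuous_norm.continuousAt.eventually (gt_mem_nhds hlt)] with y hy
    rw [max_eq_right (le_of_lt hy)]
  · rw [if_pos hgt]
    refine (hW.differentiable (by norm_num) x).hasFDerivAt.congr_of_eventuallyEq ?_
    filter_upwards [continuous_norm.continuousAt.eventually (lt_mem_nhds hgt)] with y hy
    rw [max_eq_left (le_of_lt hy), h.eq_profile y]

/-- The derivative along the flow of `x ↦ w(max |x| a)`. -/
def clampedFlow (W : R3 → ℝ) (a : ℝ) (z : R3 × R3) : ℝ :=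
  if a < ‖z.1‖ then fderiv ℝ W z.1 z.2 else 0

theorem measurable_clampedFlow {W : R3 → ℝ} (hW : ContDiff ℝ 2 W) (a : ℝ) :
    Measurable (clampedFlow W a) := by
  have h1 := hW.continuous_fderiv (by norm_num)
  refine Measurable.ite (measurableSet_lt measurable_const (by fun_prop)) ?_ measurable_const
  exact (by fun_prop : Continuous fun z : R3 × R3 => fderiv ℝ W z.1 z.2).measurable

theorem measurable_kappa {U₀ : R3 → ℝ} (h : ContDiff ℝ 2 U₀) : Measurable (kappa U₀) := by
  have h1 := (continuous_laplacian h).measurable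
  have h2 := (IsRadial.contDiff_deriv_profile h).continuous.measurable
  exact h1.add ((h2.comp measurable_norm).div measurable_norm)

theorem IsKingPotential.kappa_mem {E₀ : ℝ} {U₀ : R3 → ℝ} (h : IsKingPotential E₀ U₀) (x : R3) :
    0 ≤ kappa U₀ x ∧ kappa U₀ x ≤ 4 / 3 * Laplacian.laplacian U₀ 0 := by
  by_cases hx : x = 0
  · subst hx
    have := h.laplacian_zero_pos
    simp only [kappa, norm_zero, div_zero, add_zero]
    constructor <;> linarith
  · exact ⟨(h.kappa_pos hx).le, h.kappa_le hx⟩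

/-- The two sides differ by the square (ω/κ)(p + κηθg/(θ² + ε))². The first bracket on the right is
the derivative of ωg²·ηθ/(θ² + ε) along a flow with Dη = θ, Dθ = −κη, Dg = p, Dω = 0; here ηθ/(θ² +
ε) regularises η/θ. -/
theorem transport_inequality {κ ω ε : ℝ} (hκ : 0 < κ) (hω : 0 ≤ ω) (hε : 0 < ε) (θ η g p : ℝ) :
    ω * (θ ^ 2 / (θ ^ 2 + ε) * g ^ 2)
      ≤ (η * (θ / (θ ^ 2 + ε)) * (ω * (2 * g * p))
          + ω * (g * g) * (θ * (θ / (θ ^ 2 + ε))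
            + η * ((ε - θ ^ 2) / (θ ^ 2 + ε) ^ 2 * -(κ * η))))
        + ω * (p ^ 2 / κ + κ * η ^ 2 * (ε * g ^ 2 / (θ ^ 2 + ε) ^ 2)) := by
  have hD : 0 < θ ^ 2 + ε := by positivity
  have h : 0 ≤ ω / κ * (p + κ * η * (θ / (θ ^ 2 + ε)) * g) ^ 2 := by positivity
  have e : (η * (θ / (θ ^ 2 + ε)) * (ω * (2 * g * p))
          + ω * (g * g) * (θ * (θ / (θ ^ 2 + ε))
            + η * ((ε - θ ^ 2) / (θ ^ 2 + ε) ^ 2 * -(κ * η))))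
        + ω * (p ^ 2 / κ + κ * η ^ 2 * (ε * g ^ 2 / (θ ^ 2 + ε) ^ 2))
        - ω * (θ ^ 2 / (θ ^ 2 + ε) * g ^ 2)
        = ω / κ * (p + κ * η * (θ / (θ ^ 2 + ε)) * g) ^ 2 := by
    field_simp
    ring
  linarith

theorem mul_div_sq_le_one {ε : ℝ} (hε : 0 < ε) (θ : ℝ) : ε * θ ^ 2 / (θ ^ 2 + ε) ^ 2 ≤ 1 := by
  rw [div_le_one (by positivity)]
  nlinarith [sq_nonneg θ, sq_nonneg (θ ^ 2), mul_nonneg hε.le (sq_nonneg θ), sq_nonneg ε]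

section Linear

variable {E₀ : ℝ} {U₀ : R3 → ℝ} {W : R3 → ℝ} {a R C ε : ℝ} {n ω : ℝ → ℝ}

/-- Clamping makes the numerator vanish for |x| ≤ a, and on the remaining annulus κ is bounded
below. -/
theorem exists_clampedFlow_bound (h : IsKingPotential E₀ U₀) (hW : ContDiff ℝ 2 W) (ha : 0 < a)
    (hR : ∀ x, U₀ x ≤ E₀ / 2 → ‖x‖ ≤ R) :
    ∃ B, 0 ≤ B ∧ ∀ z : R3 × R3, energy U₀ z.1 z.2 ≤ E₀ / 2 →
      clampedFlow W a z ^ 2 / kappa U₀ z.1 ≤ B := by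
  obtain ⟨c, hc, hκ⟩ := h.exists_le_kappa ha R
  have h1 := hW.continuous_fderiv (by norm_num)
  obtain ⟨B, hB⟩ := h.isCompact_energy_le.exists_bound_of_continuousOn
    (by fun_prop : Continuous fun z : R3 × R3 => fderiv ℝ W z.1 z.2).continuousOn
  refine ⟨B ^ 2 / c, by positivity, fun z hz => ?_⟩
  rw [clampedFlow]
  split_ifs with hlt
  · have hx : ‖z.1‖ ≤ R := hR _ (by
      unfold energy at hz
      nlinarith [sq_nonneg ‖z.2‖])
    have h2 := hB z hz
    rw [Real.norm_eq_abs] at h2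
    have h3 : (fderiv ℝ W z.1 z.2) ^ 2 ≤ B ^ 2 := sq_le_sq' (abs_le.1 h2).1 (abs_le.1 h2).2
    exact div_le_div₀ (sq_nonneg B) h3 hc (hκ _ hlt.le hx)
  · simp only [ne_eq, OfNat.ofNat_ne_zero, not_false_eq_true, zero_pow, zero_div]
    positivity

/-- The weighted deviation from a function of the energy. -/
def deviation (U₀ W : R3 → ℝ) (a : ℝ) (n : ℝ → ℝ) (z : R3 × R3) : ℝ :=
  profile W (max ‖z.1‖ a) - n (energy U₀ z.1 z.2)

theorem continuous_deviation (h : IsKingPotential E₀ U₀) (hW : ContDiff ℝ 2 W)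
    (hn : Continuous n) : Continuous (deviation U₀ W a n) := by
  have h1 := (contDiff_profile hW).continuous
  have h2 := continuous_energy h.continuous
  unfold deviation
  fun_prop

/-- The regularisation error stays bounded as ε → 0 because the deviation is at most C|θ| and εθ² ≤
(θ² + ε)². This is the reason for choosing n so that the deviation vanishes with θ. -/
theorem regularized_bound (h : IsKingPotential E₀ U₀)
    (hR : ∀ x, U₀ x ≤ E₀ / 2 → ‖x‖ ≤ R) (hε : 0 < ε)
    (hC : ∀ z : R3 × R3, ‖z.1‖ ≤ R → |deviation U₀ W a n z| ≤ C * |virial U₀ z|)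
    {z : R3 × R3} (hz : energy U₀ z.1 z.2 ≤ E₀ / 2) :
    0 ≤ kappa U₀ z.1 * (inner ℝ z.1 z.2) ^ 2
        * (ε * deviation U₀ W a n z ^ 2 / (virial U₀ z ^ 2 + ε) ^ 2) ∧
    kappa U₀ z.1 * (inner ℝ z.1 z.2) ^ 2
        * (ε * deviation U₀ W a n z ^ 2 / (virial U₀ z ^ 2 + ε) ^ 2)
      ≤ 4 / 3 * Laplacian.laplacian U₀ 0 * (inner ℝ z.1 z.2) ^ 2 * C ^ 2 := by
  have hκ := h.kappa_mem z.1
  have hx : ‖z.1‖ ≤ R := hR _ (by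
    unfold energy at hz
    nlinarith [sq_nonneg ‖z.2‖])
  have h1 : deviation U₀ W a n z ^ 2 ≤ C ^ 2 * virial U₀ z ^ 2 := by
    have := hC z hx
    rw [← sq_abs (deviation U₀ W a n z), ← sq_abs (virial U₀ z), ← mul_pow]
    exact pow_le_pow_left₀ (abs_nonneg _) this 2
  have h2 : ε * deviation U₀ W a n z ^ 2 / (virial U₀ z ^ 2 + ε) ^ 2 ≤ C ^ 2 := by
    calc ε * deviation U₀ W a n z ^ 2 / (virial U₀ z ^ 2 + ε) ^ 2
        ≤ ε * (C ^ 2 * virial U₀ z ^ 2) / (virial U₀ z ^ 2 + ε) ^ 2 := by gcongr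
      _ = C ^ 2 * (ε * virial U₀ z ^ 2 / (virial U₀ z ^ 2 + ε) ^ 2) := by ring
      _ ≤ C ^ 2 * 1 := by gcongr; exact mul_div_sq_le_one hε _
      _ = C ^ 2 := mul_one _
  have h3 : 0 ≤ ε * deviation U₀ W a n z ^ 2 / (virial U₀ z ^ 2 + ε) ^ 2 := by positivity
  refine ⟨mul_nonneg (mul_nonneg hκ.1 (sq_nonneg _)) h3, ?_⟩
  exact mul_le_mul (mul_le_mul_of_nonneg_right hκ.2 (sq_nonneg _)) h2 h3
    (mul_nonneg (hκ.1.trans hκ.2) (sq_nonneg _))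

theorem measurable_regularized (h : IsKingPotential E₀ U₀) (hW : ContDiff ℝ 2 W)
    (hn : Continuous n) (hω : Continuous ω) :
    Measurable (fun z : R3 × R3 => ω (energy U₀ z.1 z.2)
      * (clampedFlow W a z ^ 2 / kappa U₀ z.1 + kappa U₀ z.1 * (inner ℝ z.1 z.2) ^ 2
        * (ε * deviation U₀ W a n z ^ 2 / (virial U₀ z ^ 2 + ε) ^ 2))) := by
  have h1 := measurable_clampedFlow hW a
  have h2 : Measurable (fun z : R3 × R3 => kappa U₀ z.1) :=
    (measurable_kappa h.contDiff).comp measurable_fst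
  have h3 := (hω.comp (continuous_energy h.continuous)).measurable
  have h4 := (continuous_deviation (a := a) h hW hn).measurable
  have h5 := (contDiff_virial h.contDiff).continuous.measurable
  have h6 : Measurable (fun z : R3 × R3 => inner ℝ z.1 z.2) :=
    (by fun_prop : Continuous fun z : R3 × R3 => inner ℝ z.1 z.2).measurable
  exact h3.mul (((h1.pow_const 2).div h2).add ((h2.mul (h6.pow_const 2)).mul
    (((h4.pow_const 2).const_mul ε).div (((h5.pow_const 2).add_const ε).pow_const 2))))

theorem ae_norm_fst_ne (a : ℝ) : ∀ᵐ z : R3 × R3, ‖z.1‖ ≠ a := by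
  have h1 : ∀ᵐ x : R3, ‖x‖ ≠ a := by
    have : volume (Metric.sphere (0 : R3) a) = 0 := Measure.addHaar_sphere _ _ _
    refine measure_mono_null (fun x hx => ?_) this
    have hx' : ‖x‖ = a := by simpa using hx
    simpa using hx'
  exact (Measure.quasiMeasurePreserving_fst (μ := (volume : Measure R3))
    (ν := (volume : Measure R3))).ae h1

set_option maxHeartbeats 1000000 in
-- The derivative of ω(E)g²·ηθ/(θ² + ε) along the flow of U₀ integrates to zero, and functions of
-- the energy, though only Lipschitz, have zero derivative along that flow almost everywhere. The
-- pointwise inequality is `transport_inequality`.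
theorem integral_regularized_le (h : IsKingPotential E₀ U₀) (hrad : IsRadial W)
    (hW : ContDiff ℝ 2 W) (ha : 0 < a) (hR : ∀ x, U₀ x ≤ E₀ / 2 → ‖x‖ ≤ R)
    (hn : LocallyLipschitz n) (hω : LocallyLipschitz ω) (hω0 : ∀ s, 0 ≤ ω s)
    (hωE : ∀ s, E₀ / 2 < s → ω s = 0) (hε : 0 < ε)
    (hC : ∀ z : R3 × R3, ‖z.1‖ ≤ R → |deviation U₀ W a n z| ≤ C * |virial U₀ z|) :
    ∫ z : R3 × R3, ω (energy U₀ z.1 z.2)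
        * (virial U₀ z ^ 2 / (virial U₀ z ^ 2 + ε) * deviation U₀ W a n z ^ 2)
      ≤ ∫ z : R3 × R3, ω (energy U₀ z.1 z.2)
        * (clampedFlow W a z ^ 2 / kappa U₀ z.1 + kappa U₀ z.1 * (inner ℝ z.1 z.2) ^ 2
          * (ε * deviation U₀ W a n z ^ 2 / (virial U₀ z ^ 2 + ε) ^ 2)) := by
  set e : R3 × R3 → ℝ := fun z => energy U₀ z.1 z.2 with he
  set θ := virial U₀ with hθ
  set η : R3 × R3 → ℝ := fun z => inner ℝ z.1 z.2 with hη
  set ψ : R3 × R3 → ℝ := fun z => profile W (max ‖z.1‖ a) with hψ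
  set g := deviation U₀ W a n with hg
  have ce : ContDiff ℝ 2 e := contDiff_energy h.contDiff
  have cθ : ContDiff ℝ 1 θ := contDiff_virial h.contDiff
  have cη : ContDiff ℝ 1 η := contDiff_fst.inner ℝ contDiff_snd
  have hden : ∀ z, 0 < θ z ^ 2 + ε := fun z => by positivity
  set A : R3 × R3 → ℝ := fun z => η z * (θ z / (θ z ^ 2 + ε)) with hA
  have cA : ContDiff ℝ 1 A :=
    cη.mul (cθ.div ((cθ.pow 2).add contDiff_const) fun z => (hden z).ne')
  have lψ : LocallyLipschitz ψ := by
    have h1 : LocallyLipschitz (profile W) :=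
      ((contDiff_profile hW).of_le (by norm_num : (1 : WithTop ℕ∞) ≤ 2)).locallyLipschitz (𝕂 := ℝ)
    have h2 : LocallyLipschitz (fun z : R3 × R3 => max ‖z.1‖ a) :=
      ((lipschitzWith_one_norm.comp LipschitzWith.prod_fst).locallyLipschitz).max
        (LocallyLipschitz.const a)
    exact h1.comp h2
  have le : LocallyLipschitz e :=
    (ce.of_le (by norm_num : (1 : WithTop ℕ∞) ≤ 2)).locallyLipschitz (𝕂 := ℝ)
  have lne : LocallyLipschitz (fun z => n (e z)) := hn.comp le
  have lωe : LocallyLipschitz (fun z => ω (e z)) := hω.comp le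
  have lg : LocallyLipschitz g :=
    (ContDiff.locallyLipschitz (𝕂 := ℝ)
      (by fun_prop : ContDiff ℝ 1 (fun q : ℝ × ℝ => q.1 - q.2))).comp (lψ.prodMk lne)
  have lG : LocallyLipschitz (fun z => A z * (ω (e z) * (g z * g z))) :=
    locallyLipschitz_mul (cA.locallyLipschitz (𝕂 := ℝ))
      (locallyLipschitz_mul lωe (locallyLipschitz_mul lg lg))
  have hD := h.isCompact_energy_le
  have hout : ∀ z ∉ {z : R3 × R3 | energy U₀ z.1 z.2 ≤ E₀ / 2}, ω (e z) = 0 := fun z hz =>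
    hωE _ (not_le.1 hz)
  have hcs : HasCompactSupport (fun z => A z * (ω (e z) * (g z * g z))) :=
    HasCompactSupport.of_support_subset_isCompact hD fun z hz => by
      by_contra hzD
      exact hz (by simp [hout z hzD])
  obtain ⟨K, hK⟩ := exists_lipschitzWith_of_locallyLipschitz lG hcs
  have cgrad : Continuous (gradient U₀) :=
    continuous_gradient (h.contDiff.of_le (by norm_num : (1 : WithTop ℕ∞) ≤ 2))
  have key := integral_fderiv_transport_eq_zero hK hcs cgrad
  have iT := integrable_fderiv_apply hK hcs
    (d := fun z : R3 × R3 => (z.2, -gradient U₀ z.1)) (by fun_prop)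
  have cω : Continuous (fun z => ω (e z)) := lωe.continuous
  have i1 : Integrable (fun z => ω (e z) * (θ z ^ 2 / (θ z ^ 2 + ε) * g z ^ 2)) := by
    refine Continuous.integrable_of_hasCompactSupport ?_
      (HasCompactSupport.of_support_subset_isCompact hD fun z hz => ?_)
    · have h1 := cθ.continuous
      have h2 := lg.continuous
      exact cω.mul ((Continuous.div (h1.pow 2) ((h1.pow 2).add continuous_const)
        fun z => (hden z).ne').mul (h2.pow 2))
    · by_contra hzD
      exact hz (by simp [hout z hzD])
  obtain ⟨B, hB0, hB⟩ := exists_clampedFlow_bound h hW ha hR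
  obtain ⟨Bη, hBη⟩ := hD.exists_bound_of_continuousOn cη.continuous.continuousOn
  obtain ⟨Bω, hBω⟩ := hD.exists_bound_of_continuousOn cω.continuousOn
  have i2 : Integrable (fun z : R3 × R3 => ω (e z)
      * (clampedFlow W a z ^ 2 / kappa U₀ z.1 + kappa U₀ z.1 * η z ^ 2
          * (ε * g z ^ 2 / (θ z ^ 2 + ε) ^ 2))) := by
    refine integrable_of_bound_of_isCompact
      (measurable_regularized h hW hn.continuous hω.continuous).aestronglyMeasurable hD
      (fun z hz => ?_)
      (C := Bω * (B + 4 / 3 * Laplacian.laplacian U₀ 0 * Bη ^ 2 * C ^ 2)) fun z hz => ?_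
    · rw [hout z hz, zero_mul]
    · have h1 := regularized_bound h hR hε hC hz
      have h2 := hB z hz
      have h3 : 0 ≤ clampedFlow W a z ^ 2 / kappa U₀ z.1 :=
        div_nonneg (sq_nonneg _) (h.kappa_mem z.1).1
      have h4 : η z ^ 2 ≤ Bη ^ 2 := by
        have := hBη z hz
        rw [Real.norm_eq_abs] at this
        exact sq_le_sq' (abs_le.1 this).1 (abs_le.1 this).2
      have h5 : 4 / 3 * Laplacian.laplacian U₀ 0 * η z ^ 2 * C ^ 2
          ≤ 4 / 3 * Laplacian.laplacian U₀ 0 * Bη ^ 2 * C ^ 2 := by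
        have := h.laplacian_zero_pos
        gcongr
      rw [abs_mul, abs_of_nonneg (add_nonneg h3 h1.1)]
      have h6 := hBω z hz
      exact mul_le_mul h6 (add_le_add h2 (h1.2.trans h5)) (add_nonneg h3 h1.1)
        ((norm_nonneg _).trans h6)
  have hpt : ∀ᵐ z : R3 × R3, ω (e z) * (θ z ^ 2 / (θ z ^ 2 + ε) * g z ^ 2)
      ≤ fderiv ℝ (fun z => A z * (ω (e z) * (g z * g z))) z (z.2, -gradient U₀ z.1)
        + ω (e z) * (clampedFlow W a z ^ 2 / kappa U₀ z.1 + kappa U₀ z.1 * η z ^ 2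
          * (ε * g z ^ 2 / (θ z ^ 2 + ε) ^ 2)) := by
    filter_upwards [ae_norm_fst_ne a, ae_norm_fst_ne 0,
      LocallyLipschitz.ae_differentiableAt_real lne,
      LocallyLipschitz.ae_differentiableAt_real lωe] with z hza hz0 dn dω
    have hx : z.1 ≠ 0 := by simpa using hz0
    set d : R3 × R3 := (z.2, -gradient U₀ z.1) with hd
    have de : fderiv ℝ e z d = 0 :=
      fderiv_energy_transport (h.contDiff.differentiable (by norm_num)) z
    have dediff : DifferentiableAt ℝ e z := ce.differentiable (by norm_num) z
    have tn : fderiv ℝ (fun z => n (e z)) z d = 0 := fderiv_comp_apply_eq_zero hn dediff de dn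
    have tω : fderiv ℝ (fun z => ω (e z)) z d = 0 := fderiv_comp_apply_eq_zero hω dediff de dω
    have hψd : HasFDerivAt ψ ((if a < ‖z.1‖ then fderiv ℝ W z.1 else 0).comp
        (ContinuousLinearMap.fst ℝ R3 R3)) z :=
      HasFDerivAt.comp z (g := fun y => profile W (max ‖y‖ a)) (hrad.hasFDerivAt_clamped hW hza)
        hasFDerivAt_fst
    have tψ : fderiv ℝ ψ z d = clampedFlow W a z := by
      rw [hψd.fderiv, ContinuousLinearMap.comp_apply, ContinuousLinearMap.coe_fst', clampedFlow]
      split_ifs <;> simp [hd]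
    have dg : DifferentiableAt ℝ g z := hψd.differentiableAt.sub dn
    have tg : fderiv ℝ g z d = clampedFlow W a z := by
      have : fderiv ℝ g z = fderiv ℝ ψ z - fderiv ℝ (fun z => n (e z)) z :=
        fderiv_sub hψd.differentiableAt dn
      rw [this, sub_apply, tψ, tn, sub_zero]
    have tη : fderiv ℝ η z d = θ z := fderiv_inner_transport U₀ z
    have tθ : fderiv ℝ θ z d = -(kappa U₀ z.1 * η z) := fderiv_virial_transport h.isRadial h.contDiff hx
    have dη : DifferentiableAt ℝ η z := cη.differentiable (by norm_num) z
    have dθ : DifferentiableAt ℝ θ z := cθ.differentiable (by norm_num) z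
    have hq : HasDerivAt (fun s : ℝ => s / (s ^ 2 + ε))
        ((ε - θ z ^ 2) / (θ z ^ 2 + ε) ^ 2) (θ z) := by
      have h1 := (hasDerivAt_id (θ z)).div
        ((hasDerivAt_pow 2 (θ z)).add_const ε) (hden z).ne'
      refine h1.congr_deriv ?_
      simp
      ring
    have hl : HasFDerivAt (fun z => θ z / (θ z ^ 2 + ε))
        (((ε - θ z ^ 2) / (θ z ^ 2 + ε) ^ 2) • fderiv ℝ θ z) z :=
      hq.comp_hasFDerivAt z dθ.hasFDerivAt
    have tl : fderiv ℝ (fun z => θ z / (θ z ^ 2 + ε)) z d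
        = (ε - θ z ^ 2) / (θ z ^ 2 + ε) ^ 2 * -(kappa U₀ z.1 * η z) := by
      rw [hl.fderiv, smul_apply, tθ, smul_eq_mul]
    have tA : fderiv ℝ A z d = η z * ((ε - θ z ^ 2) / (θ z ^ 2 + ε) ^ 2 * -(kappa U₀ z.1 * η z))
        + θ z / (θ z ^ 2 + ε) * θ z := by
      rw [hA, fderiv_mul_apply dη hl.differentiableAt, tl, tη]
    have dA : DifferentiableAt ℝ A z := cA.differentiable (by norm_num) z
    have dgg : DifferentiableAt ℝ (fun z => g z * g z) z := dg.mul dg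
    have dB : DifferentiableAt ℝ (fun z => ω (e z) * (g z * g z)) z := dω.mul dgg
    rw [fderiv_mul_apply dA dB, fderiv_mul_apply dω dgg, fderiv_mul_apply dg dg, tω, tg, tA]
    refine (transport_inequality (h.kappa_pos hx) (hω0 (e z)) hε (θ z) (η z) (g z)
      (clampedFlow W a z)).trans (le_of_eq ?_)
    simp only [hA]
    ring
  have := integral_mono_ae i1 (iT.add i2) hpt
  have e3 : ∫ z, ((fun z => fderiv ℝ (fun z => A z * (ω (e z) * (g z * g z))) z
      (z.2, -gradient U₀ z.1)) + fun z => ω (e z) * (clampedFlow W a z ^ 2 / kappa U₀ z.1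
      + kappa U₀ z.1 * η z ^ 2 * (ε * g z ^ 2 / (θ z ^ 2 + ε) ^ 2))) z = _ :=
    integral_add iT i2
  rw [e3, key, zero_add] at this
  exact this

end Linear

/-- `exp (E₀ - s)` for `s ≤ E₀` and zero otherwise. -/
def cutExp (E₀ s : ℝ) : ℝ := if s ≤ E₀ then Real.exp (E₀ - s) else 0

theorem cutExp_nonneg (E₀ s : ℝ) : 0 ≤ cutExp E₀ s := by
  unfold cutExp; split_ifs <;> positivity

theorem cutExp_le (E₀ s : ℝ) : cutExp E₀ s ≤ Real.exp (E₀ - s) := by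
  unfold cutExp; split_ifs
  · exact le_rfl
  · positivity

theorem measurable_cutExp (E₀ : ℝ) : Measurable (cutExp E₀) :=
  Measurable.ite measurableSet_Iic (by fun_prop) measurable_const

/-- Locally Lipschitz approximations of `cutExp`. -/
def cutExpApprox (E₀ k s : ℝ) : ℝ := Real.exp (E₀ - s) * max 0 (min 1 (1 - k * (s - E₀)))

theorem cutExpApprox_nonneg (E₀ k s : ℝ) : 0 ≤ cutExpApprox E₀ k s :=
  mul_nonneg (Real.exp_pos _).le (le_max_left _ _)

theorem cutExpApprox_le (E₀ k s : ℝ) : cutExpApprox E₀ k s ≤ Real.exp (E₀ - s) :=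
  mul_le_of_le_one_right (Real.exp_pos _).le (max_le zero_le_one (min_le_left _ _))

theorem locallyLipschitz_cutExpApprox (E₀ k : ℝ) : LocallyLipschitz (cutExpApprox E₀ k) := by
  have h1 : LocallyLipschitz (fun s : ℝ => Real.exp (E₀ - s)) :=
    ContDiff.locallyLipschitz (𝕂 := ℝ) (by fun_prop)
  have h2 : LocallyLipschitz (fun s : ℝ => 1 - k * (s - E₀)) :=
    ContDiff.locallyLipschitz (𝕂 := ℝ) (by fun_prop)
  exact locallyLipschitz_mul h1
    ((LocallyLipschitz.const 0).max ((LocallyLipschitz.const 1).min h2))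

theorem cutExpApprox_of_le {E₀ k s : ℝ} (hk : 0 ≤ k) (hs : s ≤ E₀) :
    cutExpApprox E₀ k s = Real.exp (E₀ - s) := by
  have : 1 ≤ 1 - k * (s - E₀) := by nlinarith
  rw [cutExpApprox, min_eq_left this, max_eq_right zero_le_one, mul_one]

theorem cutExpApprox_of_ge {E₀ k s : ℝ} (hs : 1 ≤ k * (s - E₀)) : cutExpApprox E₀ k s = 0 := by
  rw [cutExpApprox, max_eq_left ((min_le_right _ _).trans (by linarith)), mul_zero]

section Linear

variable {E₀ : ℝ} {U₀ : R3 → ℝ} {W : R3 → ℝ} {a R C : ℝ} {n : ℝ → ℝ}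

theorem integrable_cutExp_mul (h : IsKingPotential E₀ U₀) {φ : R3 × R3 → ℝ} (hφ : Measurable φ)
    {B : ℝ} (hB : ∀ z : R3 × R3, energy U₀ z.1 z.2 ≤ E₀ / 2 → |φ z| ≤ B) :
    Integrable (fun z : R3 × R3 => cutExp E₀ (energy U₀ z.1 z.2) * φ z) := by
  have hm : Measurable (fun z : R3 × R3 => cutExp E₀ (energy U₀ z.1 z.2) * φ z) :=
    ((measurable_cutExp E₀).comp (continuous_energy h.continuous).measurable).mul hφ
  refine integrable_of_bound_of_isCompact (C := Real.exp (E₀ - U₀ 0) * B) hm.aestronglyMeasurable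
    h.isCompact_energy_le (fun z hz => ?_) fun z hz => ?_
  · have : E₀ / 2 < energy U₀ z.1 z.2 := not_le.1 hz
    rw [cutExp, if_neg (by linarith [h.cutoff_neg]), zero_mul]
  · rw [abs_mul, abs_of_nonneg (cutExp_nonneg _ _)]
    refine mul_le_mul ((cutExp_le _ _).trans (Real.exp_le_exp.2 ?_)) (hB z hz) (abs_nonneg _)
      (Real.exp_pos _).le
    have := h.apply_zero_le z.1
    unfold energy
    nlinarith [sq_nonneg ‖z.2‖]

/-- For |x| > a the flow derivative of w is (w'/r)(x·v). `integral_exp_mul_inner_sq` evaluates the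
velocity integral to (ρ₀/κ)w'², and ρ₀/κ ≤ 3/(16π). -/
theorem integral_cutExp_clampedFlow_le (h : IsKingPotential E₀ U₀) (hrad : IsRadial W)
    (hW : ContDiff ℝ 2 W) (hi : Integrable (fun x => ‖gradient W x‖ ^ 2)) (ha : 0 < a)
    (hR : ∀ x, U₀ x ≤ E₀ / 2 → ‖x‖ ≤ R) :
    ∫ z : R3 × R3, cutExp E₀ (energy U₀ z.1 z.2) * (clampedFlow W a z ^ 2 / kappa U₀ z.1)
      ≤ 3 / (16 * Real.pi) * ∫ x, ‖gradient W x‖ ^ 2 := by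
  obtain ⟨B, hB0, hB⟩ := exists_clampedFlow_bound h hW ha hR
  have h2 : Measurable (fun z : R3 × R3 => kappa U₀ z.1) :=
    (measurable_kappa h.contDiff).comp measurable_fst
  have hint := integrable_cutExp_mul h (φ := fun z => clampedFlow W a z ^ 2 / kappa U₀ z.1)
    (((measurable_clampedFlow hW a).pow_const 2).div h2) (B := B) (fun z hz => by
      rw [abs_of_nonneg (div_nonneg (sq_nonneg _) (h.kappa_mem z.1).1)]; exact hB z hz)
  have e1 := integral_prod (μ := (volume : Measure R3)) (ν := (volume : Measure R3)) _ hint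
  refine (le_of_eq e1).trans ?_
  rw [← integral_const_mul]
  refine integral_mono_of_nonneg (Eventually.of_forall fun x => integral_nonneg fun v => ?_)
    (hi.const_mul _) (Eventually.of_forall fun x => ?_)
  · exact mul_nonneg (cutExp_nonneg _ _) (div_nonneg (sq_nonneg _) (h.kappa_mem x).1)
  · by_cases hx : a < ‖x‖
    · have hx0 : x ≠ 0 := norm_pos_iff.1 (ha.trans hx)
      have hxp : 0 < ‖x‖ := ha.trans hx
      have hκ := h.kappa_pos hx0
      set c := (deriv (profile W) ‖x‖ / ‖x‖) ^ 2 / kappa U₀ x with hc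
      have e2 : ∀ v, cutExp E₀ (energy U₀ x v) * (clampedFlow W a (x, v) ^ 2 / kappa U₀ x)
          = c * {v | energy U₀ x v ≤ E₀}.indicator
            (fun v => Real.exp (E₀ - energy U₀ x v) * (inner ℝ x v) ^ 2) v := by
        intro v
        have e3 : clampedFlow W a (x, v) = deriv (profile W) ‖x‖ / ‖x‖ * inner ℝ x v := by
          rw [clampedFlow, if_pos hx, ← inner_gradient_left, hrad.gradient_eq hW hx0,
            inner_smul_left]
          rfl
        rw [e3, cutExp]
        by_cases hv : energy U₀ x v ≤ E₀
        · rw [if_pos hv, indicator_of_mem (show v ∈ {v | energy U₀ x v ≤ E₀} from hv), hc]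
          ring
        · rw [if_neg hv, indicator_of_notMem (show v ∉ {v | energy U₀ x v ≤ E₀} from hv)]
          ring
      simp_rw [e2]
      rw [integral_const_mul, integral_exp_mul_inner_sq, hrad.norm_gradient_eq hW hx0, sq_abs]
      have h4 := h.four_pi_density_le_kappa hx0
      have h5 : density (kingDensity E₀ U₀) x / kappa U₀ x ≤ 3 / (16 * Real.pi) := by
        rw [div_le_div_iff₀ hκ (by positivity)]
        linarith
      have e4 : c * (‖x‖ ^ 2 * density (kingDensity E₀ U₀) x)
          = density (kingDensity E₀ U₀) x / kappa U₀ x * deriv (profile W) ‖x‖ ^ 2 := by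
        rw [hc]; field_simp
      rw [e4]
      exact mul_le_mul_of_nonneg_right h5 (sq_nonneg _)
    · have e2 : ∀ v, cutExp E₀ (energy U₀ x v) * (clampedFlow W a (x, v) ^ 2 / kappa U₀ x) = 0 := by
        intro v
        rw [clampedFlow, if_neg hx]
        simp
      simp_rw [e2]
      rw [integral_zero]
      positivity

set_option maxHeartbeats 1000000 in
/-- The Antonov-type stability estimate: on the support of the King model, a radial function is
close to a function of the energy. -/
theorem integral_cutExp_mul_deviation_sq_le (h : IsKingPotential E₀ U₀) (hrad : IsRadial W)
    (hW : ContDiff ℝ 2 W) (hi : Integrable (fun x => ‖gradient W x‖ ^ 2)) (ha : 0 < a)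
    (hR : ∀ x, U₀ x ≤ E₀ / 2 → ‖x‖ ≤ R) (hn : LocallyLipschitz n)
    (hC : ∀ z : R3 × R3, ‖z.1‖ ≤ R → |deviation U₀ W a n z| ≤ C * |virial U₀ z|) :
    ∫ z : R3 × R3, cutExp E₀ (energy U₀ z.1 z.2) * deviation U₀ W a n z ^ 2
      ≤ 3 / (16 * Real.pi) * ∫ x, ‖gradient W x‖ ^ 2 := by
  refine le_trans ?_ (integral_cutExp_clampedFlow_le h hrad hW hi ha hR)
  have hE := h.cutoff_neg
  -- Steepness at least 2/(−E₀) makes every approximate cut-off vanish above E₀/2. The same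
  -- parameter drives both the cut-offs to `cutExp` and ε to zero.
  obtain ⟨K, hK⟩ := exists_nat_gt (max 1 (2 / -E₀))
  have hK1 : (1 : ℝ) < K := (le_max_left _ _).trans_lt hK
  have hK2 : 2 / -E₀ < K := (le_max_right _ _).trans_lt hK
  set κ : ℕ → ℝ := fun k => (k : ℝ) + K with hκ
  have hκK : ∀ k, (K : ℝ) ≤ κ k := fun k => by simp [hκ]
  have hκ0 : ∀ k, 0 < κ k := fun k => by linarith [hκK k]
  have hκt : Tendsto κ atTop atTop :=
    tendsto_atTop_add_const_right _ _ tendsto_natCast_atTop_atTop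
  set ε : ℕ → ℝ := fun k => (κ k)⁻¹ with hε
  have hε0 : ∀ k, 0 < ε k := fun k => inv_pos.2 (hκ0 k)
  have hεt : Tendsto ε atTop (𝓝 0) := tendsto_inv_atTop_zero.comp hκt
  have hωE : ∀ k s, E₀ / 2 < s → cutExpApprox E₀ (κ k) s = 0 := by
    intro k s hs
    refine cutExpApprox_of_ge ?_
    have h1 : 2 < K * -E₀ := by rwa [div_lt_iff₀ (by linarith)] at hK2
    have h2 : (K : ℝ) * (-E₀ / 2) ≤ κ k * (s - E₀) :=
      mul_le_mul (hκK k) (by linarith) (by linarith) (hκ0 k).le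
    linarith
  have hmain := fun k => integral_regularized_le h hrad hW ha hR hn
    (locallyLipschitz_cutExpApprox E₀ (κ k)) (cutExpApprox_nonneg E₀ (κ k)) (hωE k) (hε0 k) hC
  have hD := h.isCompact_energy_le
  have hDm := hD.isClosed.measurableSet
  -- The factor θ²/(θ² + ε) fails to tend to 1 only on the zero set of θ, where the deviation is
  -- zero anyway.
  have hvan : ∀ z : R3 × R3, energy U₀ z.1 z.2 ≤ E₀ → virial U₀ z = 0 →
      deviation U₀ W a n z = 0 := by
    intro z hz hθ
    have hx : ‖z.1‖ ≤ R := hR _ (by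
      unfold energy at hz
      nlinarith [sq_nonneg ‖z.2‖])
    have := hC z hx
    rw [hθ, abs_zero, mul_zero] at this
    exact abs_nonpos_iff.1 this
  have hgt : ∀ s, E₀ < s → ∀ᶠ k in atTop, cutExpApprox E₀ (κ k) s = 0 := by
    intro s hs
    filter_upwards [hκt.eventually_ge_atTop (1 / (s - E₀))] with k hk
    refine cutExpApprox_of_ge ?_
    rwa [div_le_iff₀ (by linarith)] at hk
  have hlim : ∀ (z : R3 × R3) (φ : ℕ → ℝ) (φ' : ℝ),
      (energy U₀ z.1 z.2 ≤ E₀ → Tendsto φ atTop (𝓝 φ')) →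
      Tendsto (fun k => cutExpApprox E₀ (κ k) (energy U₀ z.1 z.2) * φ k) atTop
        (𝓝 (cutExp E₀ (energy U₀ z.1 z.2) * φ')) := by
    intro z φ φ' hφ
    by_cases hz : energy U₀ z.1 z.2 ≤ E₀
    · rw [cutExp, if_pos hz]
      refine ((hφ hz).const_mul _).congr fun k => ?_
      rw [cutExpApprox_of_le (hκ0 k).le hz]
    · rw [cutExp, if_neg hz, zero_mul]
      refine tendsto_const_nhds.congr' ?_
      filter_upwards [hgt _ (not_le.1 hz)] with k hk
      rw [hk, zero_mul]
  have hdom : ∀ (k : ℕ) (z : R3 × R3) (φ B : ℝ), (energy U₀ z.1 z.2 ≤ E₀ / 2 → |φ| ≤ B) →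
      ‖cutExpApprox E₀ (κ k) (energy U₀ z.1 z.2) * φ‖
        ≤ {z : R3 × R3 | energy U₀ z.1 z.2 ≤ E₀ / 2}.indicator
          (fun _ => Real.exp (E₀ - U₀ 0) * B) z := by
    intro k z φ B hφ
    by_cases hz : energy U₀ z.1 z.2 ≤ E₀ / 2
    · rw [indicator_of_mem (show z ∈ {z : R3 × R3 | energy U₀ z.1 z.2 ≤ E₀ / 2} from hz), norm_mul,
        Real.norm_of_nonneg (cutExpApprox_nonneg _ _ _)]
      refine mul_le_mul ((cutExpApprox_le _ _ _).trans (Real.exp_le_exp.2 ?_)) (hφ hz)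
        (norm_nonneg _) (Real.exp_pos _).le
      have := h.apply_zero_le z.1
      unfold energy
      nlinarith [sq_nonneg ‖z.2‖]
    · rw [indicator_of_notMem (show z ∉ {z : R3 × R3 | energy U₀ z.1 z.2 ≤ E₀ / 2} from hz),
        hωE k _ (not_le.1 hz)]
      simp
  have hibd : ∀ B : ℝ, Integrable ({z : R3 × R3 | energy U₀ z.1 z.2 ≤ E₀ / 2}.indicator
          (fun _ => Real.exp (E₀ - U₀ 0) * B)) := fun B =>
    (integrableOn_const hD.measure_lt_top.ne).integrable_indicator hDm
  have cg := continuous_deviation (a := a) h hW hn.continuous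
  have cθ := (contDiff_virial h.contDiff).continuous
  have cη : Continuous (fun z : R3 × R3 => inner ℝ z.1 z.2) := by fun_prop
  have cω : ∀ k, Continuous (fun z : R3 × R3 => cutExpApprox E₀ (κ k) (energy U₀ z.1 z.2)) :=
    fun k => (locallyLipschitz_cutExpApprox E₀ (κ k)).continuous.comp
      (continuous_energy h.continuous)
  obtain ⟨Bg, hBg⟩ := hD.exists_bound_of_continuousOn cg.continuousOn
  obtain ⟨Bη, hBη⟩ := hD.exists_bound_of_continuousOn cη.continuousOn
  obtain ⟨B, hB0, hB⟩ := exists_clampedFlow_bound h hW ha hR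
  have L1 : Tendsto (fun k => ∫ z : R3 × R3, cutExpApprox E₀ (κ k) (energy U₀ z.1 z.2)
      * (virial U₀ z ^ 2 / (virial U₀ z ^ 2 + ε k) * deviation U₀ W a n z ^ 2)) atTop
      (𝓝 (∫ z : R3 × R3, cutExp E₀ (energy U₀ z.1 z.2) * deviation U₀ W a n z ^ 2)) := by
    refine tendsto_integral_of_dominated_convergence _ (fun k => ?_) (hibd (Bg ^ 2))
      (fun k => Eventually.of_forall fun z => hdom k z _ (Bg ^ 2) fun hz => ?_)
      (Eventually.of_forall fun z => hlim z _ _ fun hz => ?_)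
    · refine Continuous.aestronglyMeasurable ((cω k).mul ((Continuous.div (cθ.pow 2)
        ((cθ.pow 2).add continuous_const) fun z => ?_).mul (cg.pow 2)))
      exact (add_pos_of_nonneg_of_pos (sq_nonneg _) (hε0 k)).ne'
    · have h1 := hBg z hz
      rw [Real.norm_eq_abs] at h1
      have h2 : deviation U₀ W a n z ^ 2 ≤ Bg ^ 2 := sq_le_sq' (abs_le.1 h1).1 (abs_le.1 h1).2
      have h3 : virial U₀ z ^ 2 / (virial U₀ z ^ 2 + ε k) ≤ 1 := by
        have := hε0 k
        rw [div_le_one (by positivity)]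
        linarith
      have := hε0 k
      rw [abs_of_nonneg (by positivity)]
      exact (mul_le_of_le_one_left (sq_nonneg _) h3).trans h2
    · by_cases hθ : virial U₀ z = 0
      · simp [hvan z hz hθ]
      · have h1 : Tendsto (fun k => virial U₀ z ^ 2 / (virial U₀ z ^ 2 + ε k)) atTop
            (𝓝 (virial U₀ z ^ 2 / (virial U₀ z ^ 2 + 0))) :=
          tendsto_const_nhds.div (tendsto_const_nhds.add hεt) (by simpa using hθ)
        rw [add_zero, div_self (pow_ne_zero 2 hθ)] at h1
        simpa using h1.mul_const (deviation U₀ W a n z ^ 2)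
  have L2 : Tendsto (fun k => ∫ z : R3 × R3, cutExpApprox E₀ (κ k) (energy U₀ z.1 z.2)
      * (clampedFlow W a z ^ 2 / kappa U₀ z.1 + kappa U₀ z.1 * (inner ℝ z.1 z.2) ^ 2
        * (ε k * deviation U₀ W a n z ^ 2 / (virial U₀ z ^ 2 + ε k) ^ 2))) atTop
      (𝓝 (∫ z : R3 × R3, cutExp E₀ (energy U₀ z.1 z.2)
        * (clampedFlow W a z ^ 2 / kappa U₀ z.1))) := by
    refine tendsto_integral_of_dominated_convergence _ (fun k => ?_)
      (hibd (B + 4 / 3 * Laplacian.laplacian U₀ 0 * Bη ^ 2 * C ^ 2))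
      (fun k => Eventually.of_forall fun z => hdom k z _ _ fun hz => ?_)
      (Eventually.of_forall fun z => hlim z _ _ fun hz => ?_)
    · exact (measurable_regularized h hW hn.continuous
        (locallyLipschitz_cutExpApprox E₀ (κ k)).continuous).aestronglyMeasurable
    · have h1 := regularized_bound h hR (hε0 k) hC hz
      have h3 : 0 ≤ clampedFlow W a z ^ 2 / kappa U₀ z.1 :=
        div_nonneg (sq_nonneg _) (h.kappa_mem z.1).1
      have h4 : inner ℝ z.1 z.2 ^ 2 ≤ Bη ^ 2 := by
        have := hBη z hz
        rw [Real.norm_eq_abs] at this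
        exact sq_le_sq' (abs_le.1 this).1 (abs_le.1 this).2
      have h5 : 4 / 3 * Laplacian.laplacian U₀ 0 * inner ℝ z.1 z.2 ^ 2 * C ^ 2
          ≤ 4 / 3 * Laplacian.laplacian U₀ 0 * Bη ^ 2 * C ^ 2 := by
        have := h.laplacian_zero_pos
        gcongr
      rw [abs_of_nonneg (add_nonneg h3 h1.1)]
      exact add_le_add (hB z hz) (h1.2.trans h5)
    · by_cases hθ : virial U₀ z = 0
      · simp [hvan z hz hθ]
      · have h1 : Tendsto (fun k => ε k * deviation U₀ W a n z ^ 2 / (virial U₀ z ^ 2 + ε k) ^ 2)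
            atTop (𝓝 (0 * deviation U₀ W a n z ^ 2 / (virial U₀ z ^ 2 + 0) ^ 2)) :=
          (hεt.mul_const _).div ((tendsto_const_nhds.add hεt).pow 2) (by simpa using hθ)
        rw [zero_mul, zero_div] at h1
        simpa using (h1.const_mul (kappa U₀ z.1 * (inner ℝ z.1 z.2) ^ 2)).const_add
          (clampedFlow W a z ^ 2 / kappa U₀ z.1)
  exact le_of_tendsto_of_tendsto' L1 L2 hmain

end Linear

/-! ### Convexity bounds for the Casimir function -/

/-- The difference of the two sides has derivative log(1 + s) − s/(1 + Z), nonpositive on (−1, 0)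
and nonnegative on (0, Z), so its minimum is the value 0 at the origin. -/
theorem sq_div_le_casimirFun {Z z : ℝ} (hZ : 0 ≤ Z) (h1 : -1 ≤ z) (h2 : z ≤ Z) :
    z ^ 2 / (2 * (1 + Z)) ≤ casimirFun z := by
  set φ : ℝ → ℝ := fun z => casimirFun z - z ^ 2 / (2 * (1 + Z)) with hφ
  have hc : Continuous φ := continuous_casimirFun.sub (by fun_prop)
  have hd : ∀ s, -1 < s → HasDerivAt φ (Real.log (1 + s) - s / (1 + Z)) s := by
    intro s hs
    refine ((hasDerivAt_casimirFun hs).sub ((hasDerivAt_pow 2 s).div_const _)).congr_deriv ?_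
    have : 1 + Z ≠ 0 := by linarith
    field_simp
    norm_num
    ring
  have h0 : φ 0 = 0 := by simp [hφ, casimirFun]
  suffices hs : 0 ≤ φ z by simp only [hφ] at hs; linarith
  rcases le_total 0 z with hz | hz
  · have hm : MonotoneOn φ (Icc 0 Z) := by
      refine monotoneOn_of_hasDerivWithinAt_nonneg (convex_Icc 0 Z) hc.continuousOn
        (f' := fun s => Real.log (1 + s) - s / (1 + Z)) (fun s hs => ?_) fun s hs => ?_
      · rw [interior_Icc] at hs
        exact (hd s (by linarith [hs.1])).hasDerivWithinAt
      · rw [interior_Icc] at hs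
        have hs0 : 0 < 1 + s := by linarith [hs.1]
        have h3 := Real.one_sub_inv_le_log_of_pos hs0
        have h4 : 1 - (1 + s)⁻¹ = s / (1 + s) := by field_simp; ring
        have h5 : s / (1 + Z) ≤ s / (1 + s) :=
          div_le_div_of_nonneg_left hs.1.le hs0 (by linarith [hs.2])
        linarith
    have := hm (left_mem_Icc.2 hZ) ⟨hz, h2⟩ hz
    rwa [h0] at this
  · have hm : AntitoneOn φ (Icc (-1) 0) := by
      refine antitoneOn_of_hasDerivWithinAt_nonpos (convex_Icc (-1) 0) hc.continuousOn
        (f' := fun s => Real.log (1 + s) - s / (1 + Z)) (fun s hs => ?_) fun s hs => ?_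
      · rw [interior_Icc] at hs
        exact (hd s hs.1).hasDerivWithinAt
      · rw [interior_Icc] at hs
        have h3 := Real.log_le_sub_one_of_pos (by linarith [hs.1] : 0 < 1 + s)
        have h4 : s ≤ s / (1 + Z) := by
          rw [le_div_iff₀ (by linarith)]
          nlinarith [hs.2]
        linarith
    have := hm ⟨h1, hz⟩ (right_mem_Icc.2 (by norm_num)) hz
    rwa [h0] at this

theorem casimirFun_nonneg {z : ℝ} (h : -1 ≤ z) : 0 ≤ casimirFun z := by
  have := sq_div_le_casimirFun (abs_nonneg z) h (le_abs_self z)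
  exact le_trans (by positivity) this

/-- A quantitative Legendre transform bound. -/
theorem exists_casimirFun_add_mul_ge {Z : ℝ} (hZ : 0 ≤ Z) :
    ∃ ε C : ℝ, 0 < ε ∧ 0 ≤ C ∧ ∀ z, -1 ≤ z → z ≤ Z → ∀ y,
      -(11 / 20 * y ^ 2 + C * y ^ 4) ≤ casimirFun z + y * z - ε * z ^ 2 := by
  set c := 1 / (2 * (1 + Z)) with hc
  have hc0 : 0 < c := by positivity
  refine ⟨min (1 / 50) (c / 2), 800 / c ^ 3, lt_min (by norm_num) (by positivity), by positivity,
    fun z h1 h2 y => ?_⟩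
  have hC0 : 0 ≤ 800 / c ^ 3 * y ^ 4 := by positivity
  -- For z ≤ 1/20 the Casimir function is at least (10/21)z², and giving up z²/50 leaves at least
  -- (5/11)z², whose Legendre transform is (11/20)y². The optimal constant 1/2 is missed only
  -- slightly.
  rcases le_total z (1 / 20) with hz | hz
  · have h3 := sq_div_le_casimirFun (by norm_num : (0 : ℝ) ≤ 1 / 20) h1 hz
    have h4 : min (1 / 50) (c / 2) * z ^ 2 ≤ 1 / 50 * z ^ 2 :=
      mul_le_mul_of_nonneg_right (min_le_left _ _) (sq_nonneg z)
    have h5 : 10 / 21 * z ^ 2 ≤ casimirFun z := by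
      refine le_trans (le_of_eq ?_) h3
      ring
    have h6 : 0 ≤ 5 / 11 * (z + 11 / 10 * y) ^ 2 := by positivity
    have h7 : 5 / 11 * (z + 11 / 10 * y) ^ 2 = 5 / 11 * z ^ 2 + y * z + 11 / 20 * y ^ 2 := by ring
    have h8 := sq_nonneg z
    linarith
  · have h3 := sq_div_le_casimirFun hZ h1 h2
    have h3' : c * z ^ 2 ≤ casimirFun z := by rw [hc]; convert h3 using 1; ring
    have h4 : min (1 / 50) (c / 2) * z ^ 2 ≤ c / 2 * z ^ 2 :=
      mul_le_mul_of_nonneg_right (min_le_right _ _) (sq_nonneg z)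
    have hz0 : 0 < z := by linarith
    -- For z ≥ 1/20 the linear term hurts only if y < −c/40, and such y is large enough for y² to be
    -- bounded by a multiple of y⁴.
    by_cases hy : -(c / 40) ≤ y
    · have h5 : 0 ≤ c / 2 * z ^ 2 + y * z := by
        have : 0 ≤ z * (c / 2 * z + y) := by
          refine mul_nonneg hz0.le ?_
          nlinarith
        nlinarith
      nlinarith [sq_nonneg y]
    · have hy' : c / 40 < -y := by linarith
      have h5 : (c / 40) ^ 2 ≤ y ^ 2 := by nlinarith
      have h6 : -(y ^ 2 / (2 * c)) ≤ c / 2 * z ^ 2 + y * z := by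
        have : c / 2 * z ^ 2 + y * z + y ^ 2 / (2 * c) = (c * z + y) ^ 2 / (2 * c) := by
          field_simp
          ring
        have : 0 ≤ (c * z + y) ^ 2 / (2 * c) := by positivity
        linarith
      have h7 : y ^ 2 / (2 * c) ≤ 800 / c ^ 3 * y ^ 4 := by
        have h8 : y ^ 2 / (2 * c) * (c / 40) ^ 2 ≤ y ^ 2 / (2 * c) * y ^ 2 :=
          mul_le_mul_of_nonneg_left h5 (by positivity)
        have h9 : y ^ 2 / (2 * c) = y ^ 2 / (2 * c) * (c / 40) ^ 2 * (1600 / c ^ 2) := by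
          field_simp
          norm_num
        have h10 : 800 / c ^ 3 * y ^ 4 = y ^ 2 / (2 * c) * y ^ 2 * (1600 / c ^ 2) := by
          field_simp
          ring
        rw [h9, h10]
        exact mul_le_mul_of_nonneg_right h8 (by positivity)
      nlinarith [sq_nonneg y]

/-- With 1 + s = (1 + s₀)(1 + z) the Bregman divergence scales. At s₀ = f₀ the prefactor is e^{E₀−E}
on the support, precisely the weight in the Antonov-type estimate. -/
theorem casimirFun_bregman {s s₀ : ℝ} (hs : 0 ≤ s) (hs₀ : 0 ≤ s₀) :
    casimirFun s - casimirFun s₀ - Real.log (1 + s₀) * (s - s₀)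
      = (1 + s₀) * casimirFun ((s - s₀) / (1 + s₀)) := by
  have h1 : 1 + s₀ ≠ 0 := by linarith
  have h2 : 1 + s ≠ 0 := by linarith
  have e : 1 + (s - s₀) / (1 + s₀) = (1 + s) / (1 + s₀) := by field_simp; ring
  unfold casimirFun
  rw [e, Real.log_div h2 h1]
  field_simp
  ring

theorem neg_one_le_sub_div {s s₀ : ℝ} (hs : 0 ≤ s) (hs₀ : 0 ≤ s₀) : -1 ≤ (s - s₀) / (1 + s₀) := by
  rw [le_div_iff₀ (by linarith)]
  linarith

/-! ### Integration over the support and over the energy shell outside it -/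

/-- The weight `1 + |x|⁻²`, cut off at radius `R`. -/
def singularWeight (R : ℝ) : R3 → ℝ :=
  (Metric.closedBall (0 : R3) R).indicator fun x => 1 + (‖x‖ ^ 2)⁻¹

theorem singularWeight_nonneg (R : ℝ) (x : R3) : 0 ≤ singularWeight R x :=
  indicator_nonneg (fun x _ => by positivity) x

theorem integrable_singularWeight (R : ℝ) : Integrable (singularWeight R) := by
  have e : singularWeight R
      = fun x : R3 => (Iic R).indicator (fun r : ℝ => 1 + (r ^ 2)⁻¹) ‖x‖ := by
    ext x
    by_cases hx : ‖x‖ ≤ R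
    · rw [singularWeight, indicator_of_mem (by simpa using hx), indicator_of_mem (by simpa using hx)]
    · rw [singularWeight, indicator_of_notMem (by simpa using hx),
        indicator_of_notMem (by simpa using hx)]
  rw [e, integrable_fun_norm_addHaar (volume : Measure R3)
    (f := (Iic R).indicator (fun r : ℝ => 1 + (r ^ 2)⁻¹))]
  simp only [finrank_euclideanSpace, Fintype.card_fin, smul_eq_mul, Nat.add_one_sub_one]
  have h1 : IntegrableOn ((Iic R).indicator (fun r : ℝ => r ^ 2 + 1)) (Ioi 0) := by
    rw [integrableOn_indicator_iff measurableSet_Iic, inter_comm, Ioi_inter_Iic]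
    exact ((by fun_prop : Continuous fun r : ℝ => r ^ 2 + 1).integrableOn_Icc).mono_set
      Ioc_subset_Icc_self
  refine h1.congr_fun (fun r hr => ?_) measurableSet_Ioi
  have hr0 : r ≠ 0 := ne_of_gt hr
  by_cases hrR : r ∈ Iic R
  · rw [indicator_of_mem hrR, indicator_of_mem hrR]
    field_simp
  · rw [indicator_of_notMem hrR, indicator_of_notMem hrR, mul_zero]

/-- The squared radii differ by at most 2τ, so the shell volume is linear in τ; the negative
contribution from outside the support is then of third order. -/
theorem volume_shell_le {α τ C : ℝ} (hτ : 0 ≤ τ) (hC : α ≤ C) (hC0 : 0 ≤ C) :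
    (volume : Measure R3).real {v | α < ‖v‖ ^ 2 / 2 ∧ ‖v‖ ^ 2 / 2 < α + τ}
      ≤ 16 * Real.pi / 3 * (τ * (1 + C + τ)) := by
  set p := √(2 * max α 0) with hp
  set q := √(2 * max (α + τ) 0) with hq
  have hp0 : 0 ≤ p := Real.sqrt_nonneg _
  have hq0 : 0 ≤ q := Real.sqrt_nonneg _
  have hp2 : p ^ 2 = 2 * max α 0 := Real.sq_sqrt (by positivity)
  have hq2 : q ^ 2 = 2 * max (α + τ) 0 := Real.sq_sqrt (by positivity)
  have hpq : p ≤ q := Real.sqrt_le_sqrt (by gcongr; linarith)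
  have hv : ∀ r : ℝ, 0 ≤ r →
      (volume : Measure R3).real (Metric.ball 0 r) = 4 * Real.pi / 3 * r ^ 3 := by
    intro r hr
    rw [measureReal_def, EuclideanSpace.volume_ball_fin_three, ENNReal.toReal_mul,
      ENNReal.toReal_pow, ENNReal.toReal_ofReal hr, ENNReal.toReal_ofReal (by positivity)]
    ring
  have hsub : {v : R3 | α < ‖v‖ ^ 2 / 2 ∧ ‖v‖ ^ 2 / 2 < α + τ}
      ⊆ Metric.ball 0 q \ Metric.ball 0 p := by
    rintro v ⟨h1, h2⟩
    refine ⟨?_, ?_⟩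
    · rw [mem_ball_zero_iff]
      refine Real.lt_sqrt_of_sq_lt ?_
      linarith [le_max_left (α + τ) 0]
    · rw [mem_ball_zero_iff, not_lt]
      refine Real.sqrt_le_iff.2 ⟨norm_nonneg v, ?_⟩
      rcases max_cases α 0 with ⟨h3, -⟩ | ⟨h3, -⟩ <;> rw [h3] <;> nlinarith [sq_nonneg ‖v‖]
  have hfin : (volume : Measure R3) (Metric.ball 0 q \ Metric.ball 0 p) ≠ ⊤ :=
    ne_top_of_le_ne_top Metric.isBounded_ball.measure_lt_top.ne (measure_mono sdiff_subset)
  refine (measureReal_mono hsub hfin).trans ?_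
  rw [measureReal_sdiff (Metric.ball_subset_ball hpq) Metric.isOpen_ball.measurableSet, hv q hq0,
    hv p hp0]
  have h1 : q ^ 2 - p ^ 2 ≤ 2 * τ := by
    rw [hp2, hq2]
    rcases max_cases α 0 with ⟨h3, h3'⟩ | ⟨h3, h3'⟩ <;>
    rcases max_cases (α + τ) 0 with ⟨h4, h4'⟩ | ⟨h4, h4'⟩ <;> rw [h3, h4] <;> linarith
  have h2 : q ≤ 1 + C + τ := by
    have : max (α + τ) 0 ≤ C + τ := max_le (by linarith) (by linarith)
    nlinarith [sq_nonneg (q - 1)]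
  have h3 : q ^ 3 - p ^ 3 ≤ 4 * (τ * q) := by
    have e : q ^ 3 - p ^ 3 = (q ^ 2 - p ^ 2) * (q + p) - q * p * (q - p) := by ring
    have h4 : 0 ≤ q * p * (q - p) := mul_nonneg (mul_nonneg hq0 hp0) (sub_nonneg.2 hpq)
    have h5 : (q ^ 2 - p ^ 2) * (q + p) ≤ 2 * τ * (2 * q) :=
      mul_le_mul h1 (by linarith) (by linarith) (by linarith)
    linarith
  have h6 : τ * q ≤ τ * (1 + C + τ) := mul_le_mul_of_nonneg_left h2 hτ
  have hπ := Real.pi_pos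
  nlinarith

/-- Here m is the Taylor remainder of the subtracted Casimir functional. The reserve εz² pays for
its quadratic part and, by Young's inequality, for its linear part, up to β²/(2ε). -/
theorem bregman_lower_bound {S ε C : ℝ} (hε : 0 < ε)
    (hL : ∀ z, -1 ≤ z → z ≤ S → ∀ y,
      -(11 / 20 * y ^ 2 + C * y ^ 4) ≤ casimirFun z + y * z - ε * z ^ 2)
    {s s₀ y m β : ℝ} (hs : 0 ≤ s) (hsS : s ≤ S) (hs₀ : 0 ≤ s₀) (hs₀S : s₀ ≤ S)
    (hm : |m| ≤ ε / (2 * (1 + S)) * (s - s₀) ^ 2 + β * |s - s₀|) :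
    -((1 + s₀) * (11 / 20 * y ^ 2 + C * y ^ 4 + β ^ 2 / (2 * ε)))
      ≤ casimirFun s - casimirFun s₀ - Real.log (1 + s₀) * (s - s₀) + y * (s - s₀) - m := by
  have hS : 0 ≤ S := hs.trans hsS
  rw [casimirFun_bregman hs hs₀]
  set z := (s - s₀) / (1 + s₀) with hz
  have h1 : s - s₀ = (1 + s₀) * z := by rw [hz]; field_simp
  have hz1 : -1 ≤ z := neg_one_le_sub_div hs hs₀
  have hz2 : z ≤ S := by
    rw [hz, div_le_iff₀ (by linarith)]
    nlinarith
  have h2 := hL z hz1 hz2 y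
  have h3 : β * |z| ≤ ε / 2 * z ^ 2 + β ^ 2 / (2 * ε) := by
    have e : ε / 2 * z ^ 2 + β ^ 2 / (2 * ε) - β * |z| = (ε * |z| - β) ^ 2 / (2 * ε) := by
      rw [← sq_abs z]; field_simp; ring
    have : 0 ≤ (ε * |z| - β) ^ 2 / (2 * ε) := by positivity
    linarith
  have h4 : m ≤ (1 + s₀) * (ε * z ^ 2 + β ^ 2 / (2 * ε)) := by
    refine (le_abs_self m).trans (hm.trans ?_)
    rw [h1, abs_mul, abs_of_pos (by linarith : 0 < 1 + s₀)]
    have h5 : ε / (2 * (1 + S)) * ((1 + s₀) * z) ^ 2 ≤ (1 + s₀) * (ε / 2 * z ^ 2) := by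
      have e : ε / (2 * (1 + S)) * ((1 + s₀) * z) ^ 2
          = (1 + s₀) / (1 + S) * ((1 + s₀) * (ε / 2 * z ^ 2)) := by field_simp
      rw [e]
      refine mul_le_of_le_one_left (by positivity) ?_
      rw [div_le_one (by linarith)]
      linarith
    have h6 : β * ((1 + s₀) * |z|) = (1 + s₀) * (β * |z|) := by ring
    have h7 := mul_le_mul_of_nonneg_left h3 (by linarith : 0 ≤ 1 + s₀)
    rw [h6]
    calc ε / (2 * (1 + S)) * ((1 + s₀) * z) ^ 2 + (1 + s₀) * (β * |z|)
        ≤ (1 + s₀) * (ε / 2 * z ^ 2) + (1 + s₀) * (ε / 2 * z ^ 2 + β ^ 2 / (2 * ε)) :=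
          add_le_add h5 h7
      _ = (1 + s₀) * (ε * z ^ 2 + β ^ 2 / (2 * ε)) := by ring
  have h8 := mul_le_mul_of_nonneg_left h2 (by linarith : 0 ≤ 1 + s₀)
  have e1 : y * (s - s₀) = (1 + s₀) * (y * z) := by rw [h1]; ring
  rw [e1]
  nlinarith

/-- For vanishing f₀: the linear term e·s either dominates the perturbation outright, or the
quadratic lower bound of the Casimir function limits the loss by completing a square. -/
theorem casimirFun_lower_bound {S s e N ψ m : ℝ} (hs : 0 ≤ s) (hsS : s ≤ S) (he : 0 ≤ e)
    (hm : |m| ≤ N * s) :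
    (|ψ| + N ≤ e → 0 ≤ casimirFun s + e * s + ψ * s - m) ∧
      -((1 + S) / 2 * (|ψ| + N) ^ 2) ≤ casimirFun s + e * s + ψ * s - m := by
  have hS : 0 ≤ S := hs.trans hsS
  have h1 := sq_div_le_casimirFun hS (by linarith : -1 ≤ s) hsS
  have h2 : m ≤ N * s := (le_abs_self m).trans hm
  have h3 : -(|ψ| * s) ≤ ψ * s := by
    have := mul_le_mul_of_nonneg_right (neg_abs_le ψ) hs
    linarith
  have h4 : 0 ≤ s ^ 2 / (2 * (1 + S)) := by positivity
  constructor
  · intro hle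
    have := mul_le_mul_of_nonneg_right hle hs
    linarith
  · set τ := |ψ| + N
    have h5 : 0 ≤ s ^ 2 / (2 * (1 + S)) - τ * s + (1 + S) / 2 * τ ^ 2 := by
      have e1 : s ^ 2 / (2 * (1 + S)) - τ * s + (1 + S) / 2 * τ ^ 2
          = (s - (1 + S) * τ) ^ 2 / (2 * (1 + S)) := by
        have : 1 + S ≠ 0 := by linarith
        field_simp
        ring
      rw [e1]; positivity
    have h6 := mul_nonneg he hs
    have h7 : τ * s = |ψ| * s + N * s := add_mul _ _ _
    linarith

section Coercivity

variable {E₀ : ℝ} {U₀ : R3 → ℝ}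

theorem integrable_cutExp_mul_inv_sq (h : IsKingPotential E₀ U₀) :
    Integrable (fun z : R3 × R3 => cutExp E₀ (energy U₀ z.1 z.2) * (1 + (‖z.1‖ ^ 2)⁻¹)) := by
  obtain ⟨R, hR0, hR⟩ := h.isCompact_energy_le.isBounded.subset_closedBall_lt 0 0
  have h1 : Integrable (fun z : R3 × R3 => singularWeight R z.1
      * (Metric.closedBall (0 : R3) R).indicator (fun _ => Real.exp (E₀ - U₀ 0)) z.2) :=
    (integrable_singularWeight R).mul_prod
      ((integrableOn_const (isCompact_closedBall _ _).measure_lt_top.ne).integrable_indicator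
        Metric.isClosed_closedBall.measurableSet)
  have hm : Measurable
      (fun z : R3 × R3 => cutExp E₀ (energy U₀ z.1 z.2) * (1 + (‖z.1‖ ^ 2)⁻¹)) := by
    have h2 : Measurable (fun z : R3 × R3 => (1 + (‖z.1‖ ^ 2)⁻¹ : ℝ)) := by fun_prop
    exact ((measurable_cutExp E₀).comp (continuous_energy h.continuous).measurable).mul h2
  refine h1.mono' hm.aestronglyMeasurable (Eventually.of_forall fun z => ?_)
  have hw : 0 ≤ 1 + (‖z.1‖ ^ 2)⁻¹ := by positivity
  rw [norm_mul, Real.norm_of_nonneg (cutExp_nonneg _ _), Real.norm_of_nonneg hw]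
  by_cases hz : energy U₀ z.1 z.2 ≤ E₀
  · have hzR := hR (show z ∈ {z : R3 × R3 | energy U₀ z.1 z.2 ≤ E₀ / 2} by
      have := h.cutoff_neg
      change energy U₀ z.1 z.2 ≤ E₀ / 2
      linarith)
    rw [mem_closedBall_zero_iff, Prod.norm_def, max_le_iff] at hzR
    rw [singularWeight, indicator_of_mem (by simpa using hzR.1),
      indicator_of_mem (by simpa using hzR.2), mul_comm]
    refine mul_le_mul_of_nonneg_left ((cutExp_le _ _).trans (Real.exp_le_exp.2 ?_)) hw
    have := h.apply_zero_le z.1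
    unfold energy
    nlinarith [sq_nonneg ‖z.2‖]
  · rw [cutExp, if_neg hz, zero_mul]
    exact mul_nonneg (singularWeight_nonneg _ _)
      (indicator_nonneg (fun _ _ => (Real.exp_pos _).le) _)

theorem setIntegral_energy_le_ge (h : IsKingPotential E₀ U₀) {J : R3 × R3 → ℝ}
    (hJ : Integrable J) {δ : R3 × R3 → ℝ} (hδ : Continuous δ) {c D : ℝ}
    (hle : ∀ z : R3 × R3, z.1 ≠ 0 → energy U₀ z.1 z.2 ≤ E₀ →
      -(cutExp E₀ (energy U₀ z.1 z.2) * (c * δ z ^ 2 + D * (1 + (‖z.1‖ ^ 2)⁻¹))) ≤ J z) :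
    -(c * (∫ z : R3 × R3, cutExp E₀ (energy U₀ z.1 z.2) * δ z ^ 2)
        + D * ∫ z : R3 × R3, cutExp E₀ (energy U₀ z.1 z.2) * (1 + (‖z.1‖ ^ 2)⁻¹))
      ≤ ∫ z in {z : R3 × R3 | energy U₀ z.1 z.2 ≤ E₀}, J z := by
  have hQm : MeasurableSet {z : R3 × R3 | energy U₀ z.1 z.2 ≤ E₀} :=
    (isClosed_le (continuous_energy h.continuous) continuous_const).measurableSet
  obtain ⟨B, hB⟩ := h.isCompact_energy_le.exists_bound_of_continuousOn
    (f := fun z => δ z ^ 2) (hδ.pow 2).continuousOn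
  have i1 := integrable_cutExp_mul h (φ := fun z => δ z ^ 2) (hδ.pow 2).measurable hB
  have i2 := integrable_cutExp_mul_inv_sq h
  rw [← integral_indicator hQm, ← integral_const_mul, ← integral_const_mul,
    ← integral_add (i1.const_mul c) (i2.const_mul D), ← integral_neg]
  refine integral_mono_ae ((i1.const_mul c).add (i2.const_mul D)).neg (hJ.indicator hQm) ?_
  filter_upwards [ae_norm_fst_ne 0] with z hz
  have hx : z.1 ≠ 0 := by simpa using hz
  by_cases hzQ : energy U₀ z.1 z.2 ≤ E₀
  · rw [indicator_of_mem (show z ∈ {z : R3 × R3 | energy U₀ z.1 z.2 ≤ E₀} from hzQ)]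
    refine le_trans (le_of_eq ?_) (hle z hx hzQ)
    ring
  · rw [indicator_of_notMem (show z ∉ {z : R3 × R3 | energy U₀ z.1 z.2 ≤ E₀} from hzQ), cutExp,
      if_neg hzQ]
    simp

/-- Negative values occur only for energies between E₀ and E₀ + τ. Beyond radius R there are none,
since there U₀ > E₀/2 already lies at least τ above E₀; within it the shell volume is bounded for
each x. -/
theorem setIntegral_energy_gt_ge (h : IsKingPotential E₀ U₀) {J : R3 × R3 → ℝ}
    (hJ : Integrable J) {τ : R3 → ℝ} (hτ : ∀ x, 0 ≤ τ x) {R Ω G : ℝ} (hΩ : 0 ≤ Ω)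
    (hR : ∀ x, U₀ x ≤ E₀ / 2 → ‖x‖ ≤ R)
    (hJ0 : ∀ x v, E₀ < energy U₀ x v → E₀ + τ x ≤ energy U₀ x v → 0 ≤ J (x, v))
    (hJ1 : ∀ x v, E₀ < energy U₀ x v → -(Ω / 2 * τ x ^ 2) ≤ J (x, v))
    (hτR : ∀ x, R < ‖x‖ → τ x ≤ -E₀ / 2)
    (hG : ∀ x, x ≠ 0 → ‖x‖ ≤ R →
      Ω / 2 * τ x ^ 2 * (16 * Real.pi / 3 * (τ x * (1 + (E₀ - U₀ 0) + τ x)))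
        ≤ G * (1 + (‖x‖ ^ 2)⁻¹)) :
    -(G * ∫ x, singularWeight R x)
      ≤ ∫ z in {z : R3 × R3 | energy U₀ z.1 z.2 ≤ E₀}ᶜ, J z := by
  have hQm : MeasurableSet {z : R3 × R3 | energy U₀ z.1 z.2 ≤ E₀}ᶜ :=
    (isClosed_le (continuous_energy h.continuous) continuous_const).measurableSet.compl
  have hJi := hJ.indicator hQm
  rw [← integral_indicator hQm]
  have e1 := integral_prod (μ := (volume : Measure R3)) (ν := (volume : Measure R3)) _ hJi
  refine le_trans ?_ (le_of_eq e1.symm)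
  rw [← integral_const_mul, ← integral_neg]
  refine integral_mono_ae ((integrable_singularWeight R).const_mul G).neg
    (Integrable.integral_prod_left (μ := (volume : Measure R3)) (ν := (volume : Measure R3)) hJi) ?_
  filter_upwards [IsRadial.ae_ne_zero, Integrable.prod_right_ae
    (μ := (volume : Measure R3)) (ν := (volume : Measure R3)) hJi] with x hx hix
  have hmem : ∀ v, (x, v) ∈ {z : R3 × R3 | energy U₀ z.1 z.2 ≤ E₀}ᶜ ↔ E₀ < energy U₀ x v :=
    fun v => by rw [mem_compl_iff, mem_ofPred_eq, not_le]
  by_cases hxR : ‖x‖ ≤ R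
  · set Sh : Set R3 := {v | E₀ - U₀ x < ‖v‖ ^ 2 / 2 ∧ ‖v‖ ^ 2 / 2 < E₀ - U₀ x + τ x} with hSh
    have hShm : MeasurableSet Sh :=
      ((isOpen_lt continuous_const (by fun_prop : Continuous fun v : R3 => ‖v‖ ^ 2 / 2)).inter
        (isOpen_lt (by fun_prop : Continuous fun v : R3 => ‖v‖ ^ 2 / 2)
          continuous_const)).measurableSet
    have hfin : volume Sh ≠ ⊤ := by
      refine ne_top_of_le_ne_top (Metric.isBounded_closedBall (x := (0 : R3))
        (r := 1 + |E₀ - U₀ x + τ x|)).measure_lt_top.ne (measure_mono fun v hv => ?_)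
      rw [mem_closedBall_zero_iff]
      nlinarith [hv.2, le_abs_self (E₀ - U₀ x + τ x), norm_nonneg v, sq_nonneg (‖v‖ - 1)]
    have h1 : ∫ v, Sh.indicator (fun _ => -(Ω / 2 * τ x ^ 2)) v
        ≤ ∫ v, ({z : R3 × R3 | energy U₀ z.1 z.2 ≤ E₀}ᶜ).indicator J (x, v) := by
      refine integral_mono_ae ((integrableOn_const hfin).integrable_indicator hShm) hix
        (Eventually.of_forall fun v => ?_)
      beta_reduce
      by_cases hv : E₀ < energy U₀ x v
      · rw [indicator_of_mem ((hmem v).2 hv)]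
        by_cases hvS : v ∈ Sh
        · rw [indicator_of_mem hvS]; exact hJ1 x v hv
        · rw [indicator_of_notMem hvS]
          refine hJ0 x v hv ?_
          by_contra hlt
          refine hvS ⟨?_, ?_⟩ <;> unfold energy at hv hlt <;> linarith
      · rw [indicator_of_notMem (fun hm => hv ((hmem v).1 hm))]
        exact indicator_nonpos (fun v _ => by
          have := mul_nonneg (div_nonneg hΩ (by norm_num : (0 : ℝ) ≤ 2)) (sq_nonneg (τ x))
          linarith) v
    refine le_trans ?_ h1
    rw [integral_indicator hShm, setIntegral_const, smul_eq_mul, singularWeight,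
      indicator_of_mem (by simpa using hxR)]
    have h2 := volume_shell_le (α := E₀ - U₀ x) (hτ x) (sub_le_sub_left (h.apply_zero_le x) E₀)
      (sub_nonneg.2 h.apply_zero_lt.le)
    have h3 := hG x hx hxR
    have h4 : 0 ≤ Ω / 2 * τ x ^ 2 := by positivity
    have h5 := mul_le_mul_of_nonneg_left h2 h4
    have h6 : (volume : Measure R3).real Sh * -(Ω / 2 * τ x ^ 2)
        = -(Ω / 2 * τ x ^ 2 * (volume : Measure R3).real Sh) := by ring
    rw [h6]
    exact neg_le_neg (h5.trans h3)
  · rw [singularWeight, indicator_of_notMem (by simpa using hxR), mul_zero, neg_zero]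
    refine integral_nonneg fun v => ?_
    by_cases hv : E₀ < energy U₀ x v
    · rw [indicator_of_mem ((hmem v).2 hv)]
      refine hJ0 x v hv ?_
      have h1 : E₀ / 2 < U₀ x := by
        by_contra hle
        exact hxR (hR x (not_lt.1 hle))
      have h2 := hτR x (not_le.1 hxR)
      unfold energy
      nlinarith [sq_nonneg ‖v‖]
    · rw [indicator_of_notMem (fun hm => hv ((hmem v).1 hm))]
      exact le_rfl

/-- On the support of f₀ the integrand is a Bregman divergence of a convex function, because log(1 +
f₀) = E₀ − E there; outside, each remaining term is nonnegative. -/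
theorem IsState.freeEnergy_nonneg {g : R3 → R3 → ℝ} {V : R3 → ℝ} (hst : IsState E₀ U₀ g V) :
    0 ≤ freeEnergy E₀ U₀ g := by
  refine integral_nonneg fun z => ?_
  have hg := hst.nonneg z.1 z.2
  simp only [Pi.zero_apply]
  rcases le_total (energy U₀ z.1 z.2) E₀ with hE | hE
  · have h0 := kingDensity_nonneg E₀ U₀ z.1 z.2
    have h1 := casimirFun_bregman hg h0
    have h2 : Real.log (1 + kingDensity E₀ U₀ z.1 z.2) = E₀ - energy U₀ z.1 z.2 := by
      rw [kingDensity_of_le hE, add_sub_cancel, Real.log_exp]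
    rw [h2] at h1
    have h3 := mul_nonneg (by linarith : 0 ≤ 1 + kingDensity E₀ U₀ z.1 z.2)
      (casimirFun_nonneg (neg_one_le_sub_div hg h0))
    linarith
  · rw [kingDensity_of_ge hE]
    have h1 := casimirFun_nonneg (by linarith : -1 ≤ g z.1 z.2)
    have h2 := mul_nonneg (sub_nonneg.2 hE) hg
    have h3 : casimirFun 0 = 0 := by simp [casimirFun]
    rw [h3]
    linarith

end Coercivity

/-! ### The multiplier n(E) and its properties -/

theorem abs_primitive_sub_le {n : ℝ → ℝ} (hn : Continuous n) {s s₀ B : ℝ}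
    (hB : ∀ τ ∈ uIcc s₀ s, |n τ - n s₀| ≤ B) :
    |(∫ τ in (0 : ℝ)..s, n τ) - (∫ τ in (0 : ℝ)..s₀, n τ) - n s₀ * (s - s₀)| ≤ B * |s - s₀| := by
  have hi := fun a b => hn.intervalIntegrable (μ := volume) a b
  have e : (∫ τ in (0 : ℝ)..s, n τ) - (∫ τ in (0 : ℝ)..s₀, n τ) - n s₀ * (s - s₀)
      = ∫ τ in s₀..s, (n τ - n s₀) := by
    rw [intervalIntegral.integral_interval_sub_left (hi _ _) (hi _ _),
      intervalIntegral.integral_sub (hi _ _) intervalIntegrable_const,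
      intervalIntegral.integral_const, smul_eq_mul, mul_comm]
  rw [e, ← Real.norm_eq_abs]
  exact intervalIntegral.norm_integral_le_of_norm_le_const fun τ hτ =>
    hB τ (uIoc_subset_uIcc hτ)

theorem abs_log_one_add_sub_le {s t : ℝ} (hs : 0 ≤ s) (ht : 0 ≤ t) :
    |Real.log (1 + s) - Real.log (1 + t)| ≤ |s - t| := by
  wlog hst : t ≤ s generalizing s t
  · rw [abs_sub_comm, abs_sub_comm s]; exact this ht hs (le_of_not_ge hst)
  have h1 : Real.log (1 + t) ≤ Real.log (1 + s) := Real.log_le_log (by linarith) (by linarith)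
  rw [abs_of_nonneg (sub_nonneg.2 h1), abs_of_nonneg (sub_nonneg.2 hst),
    ← Real.log_div (by linarith) (by linarith)]
  have h2 := Real.log_le_sub_one_of_pos (x := (1 + s) / (1 + t)) (div_pos (by linarith) (by linarith))
  refine h2.trans ?_
  rw [div_sub_one (by linarith), div_le_iff₀ (by linarith)]
  nlinarith

/-- Take n(E) = w(ρ(E)) with ρ(E) the clamped radius of vanishing virial. Size and modulus are
controlled by the Dirichlet energy; the true Lipschitz constant of w enters only qualitatively, to
make the Antonov-type estimate applicable. -/
theorem exists_multiplier {U₀ W : R3 → ℝ} (hrad : IsRadial W) (hW : ContDiff ℝ 2 W)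
    (hc : HasCompactSupport W) {a R : ℝ} (ha : 0 < a) {ρ : ℝ → ℝ} {c : ℝ} (hc0 : 0 ≤ c)
    (hρ : ∀ E, a ≤ ρ E) (hρl : ∀ E E', |ρ E - ρ E'| ≤ c * |E - E'|)
    (hv : ∀ z : R3 × R3, ‖z.1‖ ≤ R →
      |max ‖z.1‖ a - ρ (energy U₀ z.1 z.2)| ≤ c * |virial U₀ z|)
    {A : ℝ} (hA : (∫ x, ‖gradient W x‖ ^ 2) / (4 * Real.pi) = A) :
    ∃ n : ℝ → ℝ, LocallyLipschitz n ∧ (∀ E, n E ^ 2 ≤ A * a⁻¹) ∧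
      (∃ C, ∀ z : R3 × R3, ‖z.1‖ ≤ R → |deviation U₀ W a n z| ≤ C * |virial U₀ z|) ∧
      ∀ ε, 0 < ε → ∀ E E', |n E - n E'| ≤ ε * c * |E - E'| + A / (4 * ε * a ^ 2) := by
  obtain ⟨L, hL⟩ := exists_lipschitzWith_of_locallyLipschitz
    ((hW.of_le (by norm_num : (1 : WithTop ℕ∞) ≤ 2)).locallyLipschitz) hc
  have hp : ∀ r s, |profile W r - profile W s| ≤ L * |r - s| := fun r s => by
    have h1 := hL.dist_le_mul (r • unitVec) (s • unitVec)
    rw [Real.dist_eq, dist_eq_norm, ← sub_smul, norm_smul, norm_unitVec, mul_one,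
      Real.norm_eq_abs] at h1
    exact h1
  refine ⟨fun E => profile W (ρ E), ?_, fun E => ?_, ⟨L * c, fun z hz => ?_⟩, fun ε hε E E' => ?_⟩
  · refine (LipschitzWith.of_dist_le_mul (K := L * c.toNNReal) fun E E' => ?_).locallyLipschitz
    rw [Real.dist_eq, Real.dist_eq, NNReal.coe_mul, Real.coe_toNNReal _ hc0, mul_assoc]
    exact (hp _ _).trans (mul_le_mul_of_nonneg_left (hρl _ _) L.2)
  · have h1 := hrad.norm_mul_sq_le hW hc (ρ E • unitVec)
    have hpos : 0 < ρ E := ha.trans_le (hρ E)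
    rw [norm_smul, norm_unitVec, mul_one, Real.norm_of_nonneg hpos.le, hA] at h1
    rw [← div_eq_mul_inv, le_div_iff₀ ha, mul_comm]
    exact (mul_le_mul_of_nonneg_right (hρ E) (sq_nonneg _)).trans h1
  · rw [mul_assoc]
    exact (hp _ _).trans (mul_le_mul_of_nonneg_left (hv z hz) L.2)
  · have h1 := hrad.abs_profile_sub_le_of_le hW hc ha (hρ E') (hρ E) hε
    rw [hA] at h1
    refine h1.trans (add_le_add ?_ le_rfl)
    rw [mul_assoc]
    exact mul_le_mul_of_nonneg_left (hρl _ _) hε.le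

theorem pow_four_le_of_sq_le {A q b y : ℝ} (hA : 0 ≤ A) (hb : 0 ≤ b)
    (hy : y ^ 2 ≤ 2 * A * (q + b)) :
    y ^ 2 ≤ 2 * A * (1 + b) * (1 + q ^ 2) ∧ y ^ 4 ≤ 8 * A ^ 2 * (1 + b ^ 2) * (1 + q ^ 2) := by
  constructor
  · refine hy.trans ?_
    rw [mul_assoc (2 * A)]
    refine mul_le_mul_of_nonneg_left ?_ (by positivity)
    nlinarith [sq_nonneg (q - 1), mul_nonneg hb (sq_nonneg q)]
  · have h1 : y ^ 4 ≤ (2 * A * (q + b)) ^ 2 := by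
      rw [show y ^ 4 = (y ^ 2) ^ 2 by ring]
      exact pow_le_pow_left₀ (sq_nonneg _) hy 2
    refine h1.trans ?_
    have e : (2 * A * (q + b)) ^ 2 = 4 * A ^ 2 * (q + b) ^ 2 := by ring
    have e' : 8 * A ^ 2 * (1 + b ^ 2) * (1 + q ^ 2) = 4 * A ^ 2 * (2 * (1 + b ^ 2) * (1 + q ^ 2)) := by
      ring
    rw [e, e']
    refine mul_le_mul_of_nonneg_left ?_ (by positivity)
    nlinarith [sq_nonneg (q - b), sq_nonneg (b * q)]

theorem sq_add_le_of_sq_le {A q b y n : ℝ} (hy : y ^ 2 ≤ A * q) (hn : n ^ 2 ≤ A * b) :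
    (y + n) ^ 2 ≤ 2 * A * (q + b) := by nlinarith [sq_nonneg (y - n)]

/-- Replacing the potential by its clamped profile costs little near the origin. -/
theorem IsRadial.sub_sq_le {U₀ W : R3 → ℝ} (hrad : IsRadial W) {a A : ℝ} (ha : 0 < a) (hA : 0 ≤ A)
    (hWA : ∀ x, ‖x‖ * W x ^ 2 ≤ A) {n : ℝ → ℝ} {z : R3 × R3} (hz : z.1 ≠ 0) :
    (W z.1 - n (energy U₀ z.1 z.2)) ^ 2
      ≤ 11 / 10 * deviation U₀ W a n z ^ 2 + 44 * A * a * (‖z.1‖ ^ 2)⁻¹ := by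
  have hr : 0 < ‖z.1‖ := norm_pos_iff.2 hz
  have hpos : 0 ≤ 44 * A * a * (‖z.1‖ ^ 2)⁻¹ := by positivity
  unfold deviation
  rcases le_total a ‖z.1‖ with h | h
  · rw [max_eq_left h, ← hrad.eq_profile]
    nlinarith [sq_nonneg (W z.1 - n (energy U₀ z.1 z.2))]
  · rw [max_eq_right h]
    have h1 : W z.1 ^ 2 ≤ A / ‖z.1‖ := by
      rw [le_div_iff₀ hr, mul_comm]; exact hWA _
    have h2 : profile W a ^ 2 ≤ A / ‖z.1‖ := by
      have h3 := hWA (a • unitVec)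
      rw [norm_smul, norm_unitVec, mul_one, Real.norm_of_nonneg ha.le] at h3
      rw [le_div_iff₀ hr, mul_comm]
      exact (mul_le_mul_of_nonneg_right h (sq_nonneg _)).trans h3
    have h4 : A / ‖z.1‖ ≤ A * a * (‖z.1‖ ^ 2)⁻¹ := by
      rw [← div_eq_mul_inv, div_le_div_iff₀ hr (by positivity)]
      nlinarith [mul_le_mul_of_nonneg_left h (mul_nonneg hA hr.le)]
    set p := profile W a
    set w := W z.1
    set k := n (energy U₀ z.1 z.2)
    -- Young's inequality with parameter 1/10: the main term may grow only slightly, since its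
    -- coefficient enters the final balance.
    have h5 : (w - k) ^ 2 ≤ 11 / 10 * (p - k) ^ 2 + 11 * (w - p) ^ 2 := by
      nlinarith [sq_nonneg ((p - k) - 10 * (w - p))]
    have h6 : (w - p) ^ 2 ≤ 4 * (A / ‖z.1‖) := by nlinarith [sq_nonneg (w + p)]
    linarith

/-! ### The corrected energy density and its lower bounds -/

section Coercivity

variable {E₀ : ℝ} {U₀ : R3 → ℝ} {g : R3 → R3 → ℝ} {V : R3 → ℝ}

/-- The free energy density, corrected by the linear field term and by a Casimir functional. -/
def correctedDensity (E₀ : ℝ) (U₀ : R3 → ℝ) (g : R3 → R3 → ℝ) (V : R3 → ℝ) (n : ℝ → ℝ)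
    (z : R3 × R3) : ℝ :=
  casimirFun (g z.1 z.2) - casimirFun (kingDensity E₀ U₀ z.1 z.2)
    + (energy U₀ z.1 z.2 - E₀) * (g z.1 z.2 - kingDensity E₀ U₀ z.1 z.2)
    + (V - U₀) z.1 * (g z.1 z.2 - kingDensity E₀ U₀ z.1 z.2)
    - ((∫ τ in (0 : ℝ)..g z.1 z.2, n τ) - ∫ τ in (0 : ℝ)..kingDensity E₀ U₀ z.1 z.2, n τ)

/-- The field term integrates to −2K by Poisson's equation, and the Casimir difference to zero by
equimeasurability, whatever n is. -/
theorem IsState.integral_correctedDensity (hst : IsState E₀ U₀ g V) (h : IsKingPotential E₀ U₀)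
    {n : ℝ → ℝ} (hn : Continuous n) {N : ℝ} (hN : ∀ s, |n s| ≤ N) :
    Integrable (correctedDensity E₀ U₀ g V n) ∧
    ∫ z, correctedDensity E₀ U₀ g V n z = freeEnergy E₀ U₀ g - 2 * fieldEnergy U₀ V := by
  have hE : Continuous (fun z : R3 × R3 => energy U₀ z.1 z.2 - E₀) :=
    (continuous_energy h.continuous).sub continuous_const
  have hψ : Continuous (fun z : R3 × R3 => (V - U₀) z.1) :=
    (hst.contDiff_sub h).continuous.comp continuous_fst
  have hmul : ∀ {ζ : R3 × R3 → ℝ}, Continuous ζ →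
      Integrable (fun z : R3 × R3 => ζ z * (g z.1 z.2 - kingDensity E₀ U₀ z.1 z.2)) := by
    intro ζ hζ
    simp_rw [mul_sub]
    exact (hst.integrable_continuous_mul hζ).sub (h.isState.integrable_continuous_mul hζ)
  have hM : ∀ {g' : R3 → R3 → ℝ} {V' : R3 → ℝ}, IsState E₀ U₀ g' V' →
      Integrable (fun z : R3 × R3 => ∫ τ in (0 : ℝ)..g' z.1 z.2, n τ) := by
    intro g' V' hs
    exact ((contDiff_primitive hn).continuous.comp hs.continuous).integrable_of_hasCompactSupport
      (hs.hasCompactSupport.comp_left (g := fun s => ∫ τ in (0 : ℝ)..s, n τ) (by simp))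
  have i1 := (hst.integrable_casimirFun.sub h.isState.integrable_casimirFun).add (hmul hE)
  have i2 := hmul hψ
  have i3 := (hM hst).sub (hM h.isState)
  refine ⟨(i1.add i2).sub i3, ?_⟩
  have e1 := integral_sub (i1.add i2) i3
  have e2 := integral_add i1 i2
  have e3 := integral_sub (hM hst) (hM h.isState)
  rw [hst.casimir n hn N hN, sub_self] at e3
  have e4 := hst.integral_potential_mul_sub h
  refine e1.trans ?_
  have e3' : ∫ z, ((fun z : R3 × R3 => ∫ τ in (0 : ℝ)..g z.1 z.2, n τ)
    - fun z : R3 × R3 => ∫ τ in (0 : ℝ)..kingDensity E₀ U₀ z.1 z.2, n τ) z = 0 := e3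
  rw [e3', sub_zero]
  refine e2.trans ?_
  rw [e4]
  unfold freeEnergy
  simp only [Pi.add_apply, Pi.sub_apply]
  ring

/-- The multiplier `n`, given in terms of the energy, as a function of the value of the King
density. -/
def densityMultiplier (E₀ : ℝ) (n : ℝ → ℝ) (s : ℝ) : ℝ := n (E₀ - Real.log (1 + max s 0))

theorem continuous_densityMultiplier {n : ℝ → ℝ} (hn : Continuous n) :
    Continuous (densityMultiplier E₀ n) :=
  hn.comp (continuous_const.sub continuous_log_one_add_max)

theorem log_one_add_kingDensity {x v : R3} (hE : energy U₀ x v ≤ E₀) :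
    Real.log (1 + kingDensity E₀ U₀ x v) = E₀ - energy U₀ x v := by
  rw [kingDensity_of_le hE, add_sub_cancel, Real.log_exp]

theorem densityMultiplier_kingDensity {n : ℝ → ℝ} {x v : R3} (hE : energy U₀ x v ≤ E₀) :
    densityMultiplier E₀ n (kingDensity E₀ U₀ x v) = n (energy U₀ x v) := by
  rw [densityMultiplier, max_eq_left (kingDensity_nonneg _ _ _ _), log_one_add_kingDensity hE,
    sub_sub_cancel]

/-- To first order the subtracted Casimir functional contributes n(E)(g − f₀), so the effective
perturbation is y = ψ − n(E). The remainder inherits the approximate modulus of n because log(1 + s)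
is 1-Lipschitz on s ≥ 0. -/
theorem IsState.correctedDensity_ge_of_le {S ε C β κ : ℝ} (hst : IsState E₀ U₀ g V)
    (hS0 : 0 ≤ S) (hS : ∀ x v, kingDensity E₀ U₀ x v ≤ S) (hε : 0 < ε)
    (hL : ∀ z, -1 ≤ z → z ≤ S → ∀ y,
      -(11 / 20 * y ^ 2 + C * y ^ 4) ≤ casimirFun z + y * z - ε * z ^ 2)
    {n : ℝ → ℝ} (hn : Continuous n) (hκ0 : 0 ≤ κ) (hκ : κ ≤ ε / (2 * (1 + S)))
    (hnκ : ∀ E E', |n E - n E'| ≤ κ * |E - E'| + β) {z : R3 × R3}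
    (hz : energy U₀ z.1 z.2 ≤ E₀) :
    -(cutExp E₀ (energy U₀ z.1 z.2)
        * (11 / 20 * ((V - U₀) z.1 - n (energy U₀ z.1 z.2)) ^ 2
          + C * ((V - U₀) z.1 - n (energy U₀ z.1 z.2)) ^ 4 + β ^ 2 / (2 * ε)))
      ≤ correctedDensity E₀ U₀ g V (densityMultiplier E₀ n) z := by
  have hs := hst.nonneg z.1 z.2
  have hsS := hst.le hS0 hS z.1 z.2
  have hs₀ := kingDensity_nonneg E₀ U₀ z.1 z.2
  have hs₀S := hS z.1 z.2
  have hlog := log_one_add_kingDensity hz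
  have hn₀ := densityMultiplier_kingDensity (n := n) hz
  have hcut : cutExp E₀ (energy U₀ z.1 z.2) = 1 + kingDensity E₀ U₀ z.1 z.2 := by
    rw [cutExp, if_pos hz, kingDensity_of_le hz]; ring
  unfold correctedDensity
  set s := g z.1 z.2
  set s₀ := kingDensity E₀ U₀ z.1 z.2
  have hm := abs_primitive_sub_le (continuous_densityMultiplier (E₀ := E₀) hn) (s := s) (s₀ := s₀)
    (B := κ * |s - s₀| + β) (fun τ hτ => by
      have hτ0 : 0 ≤ τ := (le_min hs₀ hs).trans hτ.1
      refine (hnκ _ _).trans (add_le_add (mul_le_mul_of_nonneg_left ?_ hκ0) le_rfl)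
      rw [sub_sub_sub_cancel_left, max_eq_left hτ0, max_eq_left hs₀]
      refine (abs_log_one_add_sub_le hs₀ hτ0).trans ?_
      rw [abs_sub_comm, abs_sub_comm s]
      have := abs_sub_left_of_mem_uIcc hτ
      rw [abs_sub_comm s₀]
      exact this)
  have hm' : |(∫ τ in (0 : ℝ)..s, densityMultiplier E₀ n τ)
      - (∫ τ in (0 : ℝ)..s₀, densityMultiplier E₀ n τ) - densityMultiplier E₀ n s₀ * (s - s₀)|
      ≤ ε / (2 * (1 + S)) * (s - s₀) ^ 2 + β * |s - s₀| := by
    refine hm.trans ?_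
    rw [add_mul, mul_assoc, ← pow_two, sq_abs]
    exact add_le_add (mul_le_mul_of_nonneg_right hκ (sq_nonneg _)) le_rfl
  have h1 := bregman_lower_bound hε hL (y := (V - U₀) z.1 - n (energy U₀ z.1 z.2)) hs hsS hs₀ hs₀S hm'
  rw [hcut]
  rw [hlog, hn₀] at h1
  refine h1.trans (le_of_eq ?_)
  ring

theorem IsState.correctedDensity_ge_of_gt {S N : ℝ} (hst : IsState E₀ U₀ g V)
    (hS0 : 0 ≤ S) (hS : ∀ x v, kingDensity E₀ U₀ x v ≤ S) {n : ℝ → ℝ}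
    (hN : ∀ s, |n s| ≤ N) {x v : R3} (hz : E₀ < energy U₀ x v) :
    (E₀ + (|(V - U₀) x| + N) ≤ energy U₀ x v → 0 ≤ correctedDensity E₀ U₀ g V n (x, v)) ∧
      -((1 + S) / 2 * (|(V - U₀) x| + N) ^ 2) ≤ correctedDensity E₀ U₀ g V n (x, v) := by
  have hs := hst.nonneg x v
  have hm : |∫ τ in (0 : ℝ)..g x v, n τ| ≤ N * g x v := by
    have := intervalIntegral.norm_integral_le_of_norm_le_const (a := 0) (b := g x v) (f := n)
      (C := N) fun τ _ => hN τ
    rwa [sub_zero, abs_of_nonneg hs] at this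
  have h1 := casimirFun_lower_bound (ψ := (V - U₀) x) hs (hst.le hS0 hS x v)
    (sub_nonneg.2 hz.le) hm
  have e : correctedDensity E₀ U₀ g V n (x, v)
      = casimirFun (g x v) + (energy U₀ x v - E₀) * g x v + (V - U₀) x * g x v
        - ∫ τ in (0 : ℝ)..g x v, n τ := by
    simp [correctedDensity, kingDensity_of_ge hz.le, casimirFun]
  rw [e]
  exact ⟨fun hle => h1.1 (by linarith), h1.2⟩

end Coercivity

section Coercivity

variable {E₀ : ℝ} {U₀ : R3 → ℝ} {g : R3 → R3 → ℝ} {V : R3 → ℝ}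

/-- The balance sheet. The main loss is 363/400 = (11/20)·(11/10)·(3/2) of the field energy:
Legendre constant, clamping constant, Antonov constant. The other losses are linear in A with the
small factors a or l, or quadratic in A. -/
theorem IsState.le_freeEnergy_sub_fieldEnergy (hst : IsState E₀ U₀ g V)
    (h : IsKingPotential E₀ U₀) {S ε C : ℝ} (hS0 : 0 ≤ S)
    (hS : ∀ x v, kingDensity E₀ U₀ x v ≤ S) (hε : 0 < ε) (hC : 0 ≤ C)
    (hL : ∀ z, -1 ≤ z → z ≤ S → ∀ y,
      -(11 / 20 * y ^ 2 + C * y ^ 4) ≤ casimirFun z + y * z - ε * z ^ 2)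
    {a R c l : ℝ} (ha : 0 < a) (hR0 : 0 < R) (hR : ∀ x, U₀ x ≤ E₀ / 2 → ‖x‖ ≤ R) {ρ : ℝ → ℝ}
    (hc0 : 0 ≤ c) (hρ : ∀ E, a ≤ ρ E) (hρl : ∀ E E', |ρ E - ρ E'| ≤ c * |E - E'|)
    (hv : ∀ z : R3 × R3, ‖z.1‖ ≤ R →
      |max ‖z.1‖ a - ρ (energy U₀ z.1 z.2)| ≤ c * |virial U₀ z|)
    (hl : 0 < l) {A β : ℝ} (hA : A = 2 * fieldEnergy U₀ V)
    (hβ : β = A / (4 * (ε / (2 * (1 + S) * (c + 1))) * a ^ 2))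
    (hsmall : 2 * A * (R⁻¹ + a⁻¹) ≤ (-E₀ / 2) ^ 2) :
    fieldEnergy U₀ V - 363 / 400 * fieldEnergy U₀ V
      - (121 / 5 * A * a + 8 * C * A ^ 2 * (1 + a⁻¹ ^ 2) + β ^ 2 / (2 * ε))
        * (∫ z : R3 × R3, cutExp E₀ (energy U₀ z.1 z.2) * (1 + (‖z.1‖ ^ 2)⁻¹))
      - 8 * Real.pi / 3 * (1 + S) * ((1 + (E₀ - U₀ 0))
          * (l * A * (1 + a⁻¹) + 4 * A ^ 2 * (1 + a⁻¹ ^ 2) / l) + 8 * A ^ 2 * (1 + a⁻¹ ^ 2))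
        * (∫ x, singularWeight R x)
      ≤ freeEnergy E₀ U₀ g - fieldEnergy U₀ V := by
  have hK0 := fieldEnergy_nonneg U₀ V
  have hA0 : 0 ≤ A := by linarith
  have hb0 : 0 < a⁻¹ := inv_pos.2 ha
  have hW := hst.contDiff_sub h
  have hWr := hst.isRadial_sub h
  have hWc := hst.hasCompactSupport_sub h
  have hπ := Real.pi_pos
  have hI : ∫ x, ‖gradient (V - U₀) x‖ ^ 2 = 4 * Real.pi * A := by
    rw [hA, hst.fieldEnergy_eq h]; field_simp; ring
  have hIA : (∫ x, ‖gradient (V - U₀) x‖ ^ 2) / (4 * Real.pi) = A := by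
    rw [hI]; field_simp
  have hWA : ∀ x, ‖x‖ * (V - U₀) x ^ 2 ≤ A := fun x => by
    rw [← hIA]; exact hWr.norm_mul_sq_le hW hWc x
  have hWq : ∀ x, x ≠ 0 → (V - U₀) x ^ 2 ≤ A * ‖x‖⁻¹ := fun x hx => by
    rw [← div_eq_mul_inv, le_div_iff₀ (norm_pos_iff.2 hx), mul_comm]; exact hWA x
  obtain ⟨n, hnl, hnA, ⟨C', hC'⟩, hnε⟩ := exists_multiplier (U₀ := U₀) (R := R) hWr hW hWc ha hc0
    hρ hρl hv hIA
  -- The slope allowed for w, so that after composition with the c-Lipschitz radius the slope of n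
  -- is within the reserve ε/(2(1 + S)).
  set ε' := ε / (2 * (1 + S) * (c + 1)) with hε'
  have hε'0 : 0 < ε' := by positivity
  set N := √(A * a⁻¹) with hN
  have hN2 : N ^ 2 = A * a⁻¹ := Real.sq_sqrt (by positivity)
  have hN0 : 0 ≤ N := Real.sqrt_nonneg _
  have hnN : ∀ s, |densityMultiplier E₀ n s| ≤ N := fun s => Real.abs_le_sqrt (hnA _)
  obtain ⟨hJ, hJe⟩ := hst.integral_correctedDensity h
    (continuous_densityMultiplier (E₀ := E₀) hnl.continuous) hnN
  set J := correctedDensity E₀ U₀ g V (densityMultiplier E₀ n) with hJdef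
  have hQm : MeasurableSet {z : R3 × R3 | energy U₀ z.1 z.2 ≤ E₀} :=
    (isClosed_le (continuous_energy h.continuous) continuous_const).measurableSet
  have hdev := integral_cutExp_mul_deviation_sq_le h hWr hW (hst.integrable_norm_gradient_sq h) ha hR
    hnl hC'
  have hκ : ε' * c ≤ ε / (2 * (1 + S)) := by
    have e : ε' * c = ε / (2 * (1 + S)) * (c / (c + 1)) := by rw [hε']; field_simp
    rw [e]
    refine mul_le_of_le_one_right (by positivity) ?_
    rw [div_le_one (by linarith)]
    linarith
  have hin := setIntegral_energy_le_ge h hJ (δ := deviation U₀ (V - U₀) a n)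
    (continuous_deviation h hW hnl.continuous) (c := 121 / 200)
    (D := 121 / 5 * A * a + 8 * C * A ^ 2 * (1 + a⁻¹ ^ 2) + β ^ 2 / (2 * ε)) (fun z hz hzQ => by
      refine le_trans (neg_le_neg (mul_le_mul_of_nonneg_left ?_ (cutExp_nonneg _ _)))
        (hst.correctedDensity_ge_of_le hS0 hS hε hL hnl.continuous (mul_nonneg hε'0.le hc0) hκ
          (fun E E' => hnε ε' hε'0 E E') hzQ)
      have h1 := hWr.sub_sq_le (U₀ := U₀) (n := n) ha hA0 hWA hz
      have h2 := (pow_four_le_of_sq_le hA0 hb0.le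
        (y := (V - U₀) z.1 - n (energy U₀ z.1 z.2)) (q := ‖z.1‖⁻¹) (by
          rw [sub_eq_add_neg]
          exact sq_add_le_of_sq_le (hWq _ hz) (by rw [neg_sq]; exact hnA _))).2
      rw [inv_pow ‖z.1‖] at h2
      rw [← hβ]
      set q := (‖z.1‖ ^ 2)⁻¹ with hq
      have hq0 : 0 ≤ q := by positivity
      have h3 := mul_le_mul_of_nonneg_left h2 hC
      have h4 : 0 ≤ β ^ 2 / (2 * ε) * q := by positivity
      have h5 : 0 ≤ A * a := by positivity
      nlinarith)
  have hτ2 : ∀ x, x ≠ 0 → (|(V - U₀) x| + N) ^ 2 ≤ 2 * A * (‖x‖⁻¹ + a⁻¹) := fun x hx =>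
    sq_add_le_of_sq_le (by rw [sq_abs]; exact hWq x hx) hN2.le
  have hout := setIntegral_energy_gt_ge h hJ (τ := fun x => |(V - U₀) x| + N)
    (fun x => add_nonneg (abs_nonneg _) hN0) (R := R) (Ω := 1 + S)
    (G := 8 * Real.pi / 3 * (1 + S) * ((1 + (E₀ - U₀ 0))
          * (l * A * (1 + a⁻¹) + 4 * A ^ 2 * (1 + a⁻¹ ^ 2) / l) + 8 * A ^ 2 * (1 + a⁻¹ ^ 2)))
    (by linarith) hR (fun x v hE hle => (hst.correctedDensity_ge_of_gt hS0 hS hnN hE).1 hle)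
    (fun x v hE => (hst.correctedDensity_ge_of_gt hS0 hS hnN hE).2)
    (fun x hx => by
      refine abs_le_of_sq_le_sq' ((hτ2 x ?_).trans (le_trans ?_ hsmall)) ?_ |>.2
      · exact norm_pos_iff.1 (hR0.trans hx)
      · have : ‖x‖⁻¹ ≤ R⁻¹ := inv_anti₀ hR0 hx.le
        gcongr
      · have := h.cutoff_neg
        linarith)
    (fun x hx _ => by
      obtain ⟨h1, h2⟩ := pow_four_le_of_sq_le hA0 hb0.le (hτ2 x hx)
      rw [inv_pow ‖x‖] at h1 h2
      have h0 : 0 ≤ |(V - U₀) x| + N := add_nonneg (abs_nonneg _) hN0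
      set τ := |(V - U₀) x| + N
      set w := 1 + (‖x‖ ^ 2)⁻¹
      -- Cubic terms would be of order A^{3/2}. Young's inequality trades them for a small multiple
      -- of A plus A², with the weight 1 + |x|⁻² needed for τ⁴ anyway.
      have h3 : τ ^ 3 ≤ l / 2 * τ ^ 2 + τ ^ 4 / (2 * l) := by
        have e : l / 2 * τ ^ 2 + τ ^ 4 / (2 * l) - τ ^ 3 = τ ^ 2 * (τ - l) ^ 2 / (2 * l) := by
          field_simp; ring
        have : 0 ≤ τ ^ 2 * (τ - l) ^ 2 / (2 * l) := by positivity
        linarith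
      have h4 : τ ^ 3 ≤ (l * A * (1 + a⁻¹) + 4 * A ^ 2 * (1 + a⁻¹ ^ 2) / l) * w := by
        have h5 : τ ^ 4 / (2 * l) ≤ 8 * A ^ 2 * (1 + a⁻¹ ^ 2) * w / (2 * l) := by gcongr
        have h6 : l / 2 * τ ^ 2 ≤ l / 2 * (2 * A * (1 + a⁻¹) * w) := by gcongr
        refine h3.trans ((add_le_add h6 h5).trans (le_of_eq ?_))
        field_simp
        ring
      have hC4 : 0 ≤ 1 + (E₀ - U₀ 0) := by
        have := h.apply_zero_lt
        linarith
      have h7 := add_le_add (mul_le_mul_of_nonneg_left h4 hC4) h2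
      have h8 := mul_le_mul_of_nonneg_left h7
        (by positivity : 0 ≤ 8 * Real.pi / 3 * (1 + S))
      refine le_trans (le_of_eq ?_) (h8.trans (le_of_eq ?_)) <;> ring)
  have hsplit := integral_add_compl hQm hJ
  rw [hI] at hdev
  have e1 : 3 / (16 * Real.pi) * (4 * Real.pi * A) = 3 / 2 * fieldEnergy U₀ V := by
    rw [hA]; field_simp; ring
  rw [e1] at hdev
  rw [hJe] at hsplit
  linarith

end Coercivity

/-! ### Coercivity and stability -/

/-- Near the King model the conserved difference of free energy and field energy controls the
field energy. -/
theorem IsKingPotential.exists_coercivity {E₀ : ℝ} {U₀ : R3 → ℝ} (h : IsKingPotential E₀ U₀) :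
    ∃ k, 0 < k ∧ ∀ g V, IsState E₀ U₀ g V → fieldEnergy U₀ V ≤ k →
      fieldEnergy U₀ V / 32 ≤ freeEnergy E₀ U₀ g - fieldEnergy U₀ V := by
  have hU0 := h.apply_zero_lt
  obtain ⟨S, hSdef⟩ : ∃ S, S = Real.exp (E₀ - U₀ 0) - 1 := ⟨_, rfl⟩
  have hS0 : 0 ≤ S := by
    have := Real.one_le_exp (sub_nonneg.2 hU0.le)
    linarith
  have hS : ∀ x v, kingDensity E₀ U₀ x v ≤ S := fun x v => hSdef ▸ h.kingDensity_le x v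
  obtain ⟨ε, C, hε, hC, hL⟩ := exists_casimirFun_add_mul_ge hS0
  obtain ⟨R, hR0, hR⟩ := h.exists_radius
  obtain ⟨I, hIdef⟩ : ∃ I, I = ∫ z : R3 × R3, cutExp E₀ (energy U₀ z.1 z.2)
    * (1 + (‖z.1‖ ^ 2)⁻¹) := ⟨_, rfl⟩
  obtain ⟨I', hI'def⟩ : ∃ I', I' = ∫ x, singularWeight R x := ⟨_, rfl⟩
  have hI0 : 0 ≤ I := hIdef ▸ integral_nonneg fun z =>
    mul_nonneg (cutExp_nonneg _ _) (by positivity)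
  have hI'0 : 0 ≤ I' := hI'def ▸ integral_nonneg fun x => singularWeight_nonneg _ _
  -- The order of choices matters: a is fixed first from the clamping cost, everything depending on
  -- 1/a follows, then l, and the threshold for K last.
  obtain ⟨a, ha, haR, haI⟩ : ∃ a, 0 < a ∧ a ≤ R ∧ 242 / 5 * a * I ≤ 3 / 100 := by
    refine ⟨min R (3 / (4840 * (I + 1))), lt_min hR0 (by positivity), min_le_left _ _, ?_⟩
    have h1 : min R (3 / (4840 * (I + 1))) ≤ 3 / (4840 * (I + 1)) := min_le_right _ _
    rw [le_div_iff₀ (by positivity)] at h1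
    have h2 : 0 < min R (3 / (4840 * (I + 1))) := lt_min hR0 (by positivity)
    nlinarith
  obtain ⟨ρ, c, hc0, hρ, hρl, hv⟩ := h.exists_virialRadius ha haR
  have hb0 : 0 < a⁻¹ := inv_pos.2 ha
  have hC4 : 0 < 1 + (E₀ - U₀ 0) := by linarith
  have hπ := Real.pi_pos
  obtain ⟨p, hp⟩ : ∃ p, p = 8 * Real.pi / 3 * (1 + S) * (1 + (E₀ - U₀ 0)) * (2 * (1 + a⁻¹)) * I' :=
    ⟨_, rfl⟩
  have hp0 : 0 ≤ p := by rw [hp]; positivity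
  obtain ⟨l, hl, hlp⟩ : ∃ l, 0 < l ∧ l * p ≤ 1 / 100 := by
    refine ⟨1 / (100 * (p + 1)), by positivity, ?_⟩
    rw [div_mul_eq_mul_div, div_le_iff₀ (by positivity)]
    linarith
  obtain ⟨e, he⟩ : ∃ e, e = 2 / (4 * (ε / (2 * (1 + S) * (c + 1))) * a ^ 2) := ⟨_, rfl⟩
  obtain ⟨Q, hQ⟩ : ∃ Q, Q = (32 * C * (1 + a⁻¹ ^ 2) + e ^ 2 / (2 * ε)) * I
      + 8 * Real.pi / 3 * (1 + S) * ((1 + (E₀ - U₀ 0)) * (16 * (1 + a⁻¹ ^ 2) / l)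
        + 32 * (1 + a⁻¹ ^ 2)) * I' := ⟨_, rfl⟩
  have hQ0 : 0 ≤ Q := by rw [hQ]; positivity
  have hE0 : 0 < (-E₀ / 2) ^ 2 := by
    have := h.cutoff_neg
    have : 0 < -E₀ / 2 := by linarith
    positivity
  -- The first bound makes the quadratic losses at most K/100; the second keeps the width τ below
  -- −E₀/2 outside radius R.
  refine ⟨min (1 / (100 * (Q + 1))) ((-E₀ / 2) ^ 2 / (4 * (R⁻¹ + a⁻¹))),
    lt_min (by positivity) (by positivity), fun g V hst hk => ?_⟩
  have hK0 := fieldEnergy_nonneg U₀ V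
  have hk1 := hk.trans (min_le_left _ _)
  have hk2 := hk.trans (min_le_right _ _)
  have hmain := hst.le_freeEnergy_sub_fieldEnergy h hS0 hS hε hC hL ha hR0 hR hc0 hρ hρl hv hl rfl
    rfl (by
      rw [le_div_iff₀ (by positivity)] at hk2
      linarith)
  rw [← hIdef, ← hI'def] at hmain
  set K := fieldEnergy U₀ V
  have hQK : Q * K ≤ 1 / 100 := by
    rw [le_div_iff₀ (by positivity)] at hk1
    nlinarith
  have hβ : 2 * K / (4 * (ε / (2 * (1 + S) * (c + 1))) * a ^ 2) = e * K := by
    rw [he]; ring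
  rw [hβ] at hmain
  have hexp : (121 / 5 * (2 * K) * a + 8 * C * (2 * K) ^ 2 * (1 + a⁻¹ ^ 2)
          + (e * K) ^ 2 / (2 * ε)) * I
      + 8 * Real.pi / 3 * (1 + S) * ((1 + (E₀ - U₀ 0))
          * (l * (2 * K) * (1 + a⁻¹) + 4 * (2 * K) ^ 2 * (1 + a⁻¹ ^ 2) / l)
          + 8 * (2 * K) ^ 2 * (1 + a⁻¹ ^ 2)) * I'
      = K * (242 / 5 * a * I) + K * (l * p) + K * (Q * K) := by
    rw [hp, hQ]; ring
  have h1 := mul_le_mul_of_nonneg_left haI hK0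
  have h2 := mul_le_mul_of_nonneg_left hlp hK0
  have h3 := mul_le_mul_of_nonneg_left hQK hK0
  -- The fraction left over is 1 − 363/400 − (3 + 1 + 1)/100 = 17/400, which exceeds 1/32.
  linarith

theorem IsKingPotential.exists_stability {E₀ : ℝ} {U₀ : R3 → ℝ} (hU₀ : IsKingPotential E₀ U₀) :
    ∃ δ : ℝ, 0 < δ ∧ ∀ (f : ℝ → R3 → R3 → ℝ) (U : ℝ → R3 → ℝ), IsSolution f U →
      MemS (kingDensity E₀ U₀) (f 0) →
      HasCompactSupport (fun z : R3 × R3 => f 0 z.1 z.2) →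
      kingDist E₀ U₀ (f 0) (U 0) ≤ δ → ∀ t : ℝ, 0 < t →
        kingDist E₀ U₀ (f t) (U t) ≤ 65 * kingDist E₀ U₀ (f 0) (U 0) := by
  obtain ⟨k, hk, hco⟩ := hU₀.exists_coercivity
  -- At a time with K = k coercivity would give k ≤ 32·d(0) ≤ k/2. The final constant is 65 = 1 +
  -- 2·32, from d(t) = (P − K) + 2K.
  refine ⟨k / 64, by positivity, fun f U hf hS hc hd t ht => ?_⟩
  have hdist : ∀ s, kingDist E₀ U₀ (f s) (U s) = freeEnergy E₀ U₀ (f s) + fieldEnergy U₀ (U s) :=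
    fun s => rfl
  have hstate : ∀ s, 0 ≤ s → IsState E₀ U₀ (f s) (U s) := fun s hs => hf.isState hc hU₀ hS hs
  have hcons : ∀ s, 0 ≤ s → freeEnergy E₀ U₀ (f s) - fieldEnergy U₀ (U s)
      = freeEnergy E₀ U₀ (f 0) - fieldEnergy U₀ (U 0) :=
    fun s hs => hf.freeEnergy_sub_fieldEnergy_eq hc hU₀ hS hs
  have hP0 := (hstate 0 le_rfl).freeEnergy_nonneg
  have hK0 := fieldEnergy_nonneg U₀ (U 0)
  have hbound : ∀ s, 0 ≤ s → fieldEnergy U₀ (U s) ≤ k →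
      fieldEnergy U₀ (U s) ≤ 32 * kingDist E₀ U₀ (f 0) (U 0) := fun s hs hsk => by
    have h1 := hco _ _ (hstate s hs) hsk
    rw [hcons s hs] at h1
    rw [hdist]
    linarith
  -- Continuity argument: exceeding k would require passing through k exactly, where coercivity
  -- still applies.
  have hle : fieldEnergy U₀ (U t) ≤ k := by
    by_contra hlt
    obtain ⟨s, hs, hsk⟩ := intermediate_value_Icc ht.le (hf.continuousOn_fieldEnergy hc hU₀ hS t)
      (show k ∈ Icc (fieldEnergy U₀ (U 0)) (fieldEnergy U₀ (U t)) from
        ⟨by rw [hdist] at hd; linarith, (not_le.1 hlt).le⟩)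
    have h2 := hbound s hs.1 hsk.le
    have hsk' : fieldEnergy U₀ (U s) = k := hsk
    linarith
  have h3 := hbound t ht.le hle
  have h4 := hcons t ht.le
  rw [hdist] at h3 ⊢
  rw [hdist 0]
  linarith

end

end KingModel

theorem theorem2p1 (E₀ : ℝ) (U₀ : KingModel.R3 → ℝ) (hU₀ : KingModel.IsKingPotential E₀ U₀) :
    ∃ δ : ℝ, 0 < δ ∧ ∃ C : ℝ, 0 < C ∧
      ∀ (f : ℝ → KingModel.R3 → KingModel.R3 → ℝ) (U : ℝ → KingModel.R3 → ℝ),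
        KingModel.IsSolution f U →
        KingModel.MemS (KingModel.kingDensity E₀ U₀) (f 0) →
        HasCompactSupport (fun z : KingModel.R3 × KingModel.R3 => f 0 z.1 z.2) →
        KingModel.kingDist E₀ U₀ (f 0) (U 0) ≤ δ →
        ∀ t : ℝ, 0 < t →
          KingModel.kingDist E₀ U₀ (f t) (U t) ≤ C * KingModel.kingDist E₀ U₀ (f 0) (U 0) := by
  obtain ⟨δ, hδ, h⟩ := hU₀.exists_stability
  exact ⟨δ, hδ, 65, by norm_num, h⟩
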